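/- Let $M$ be a smooth Riemannian manifold, let $p>1$ be a real number and $k\ge 1$ an integer. Let $\xi$ be a smooth complete vector field on $M$ of bounded norm, with flow $(\phi_t)_{t\in\mathbb R}$ (a smooth one-parameter group of diffeomorphisms). For $j\ge 0$, say that $\xi$ is $(j,p)$-contracting if there are constants $C$ and $\eta>0$ such that for all $t\ge 0$, all $x\in M$ and all $\beta\in\Lambda^jT^*_{\phi_t(x)}M$ with $\iota_\xi\beta=0$, $$|\phi_t^*\beta|_x\le C\,e^{-\eta t}\,\mathrm{Jac}_x(\phi_t)^{1/p}\,|\beta|_{\phi_t(x)},$$ where $\mathrm{Jac}_x(\phi_t)$ is the Riemannian Jacobian; every vector field is $(-1,p)$-contracting. Differentials of $L^p$ forms are taken in the sense of distributions. A $k$-form is a closed $L^p$ form if it is $L^p$ and its differential vanishes. Let $dL^p$ denote the set of $L^p$ $k$-forms that are the differential of an $L^p$ $(k-1)$-form. Let $H^{k,p}(M)=\{\text{closed } L^p\ k\text{-forms}\}/dL^p$ be the $L^p$ cohomology and $T^{k,p}(M)=\overline{dL^p}/dL^p$ its torsion, the closure being taken for the $L^p$ norm. Assume that $\xi$ is $(k-1,p)$-contracting.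 1. Every closed $L^p$ $k$-form $\omega$ has a boundary value $\omega_\infty=\lim_{t\to+\infty}\phi_t^*\omega$, a $k$-form with distribution coefficients, the limit being taken in the sense of distributions; and $\omega-\omega_\infty$ is the differential of an $L^p$ $(k-1)$-form. 2. Assume moreover that $M$ is complete and that $\xi$ is $(k-2,p)$-contracting. If $\omega$ is an $L^p$ form with $\omega=d\beta$ for some $L^p$ form $\beta$, then $\omega_\infty=0$. Consequently $T^{k,p}(M)=0$. 3. Assume moreover that $M$ is complete and that $\xi$ is $(k,p)$-contracting. Then $\omega_\infty=0$ for every closed $L^p$ $k$-form $\omega$. Consequently $H^{k,p}(M)=0$. -/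

import Mathlib

open Set Filter Topology MeasureTheory Bundle
open scoped Manifold ContDiff ENNReal

noncomputable section

namespace LpForms

/-! ### Forms, multivector fields and charts on a smooth manifold -/

section Smooth

variable {n : ℕ} {M : Type*} [TopologicalSpace M] [ChartedSpace (EuclideanSpace ℝ (Fin n)) M]

/-- A differential form of degree `k` on `M`, with no regularity assumption: an alternating
`k`-linear form on each tangent space. -/
abbrev DiffForm (n : ℕ) (M : Type*) [TopologicalSpace M]
    [ChartedSpace (EuclideanSpace ℝ (Fin n)) M] (k : ℕ) : Type _ :=
  (x : M) → (TangentSpace (𝓡 n) x) [⋀^Fin k]→L[ℝ] ℝ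

/-- A field of `k`-vectors on `M`, with no regularity assumption: `Λᵏ TₓM` is realised as the dual
of the space of alternating `k`-linear forms on `TₓM`. -/
abbrev MultivectorField (n : ℕ) (M : Type*) [TopologicalSpace M]
    [ChartedSpace (EuclideanSpace ℝ (Fin n)) M] (k : ℕ) : Type _ :=
  (x : M) → ((TangentSpace (𝓡 n) x) [⋀^Fin k]→L[ℝ] ℝ) →L[ℝ] ℝ

/-- The differential at `y` of the inverse of the chart centred at `x₀`. -/
def chartInvDeriv (x₀ : M) (y : EuclideanSpace ℝ (Fin n)) :
    EuclideanSpace ℝ (Fin n) →L[ℝ] TangentSpace (𝓡 n) ((extChartAt (𝓡 n) x₀).symm y) :=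
  mfderiv 𝓘(ℝ, EuclideanSpace ℝ (Fin n)) (𝓡 n) (extChartAt (𝓡 n) x₀).symm y

/-- The differential at `x` of the chart centred at `x₀`. -/
def chartDeriv (x₀ x : M) : TangentSpace (𝓡 n) x →L[ℝ] EuclideanSpace ℝ (Fin n) :=
  mfderiv (𝓡 n) 𝓘(ℝ, EuclideanSpace ℝ (Fin n)) (extChartAt (𝓡 n) x₀) x

/-- The expression of a form in the chart centred at `x₀` (meaningful on the chart's target). -/
def coordForm {k : ℕ} (x₀ : M) (θ : DiffForm n M k) :
    EuclideanSpace ℝ (Fin n) → (EuclideanSpace ℝ (Fin n)) [⋀^Fin k]→L[ℝ] ℝ :=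
  fun y => (θ ((extChartAt (𝓡 n) x₀).symm y)).compContinuousLinearMap (chartInvDeriv x₀ y)

/-- The expression of a field of `k`-vectors in the chart centred at `x₀` (meaningful on the
chart's target). -/
def coordField {k : ℕ} (x₀ : M) (X : MultivectorField n M k) :
    EuclideanSpace ℝ (Fin n) → ((EuclideanSpace ℝ (Fin n)) [⋀^Fin k]→L[ℝ] ℝ) →L[ℝ] ℝ :=
  fun y => (X ((extChartAt (𝓡 n) x₀).symm y)).comp
    (ContinuousAlternatingMap.compContinuousLinearMapCLM
      (chartDeriv x₀ ((extChartAt (𝓡 n) x₀).symm y)))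

/-- A form is smooth if its expression in each chart is. -/
def IsSmoothForm {k : ℕ} (α : DiffForm n M k) : Prop :=
  ∀ x₀ : M, ContDiffOn ℝ ∞ (coordForm x₀ α) (extChartAt (𝓡 n) x₀).target

/-- The exterior derivative of a smooth form, computed at `x` in the chart centred at `x`. -/
def extDerivForm {k : ℕ} (α : DiffForm n M k) : DiffForm n M (k + 1) :=
  fun x => (extDeriv (coordForm x α) (extChartAt (𝓡 n) x x)).compContinuousLinearMap
    (chartDeriv x x)

/-- The pull-back of a form by a differentiable map. -/
def pullbackForm {k : ℕ} (f : M → M) (θ : DiffForm n M k) : DiffForm n M k :=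
  fun x => (θ (f x)).compContinuousLinearMap (mfderiv (𝓡 n) (𝓡 n) f x)

/-- The space of test fields of degree `k`: smooth compactly supported fields of `k`-vectors. -/
def testFields (n : ℕ) (M : Type*) [TopologicalSpace M]
    [ChartedSpace (EuclideanSpace ℝ (Fin n)) M] (k : ℕ) : Submodule ℝ (MultivectorField n M k) where
  carrier := {X | (∀ x₀ : M, ContDiffOn ℝ ∞ (coordField x₀ X) (extChartAt (𝓡 n) x₀).target) ∧
    ∃ K : Set M, IsCompact K ∧ ∀ x, x ∉ K → X x = 0}
  add_mem' := by
    rintro X Y ⟨hX, K, hK, hXK⟩ ⟨hY, L, hL, hYL⟩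
    refine ⟨fun x₀ => ?_, K ∪ L, hK.union hL, fun x hx => ?_⟩
    · have h : coordField x₀ (X + Y) = coordField x₀ X + coordField x₀ Y := by
        funext y
        exact ContinuousLinearMap.add_comp _ _ _
      rw [h]
      exact (hX x₀).add (hY x₀)
    · rw [Set.mem_union, not_or] at hx
      rw [Pi.add_apply, hXK x hx.1, hYL x hx.2, add_zero]
  zero_mem' := by
    refine ⟨fun x₀ => ?_, ∅, isCompact_empty, fun x _ => rfl⟩
    have h : coordField x₀ (0 : MultivectorField n M k) = fun _ => 0 := by
      funext y
      exact ContinuousLinearMap.zero_comp _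
    rw [h]
    exact contDiffOn_const
  smul_mem' := by
    rintro c X ⟨hX, K, hK, hXK⟩
    refine ⟨fun x₀ => ?_, K, hK, fun x hx => ?_⟩
    · have h : coordField x₀ (c • X) = c • coordField x₀ X := by
        funext y
        exact ContinuousLinearMap.smul_comp _ _ _
      rw [h]
      exact (hX x₀).const_smul c
    · rw [Pi.smul_apply, hXK x hx, smul_zero]

/-- `φ` is the flow of the (complete) vector field `ξ`: a smooth one-parameter group of
transformations of `M` whose orbits are the integral curves of `ξ`. -/
structure IsFlowOf (φ : ℝ → M → M) (ξ : (x : M) → TangentSpace (𝓡 n) x) : Prop where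
  smooth : ContMDiff (𝓘(ℝ, ℝ).prod (𝓡 n)) (𝓡 n) ∞ (fun q : ℝ × M => φ q.1 q.2)
  zero : ∀ x, φ 0 x = x
  add : ∀ s t x, φ (s + t) x = φ s (φ t x)
  integralCurve : ∀ x, IsMIntegralCurve (I := 𝓡 n) (fun t => φ t x) ξ

end Smooth

/-! ### Distributional forms -/

/-- A differential form of degree `k` with distribution coefficients: a continuous linear form `T`
on the space of smooth compactly supported `k`-vector fields. Continuity: on fields supported in a
given compact subset `K` of a chart domain, `T` is bounded by finitely many derivatives. -/
structure DistForm (n : ℕ) (M : Type*) [TopologicalSpace M]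
    [ChartedSpace (EuclideanSpace ℝ (Fin n)) M] (k : ℕ) where
  toLinearMap : testFields n M k →ₗ[ℝ] ℝ
  continuous' : ∀ (x₀ : M) (K : Set (EuclideanSpace ℝ (Fin n))), IsCompact K →
    K ⊆ (extChartAt (𝓡 n) x₀).target →
    ∃ (N : ℕ) (C : ℝ), ∀ (X : testFields n M k) (B : ℝ),
      (∀ x, x ∉ (extChartAt (𝓡 n) x₀).symm '' K → X.1 x = 0) →
      (∀ i ≤ N, ∀ y ∈ K, ‖iteratedFDeriv ℝ i (coordField x₀ X.1) y‖ ≤ B) →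
      |toLinearMap X| ≤ C * B

/-! ### Riemannian notions -/

/-- The Jacobian `√det (Lᵀ L)` of a linear map `L` between Euclidean vector spaces: the square root
of the Gram determinant of the image of an orthonormal basis. -/
def jacobian {V W : Type*} [NormedAddCommGroup V] [InnerProductSpace ℝ V]
    [FiniteDimensional ℝ V] [NormedAddCommGroup W] [InnerProductSpace ℝ W]
    (L : V →L[ℝ] W) : ℝ :=
  √(Matrix.gram ℝ (fun i => L (stdOrthonormalBasis ℝ V i))).det

instance {n : ℕ} {M : Type*} [TopologicalSpace M] [ChartedSpace (EuclideanSpace ℝ (Fin n)) M]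
    (x : M) : FiniteDimensional ℝ (TangentSpace (𝓡 n) x) :=
  inferInstanceAs (FiniteDimensional ℝ (EuclideanSpace ℝ (Fin n)))

section Riemannian

variable {n : ℕ} {M : Type*} [TopologicalSpace M] [ChartedSpace (EuclideanSpace ℝ (Fin n)) M]
  [RiemannianBundle (fun x : M => TangentSpace (𝓡 n) x)] [MeasurableSpace M]

/-- The Riemannian volume of the domain of the chart centred at `x₀`, as a measure on `M`: the
image under the inverse chart of the measure of density `√det (g_ij)`. -/
def chartVolume (n : ℕ) {M : Type*} [TopologicalSpace M]
    [ChartedSpace (EuclideanSpace ℝ (Fin n)) M]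
    [RiemannianBundle (fun x : M => TangentSpace (𝓡 n) x)] [MeasurableSpace M] (x₀ : M) :
    Measure M :=
  Measure.map (extChartAt (𝓡 n) x₀).symm
    ((volume.restrict (extChartAt (𝓡 n) x₀).target).withDensity
      (fun y => ENNReal.ofReal (jacobian (chartInvDeriv (n := n) x₀ y))))

/-- The Riemannian volume measure: the least measure which is at least the Riemannian volume of
each chart domain. (The measures `chartVolume n x₀` agree on the intersections of chart domains, so
on each chart domain this is the measure of density `√det (g_ij)`.) -/
def riemannianVolume (n : ℕ) (M : Type*) [TopologicalSpace M]
    [ChartedSpace (EuclideanSpace ℝ (Fin n)) M]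
    [RiemannianBundle (fun x : M => TangentSpace (𝓡 n) x)] [MeasurableSpace M] : Measure M :=
  ⨆ x₀ : M, chartVolume n x₀

/-- The `Lᵖ` norm of a form, where the norm of an alternating form `β` on the Euclidean space `TₓM`
is `sup |β(v₁, …, v_k)|` over vectors of norm at most `1`. -/
def lpNorm {k : ℕ} (p : ℝ) (θ : DiffForm n M k) : ℝ≥0∞ :=
  eLpNorm (fun x => ‖θ x‖) (ENNReal.ofReal p) (riemannianVolume n M)

/-- `θ` is an `Lᵖ` form: its coefficients in each chart are measurable and its `Lᵖ` norm is
finite. -/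
def IsLpForm {k : ℕ} (p : ℝ) (θ : DiffForm n M k) : Prop :=
  (∀ x₀ : M, AEStronglyMeasurable (coordForm x₀ θ)
    (volume.restrict (extChartAt (𝓡 n) x₀).target)) ∧ lpNorm p θ < ⊤

/-- The pairing `∫ ⟨θ, X⟩ dvol` of a form and a test field; `X ↦ pairing θ X` is the distributional
form defined by a locally integrable form `θ`. -/
def pairing {k : ℕ} (θ : DiffForm n M k) (X : testFields n M k) : ℝ :=
  ∫ x, X.1 x (θ x) ∂(riemannianVolume n M)

/-- `Y` is the image of the test field `X` under the formal transpose of the exterior derivative: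
`∫ ⟨dα, X⟩ dvol = ∫ ⟨α, Y⟩ dvol` for every smooth form `α`. By integration by parts such a `Y`
exists and is unique (it is minus the divergence of `X`). -/
def IsTranspose {k : ℕ} (X : testFields n M (k + 1)) (Y : testFields n M k) : Prop :=
  ∀ α : DiffForm n M k, IsSmoothForm α → pairing (extDerivForm α) X = pairing α Y

/-- `dS = T` in the sense of distributions, for functionals `S` and `T` on the test fields. -/
def IsDifferential {k : ℕ} (S : testFields n M k → ℝ) (T : testFields n M (k + 1) → ℝ) : Prop :=
  ∀ X Y, IsTranspose X Y → T X = S Y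

/-- The closed `Lᵖ` forms of degree `k` (closed in the sense of distributions). -/
def lpClosed (n : ℕ) (M : Type*) [TopologicalSpace M]
    [ChartedSpace (EuclideanSpace ℝ (Fin n)) M]
    [RiemannianBundle (fun x : M => TangentSpace (𝓡 n) x)] [MeasurableSpace M]
    (p : ℝ) (k : ℕ) : Set (DiffForm n M k) :=
  {θ | IsLpForm p θ ∧ IsDifferential (pairing θ) (fun _ => 0)}

/-- The `Lᵖ` forms of degree `k + 1` which are the differential, in the sense of distributions, of
an `Lᵖ` form of degree `k`. -/
def lpExact (n : ℕ) (M : Type*) [TopologicalSpace M]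
    [ChartedSpace (EuclideanSpace ℝ (Fin n)) M]
    [RiemannianBundle (fun x : M => TangentSpace (𝓡 n) x)] [MeasurableSpace M]
    (p : ℝ) (k : ℕ) : Set (DiffForm n M (k + 1)) :=
  {θ | IsLpForm p θ ∧
    ∃ β : DiffForm n M k, IsLpForm p β ∧ IsDifferential (pairing β) (pairing θ)}

/-- The closure of `lpExact` in the space of closed `Lᵖ` forms, for the `Lᵖ` norm. -/
def lpExactClosure (n : ℕ) (M : Type*) [TopologicalSpace M]
    [ChartedSpace (EuclideanSpace ℝ (Fin n)) M]
    [RiemannianBundle (fun x : M => TangentSpace (𝓡 n) x)] [MeasurableSpace M]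
    (p : ℝ) (k : ℕ) : Set (DiffForm n M (k + 1)) :=
  {θ | θ ∈ lpClosed n M p (k + 1) ∧
    ∀ ε : ℝ≥0∞, 0 < ε → ∃ τ ∈ lpExact n M p k, lpNorm p (θ - τ) < ε}

/-- The `Lᵖ` cohomology `ker d / im d` of `M` in degree `k + 1` vanishes. -/
def LpCohomologyVanishes (n : ℕ) (M : Type*) [TopologicalSpace M]
    [ChartedSpace (EuclideanSpace ℝ (Fin n)) M]
    [RiemannianBundle (fun x : M => TangentSpace (𝓡 n) x)] [MeasurableSpace M]
    (p : ℝ) (k : ℕ) : Prop :=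
  lpClosed n M p (k + 1) ⊆ lpExact n M p k

/-- The torsion `closure (im d) / im d` of the `Lᵖ` cohomology of `M` in degree `k + 1`
vanishes. -/
def LpTorsionVanishes (n : ℕ) (M : Type*) [TopologicalSpace M]
    [ChartedSpace (EuclideanSpace ℝ (Fin n)) M]
    [RiemannianBundle (fun x : M => TangentSpace (𝓡 n) x)] [MeasurableSpace M]
    (p : ℝ) (k : ℕ) : Prop :=
  lpExactClosure n M p k ⊆ lpExact n M p k

/-- The vector field `ξ`, with flow `φ`, is `(k, p)`-contracting: there are constants `C` and
`η > 0` such that `|φ_t^* β| ≤ C e^{-η t} Jac_x(φ_t)^{1/p} |β|` for all `t ≥ 0`, all `x` and all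
alternating `k`-forms `β` on the tangent space at `φ_t x` with `ι_ξ β = 0`. -/
def IsContracting (φ : ℝ → M → M) (ξ : (x : M) → TangentSpace (𝓡 n) x) (k : ℕ) (p : ℝ) : Prop :=
  ∃ C η : ℝ, 0 < η ∧ ∀ t : ℝ, 0 ≤ t → ∀ (x : M) (β : (TangentSpace (𝓡 n) (φ t x)) [⋀^Fin k]→L[ℝ] ℝ),
    (∀ v : Fin k → TangentSpace (𝓡 n) (φ t x), (∃ i, v i = ξ (φ t x)) → β v = 0) →
    ‖β.compContinuousLinearMap (mfderiv (𝓡 n) (𝓡 n) (φ t) x)‖ ≤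
      C * Real.exp (-η * t) * jacobian (mfderiv (𝓡 n) (𝓡 n) (φ t) x) ^ (1 / p) * ‖β‖

/-- `T` is the boundary value `lim_{t → +∞} φ_t^* θ` of `θ`, the limit being taken in the sense of
distributions. -/
def IsBoundaryValue {k : ℕ} (φ : ℝ → M → M) (θ : DiffForm n M k) (T : DistForm n M k) : Prop :=
  ∀ X : testFields n M k,
    Tendsto (fun t : ℝ => pairing (pullbackForm (φ t) θ) X) atTop (𝓝 (T.toLinearMap X))

end Riemannian

end LpForms

end

open Set Filter Topology MeasureTheory Bundle
open scoped Manifold ContDiff ENNReal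

set_option linter.unusedSectionVars false
set_option linter.style.haveILetI false

noncomputable section

namespace LpForms

local notation:max "𝔼" d:max => EuclideanSpace ℝ (Fin d)
local notation:max "ℰ" d:max => extChartAt (𝓡 d)
local notation:max "𝒟" d:max => mfderiv (𝓡 d) (𝓡 d)
local notation:max "𝕋" d:max => TangentSpace (𝓡 d)
local notation:max "𝒞" d:max => ContMDiff (𝓡 d) 𝓘(ℝ, ℝ) ∞

-- In this file the forms under study have degree `k + 1`, and the first hypothesis is contraction
-- in degree `k`.
--
-- Boundary value. For a closed `Lᵖ` form `θ`, Cartan's formula gives `d/dt φ_t^*θ = d(φ_t^* ι_ξ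
-- θ)`. The form `ι_ξ θ` is annihilated by `ι_ξ`, so contraction bounds `φ_t^* ι_ξ θ` by `C e^{-ηt}
-- Jac(φ_t)^{1/p} |ι_ξ θ| ∘ φ_t`. The change of variables shows that the `Lᵖ` norm of
-- `Jac(φ_t)^{1/p} |γ| ∘ φ_t` is that of `γ` (`IsFlowOf.lintegral_rpow_comp`). Hence `∫₀^∞ φ_s^* ι_ξ
-- θ ds` (`homotopyForm`) is an `Lᵖ` form, and `φ_t^*θ` converges to `θ` plus its differential. As
-- `θ` is only weakly closed, Cartan's formula is transposed to test fields: the transposes of `d`,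
-- of `ι_ξ`, of the Lie derivative and of multiplication by a function are computed on smooth
-- fields, and then any weak differential can be tested on them
-- (`IsFlowOf.hasDerivAt_pairing_of_isDifferential`).
--
-- Vanishing. Parts 2 and 3 both reduce to this: if `g` and `z = dg` are `Lᵖ` and the flow contracts
-- in degrees `deg g - 1` and `deg g`, the pairings of `φ_t^* g` with a test field come arbitrarily
-- close to `0` at arbitrarily large times (`LpPair.exists_small`). In part 2, `g` is a primitive of
-- the form (in degree `0` contraction applies directly); in part 3, `g` is the closed form itself
-- and `z = 0`. The difficulty is that `g` is not annihilated by `ι_ξ`. On compact sets of times and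
-- points, compactness yields `|φ_t^* b| ≤ Jac^{1/p} (2 C e^{-ηt} |b| + K |ι_ξ b|)` for every form
-- `b` (`ContractBound.exists_bound`). Iterating it along an orbit that stays in a compact set gives
-- exponential decay, up to a linear factor (`norm_pullback_iterate_le`). So the test field is cut
-- off by functions that vanish where the orbit has gone far away.
--
-- The cut-off must not spoil the estimates. Its differential meets `φ_s^* ι_ξ g` through terms `d(F
-- ∘ φ_r) ∧ φ_s^* ι_ξ g`, whose only dangerous part is proportional to `dF(ξ)` at `φ_r x`, the
-- derivative of `F` along the orbit. Taking a soft maximum of `F ∘ φ_r` over a fine grid of times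
-- `r` concentrates the weights near the maximum, where this derivative is small
-- (`sum_softWeight_deriv_le`). The quantities are then chosen in an order that makes every error
-- small (`LpPair.exists_small_pairing`). A general `g` is reduced to compact support by a cut-off
-- with small differential; completeness enters there and in the construction of `F`, through
-- Hopf–Rinow and smoothing of Lipschitz functions (`exists_cutoff`).
--
-- Consequences. A closed form with zero boundary value is exact by part 1. For the torsion, the
-- boundary value is continuous for the `Lᵖ` norm (`IsFlowOf.exists_bound_limit`) and vanishes on
-- exact forms, hence on their closure; exact forms are closed by a weak version of `d² = 0`
-- (`IsDifferential.closed`).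

local instance isManifold_one {n : ℕ} {M : Type*} [TopologicalSpace M]
    [ChartedSpace (𝔼 n) M] [IsManifold (𝓡 n) ∞ M] : IsManifold (𝓡 n) 1 M :=
  IsManifold.of_le (n := ∞) (by norm_cast)

local instance {n : ℕ} {M : Type*} [TopologicalSpace M]
    [ChartedSpace (𝔼 n) M] [IsManifold (𝓡 n) ∞ M] : TopologicalSpace
      (TotalSpace (𝔼 n) (fun x : M => 𝕋 n x)) :=
  inferInstanceAs (TopologicalSpace (TangentBundle (𝓡 n) M))

/-! ### Exterior algebra: wedge with a linear form, interior product. -/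

section Algebra

instance {V : Type*} [AddCommGroup V] [Module ℝ V] [TopologicalSpace V] [FiniteDimensional ℝ V]
    {k : ℕ} : FiniteDimensional ℝ (V [⋀^Fin k]→L[ℝ] ℝ) := by
  let i : (V [⋀^Fin k]→L[ℝ] ℝ) →ₗ[ℝ] MultilinearMap ℝ (fun _ : Fin k => V) ℝ :=
    { toFun := fun f => f.toMultilinearMap
      map_add' := fun _ _ => rfl
      map_smul' := fun _ _ => rfl }
  refine Module.Finite.of_injective i fun f g h => ?_
  ext v
  exact congrArg (fun m : MultilinearMap ℝ (fun _ : Fin k => V) ℝ => m v) h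

variable {U V W G : Type*} [NormedAddCommGroup U] [NormedSpace ℝ U]
  [NormedAddCommGroup V] [NormedSpace ℝ V] [NormedAddCommGroup W] [NormedSpace ℝ W]
  [NormedAddCommGroup G] [NormedSpace ℝ G]

/-- An injective linear map between finite-dimensional spaces has a continuous left inverse. -/
lemma exists_clm_leftInverse [FiniteDimensional ℝ V] [FiniteDimensional ℝ W] (i : V →ₗ[ℝ] W)
    (hi : Function.Injective i) : ∃ g : W →L[ℝ] V, ∀ v, g (i v) = v := by
  obtain ⟨g, hg⟩ := LinearMap.exists_leftInverse_of_injective i (LinearMap.ker_eq_bot.2 hi)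
  exact ⟨LinearMap.toContinuousLinearMap g, fun v => LinearMap.congr_fun hg v⟩

/-- Evaluation of alternating forms on tuples of vectors of a basis. -/
def evalBasis (V : Type*) [NormedAddCommGroup V] [NormedSpace ℝ V] [FiniteDimensional ℝ V] (k : ℕ) :
    (V [⋀^Fin k]→L[ℝ] ℝ) →ₗ[ℝ] ((Fin k → Fin (Module.finrank ℝ V)) → ℝ) where
  toFun f := fun I => f (fun j => (Module.finBasis ℝ V) (I j))
  map_add' _ _ := rfl
  map_smul' _ _ := rfl

lemma evalBasis_injective [FiniteDimensional ℝ V] (k : ℕ) :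
    Function.Injective (evalBasis V k) := by
  intro f g h
  have : f.toMultilinearMap = g.toMultilinearMap :=
    Module.Basis.ext_multilinear (fun _ => Module.finBasis ℝ V) fun I => congrFun h I
  ext v
  exact congrArg (fun m : MultilinearMap ℝ (fun _ : Fin k => V) ℝ => m v) this

/-- A continuous recovery of an alternating form from its values on tuples of basis vectors. -/
lemma exists_recover (V : Type*) [NormedAddCommGroup V] [NormedSpace ℝ V]
    [FiniteDimensional ℝ V] (k : ℕ) :
    ∃ g : ((Fin k → Fin (Module.finrank ℝ V)) → ℝ) →L[ℝ] (V [⋀^Fin k]→L[ℝ] ℝ),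
      ∀ f : V [⋀^Fin k]→L[ℝ] ℝ, g (fun I => f (fun j => (Module.finBasis ℝ V) (I j))) = f := by
  obtain ⟨g, hg⟩ := exists_clm_leftInverse (evalBasis V k) (evalBasis_injective k)
  exact ⟨g, fun f => hg f⟩

/-- An alternating form depends linearly, hence smoothly, on its finitely many values on tuples of
basis vectors. -/
lemma contDiffAt_alternating [FiniteDimensional ℝ V] {k : ℕ} {m : WithTop ℕ∞}
    {f : G → V [⋀^Fin k]→L[ℝ] ℝ} {x : G} (h : ∀ v, ContDiffAt ℝ m (fun z => f z v) x) :
    ContDiffAt ℝ m f x := by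
  obtain ⟨g, hg⟩ := exists_recover V k
  have : f = fun z => g (fun I => f z (fun j => (Module.finBasis ℝ V) (I j))) := by
    funext z
    exact (hg (f z)).symm
  rw [this]
  exact g.contDiff.contDiffAt.comp x (contDiffAt_pi.2 fun I => h _)

/-- Evaluated on fixed vectors `v`, the map `A ↦ β (A v₁, …, A v_k)` is polynomial in `A`. -/
lemma contDiff_compContinuousLinearMapCLM [FiniteDimensional ℝ V] [FiniteDimensional ℝ W] {k : ℕ} :
    ContDiff ℝ ∞ (fun A : V →L[ℝ] W =>
      (ContinuousAlternatingMap.compContinuousLinearMapCLM (F := ℝ) (ι := Fin k) A)) := by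
  rw [contDiff_clm_apply_iff]
  intro β
  rw [contDiff_iff_contDiffAt]
  intro A
  refine contDiffAt_alternating fun v => ?_
  have h1 : ContDiff ℝ ∞ (fun w : Fin k → W => β w) := β.toContinuousMultilinearMap.contDiff
  have h2 : ContDiff ℝ ∞ (fun A : V →L[ℝ] W => fun i => A (v i)) :=
    contDiff_pi.2 fun i => (ContinuousLinearMap.apply ℝ W (v i)).contDiff
  exact (h1.comp h2).contDiffAt

/-- The exterior product of a linear form and an alternating form. -/
def wedge {V : Type*} [NormedAddCommGroup V] [NormedSpace ℝ V] {k : ℕ} (μ : V →L[ℝ] ℝ)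
    (β : V [⋀^Fin k]→L[ℝ] ℝ) : V [⋀^Fin (k + 1)]→L[ℝ] ℝ :=
  ContinuousAlternatingMap.alternatizeUncurryFin (μ.smulRight β)

lemma wedge_apply {k : ℕ} (μ : V →L[ℝ] ℝ) (β : V [⋀^Fin k]→L[ℝ] ℝ) (v : Fin (k + 1) → V) :
    wedge μ β v = ∑ i : Fin (k + 1), (-1) ^ (i : ℕ) * (μ (v i) * β (Fin.removeNth i v)) := by
  rw [wedge, ContinuousAlternatingMap.alternatizeUncurryFin_apply]
  simp

lemma norm_wedge_le {k : ℕ} (μ : V →L[ℝ] ℝ) (β : V [⋀^Fin k]→L[ℝ] ℝ) :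
    ‖wedge μ β‖ ≤ (k + 1) * (‖μ‖ * ‖β‖) := by
  refine (ContinuousAlternatingMap.norm_alternatizeUncurryFin_le _).trans_eq ?_
  rw [ContinuousLinearMap.norm_smulRight_apply]

lemma wedge_comp {k : ℕ} (μ : W →L[ℝ] ℝ) (β : W [⋀^Fin k]→L[ℝ] ℝ) (L : V →L[ℝ] W) :
    (wedge μ β).compContinuousLinearMap L =
      wedge (μ.comp L) (β.compContinuousLinearMap L) := by
  ext v
  simp only [ContinuousAlternatingMap.compContinuousLinearMap_apply, wedge_apply]
  rfl

lemma wedge_smul {k : ℕ} (μ : V →L[ℝ] ℝ) (c : ℝ) (β : V [⋀^Fin k]→L[ℝ] ℝ) :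
    wedge μ (c • β) = c • wedge μ β := by
  ext v
  simp only [wedge_apply, ContinuousAlternatingMap.smul_apply, smul_eq_mul, Finset.mul_sum]
  exact Finset.sum_congr rfl fun i _ => by ring

lemma smul_wedge {k : ℕ} (μ : V →L[ℝ] ℝ) (c : ℝ) (β : V [⋀^Fin k]→L[ℝ] ℝ) :
    wedge (c • μ) β = c • wedge μ β := by
  ext v
  simp only [wedge_apply, ContinuousAlternatingMap.smul_apply, smul_eq_mul, Finset.mul_sum,
    smul_apply]
  exact Finset.sum_congr rfl fun i _ => by ring

/-- The wedge product as a bilinear map. -/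
def wedgeCLM (V : Type*) [NormedAddCommGroup V] [NormedSpace ℝ V] (k : ℕ) :
    (V →L[ℝ] ℝ) →L[ℝ] (V [⋀^Fin k]→L[ℝ] ℝ) →L[ℝ] (V [⋀^Fin (k + 1)]→L[ℝ] ℝ) :=
  LinearMap.mkContinuous₂ (LinearMap.mk₂ ℝ wedge
    (fun μ ν β => by
      ext v
      simp only [wedge_apply, ContinuousAlternatingMap.add_apply, ← Finset.sum_add_distrib,
        add_apply]
      exact Finset.sum_congr rfl fun i _ => by ring)
    (fun c μ β => smul_wedge μ c β)
    (fun μ β γ => by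
      ext v
      simp only [wedge_apply, ContinuousAlternatingMap.add_apply, ← Finset.sum_add_distrib]
      exact Finset.sum_congr rfl fun i _ => by ring)
    (fun c μ β => wedge_smul μ c β)) (k + 1) (fun μ β => by
      rw [mul_assoc]
      exact norm_wedge_le μ β)

@[simp] lemma wedgeCLM_apply {k : ℕ} (μ : V →L[ℝ] ℝ) (β : V [⋀^Fin k]→L[ℝ] ℝ) :
    wedgeCLM V k μ β = wedge μ β := rfl

/-- The interior product by a vector. -/
def inter {V : Type*} [NormedAddCommGroup V] [NormedSpace ℝ V] {k : ℕ} (v : V) :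
    (V [⋀^Fin (k + 1)]→L[ℝ] ℝ) →L[ℝ] (V [⋀^Fin k]→L[ℝ] ℝ) :=
  (ContinuousLinearMap.apply ℝ _ v).comp
    (ContinuousAlternatingMap.curryLeftLI (𝕜 := ℝ) (E := V) (F := ℝ)
      (n := k)).toContinuousLinearMap

lemma inter_eq {k : ℕ} (v : V) (β : V [⋀^Fin (k + 1)]→L[ℝ] ℝ) : inter v β = β.curryLeft v := rfl

lemma inter_apply {k : ℕ} (v : V) (β : V [⋀^Fin (k + 1)]→L[ℝ] ℝ) (w : Fin k → V) :
    inter v β w = β (Matrix.vecCons v w) := rfl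

lemma norm_inter_le {k : ℕ} (v : V) (β : V [⋀^Fin (k + 1)]→L[ℝ] ℝ) :
    ‖inter v β‖ ≤ ‖v‖ * ‖β‖ := by
  rw [inter_eq, mul_comm]
  refine (β.curryLeft.le_opNorm v).trans_eq ?_
  rw [ContinuousAlternatingMap.norm_curryLeft]

/-- The interior product as a bilinear map. -/
def interCLM (V : Type*) [NormedAddCommGroup V] [NormedSpace ℝ V] (k : ℕ) :
    V →L[ℝ] (V [⋀^Fin (k + 1)]→L[ℝ] ℝ) →L[ℝ] (V [⋀^Fin k]→L[ℝ] ℝ) :=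
  ContinuousLinearMap.flip (ContinuousAlternatingMap.curryLeftLI (𝕜 := ℝ) (E := V) (F := ℝ)
      (n := k)).toContinuousLinearMap

@[simp] lemma interCLM_apply {k : ℕ} (v : V) : interCLM V k v = inter v := rfl

lemma inter_comp {k : ℕ} (L : V →L[ℝ] W) (v : V) (β : W [⋀^Fin (k + 1)]→L[ℝ] ℝ) :
    inter v (β.compContinuousLinearMap L) = (inter (L v) β).compContinuousLinearMap L := by
  ext w
  simp only [inter_apply, ContinuousAlternatingMap.compContinuousLinearMap_apply]
  congr 1
  funext i
  refine Fin.cases ?_ (fun j => ?_) i <;> simp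

lemma inter_inter_self {k : ℕ} (v : V) (β : V [⋀^Fin (k + 2)]→L[ℝ] ℝ) :
    inter v (inter v β) = 0 := by
  rw [inter_eq, inter_eq, ContinuousAlternatingMap.curryLeft_same]

/-- A form whose interior product with `v` vanishes is zero on tuples containing `v`. -/
lemma eq_zero_of_inter_eq_zero {k : ℕ} {v : V} {β : V [⋀^Fin (k + 1)]→L[ℝ] ℝ}
    (h : inter v β = 0) (w : Fin (k + 1) → V) (hw : ∃ i, w i = v) : β w = 0 := by
  obtain ⟨i, hi⟩ := hw
  have h1 : w = i.insertNth v (i.removeNth w) := by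
    rw [← hi]; exact (Fin.insertNth_self_removeNth i w).symm
  rw [h1, ContinuousAlternatingMap.map_insertNth, ← inter_apply, h]
  simp

/-- `ι_v` is an antiderivation: inserting `v` in the first slot isolates the summand `i = 0`, and
each remaining summand changes sign because its index is shifted by one. -/
lemma inter_wedge {k : ℕ} (v : V) (μ : V →L[ℝ] ℝ) (β : V [⋀^Fin (k + 1)]→L[ℝ] ℝ) :
    inter v (wedge μ β) = μ v • β - wedge μ (inter v β) := by
  ext w
  rw [inter_apply, wedge_apply, Fin.sum_univ_succ]
  simp only [ContinuousAlternatingMap.sub_apply, ContinuousAlternatingMap.smul_apply, wedge_apply]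
  rw [sub_eq_add_neg, ← Finset.sum_neg_distrib]
  congr 1
  · simp
  · refine Finset.sum_congr rfl fun i _ => ?_
    have : Fin.removeNth i.succ (Matrix.vecCons v w) = Matrix.vecCons v (Fin.removeNth i w) := by
      funext j
      refine Fin.cases ?_ (fun l => ?_) j
      · simp [Fin.removeNth]
      · simp [Fin.removeNth]
    rw [this, inter_apply]
    simp [pow_succ]

end Algebra

/-! ### Jacobians of linear maps as Gram determinants. -/

section Jacobian

variable {U V W : Type*} [NormedAddCommGroup U] [InnerProductSpace ℝ U] [FiniteDimensional ℝ U]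
  [NormedAddCommGroup V] [InnerProductSpace ℝ V] [FiniteDimensional ℝ V]
  [NormedAddCommGroup W] [InnerProductSpace ℝ W]

lemma gram_sum {ι κ : Type*} [Fintype ι] [Fintype κ] (w : κ → W) (P : Matrix κ ι ℝ) :
    Matrix.gram ℝ (fun i => ∑ j, P j i • w j) = P.transpose * Matrix.gram ℝ w * P := by
  ext a b
  simp only [Matrix.gram_apply, Matrix.mul_apply, Matrix.transpose_apply, sum_inner, inner_sum,
    inner_smul_left, inner_smul_right, Finset.sum_mul]
  refine Finset.sum_congr rfl fun i _ => ?_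
  rw [Finset.mul_sum]
  refine Finset.sum_congr rfl fun j _ => ?_
  simp [real_inner_comm]
  ring

/-- A change of vectors by a matrix `P` replaces the Gram matrix `G` by `Pᵀ G P`. -/
lemma gram_eq_of_orthonormalBasis {ι : Type*} [Fintype ι] [DecidableEq ι]
    (c : OrthonormalBasis ι ℝ V) (L : V →L[ℝ] W) (u : ι → V) :
    (Matrix.gram ℝ (fun i => L (u i))).det =
      (Matrix.det (Matrix.of fun j i => c.repr (u i) j)) ^ 2 *
        (Matrix.gram ℝ (fun i => L (c i))).det := by
  have h : (fun i => L (u i)) = fun i => ∑ j, (Matrix.of fun j i => c.repr (u i) j) j i • L (c j) := by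
    funext i
    conv_lhs => rw [← c.sum_repr (u i)]
    simp [map_sum]
  rw [h, gram_sum, Matrix.det_mul, Matrix.det_mul, Matrix.det_transpose]
  ring

lemma det_repr_sq {ι : Type*} [Fintype ι] [DecidableEq ι] (c : OrthonormalBasis ι ℝ V) (u : ι → V) :
    (Matrix.det (Matrix.of fun j i => c.repr (u i) j)) ^ 2 = (Matrix.gram ℝ u).det := by
  have h := gram_eq_of_orthonormalBasis c (ContinuousLinearMap.id ℝ V) u
  have h1 : Matrix.gram ℝ (fun i => (ContinuousLinearMap.id ℝ V) (c i)) = 1 := by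
    ext i j
    simp [Matrix.gram_apply, Matrix.one_apply, orthonormal_iff_ite.1 c.orthonormal]
  rw [h1] at h
  simpa using h.symm

/-- The Jacobian may be computed in any orthonormal basis. -/
lemma jacobian_eq {ι : Type*} [Fintype ι] [DecidableEq ι] (c : OrthonormalBasis ι ℝ V)
    (L : V →L[ℝ] W) : jacobian L = √(Matrix.gram ℝ (fun i => L (c i))).det := by
  have e : Fin (Module.finrank ℝ V) ≃ ι := by
    refine Fintype.equivOfCardEq ?_
    rw [Fintype.card_fin, Module.finrank_eq_card_basis c.toBasis]
  set b := (stdOrthonormalBasis ℝ V).reindex e with hb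
  have h1 : (Matrix.gram ℝ (fun i => L (stdOrthonormalBasis ℝ V i))).det =
      (Matrix.gram ℝ (fun i => L (b i))).det := by
    rw [← Matrix.det_submatrix_equiv_self e (Matrix.gram ℝ (fun i => L (b i)))]
    congr 1
    ext i j
    simp [Matrix.gram_apply, hb]
  rw [jacobian, h1, gram_eq_of_orthonormalBasis c L, det_repr_sq]
  have h2 : Matrix.gram ℝ (fun i => b i) = 1 := by
    ext i j
    simp [Matrix.gram_apply, Matrix.one_apply, orthonormal_iff_ite.1 b.orthonormal]
  have h2' : Matrix.gram ℝ (⇑b) = 1 := h2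
  rw [h2']
  simp

lemma jacobian_nonneg (L : V →L[ℝ] W) : 0 ≤ jacobian L := Real.sqrt_nonneg _

/-- Only source and middle space need equal dimension: the coordinate matrix of `L'` in an
orthonormal basis of the middle space must be square, while the target may be anything. -/
lemma jacobian_comp (h : Module.finrank ℝ U = Module.finrank ℝ V) (L : V →L[ℝ] W) (L' : U →L[ℝ] V) :
    jacobian (L.comp L') = jacobian L * jacobian L' := by
  set c := (stdOrthonormalBasis ℝ V).reindex (finCongr h.symm) with hc
  rw [jacobian_eq c L]
  have h1 := gram_eq_of_orthonormalBasis c L (fun i => L' (stdOrthonormalBasis ℝ U i))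
  rw [det_repr_sq] at h1
  have h2 : jacobian (L.comp L') = √(Matrix.gram ℝ
    (fun i => L (L' (stdOrthonormalBasis ℝ U i)))).det := rfl
  rw [h2, h1, mul_comm, Real.sqrt_mul]
  · rfl
  · exact (Matrix.posSemidef_gram ℝ _).det_nonneg

lemma jacobian_eq_abs_det (L : V →L[ℝ] V) : jacobian L = |L.det| := by
  have h1 := det_repr_sq (stdOrthonormalBasis ℝ V) (fun i => L (stdOrthonormalBasis ℝ V i))
  rw [jacobian, ← h1, Real.sqrt_sq_eq_abs]
  congr 1
  rw [ContinuousLinearMap.det, ← LinearMap.det_toMatrix (stdOrthonormalBasis ℝ V).toBasis]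
  congr 1
  ext i j
  simp [LinearMap.toMatrix_apply]

lemma jacobian_id : jacobian (ContinuousLinearMap.id ℝ V) = 1 := by
  rw [jacobian_eq_abs_det, ContinuousLinearMap.det]
  simp [LinearMap.det_id]

lemma jacobian_pos_of_comp_eq_id (h : Module.finrank ℝ U = Module.finrank ℝ V) {L : V →L[ℝ] U}
    {L' : U →L[ℝ] V} (hL : L.comp L' = ContinuousLinearMap.id ℝ U) :
    0 < jacobian L' := by
  have := jacobian_comp h L L'
  rw [hL, jacobian_id] at this
  rcases (jacobian_nonneg L').lt_or_eq with h1 | h1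
  · exact h1
  · rw [← h1] at this
    simp at this

end Jacobian

/-! ### Expressions of maps, forms and fields in charts. -/

section ChartCalculus

variable {n : ℕ} {M : Type*} [TopologicalSpace M] [ChartedSpace (𝔼 n) M]

/-- The inverse of the differential at `x` of the chart centred at `x₀`. -/
def chartInvAt (x₀ x : M) : 𝔼 n →L[ℝ] 𝕋 n x :=
  (chartDeriv x₀ x).inverse

lemma chartInvDeriv_eq_mfderivWithin (x₀ : M) (y : 𝔼 n) :
    chartInvDeriv x₀ y = mfderivWithin 𝓘(ℝ, 𝔼 n) (𝓡 n) (ℰ n x₀).symm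
      (range (𝓡 n)) y := by
  have h : range (𝓡 n) = univ := by simp
  rw [chartInvDeriv, h, mfderivWithin_univ]

variable [IsManifold (𝓡 n) ∞ M]

lemma chartDeriv_isInvertible {x₀ x : M} (hx : x ∈ (ℰ n x₀).source) :
    (chartDeriv (n := n) x₀ x).IsInvertible :=
  haveI := isManifold_one (n := n) (M := M)
  isInvertible_mfderiv_extChartAt hx

lemma chartDeriv_comp_chartInvAt {x₀ x : M} (hx : x ∈ (ℰ n x₀).source) :
    (chartDeriv (n := n) x₀ x).comp (chartInvAt x₀ x) = ContinuousLinearMap.id ℝ _ :=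
  (chartDeriv_isInvertible hx).self_comp_inverse

lemma chartInvAt_comp_chartDeriv {x₀ x : M} (hx : x ∈ (ℰ n x₀).source) :
    (chartInvAt x₀ x).comp (chartDeriv (n := n) x₀ x) = ContinuousLinearMap.id ℝ _ :=
  (chartDeriv_isInvertible hx).inverse_comp_self

/-- Reconciles two descriptions of the same map: `chartInvDeriv` is indexed by coordinates, as in
the definitions, and `chartInvAt` by points of the manifold, whose tangent spaces then need no
transport. -/
lemma chartInvAt_symm {x₀ : M} {y : 𝔼 n} (hy : y ∈ (ℰ n x₀).target) :
    chartInvAt x₀ ((ℰ n x₀).symm y) = chartInvDeriv x₀ y := by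
  haveI := isManifold_one (n := n) (M := M)
  rw [chartInvAt, chartInvDeriv_eq_mfderivWithin]
  exact ContinuousLinearMap.inverse_eq
    (mfderiv_extChartAt_comp_mfderivWithin_extChartAt_symm hy)
    (mfderivWithin_extChartAt_symm_comp_mfderiv_extChartAt hy)

lemma chartDeriv_chartInvAt_apply {x₀ x : M} (hx : x ∈ (ℰ n x₀).source) (v : 𝔼 n) :
    chartDeriv (n := n) x₀ x (chartInvAt x₀ x v) = v :=
  DFunLike.congr_fun (chartDeriv_comp_chartInvAt hx) v

lemma chartInvAt_chartDeriv_apply {x₀ x : M} (hx : x ∈ (ℰ n x₀).source)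
    (v : 𝕋 n x) : chartInvAt x₀ x (chartDeriv (n := n) x₀ x v) = v :=
  DFunLike.congr_fun (chartInvAt_comp_chartDeriv hx) v

/-- Evaluating coordinate expressions at the image of a point `x`, rather than at a coordinate `y`,
keeps everything in the fibre over `x` and avoids comparing it with the fibre over `symm (chart x)`.
-/
lemma coordForm_chart {k : ℕ} {x₀ x : M} (hx : x ∈ (ℰ n x₀).source)
    (θ : DiffForm n M k) : coordForm x₀ θ (ℰ n x₀ x) =
      (θ x).compContinuousLinearMap (chartInvAt x₀ x) := by
  obtain ⟨y, hy, rfl⟩ : ∃ y ∈ (ℰ n x₀).target, (ℰ n x₀).symm y = x :=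
    ⟨_, (ℰ n x₀).map_source hx, (ℰ n x₀).left_inv hx⟩
  rw [(ℰ n x₀).right_inv hy, chartInvAt_symm hy]
  rfl

lemma form_eq_coordForm {k : ℕ} {x₀ x : M} (hx : x ∈ (ℰ n x₀).source)
    (θ : DiffForm n M k) : θ x = (coordForm x₀ θ (ℰ n x₀ x)).compContinuousLinearMap
      (chartDeriv x₀ x) := by
  rw [coordForm_chart hx]
  ext v
  simp only [ContinuousAlternatingMap.compContinuousLinearMap_apply, Function.comp_def,
    chartInvAt_chartDeriv_apply hx]

lemma coordField_chart {k : ℕ} {x₀ x : M} (hx : x ∈ (ℰ n x₀).source)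
    (X : MultivectorField n M k) : coordField x₀ X (ℰ n x₀ x) =
      (X x).comp (ContinuousAlternatingMap.compContinuousLinearMapCLM (chartDeriv x₀ x)) := by
  obtain ⟨y, hy, rfl⟩ : ∃ y ∈ (ℰ n x₀).target, (ℰ n x₀).symm y = x :=
    ⟨_, (ℰ n x₀).map_source hx, (ℰ n x₀).left_inv hx⟩
  rw [(ℰ n x₀).right_inv hy]
  rfl

lemma field_apply_eq {k : ℕ} {x₀ x : M} (hx : x ∈ (ℰ n x₀).source)
    (X : MultivectorField n M k) (β : (𝕋 n x) [⋀^Fin k]→L[ℝ] ℝ) :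
    X x β = coordField x₀ X (ℰ n x₀ x)
      (β.compContinuousLinearMap (chartInvAt x₀ x)) := by
  rw [coordField_chart hx]
  simp only [ContinuousLinearMap.comp_apply,
    ContinuousAlternatingMap.compContinuousLinearMapCLM_apply]
  congr 1
  ext v
  simp only [ContinuousAlternatingMap.compContinuousLinearMap_apply, Function.comp_def,
    chartInvAt_chartDeriv_apply hx]

lemma pair_eq_coord {k : ℕ} {x₀ x : M} (hx : x ∈ (ℰ n x₀).source)
    (X : MultivectorField n M k) (θ : DiffForm n M k) :
    X x (θ x) = coordField x₀ X (ℰ n x₀ x)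
      (coordForm x₀ θ (ℰ n x₀ x)) := by
  rw [field_apply_eq hx, coordForm_chart hx]

/-- The chart expression of a map. -/
def coordMap (x₁ x₀ : M) (g : M → M) : (𝔼 n) → 𝔼 n :=
  fun y => ℰ n x₀ (g ((ℰ n x₁).symm y))

lemma coordMap_chart {x₁ x₀ x : M} (hx : x ∈ (ℰ n x₁).source) (g : M → M) :
    coordMap (n := n) x₁ x₀ g (ℰ n x₁ x) = ℰ n x₀ (g x) := by
  rw [coordMap, (ℰ n x₁).left_inv hx]

lemma fderiv_coordMap {x₁ x₀ x : M} (hx : x ∈ (ℰ n x₁).source) {g : M → M}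
    (hgx : g x ∈ (ℰ n x₀).source) (hg : MDifferentiableAt (𝓡 n) (𝓡 n) g x) :
    fderiv ℝ (coordMap x₁ x₀ g) (ℰ n x₁ x) =
      (chartDeriv x₀ (g x)).comp ((𝒟 n g x).comp (chartInvAt x₁ x)) := by
  haveI := isManifold_one (n := n) (M := M)
  obtain ⟨y, hy, rfl⟩ : ∃ y ∈ (ℰ n x₁).target, (ℰ n x₁).symm y = x :=
    ⟨_, (ℰ n x₁).map_source hx, (ℰ n x₁).left_inv hx⟩
  rw [(ℰ n x₁).right_inv hy, chartInvAt_symm hy, ← mfderiv_eq_fderiv]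
  have h1 : MDifferentiableAt 𝓘(ℝ, 𝔼 n) (𝓡 n) (ℰ n x₁).symm y := by
    have := mdifferentiableWithinAt_extChartAt_symm (I := 𝓡 n) hy
    simpa [mdifferentiableWithinAt_univ] using this
  have h2 : MDifferentiableAt (𝓡 n) 𝓘(ℝ, 𝔼 n) (ℰ n x₀)
      (g ((ℰ n x₁).symm y)) :=
    mdifferentiableAt_extChartAt (by rwa [extChartAt_source] at hgx)
  have h3 : coordMap x₁ x₀ g = (ℰ n x₀) ∘ (g ∘ (ℰ n x₁).symm) := rfl
  rw [h3, mfderiv_comp (I' := 𝓡 n) y h2 (hg.comp y h1), mfderiv_comp (I' := 𝓡 n) y hg h1]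
  rfl

/-- Chart expression of the pull-back of a form. -/
lemma coordForm_pullback {k : ℕ} {x₁ x₀ x : M} (hx : x ∈ (ℰ n x₁).source) {g : M → M}
    (hgx : g x ∈ (ℰ n x₀).source) (hg : MDifferentiableAt (𝓡 n) (𝓡 n) g x)
    (θ : DiffForm n M k) :
    coordForm x₁ (pullbackForm g θ) (ℰ n x₁ x) =
      (coordForm x₀ θ (coordMap x₁ x₀ g (ℰ n x₁ x))).compContinuousLinearMap
        (fderiv ℝ (coordMap x₁ x₀ g) (ℰ n x₁ x)) := by
  rw [coordForm_chart hx, fderiv_coordMap hx hgx hg, coordMap_chart hx, coordForm_chart hgx]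
  ext v
  simp only [pullbackForm, ContinuousAlternatingMap.compContinuousLinearMap_apply, Function.comp_def,
    ContinuousLinearMap.comp_apply, chartInvAt_chartDeriv_apply hgx]

/-- The push-forward of a field of multivectors by the inverse of `g`, multiplied by `J`. -/
def pushField {k : ℕ} (J : M → ℝ) (g : M → M) (X : MultivectorField n M k) :
    MultivectorField n M k :=
  fun y => J y • (X (g y)).comp (ContinuousAlternatingMap.compContinuousLinearMapCLM
    (𝒟 n g y).inverse)

lemma coordField_push {k : ℕ} {x₁ x₀ x : M} (hx : x ∈ (ℰ n x₁).source) {g : M → M}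
    (hgx : g x ∈ (ℰ n x₀).source) (hg : MDifferentiableAt (𝓡 n) (𝓡 n) g x)
    (hi : (𝒟 n g x).IsInvertible) (J : M → ℝ) (X : MultivectorField n M k) :
    coordField x₁ (pushField J g X) (ℰ n x₁ x) =
      J x • (coordField x₀ X (coordMap x₁ x₀ g (ℰ n x₁ x))).comp
        (ContinuousAlternatingMap.compContinuousLinearMapCLM
          (fderiv ℝ (coordMap x₁ x₀ g) (ℰ n x₁ x)).inverse) := by
  have hinv : (fderiv ℝ (coordMap x₁ x₀ g) (ℰ n x₁ x)).inverse =
      (chartDeriv x₁ x).comp ((𝒟 n g x).inverse.comp (chartInvAt x₀ (g x))) := by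
    rw [fderiv_coordMap hx hgx hg]
    obtain ⟨a, ha⟩ := chartDeriv_isInvertible hx
    obtain ⟨b, hb⟩ := chartDeriv_isInvertible hgx
    obtain ⟨c, hc⟩ := hi
    rw [chartInvAt, chartInvAt, ← ha, ← hb, ← hc]
    simp only [ContinuousLinearMap.inverse_equiv]
    refine ContinuousLinearMap.inverse_eq ?_ ?_ <;> · ext v; simp
  rw [hinv, coordField_chart hx, coordMap_chart hx, coordField_chart hgx]
  ext β
  simp only [pushField, ContinuousLinearMap.comp_apply, smul_apply]
  congr 2
  ext v
  simp only [ContinuousAlternatingMap.compContinuousLinearMapCLM_apply,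
    ContinuousAlternatingMap.compContinuousLinearMap_apply, Function.comp_def,
    ContinuousLinearMap.comp_apply, chartInvAt_chartDeriv_apply hgx]

omit [IsManifold (𝓡 n) ∞ M] in
lemma pullbackForm_id {k : ℕ} (θ : DiffForm n M k) : pullbackForm id θ = θ := by
  funext x
  rw [pullbackForm, mfderiv_id]
  rfl

omit [IsManifold (𝓡 n) ∞ M] in
lemma pushField_id {k : ℕ} (X : MultivectorField n M k) : pushField 1 id X = X := by
  funext x
  rw [pushField, mfderiv_id]
  ext β
  simp only [ContinuousLinearMap.inverse_id, Pi.one_apply, one_smul]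
  rfl

/-- Smoothness in charts of a smooth family of maps. -/
lemma contDiffAt_coordMap_family {f : ℝ → M → M}
    (hf : ContMDiff (𝓘(ℝ, ℝ).prod (𝓡 n)) (𝓡 n) ∞ (fun q : ℝ × M => f q.1 q.2))
    {x₁ x₀ x : M} {s : ℝ} (hx : x ∈ (ℰ n x₁).source)
    (hfx : f s x ∈ (ℰ n x₀).source) :
    ContDiffAt ℝ ∞ (fun q : ℝ × (𝔼 n) => coordMap (n := n) x₁ x₀ (f q.1) q.2)
      (s, ℰ n x₁ x) := by
  have hy := (ℰ n x₁).map_source hx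
  have hl := (ℰ n x₁).left_inv hx
  rw [← contMDiffAt_iff_contDiffAt]
  have h1 : ContMDiffAt 𝓘(ℝ, 𝔼 n) (𝓡 n) ∞ (ℰ n x₁).symm (ℰ n x₁ x) :=
    (contMDiffOn_extChartAt_symm x₁).contMDiffAt ((isOpen_extChartAt_target x₁).mem_nhds hy)
  have h2 : ContMDiffAt 𝓘(ℝ, ℝ × 𝔼 n) (𝓘(ℝ, ℝ).prod (𝓡 n)) ∞
      (fun q : ℝ × (𝔼 n) => (q.1, (ℰ n x₁).symm q.2))
      (s, ℰ n x₁ x) := by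
    refine ContMDiffAt.prodMk ?_ ?_
    · exact contMDiffAt_iff_contDiffAt.2 contDiffAt_fst
    · exact ContMDiffAt.comp (I' := 𝓘(ℝ, 𝔼 n)) (s, ℰ n x₁ x) h1
        (contMDiffAt_iff_contDiffAt.2 contDiffAt_snd)
  have h3 : ContMDiffAt 𝓘(ℝ, ℝ × 𝔼 n) (𝓡 n) ∞
      (fun q : ℝ × (𝔼 n) => f q.1 ((ℰ n x₁).symm q.2))
      (s, ℰ n x₁ x) := hf.contMDiffAt.comp (s, ℰ n x₁ x) h2
  have h4 : ContMDiffAt (𝓡 n) 𝓘(ℝ, 𝔼 n) ∞ (ℰ n x₀) (f s x) :=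
    contMDiffAt_extChartAt' (by rwa [extChartAt_source] at hfx)
  refine ContMDiffAt.comp_of_eq h4 h3 ?_
  simp only [hl]

lemma contDiffAt_fderiv_coordMap_family {f : ℝ → M → M}
    (hf : ContMDiff (𝓘(ℝ, ℝ).prod (𝓡 n)) (𝓡 n) ∞ (fun q : ℝ × M => f q.1 q.2))
    {x₁ x₀ x : M} {s : ℝ} (hx : x ∈ (ℰ n x₁).source)
    (hfx : f s x ∈ (ℰ n x₀).source) :
    ContDiffAt ℝ ∞ (fun q : ℝ × (𝔼 n) => fderiv ℝ (coordMap (n := n) x₁ x₀ (f q.1)) q.2)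
      (s, ℰ n x₁ x) := by
  refine ContDiffAt.fderiv (n := ∞) (f := fun (q : ℝ × (𝔼 n)) (y : 𝔼 n) =>
    coordMap (n := n) x₁ x₀ (f q.1) y) (g := fun q => q.2) ?_ contDiffAt_snd (by simp)
  have h := contDiffAt_coordMap_family hf hx hfx
  exact ContDiffAt.comp (f := fun q : (ℝ × (𝔼 n)) × (𝔼 n) => (q.1.1, q.2))
    ((s, ℰ n x₁ x), ℰ n x₁ x) h
    ((contDiffAt_fst.comp _ contDiffAt_fst).prodMk contDiffAt_snd)

lemma contMDiff_const_family {g : M → M} (hg : ContMDiff (𝓡 n) (𝓡 n) ∞ g) :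
    ContMDiff (𝓘(ℝ, ℝ).prod (𝓡 n)) (𝓡 n) ∞ (fun q : ℝ × M => (fun _ : ℝ => g) q.1 q.2) :=
  hg.comp contMDiff_snd

lemma eventually_mem_source {x₁ x : M} (hx : x ∈ (ℰ n x₁).source) {Z : Set M}
    (hZ : Z ∈ 𝓝 x) : ∀ᶠ y in 𝓝 (ℰ n x₁ x), y ∈ (ℰ n x₁).target ∧
      (ℰ n x₁).symm y ∈ Z := by
  have h1 := (isOpen_extChartAt_target (I := 𝓡 n) x₁).mem_nhds
    ((ℰ n x₁).map_source hx)
  have h2 : ContinuousAt (ℰ n x₁).symm (ℰ n x₁ x) :=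
    continuousAt_extChartAt_symm' hx
  have h3 := h2.preimage_mem_nhds (t := Z) (by rwa [(ℰ n x₁).left_inv hx])
  filter_upwards [h1, h3] with y hy hy'
  exact ⟨hy, hy'⟩

lemma eventually_family_mem {f : ℝ → M → M}
    (hf : ContMDiff (𝓘(ℝ, ℝ).prod (𝓡 n)) (𝓡 n) ∞ (fun q : ℝ × M => f q.1 q.2))
    {x₁ x₀ x : M} {s : ℝ} (hx : x ∈ (ℰ n x₁).source)
    (hfx : f s x ∈ (ℰ n x₀).source) :
    ∀ᶠ q : ℝ × (𝔼 n) in 𝓝 (s, ℰ n x₁ x), q.2 ∈ (ℰ n x₁).target ∧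
      f q.1 ((ℰ n x₁).symm q.2) ∈ (ℰ n x₀).source := by
  have hc : ContinuousAt (fun q : ℝ × (𝔼 n) => f q.1 ((ℰ n x₁).symm q.2))
      (s, ℰ n x₁ x) := by
    have h5 : ContinuousAt (ℰ n x₁).symm (ℰ n x₁ x) :=
      continuousAt_extChartAt_symm' hx
    exact ContinuousAt.comp (g := fun q : ℝ × M => f q.1 q.2) hf.continuous.continuousAt
      (continuousAt_fst.prodMk (ContinuousAt.comp (g := (ℰ n x₁).symm)
        (f := fun q : ℝ × (𝔼 n) => q.2) h5 continuousAt_snd))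
  refine Filter.Eventually.and ?_ ?_
  · exact continuousAt_snd.eventually ((isOpen_extChartAt_target (I := 𝓡 n) x₁).mem_nhds
      ((ℰ n x₁).map_source hx))
  · refine hc.eventually ((isOpen_extChartAt_source (I := 𝓡 n) x₀).mem_nhds ?_)
    simp only [(ℰ n x₁).left_inv hx]
    exact hfx

end ChartCalculus

/-! ### Cartan's formula in a vector space. -/

section VectorCalculus

variable {V W G : Type*} [NormedAddCommGroup V] [NormedSpace ℝ V]
  [NormedAddCommGroup W] [NormedSpace ℝ W] [NormedAddCommGroup G] [NormedSpace ℝ G]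

lemma _root_.ContDiffAt.compAlternating [FiniteDimensional ℝ V] [FiniteDimensional ℝ W] {k : ℕ}
    {f : G → W [⋀^Fin k]→L[ℝ] ℝ} {A : G → V →L[ℝ] W} {z : G} (hf : ContDiffAt ℝ ∞ f z)
    (hA : ContDiffAt ℝ ∞ A z) :
    ContDiffAt ℝ ∞ (fun z => (f z).compContinuousLinearMap (A z)) z :=
  ((contDiff_compContinuousLinearMapCLM (k := k) (V := V) (W := W)).contDiffAt.comp z hA).clm_apply hf

/-- The algebraic half of Cartan's formula: alternating a derivative `L` behaves under `ι_v` like a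
wedge product, with `L v` as the term where the direction of differentiation is contracted. -/
lemma inter_alternatizeUncurryFin {k : ℕ} (v : V) (L : V →L[ℝ] V [⋀^Fin (k + 1)]→L[ℝ] ℝ) :
    inter v (ContinuousAlternatingMap.alternatizeUncurryFin L) =
      L v - ContinuousAlternatingMap.alternatizeUncurryFin ((inter v).comp L) := by
  ext w
  rw [inter_apply, ContinuousAlternatingMap.alternatizeUncurryFin_apply, Fin.sum_univ_succ]
  simp only [ContinuousAlternatingMap.sub_apply,
    ContinuousAlternatingMap.alternatizeUncurryFin_apply]
  rw [sub_eq_add_neg, ← Finset.sum_neg_distrib]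
  congr 1
  · simp
  · refine Finset.sum_congr rfl fun i _ => ?_
    have : Fin.removeNth i.succ (Matrix.vecCons v w) = Matrix.vecCons v (Fin.removeNth i w) := by
      funext j
      refine Fin.cases ?_ (fun l => ?_) j
      · simp [Fin.removeNth]
      · simp [Fin.removeNth]
    rw [this, ContinuousLinearMap.comp_apply, inter_apply]
    simp [pow_succ]

/-- Cartan's formula in a vector space. -/
lemma cartan_formula [FiniteDimensional ℝ V] {k : ℕ} {ψ : V → V [⋀^Fin (k + 1)]→L[ℝ] ℝ} {ζ : V → V}
    {y : V} (hψ : DifferentiableAt ℝ ψ y) (hζ : DifferentiableAt ℝ ζ y) :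
    extDeriv (fun z => inter (ζ z) (ψ z)) y + inter (ζ y) (extDeriv ψ y) =
      fderiv ℝ ψ y (ζ y) + (ψ y).fderivCompContinuousLinearMap (ContinuousLinearMap.id ℝ V)
        (fderiv ℝ ζ y) := by
  have h1 : HasFDerivAt (fun z => interCLM V k (ζ z)) ((interCLM V k).comp (fderiv ℝ ζ y)) y := by
    have h0 : HasFDerivAt (fun v => interCLM V k v) (interCLM V k) (ζ y) :=
      ContinuousLinearMap.hasFDerivAt (𝕜 := ℝ) (E := V)
        (F := (V [⋀^Fin (k + 1)]→L[ℝ] ℝ) →L[ℝ] V [⋀^Fin k]→L[ℝ] ℝ) (interCLM V k)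
    exact HasFDerivAt.comp (𝕜 := ℝ) (E := V) (F := V)
      (G := (V [⋀^Fin (k + 1)]→L[ℝ] ℝ) →L[ℝ] V [⋀^Fin k]→L[ℝ] ℝ) (f := ζ)
      (g := fun v => interCLM V k v) y h0 hζ.hasFDerivAt
  have h2 : HasFDerivAt (fun z => inter (ζ z) (ψ z)) _ y := h1.clm_apply hψ.hasFDerivAt
  rw [extDeriv, h2.fderiv, extDeriv, inter_alternatizeUncurryFin,
    ContinuousAlternatingMap.alternatizeUncurryFin_add, interCLM_apply,
    ContinuousAlternatingMap.fderivCompContinuousLinearMap_eq_alternatizeUncurryFin]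
  -- The terms in which the derivative falls on `ζ` form, once alternated, the derivative of `A ↦
  -- A^*(ψ y)` at the identity in the direction `fderiv ℝ ζ y`.
  have h3 : ContinuousAlternatingMap.alternatizeUncurryFin
      ((((interCLM V k).comp (fderiv ℝ ζ y)).flip) (ψ y)) =
      ((ContinuousAlternatingMap.alternatizeUncurryFinCLM ℝ V ℝ).comp
        (((ContinuousAlternatingMap.compContinuousLinearMapCLM (ContinuousLinearMap.id ℝ V)).comp
          (ψ y).curryLeft).postcomp V)) (fderiv ℝ ζ y) := by
    rw [ContinuousLinearMap.comp_apply]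
    change ContinuousAlternatingMap.alternatizeUncurryFin _ =
      ContinuousAlternatingMap.alternatizeUncurryFin _
    congr 1
  rw [← h3]
  abel

/-- Derivative at time `0` of the pull-backs of a form by a family of maps starting at the
identity. -/
lemma hasDerivAt_pullback_zero [FiniteDimensional ℝ V] {k : ℕ} {ψ : V → V [⋀^Fin (k + 1)]→L[ℝ] ℝ}
    {Φ : ℝ × V → V} {ζ : V → V} {y : V} (hψ : DifferentiableAt ℝ ψ y)
    (hΦ : ContDiffAt ℝ ∞ Φ (0, y)) (h0 : ∀ᶠ z in 𝓝 y, Φ (0, z) = z)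
    (hζ : ∀ᶠ z in 𝓝 y, HasDerivAt (fun s => Φ (s, z)) (ζ z) 0) :
    HasDerivAt (fun s : ℝ => (ψ (Φ (s, y))).compContinuousLinearMap
        (fderiv ℝ (fun z => Φ (s, z)) y))
      (extDeriv (fun z => inter (ζ z) (ψ z)) y + inter (ζ y) (extDeriv ψ y)) 0 := by
  have hΦ1 : ∀ᶠ q in 𝓝 ((0 : ℝ), y), DifferentiableAt ℝ Φ q := by
    have := (hΦ.of_le (m := 1) (by norm_cast)).eventually (by simp)
    filter_upwards [this] with q hq using hq.differentiableAt (by simp)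
  have hD : ContDiffAt ℝ ∞ (fderiv ℝ Φ) (0, y) := hΦ.fderiv_right (by simp)
  have hDd : DifferentiableAt ℝ (fderiv ℝ Φ) (0, y) := hD.differentiableAt (by simp)
  have hin : ∀ s z, HasFDerivAt (fun z : V => (s, z) : V → ℝ × V) (ContinuousLinearMap.inr ℝ ℝ V) z :=
    fun s z => hasFDerivAt_prodMk_right s z
  have hil : ∀ s (z : V), HasFDerivAt (fun s : ℝ => (s, z)) (ContinuousLinearMap.inl ℝ ℝ V) s :=
    fun s z => hasFDerivAt_prodMk_left s z
  have hc1 : ContinuousAt (fun z : V => ((0 : ℝ), z)) y := by fun_prop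
  have hc2 : ContinuousAt (fun s : ℝ => (s, y)) 0 := by fun_prop
  -- the field is the time derivative
  have hζ' : ζ =ᶠ[𝓝 y] fun z => fderiv ℝ Φ (0, z) (1, 0) := by
    filter_upwards [hζ, hc1.eventually hΦ1] with z hz hz'
    have h1 : HasDerivAt (fun s => Φ (s, z)) (fderiv ℝ Φ (0, z) (1, 0)) 0 := by
      have : HasDerivAt (fun s => Φ (s, z)) _ 0 :=
        (hz'.hasFDerivAt.comp (0 : ℝ) (hil 0 z)).hasDerivAt
      simpa using this
    exact hz.unique h1
  have hζd : HasFDerivAt ζ ((ContinuousLinearMap.apply ℝ V ((1 : ℝ), (0 : V))).comp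
      ((fderiv ℝ (fderiv ℝ Φ) (0, y)).comp (ContinuousLinearMap.inr ℝ ℝ V))) y := by
    have h1 : HasFDerivAt (fun z => fderiv ℝ Φ (0, z)) _ y := hDd.hasFDerivAt.comp y (hin 0 y)
    exact (((ContinuousLinearMap.apply ℝ V ((1 : ℝ), (0 : V))).hasFDerivAt.comp y h1)).congr_of_eventuallyEq hζ'
  have hsym : IsSymmSndFDerivAt ℝ Φ (0, y) :=
    hΦ.isSymmSndFDerivAt (by simp; exact WithTop.coe_le_coe.2 le_top)
  have hy0 : Φ (0, y) = y := h0.self_of_nhds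
  have hid : fderiv ℝ (fun z => Φ (0, z)) y = ContinuousLinearMap.id ℝ V := by
    have : (fun z => Φ (0, z)) =ᶠ[𝓝 y] id := h0
    rw [this.fderiv_eq, fderiv_id]
  -- The time derivative of the spatial differential is the spatial differential of the time
  -- derivative: this is the symmetry of the second derivative of `Φ`.
  have hA : HasDerivAt (fun s : ℝ => fderiv ℝ (fun z => Φ (s, z)) y) (fderiv ℝ ζ y) 0 := by
    have h1 : (fun s : ℝ => fderiv ℝ (fun z => Φ (s, z)) y) =ᶠ[𝓝 0]
        fun s => (fderiv ℝ Φ (s, y)).comp (ContinuousLinearMap.inr ℝ ℝ V) := by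
      filter_upwards [hc2.eventually hΦ1] with s hs
      exact (hs.hasFDerivAt.comp y (hin s y)).fderiv
    have h2 : HasFDerivAt (fun s : ℝ => fderiv ℝ Φ (s, y)) _ 0 := hDd.hasFDerivAt.comp 0 (hil 0 y)
    have h3 := (h2.hasDerivAt.clm_comp (hasDerivAt_const (0 : ℝ) (ContinuousLinearMap.inr ℝ ℝ V)))
    refine (h3.congr_of_eventuallyEq h1).congr_deriv ?_
    rw [hζd.fderiv]
    ext v
    simpa using (hsym (1, 0) (0, v))
  have hP : HasDerivAt (fun s : ℝ => Φ (s, y)) (ζ y) 0 := hζ.self_of_nhds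
  have hψΦ : HasDerivAt (fun s : ℝ => ψ (Φ (s, y))) (fderiv ℝ ψ y (ζ y)) 0 := by
    have : HasFDerivAt ψ (fderiv ℝ ψ y) (Φ (0, y)) := by rw [hy0]; exact hψ.hasFDerivAt
    exact this.comp_hasDerivAt (0 : ℝ) hP
  have hmain := (hψΦ.hasFDerivAt.continuousAlternatingMapCompContinuousLinearMap
    hA.hasFDerivAt).hasDerivAt
  refine hmain.congr_deriv ?_
  rw [cartan_formula hψ hζd.differentiableAt, hy0, hid]
  simp
  rfl

end VectorCalculus

/-! ### Smooth forms, pull-backs and the exterior derivative on the manifold. -/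

section FormCalculus

variable {n : ℕ} {M : Type*} [TopologicalSpace M] [ChartedSpace (𝔼 n) M]
  [IsManifold (𝓡 n) ∞ M]

/-- The transfer principle used throughout: an identity checked at points of the manifold near `x`
holds for all coordinates near the image of `x`, so it can be differentiated. -/
lemma eventually_chart {x₀ x : M} (hx : x ∈ (ℰ n x₀).source) {Z : Set M}
    (hZ : Z ∈ 𝓝 x) {P : (𝔼 n) → Prop}
    (h : ∀ x' ∈ (ℰ n x₀).source, x' ∈ Z → P (ℰ n x₀ x')) :
    ∀ᶠ y in 𝓝 (ℰ n x₀ x), P y := by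
  filter_upwards [eventually_mem_source hx hZ] with y hy
  have := h _ ((ℰ n x₀).map_target hy.1) hy.2
  rwa [(ℰ n x₀).right_inv hy.1] at this

lemma contDiffOn_target_iff {G : Type*} [NormedAddCommGroup G] [NormedSpace ℝ G] {x₀ : M}
    {f : (𝔼 n) → G} : ContDiffOn ℝ ∞ f (ℰ n x₀).target ↔
      ∀ x ∈ (ℰ n x₀).source, ContDiffAt ℝ ∞ f (ℰ n x₀ x) := by
  constructor
  · intro h x hx
    have hy := (ℰ n x₀).map_source hx
    exact (h _ hy).contDiffAt ((isOpen_extChartAt_target x₀).mem_nhds hy)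
  · intro h y hy
    have := h _ ((ℰ n x₀).map_target hy)
    rw [(ℰ n x₀).right_inv hy] at this
    exact this.contDiffWithinAt

lemma isSmoothForm_iff {k : ℕ} {α : DiffForm n M k} : IsSmoothForm α ↔
    ∀ x₀ x : M, x ∈ (ℰ n x₀).source →
      ContDiffAt ℝ ∞ (coordForm x₀ α) (ℰ n x₀ x) :=
  forall_congr' fun _ => contDiffOn_target_iff

lemma coordForm_pullback_eventuallyEq {k : ℕ} {x₁ x₀ x : M}
    (hx : x ∈ (ℰ n x₁).source) {g : M → M} (hg : ContMDiff (𝓡 n) (𝓡 n) ∞ g)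
    (hgx : g x ∈ (ℰ n x₀).source) (θ : DiffForm n M k) :
    coordForm x₁ (pullbackForm g θ) =ᶠ[𝓝 (ℰ n x₁ x)]
      fun y => (coordForm x₀ θ (coordMap x₁ x₀ g y)).compContinuousLinearMap
        (fderiv ℝ (coordMap x₁ x₀ g) y) :=
  eventually_chart (Z := g ⁻¹' (ℰ n x₀).source) hx
    (hg.continuous.continuousAt.preimage_mem_nhds
      ((isOpen_extChartAt_source x₀).mem_nhds hgx))
    fun _ hx' hx'' => coordForm_pullback hx' hx'' (hg.mdifferentiable (by simp) _) θ

lemma contDiffAt_coordMap {g : M → M} (hg : ContMDiff (𝓡 n) (𝓡 n) ∞ g) {x₁ x₀ x : M}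
    (hx : x ∈ (ℰ n x₁).source) (hgx : g x ∈ (ℰ n x₀).source) :
    ContDiffAt ℝ ∞ (coordMap (n := n) x₁ x₀ g) (ℰ n x₁ x) :=
  ContDiffAt.comp (f := fun y => ((0 : ℝ), y))
    (g := fun q : ℝ × (𝔼 n) => coordMap (n := n) x₁ x₀ g q.2) (ℰ n x₁ x)
    (contDiffAt_coordMap_family (f := fun _ => g) (contMDiff_const_family hg) (s := 0) hx hgx)
    (by fun_prop)

lemma IsSmoothForm.pullback {k : ℕ} {α : DiffForm n M k} (hα : IsSmoothForm α) {g : M → M}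
    (hg : ContMDiff (𝓡 n) (𝓡 n) ∞ g) : IsSmoothForm (pullbackForm g α) := by
  rw [isSmoothForm_iff] at hα ⊢
  intro x₁ x hx
  have hgx := mem_extChartAt_source (I := 𝓡 n) (g x)
  refine ContDiffAt.congr_of_eventuallyEq ?_ (coordForm_pullback_eventuallyEq hx hg hgx α)
  have h1 := contDiffAt_coordMap hg hx hgx
  refine ContDiffAt.compAlternating (f := fun y => coordForm (g x) α (coordMap x₁ (g x) g y)) ?_
    (h1.fderiv_right (m := ∞) (by simp))
  refine ContDiffAt.comp (g := coordForm (g x) α) (ℰ n x₁ x) ?_ h1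
  rw [coordMap_chart hx]
  exact hα _ _ hgx

/-- Pull-back of the chart expression of the exterior derivative. -/
lemma coordForm_extDeriv_aux {k : ℕ} {α : DiffForm n M k} (hα : IsSmoothForm α) {g : M → M}
    (hg : ContMDiff (𝓡 n) (𝓡 n) ∞ g) {x₁ x₀ x : M}
    (hx : x ∈ (ℰ n x₁).source) (hgx : g x ∈ (ℰ n x₀).source) :
    extDeriv (coordForm x₁ (pullbackForm g α)) (ℰ n x₁ x) =
      (extDeriv (coordForm x₀ α) (ℰ n x₀ (g x))).compContinuousLinearMap
        ((chartDeriv x₀ (g x)).comp ((𝒟 n g x).comp (chartInvAt x₁ x))) := by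
  have h1 := contDiffAt_coordMap hg hx hgx
  rw [(coordForm_pullback_eventuallyEq hx hg hgx α).extDeriv_eq,
    ← fderiv_coordMap hx hgx (hg.mdifferentiable (by simp) _), ← coordMap_chart hx g]
  refine extDeriv_pullback ?_ h1 (by simp; exact WithTop.coe_le_coe.2 le_top)
  rw [coordMap_chart hx]
  exact (isSmoothForm_iff.1 hα _ _ hgx).differentiableAt (by simp)

/-- `extDerivForm` is computed at each point in the chart centred there. Naturality of `d`, applied
to the identity map seen between two charts, shows that every chart gives the same result. -/
lemma coordForm_extDerivForm {k : ℕ} {α : DiffForm n M k} (hα : IsSmoothForm α) {x₀ x : M}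
    (hx : x ∈ (ℰ n x₀).source) :
    coordForm x₀ (extDerivForm α) (ℰ n x₀ x) =
      extDeriv (coordForm x₀ α) (ℰ n x₀ x) := by
  have h := coordForm_extDeriv_aux hα contMDiff_id hx (mem_extChartAt_source (I := 𝓡 n) x)
  rw [pullbackForm_id] at h
  rw [h, coordForm_chart hx]
  ext v
  simp only [extDerivForm, mfderiv_id, ContinuousAlternatingMap.compContinuousLinearMap_apply,
    Function.comp_def, ContinuousLinearMap.comp_apply]
  rfl

lemma coordForm_extDerivForm_eventuallyEq {k : ℕ} {α : DiffForm n M k} (hα : IsSmoothForm α)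
    {x₀ x : M} (hx : x ∈ (ℰ n x₀).source) :
    coordForm x₀ (extDerivForm α) =ᶠ[𝓝 (ℰ n x₀ x)] extDeriv (coordForm x₀ α) :=
  eventually_chart hx univ_mem fun _ hx' _ => coordForm_extDerivForm hα hx'

lemma contDiffAt_extDeriv {V : Type*} [NormedAddCommGroup V] [NormedSpace ℝ V] {k : ℕ}
    {f : V → V [⋀^Fin k]→L[ℝ] ℝ} {y : V} (hf : ContDiffAt ℝ ∞ f y) :
    ContDiffAt ℝ ∞ (extDeriv f) y :=
  ContDiffAt.comp (𝕜 := ℝ) (F := V →L[ℝ] V [⋀^Fin k]→L[ℝ] ℝ)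
    (g := fun z => ContinuousAlternatingMap.alternatizeUncurryFinCLM ℝ V ℝ z) y
    (ContinuousLinearMap.contDiff (𝕜 := ℝ) (E := V →L[ℝ] V [⋀^Fin k]→L[ℝ] ℝ)
      (ContinuousAlternatingMap.alternatizeUncurryFinCLM ℝ V ℝ)).contDiffAt
    (hf.fderiv_right (m := ∞) (by simp))

lemma IsSmoothForm.extDeriv {k : ℕ} {α : DiffForm n M k} (hα : IsSmoothForm α) :
    IsSmoothForm (extDerivForm α) := by
  rw [isSmoothForm_iff]
  intro x₀ x hx
  exact (contDiffAt_extDeriv (isSmoothForm_iff.1 hα _ _ hx)).congr_of_eventuallyEq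
    (coordForm_extDerivForm_eventuallyEq hα hx)

lemma extDerivForm_pullback {k : ℕ} {α : DiffForm n M k} (hα : IsSmoothForm α) {g : M → M}
    (hg : ContMDiff (𝓡 n) (𝓡 n) ∞ g) :
    extDerivForm (pullbackForm g α) = pullbackForm g (extDerivForm α) := by
  funext x
  have hx := mem_extChartAt_source (I := 𝓡 n) x
  have hgx := mem_extChartAt_source (I := 𝓡 n) (g x)
  rw [extDerivForm, coordForm_extDeriv_aux hα hg hx hgx, pullbackForm, extDerivForm]
  ext v
  simp only [ContinuousAlternatingMap.compContinuousLinearMap_apply, Function.comp_def,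
    ContinuousLinearMap.comp_apply, chartInvAt_chartDeriv_apply hx]

section Leibniz

variable {V : Type*} [NormedAddCommGroup V] [NormedSpace ℝ V]

lemma extDeriv_smul_fun {k : ℕ} {h : V → ℝ} {f : V → V [⋀^Fin k]→L[ℝ] ℝ} {y : V}
    (hh : DifferentiableAt ℝ h y) (hf : DifferentiableAt ℝ f y) :
    extDeriv (fun z => h z • f z) y = h y • extDeriv f y + wedge (fderiv ℝ h y) (f y) := by
  have h1 : fderiv ℝ (fun z => h z • f z) y = _ := fderiv_fun_smul hh hf
  rw [extDeriv, h1, ContinuousAlternatingMap.alternatizeUncurryFin_add,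
    ContinuousAlternatingMap.alternatizeUncurryFin_smul]
  rfl

end Leibniz

end FormCalculus

/-! ### Operations on smooth forms, smoothness of the field, and the Lie derivative. -/

section RiemannianForms

variable {n : ℕ} {M : Type*} [TopologicalSpace M] [ChartedSpace (𝔼 n) M]
  [IsManifold (𝓡 n) ∞ M] [RiemannianBundle (fun x : M => 𝕋 n x)]

/-- The contraction of a form by a vector field. -/
def interForm {k : ℕ} (ξ : (x : M) → 𝕋 n x) (α : DiffForm n M (k + 1)) :
    DiffForm n M k := fun x => inter (ξ x) (α x)

/-- The differential of a function. -/
def dfun (h : M → ℝ) (x : M) : 𝕋 n x →L[ℝ] ℝ := mfderiv (𝓡 n) 𝓘(ℝ, ℝ) h x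

/-- The exterior product of the differential of a function and a form. -/
def dwedge {k : ℕ} (h : M → ℝ) (α : DiffForm n M k) : DiffForm n M (k + 1) :=
  fun x => wedge (dfun h x) (α x)

/-- The expression of a vector field in a chart. -/
def coordVec (x₀ : M) (ξ : (x : M) → 𝕋 n x) : (𝔼 n) → 𝔼 n :=
  fun y => chartDeriv x₀ ((ℰ n x₀).symm y) (ξ ((ℰ n x₀).symm y))

/-- The expression of a function in a chart. -/
def coordFun (x₀ : M) (h : M → ℝ) : (𝔼 n) → ℝ := fun y => h ((ℰ n x₀).symm y)

lemma coordVec_chart {x₀ x : M} (hx : x ∈ (ℰ n x₀).source)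
    (ξ : (x : M) → 𝕋 n x) :
    coordVec x₀ ξ (ℰ n x₀ x) = chartDeriv x₀ x (ξ x) := by
  obtain ⟨y, hy, rfl⟩ : ∃ y ∈ (ℰ n x₀).target, (ℰ n x₀).symm y = x :=
    ⟨_, (ℰ n x₀).map_source hx, (ℰ n x₀).left_inv hx⟩
  rw [(ℰ n x₀).right_inv hy]
  rfl

lemma coordFun_chart {x₀ x : M} (hx : x ∈ (ℰ n x₀).source) (h : M → ℝ) :
    coordFun (n := n) x₀ h (ℰ n x₀ x) = h x := by
  rw [coordFun, (ℰ n x₀).left_inv hx]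

lemma contDiffAt_coordFun {h : M → ℝ} (hh : 𝒞 n h) {x₀ x : M}
    (hx : x ∈ (ℰ n x₀).source) :
    ContDiffAt ℝ ∞ (coordFun (n := n) x₀ h) (ℰ n x₀ x) := by
  rw [← contMDiffAt_iff_contDiffAt]
  exact hh.contMDiffAt.comp (ℰ n x₀ x)
    ((contMDiffOn_extChartAt_symm x₀).contMDiffAt ((isOpen_extChartAt_target x₀).mem_nhds
      ((ℰ n x₀).map_source hx)))

lemma fderiv_coordFun {h : M → ℝ} {x₀ x : M} (hx : x ∈ (ℰ n x₀).source)
    (hh : MDifferentiableAt (𝓡 n) 𝓘(ℝ, ℝ) h x) :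
    fderiv ℝ (coordFun x₀ h) (ℰ n x₀ x) = (dfun h x).comp (chartInvAt x₀ x) := by
  haveI := isManifold_one (n := n) (M := M)
  obtain ⟨y, hy, rfl⟩ : ∃ y ∈ (ℰ n x₀).target, (ℰ n x₀).symm y = x :=
    ⟨_, (ℰ n x₀).map_source hx, (ℰ n x₀).left_inv hx⟩
  rw [(ℰ n x₀).right_inv hy, chartInvAt_symm hy, ← mfderiv_eq_fderiv]
  have h1 : MDifferentiableAt 𝓘(ℝ, 𝔼 n) (𝓡 n) (ℰ n x₀).symm y := by
    have := mdifferentiableWithinAt_extChartAt_symm (I := 𝓡 n) hy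
    simpa [mdifferentiableWithinAt_univ] using this
  exact mfderiv_comp (I' := 𝓡 n) y hh h1

lemma coordForm_inter {k : ℕ} {x₀ x : M} (hx : x ∈ (ℰ n x₀).source)
    (ξ : (x : M) → 𝕋 n x) (α : DiffForm n M (k + 1)) :
    coordForm x₀ (interForm ξ α) (ℰ n x₀ x) =
      inter (coordVec x₀ ξ (ℰ n x₀ x))
        (coordForm x₀ α (ℰ n x₀ x)) := by
  rw [coordForm_chart hx, coordForm_chart hx, coordVec_chart hx, interForm]
  ext w
  rw [inter_apply, ContinuousAlternatingMap.compContinuousLinearMap_apply,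
    ContinuousAlternatingMap.compContinuousLinearMap_apply, inter_apply]
  congr 1
  funext i
  refine Fin.cases ?_ (fun j => ?_) i
  · exact (chartInvAt_chartDeriv_apply hx (ξ x)).symm
  · rfl

lemma coordForm_dwedge {k : ℕ} {x₀ x : M} (hx : x ∈ (ℰ n x₀).source)
    {h : M → ℝ} (hh : MDifferentiableAt (𝓡 n) 𝓘(ℝ, ℝ) h x) (α : DiffForm n M k) :
    coordForm x₀ (dwedge h α) (ℰ n x₀ x) =
      wedge (fderiv ℝ (coordFun x₀ h) (ℰ n x₀ x))
        (coordForm x₀ α (ℰ n x₀ x)) := by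
  rw [coordForm_chart hx, coordForm_chart hx, fderiv_coordFun hx hh, ← wedge_comp]
  rfl

lemma coordForm_smul {k : ℕ} {x₀ x : M} (hx : x ∈ (ℰ n x₀).source) (h : M → ℝ)
    (α : DiffForm n M k) : coordForm x₀ (h • α) (ℰ n x₀ x) =
      coordFun x₀ h (ℰ n x₀ x) • coordForm x₀ α (ℰ n x₀ x) := by
  rw [coordForm_chart hx, coordForm_chart hx, coordFun_chart hx]
  rfl

lemma IsSmoothForm.smul {k : ℕ} {α : DiffForm n M k} (hα : IsSmoothForm α) {h : M → ℝ}
    (hh : 𝒞 n h) : IsSmoothForm (h • α) := by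
  rw [isSmoothForm_iff] at hα ⊢
  intro x₀ x hx
  exact ((contDiffAt_coordFun hh hx).smul (hα _ _ hx)).congr_of_eventuallyEq
    (eventually_chart hx univ_mem fun _ hx' _ => coordForm_smul hx' h α)

lemma contDiffAt_wedge {V G : Type*} [NormedAddCommGroup V] [NormedSpace ℝ V]
    [NormedAddCommGroup G] [NormedSpace ℝ G] {k : ℕ} {μ : G → V →L[ℝ] ℝ}
    {f : G → V [⋀^Fin k]→L[ℝ] ℝ} {y : G} (hμ : ContDiffAt ℝ ∞ μ y) (hf : ContDiffAt ℝ ∞ f y) :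
    ContDiffAt ℝ ∞ (fun z => wedge (μ z) (f z)) y := by
  have h1 : ContDiffAt ℝ ∞ (fun z => wedgeCLM V k (μ z)) y :=
    ContDiffAt.comp (g := fun μ => wedgeCLM V k μ) y
      (ContinuousLinearMap.contDiff (𝕜 := ℝ) (E := V →L[ℝ] ℝ)
        (F := (V [⋀^Fin k]→L[ℝ] ℝ) →L[ℝ] V [⋀^Fin (k + 1)]→L[ℝ] ℝ) (wedgeCLM V k)).contDiffAt hμ
  exact h1.clm_apply hf

lemma contDiffAt_inter {V G : Type*} [NormedAddCommGroup V] [NormedSpace ℝ V]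
    [NormedAddCommGroup G] [NormedSpace ℝ G] {k : ℕ} {v : G → V}
    {f : G → V [⋀^Fin (k + 1)]→L[ℝ] ℝ} {y : G} (hv : ContDiffAt ℝ ∞ v y)
    (hf : ContDiffAt ℝ ∞ f y) : ContDiffAt ℝ ∞ (fun z => inter (v z) (f z)) y := by
  have h1 : ContDiffAt ℝ ∞ (fun z => interCLM V k (v z)) y :=
    ContDiffAt.comp (g := fun μ => interCLM V k μ) y
      (ContinuousLinearMap.contDiff (𝕜 := ℝ) (E := V)
        (F := (V [⋀^Fin (k + 1)]→L[ℝ] ℝ) →L[ℝ] V [⋀^Fin k]→L[ℝ] ℝ) (interCLM V k)).contDiffAt hv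
  exact h1.clm_apply hf

lemma IsSmoothForm.dwedge {k : ℕ} {α : DiffForm n M k} (hα : IsSmoothForm α) {h : M → ℝ}
    (hh : 𝒞 n h) : IsSmoothForm (dwedge h α) := by
  rw [isSmoothForm_iff] at hα ⊢
  intro x₀ x hx
  exact (contDiffAt_wedge ((contDiffAt_coordFun hh hx).fderiv_right (m := ∞) (by simp))
    (hα _ _ hx)).congr_of_eventuallyEq (eventually_chart hx univ_mem fun _ hx' _ =>
      coordForm_dwedge hx' (hh.mdifferentiable (by simp) _) α)

/-- A vector field is smooth in charts. -/
def IsSmoothVec (ξ : (x : M) → 𝕋 n x) : Prop :=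
  ∀ x₀ x : M, x ∈ (ℰ n x₀).source →
    ContDiffAt ℝ ∞ (coordVec x₀ ξ) (ℰ n x₀ x)

lemma IsSmoothForm.inter {k : ℕ} {α : DiffForm n M (k + 1)} (hα : IsSmoothForm α)
    {ξ : (x : M) → 𝕋 n x} (hξ : IsSmoothVec ξ) : IsSmoothForm (interForm ξ α) := by
  rw [isSmoothForm_iff] at hα ⊢
  intro x₀ x hx
  exact (contDiffAt_inter (hξ _ _ hx) (hα _ _ hx)).congr_of_eventuallyEq
    (eventually_chart hx univ_mem fun _ hx' _ => coordForm_inter hx' ξ α)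

lemma extDerivForm_smul {k : ℕ} {α : DiffForm n M k} (hα : IsSmoothForm α) {h : M → ℝ}
    (hh : 𝒞 n h) :
    extDerivForm (h • α) = h • extDerivForm α + LpForms.dwedge h α := by
  funext x
  have hx := mem_extChartAt_source (I := 𝓡 n) x
  have h1 : coordForm x (h • α) =ᶠ[𝓝 (ℰ n x x)] fun y => coordFun x h y •
      coordForm x α y := eventually_chart hx univ_mem fun _ hx' _ => coordForm_smul hx' h α
  rw [Pi.add_apply, Pi.smul_apply', extDerivForm, h1.extDeriv_eq,
    extDeriv_smul_fun ((contDiffAt_coordFun hh hx).differentiableAt (by simp))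
      ((isSmoothForm_iff.1 hα _ _ hx).differentiableAt (by simp)), coordFun_chart hx,
    form_eq_coordForm hx (LpForms.dwedge h α),
    coordForm_dwedge hx (hh.mdifferentiable (by simp) _)]
  rfl

variable {φ : ℝ → M → M} {ξ : (x : M) → 𝕋 n x}

lemma IsFlowOf.contMDiff (hφ : IsFlowOf φ ξ) (s : ℝ) : ContMDiff (𝓡 n) (𝓡 n) ∞ (φ s) :=
  hφ.smooth.comp (contMDiff_const.prodMk contMDiff_id)

lemma IsFlowOf.continuous (hφ : IsFlowOf φ ξ) : Continuous (fun q : ℝ × M => φ q.1 q.2) :=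
  hφ.smooth.continuous

lemma IsFlowOf.mdifferentiableAt (hφ : IsFlowOf φ ξ) (s : ℝ) (x : M) :
    MDifferentiableAt (𝓡 n) (𝓡 n) (φ s) x := (hφ.contMDiff s).mdifferentiable (by simp) x

lemma IsFlowOf.hasDerivAt_chart (hφ : IsFlowOf φ ξ) {x₀ x : M} {s : ℝ}
    (hx : φ s x ∈ (ℰ n x₀).source) :
    HasDerivAt (fun s => ℰ n x₀ (φ s x)) (chartDeriv x₀ (φ s x) (ξ (φ s x))) s := by
  haveI := isManifold_one (n := n) (M := M)
  have h1 := hφ.integralCurve x s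
  have h2 : HasMFDerivAt (𝓡 n) 𝓘(ℝ, 𝔼 n) (ℰ n x₀) (φ s x)
      (chartDeriv x₀ (φ s x)) :=
    (mdifferentiableAt_extChartAt (by rwa [extChartAt_source] at hx)).hasMFDerivAt
  have h3 := h2.comp s h1
  rw [hasMFDerivAt_iff_hasFDerivAt] at h3
  have h4 : HasDerivAt (fun s => ℰ n x₀ (φ s x)) _ s := HasFDerivAt.hasDerivAt h3
  refine h4.congr_deriv ?_
  change (chartDeriv x₀ (φ s x)) ((1 : ℝ) • (ξ (φ s x))) = _
  congr 1
  exact one_smul ℝ _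

/-- In a chart the field is the time derivative at `0` of the jointly smooth flow. -/
lemma IsFlowOf.isSmoothVec (hφ : IsFlowOf φ ξ) : IsSmoothVec ξ := by
  intro x₀ x hx
  have h0x : φ 0 x ∈ (ℰ n x₀).source := by rwa [hφ.zero]
  have h1 := contDiffAt_coordMap_family hφ.smooth (s := 0) hx h0x
  have h2 : ContDiffAt ℝ ∞ (fun y => fderiv ℝ (fun q : ℝ × (𝔼 n) =>
      coordMap (n := n) x₀ x₀ (φ q.1) q.2) (0, y) (1, 0)) (ℰ n x₀ x) := by
    have h3 := h1.fderiv_right (m := ∞) (by simp)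
    exact (ContDiffAt.comp (f := fun y : 𝔼 n => ((0 : ℝ), y)) (ℰ n x₀ x) h3
      (by fun_prop)).clm_apply contDiffAt_const
  refine h2.congr_of_eventuallyEq (eventually_chart hx univ_mem fun x' hx' _ => ?_)
  have h0x' : φ 0 x' ∈ (ℰ n x₀).source := by rwa [hφ.zero]
  have h4 := (contDiffAt_coordMap_family hφ.smooth (s := 0) hx' h0x').differentiableAt (by simp)
  have h5 : HasDerivAt (fun s => coordMap (n := n) x₀ x₀ (φ s) (ℰ n x₀ x')) _ 0 :=
    (HasFDerivAt.comp (g := fun q : ℝ × (𝔼 n) => coordMap (n := n) x₀ x₀ (φ q.1) q.2)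
      (f := fun s : ℝ => (s, ℰ n x₀ x')) (0 : ℝ) h4.hasFDerivAt
      (hasFDerivAt_prodMk_left (0 : ℝ) _)).hasDerivAt
  have h6 := hφ.hasDerivAt_chart h0x'
  simp only [coordMap_chart hx'] at h5
  rw [coordVec_chart hx']
  have h7 := h6.unique h5
  rw [hφ.zero] at h7
  rw [h7]
  simp

/-- The Lie derivative of a form. -/
def lieForm {k : ℕ} (ξ : (x : M) → 𝕋 n x) (α : DiffForm n M (k + 1)) :
    DiffForm n M (k + 1) := extDerivForm (interForm ξ α) + interForm ξ (extDerivForm α)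

/-- Composing with a linear form `L` on the fibre makes the statement scalar, so the computation can
be moved to the fixed model space of a chart, where Cartan's formula is available. -/
lemma IsFlowOf.hasDerivAt_pullback_zero (hφ : IsFlowOf φ ξ) {k : ℕ} {α : DiffForm n M (k + 1)}
    (hα : IsSmoothForm α) (x : M) (L : ((𝕋 n x) [⋀^Fin (k + 1)]→L[ℝ] ℝ) →L[ℝ] ℝ) :
    HasDerivAt (fun s => L (pullbackForm (φ s) α x)) (L (lieForm ξ α x)) 0 := by
  have hx := mem_extChartAt_source (I := 𝓡 n) x
  have h0x : φ 0 x ∈ (ℰ n x).source := by rwa [hφ.zero]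
  have h1 := contDiffAt_coordMap_family hφ.smooth (s := 0) hx h0x
  have h2 := LpForms.hasDerivAt_pullback_zero (ψ := coordForm x α) (ζ := coordVec x ξ)
    ((isSmoothForm_iff.1 hα _ _ hx).differentiableAt (by simp)) h1
    (eventually_chart hx univ_mem fun x' hx' _ => by
      rw [coordMap_chart hx', hφ.zero])
    (eventually_chart hx univ_mem fun x' hx' _ => by
      have h0x' : φ 0 x' ∈ (ℰ n x).source := by rwa [hφ.zero]
      simp only [coordMap_chart hx']
      have := hφ.hasDerivAt_chart h0x'
      rw [coordVec_chart hx']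
      rwa [hφ.zero] at this)
  let L' : ((𝔼 n) [⋀^Fin (k + 1)]→L[ℝ] ℝ) →L[ℝ] ℝ :=
    L.comp (ContinuousAlternatingMap.compContinuousLinearMapCLM (chartDeriv x x))
  have h3 := L'.hasFDerivAt.comp_hasDerivAt (0 : ℝ) h2
  have h4 : ∀ᶠ s in 𝓝 (0 : ℝ), φ s x ∈ (ℰ n x).source := by
    have hc : ContinuousAt (fun s => φ s x) 0 :=
      (hφ.continuous.comp (by fun_prop : Continuous fun s : ℝ => (s, x))).continuousAt
    exact hc.eventually ((isOpen_extChartAt_source (I := 𝓡 n) x).mem_nhds h0x)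
  refine (h3.congr_of_eventuallyEq ?_).congr_deriv ?_
  · filter_upwards [h4] with s hs
    rw [form_eq_coordForm hx (pullbackForm (φ s) α),
      coordForm_pullback hx hs (hφ.mdifferentiableAt s x)]
    rfl
  · have e1 : extDeriv (fun z => inter (coordVec x ξ z) (coordForm x α z))
        (ℰ n x x) = coordForm x (extDerivForm (interForm ξ α))
        (ℰ n x x) := by
      rw [coordForm_extDerivForm (hα.inter hφ.isSmoothVec) hx]
      refine Filter.EventuallyEq.extDeriv_eq (Filter.EventuallyEq.symm ?_)
      exact eventually_chart hx univ_mem fun _ hx' _ => coordForm_inter hx' ξ α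
    rw [e1, ← coordForm_extDerivForm hα hx, ← coordForm_inter hx, lieForm, Pi.add_apply,
      form_eq_coordForm hx (extDerivForm (interForm ξ α)),
      form_eq_coordForm hx (interForm ξ (extDerivForm α))]
    rfl

end RiemannianForms

/-! ### The Riemannian density in charts. -/

section Volume

variable {n : ℕ} {M : Type*} [TopologicalSpace M] [ChartedSpace (𝔼 n) M]
  [IsManifold (𝓡 n) ∞ M] [RiemannianBundle (fun x : M => 𝕋 n x)]

/-- The density of the Riemannian volume in the chart centred at `x₀`. -/
def rho (x₀ x : M) : ℝ := jacobian (chartInvAt (n := n) x₀ x)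

lemma rho_symm {x₀ : M} {y : 𝔼 n} (hy : y ∈ (ℰ n x₀).target) :
    jacobian (chartInvDeriv x₀ y) = rho (n := n) x₀ ((ℰ n x₀).symm y) := by
  rw [rho, chartInvAt_symm hy]

lemma rho_pos {x₀ x : M} (hx : x ∈ (ℰ n x₀).source) : 0 < rho (n := n) x₀ x :=
  jacobian_pos_of_comp_eq_id (U := 𝔼 n) (V := 𝕋 n x) rfl
    (L := chartDeriv (n := n) x₀ x) (L' := chartInvAt (n := n) x₀ x) (chartDeriv_comp_chartInvAt hx)

/-- Both sides are the Jacobian of the inverse chart at `x₁` followed by the differential of `g`,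
factored once through the chart at `x₀` and once through the tangent space at `x`. -/
lemma rho_mul_det {x₁ x₀ x : M} (hx : x ∈ (ℰ n x₁).source) {g : M → M}
    (hgx : g x ∈ (ℰ n x₀).source) (hg : MDifferentiableAt (𝓡 n) (𝓡 n) g x) :
    rho (n := n) x₀ (g x) * |(fderiv ℝ (coordMap x₁ x₀ g) (ℰ n x₁ x)).det| =
      jacobian (𝒟 n g x) * rho (n := n) x₁ x := by
  have h1 := jacobian_comp (U := 𝔼 n) (V := 𝔼 n) (W := 𝕋 n (g x)) rfl
    (chartInvAt x₀ (g x)) (fderiv ℝ (coordMap x₁ x₀ g) (ℰ n x₁ x))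
  have h2 := jacobian_comp (U := 𝔼 n) (V := 𝕋 n x)
    (W := 𝕋 n (g x)) rfl (𝒟 n g x) (chartInvAt x₁ x)
  rw [← jacobian_eq_abs_det, rho, rho, ← h1, ← h2, fderiv_coordMap hx hgx hg]
  congr 1
  ext v
  simp only [ContinuousLinearMap.comp_apply, chartInvAt_chartDeriv_apply hgx]

variable [IsContMDiffRiemannianBundle (𝓡 n) ∞ (𝔼 n) (fun x : M => 𝕋 n x)]

/-- In the trivialization given by the chart, `x' ↦ chartInvAt x₀ x' w` is the constant section `w`,
hence smooth, and the metric is smooth. -/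
lemma contDiffAt_inner_chart {x₀ x : M} (hx : x ∈ (ℰ n x₀).source) (u v : 𝔼 n) :
    ContDiffAt ℝ ∞ (coordFun (n := n) x₀
      (fun x' => inner ℝ (chartInvAt x₀ x' u) (chartInvAt x₀ x' v))) (ℰ n x₀ x) := by
  haveI := isManifold_one (n := n) (M := M)
  have hx' : x ∈ (chartAt (𝔼 n) x₀).source := by rwa [extChartAt_source] at hx
  have hsec : ∀ w : 𝔼 n, ContMDiffAt (𝓡 n) ((𝓡 n).prod 𝓘(ℝ, 𝔼 n)) ∞
      (fun x' => (⟨x', chartInvAt x₀ x' w⟩ : TotalSpace (𝔼 n) (𝕋 n : M → Type _)))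
      x := by
    intro w
    have he : x ∈ (trivializationAt (𝔼 n) (𝕋 n : M → Type _) x₀).baseSet := hx'
    rw [(trivializationAt (𝔼 n) (𝕋 n : M → Type _) x₀).contMDiffAt_section_iff he]
    refine (contMDiffAt_const (c := w)).congr_of_eventuallyEq ?_
    filter_upwards [(chartAt (𝔼 n) x₀).open_source.mem_nhds hx'] with z hz
    have h1 := TangentBundle.continuousLinearMapAt_trivializationAt (I := 𝓡 n) hz
    have h2 : (trivializationAt (𝔼 n) (𝕋 n) x₀).continuousLinearMapAt ℝ z
        (chartInvAt x₀ z w) = w := by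
      rw [h1]
      exact chartDeriv_chartInvAt_apply (by rwa [extChartAt_source]) w
    have hz' : z ∈ (trivializationAt (𝔼 n) (𝕋 n : M → Type _) x₀).baseSet := hz
    rw [Trivialization.continuousLinearMapAt_apply, Trivialization.linearMapAt_apply,
      if_pos hz'] at h2
    exact h2
  have h := ContMDiffAt.inner_bundle (hsec u) (hsec v)
  rw [← contMDiffAt_iff_contDiffAt]
  have h1 : ContMDiffAt 𝓘(ℝ, 𝔼 n) (𝓡 n) ∞ (ℰ n x₀).symm (ℰ n x₀ x) :=
    (contMDiffOn_extChartAt_symm x₀).contMDiffAt ((isOpen_extChartAt_target x₀).mem_nhds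
      ((ℰ n x₀).map_source hx))
  exact ContMDiffAt.comp_of_eq h h1 ((ℰ n x₀).left_inv hx)

/-- The density is the square root of a Gram determinant with smooth entries, which is nonzero
because the density is positive. -/
lemma contDiffAt_rho {x₀ x : M} (hx : x ∈ (ℰ n x₀).source) :
    ContDiffAt ℝ ∞ (coordFun (n := n) x₀ (rho (n := n) x₀)) (ℰ n x₀ x) := by
  have h1 : coordFun (n := n) x₀ (rho (n := n) x₀) = fun y =>
      √(Matrix.of fun i j => coordFun (n := n) x₀ (fun x' =>
        inner ℝ (chartInvAt x₀ x' (stdOrthonormalBasis ℝ (𝔼 n) i))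
          (chartInvAt x₀ x' (stdOrthonormalBasis ℝ (𝔼 n) j))) y).det := rfl
  rw [h1]
  refine ContDiffAt.sqrt ?_ ?_
  · simp only [Matrix.det_apply]
    refine ContDiffAt.sum fun σ _ => ContDiffAt.const_smul _ ?_
    exact contDiffAt_prod fun i _ => contDiffAt_inner_chart hx _ _
  · have h2 := (rho_pos (n := n) hx).ne'
    rw [← coordFun_chart (n := n) hx (rho (n := n) x₀), h1] at h2
    intro h3
    exact h2 (by simp only [h3, Real.sqrt_zero])

/-- Smoothness of the Jacobian of a smooth family of local diffeomorphisms. -/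
lemma contDiffAt_jacobian_family {f : ℝ → M → M}
    (hf : ContMDiff (𝓘(ℝ, ℝ).prod (𝓡 n)) (𝓡 n) ∞ (fun q : ℝ × M => f q.1 q.2))
    (hJ : ∀ s x, 0 < jacobian (𝒟 n (f s) x))
    {x₁ x : M} {s : ℝ} (hx : x ∈ (ℰ n x₁).source) :
    ContDiffAt ℝ ∞ (fun q : ℝ × (𝔼 n) => coordFun (n := n) x₁
      (fun x' => jacobian (𝒟 n (f q.1) x')) q.2) (s, ℰ n x₁ x) := by
  set x₀ := f s x with hx₀
  have hfx : f s x ∈ (ℰ n x₀).source := mem_extChartAt_source (f s x)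
  have hfd : ∀ s x, MDifferentiableAt (𝓡 n) (𝓡 n) (f s) x := fun s x =>
    ((hf.comp (contMDiff_const.prodMk contMDiff_id)).mdifferentiable (by simp) x :
      MDifferentiableAt (𝓡 n) (𝓡 n) (fun x => f s x) x)
  have h1 := contDiffAt_coordMap_family hf hx hfx
  have h2 := contDiffAt_fderiv_coordMap_family hf hx hfx
  have hdet : ContDiff ℝ ∞ (fun A : (𝔼 n) →L[ℝ] (𝔼 n) => A.det) := by
    have : (fun A : (𝔼 n) →L[ℝ] (𝔼 n) => A.det) = fun A => (Matrix.of fun i j : Fin n =>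
        (A ((EuclideanSpace.basisFun (Fin n) ℝ) j)) i).det := by
      funext A
      rw [ContinuousLinearMap.det, ← LinearMap.det_toMatrix (EuclideanSpace.basisFun (Fin n) ℝ).toBasis]
      congr 1
      ext i j
      simp [LinearMap.toMatrix_apply]
    rw [this]
    simp only [Matrix.det_apply]
    refine ContDiff.sum fun σ _ => ContDiff.const_smul _ ?_
    refine contDiff_prod fun i _ => ?_
    simp only [Matrix.of_apply]
    fun_prop
  -- The Jacobian is the quotient furnished by `rho_mul_det`; the absolute value is smooth there
  -- because the determinant does not vanish when the Jacobian is positive.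
  have h3 : ContDiffAt ℝ ∞ (fun q : ℝ × (𝔼 n) =>
      coordFun (n := n) x₀ (rho (n := n) x₀) (coordMap (n := n) x₁ x₀ (f q.1) q.2) *
      |(fderiv ℝ (coordMap (n := n) x₁ x₀ (f q.1)) q.2).det| /
      coordFun (n := n) x₁ (rho (n := n) x₁) q.2) (s, ℰ n x₁ x) := by
    have hr1 := rho_pos (n := n) hx
    have hr0 := rho_pos (n := n) hfx
    refine ContDiffAt.div (ContDiffAt.mul ?_ ?_) ?_ ?_
    · refine ContDiffAt.comp (g := coordFun (n := n) x₀ (rho (n := n) x₀))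
        (s, ℰ n x₁ x) ?_ h1
      simp only [coordMap_chart hx]
      exact contDiffAt_rho hfx
    · have h4 := ContDiffAt.comp (s, ℰ n x₁ x) hdet.contDiffAt h2
      refine ContDiffAt.abs (f := fun q : ℝ × (𝔼 n) =>
        (fderiv ℝ (coordMap (n := n) x₁ x₀ (f q.1)) q.2).det) h4 ?_
      intro h5
      have h6 := rho_mul_det hx hfx (hfd s x)
      have h5' : (fderiv ℝ (coordMap x₁ x₀ (f s)) (ℰ n x₁ x)).det = 0 := h5
      rw [h5', abs_zero, mul_zero] at h6
      exact (mul_pos (hJ s x) hr1).ne h6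
    · exact ContDiffAt.comp (g := coordFun (n := n) x₁ (rho (n := n) x₁))
        (f := fun q : ℝ × (𝔼 n) => q.2) (s, ℰ n x₁ x) (contDiffAt_rho hx)
        contDiffAt_snd
    · simp only [coordFun_chart hx]
      exact hr1.ne'
  refine h3.congr_of_eventuallyEq ?_
  have hev := eventually_family_mem hf hx hfx
  filter_upwards [hev] with q hq
  have hqx := (ℰ n x₁).map_target hq.1
  have h7 := rho_mul_det hqx hq.2 (hfd q.1 _)
  rw [(ℰ n x₁).right_inv hq.1] at h7
  rw [eq_div_iff (by rw [coordFun]; exact (rho_pos hqx).ne')]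
  rw [coordMap, coordFun_chart hq.2]
  exact h7.symm

omit [RiemannianBundle (fun x : M => TangentSpace (𝓡 n) x)]
  [IsContMDiffRiemannianBundle (𝓡 n) ∞ (𝔼 n) (fun x : M => TangentSpace (𝓡 n) x)] in
lemma continuousAt_of_coord {S G : Type*} [TopologicalSpace S] [TopologicalSpace G] {F : S × M → G}
    {x₀ x : M} {s : S} (hx : x ∈ (ℰ n x₀).source)
    (hF : ContinuousAt (fun q : S × (𝔼 n) => F (q.1, (ℰ n x₀).symm q.2))
      (s, ℰ n x₀ x)) : ContinuousAt F (s, x) := by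
  have h1 : ContinuousAt (fun q : S × M => (q.1, ℰ n x₀ q.2)) (s, x) :=
    continuousAt_fst.prodMk (ContinuousAt.comp (g := ℰ n x₀) (f := fun q : S × M => q.2)
      (continuousAt_extChartAt' hx) continuousAt_snd)
  have h2 := ContinuousAt.comp (f := fun q : S × M => (q.1, ℰ n x₀ q.2)) hF h1
  refine h2.congr ?_
  have h3 : ∀ᶠ q : S × M in 𝓝 (s, x), q.2 ∈ (ℰ n x₀).source :=
    continuousAt_snd.eventually ((isOpen_extChartAt_source (I := 𝓡 n) x₀).mem_nhds hx)
  filter_upwards [h3] with q hq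
  simp only [Function.comp_apply, (ℰ n x₀).left_inv hq]

lemma continuous_jacobian_family {f : ℝ → M → M}
    (hf : ContMDiff (𝓘(ℝ, ℝ).prod (𝓡 n)) (𝓡 n) ∞ (fun q : ℝ × M => f q.1 q.2))
    (hJ : ∀ s x, 0 < jacobian (𝒟 n (f s) x)) :
    Continuous (fun q : ℝ × M => jacobian (𝒟 n (f q.1) q.2)) := by
  rw [continuous_iff_continuousAt]
  rintro ⟨s, x⟩
  exact continuousAt_of_coord (mem_extChartAt_source (I := 𝓡 n) x)
    (contDiffAt_jacobian_family hf hJ (mem_extChartAt_source (I := 𝓡 n) x)).continuousAt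

variable [MeasurableSpace M] [BorelSpace M]

omit [IsManifold (𝓡 n) ∞ M] [RiemannianBundle (fun x : M => TangentSpace (𝓡 n) x)]
  [IsContMDiffRiemannianBundle (𝓡 n) ∞ (𝔼 n) (fun x : M => TangentSpace (𝓡 n) x)] in
lemma aemeasurable_chart_symm (x₀ : M) : AEMeasurable (ℰ n x₀).symm
    ((volume : Measure (𝔼 n)).restrict (ℰ n x₀).target) :=
  (continuousOn_extChartAt_symm x₀).aemeasurable (isOpen_extChartAt_target x₀).measurableSet

lemma continuousOn_rho (x₀ : M) : ContinuousOn (fun y : 𝔼 n => jacobian (chartInvDeriv x₀ y))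
    (ℰ n x₀).target := by
  have h : ContDiffOn ℝ ∞ (coordFun (n := n) x₀ (rho (n := n) x₀)) (ℰ n x₀).target :=
    contDiffOn_target_iff.2 fun x hx => contDiffAt_rho hx
  exact h.continuousOn.congr fun y hy => rho_symm hy

lemma aemeasurable_rho (x₀ : M) :
    AEMeasurable (fun y : 𝔼 n => ENNReal.ofReal (jacobian (chartInvDeriv x₀ y)))
      ((volume : Measure (𝔼 n)).restrict (ℰ n x₀).target) :=
  ((continuousOn_rho x₀).aemeasurable (isOpen_extChartAt_target x₀).measurableSet).ennreal_ofReal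

lemma chartVolume_apply (x₀ : M) {A : Set M} (hA : MeasurableSet A) :
    chartVolume n x₀ A = ∫⁻ y in (ℰ n x₀).target ∩ (ℰ n x₀).symm ⁻¹' A,
      ENNReal.ofReal (rho (n := n) x₀ ((ℰ n x₀).symm y)) := by
  have hT := (isOpen_extChartAt_target (I := 𝓡 n) x₀).measurableSet
  have hm := aemeasurable_chart_symm (n := n) x₀
  rw [chartVolume, Measure.map_apply_of_aemeasurable
    (hm.mono_ac (withDensity_absolutelyContinuous _ _)) hA]
  have hn : NullMeasurableSet ((ℰ n x₀).symm ⁻¹' A)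
      ((volume : Measure (𝔼 n)).restrict (ℰ n x₀).target) :=
    hm.nullMeasurableSet_preimage hA
  rw [withDensity_apply₀ _ hn, Measure.restrict_restrict₀ hn, inter_comm]
  have hn' : NullMeasurableSet ((ℰ n x₀).target ∩ (ℰ n x₀).symm ⁻¹' A)
      (volume : Measure (𝔼 n)) := by
    rw [inter_comm]
    exact (nullMeasurableSet_restrict hT.nullMeasurableSet).1 hn
  refine lintegral_congr_ae ((ae_restrict_iff'₀ hn').2 (Eventually.of_forall fun y hy => ?_))
  simp only [rho_symm hy.1]

end Volume

/-! ### The Riemannian measure and the change of variables. -/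

section VolumeChange

variable {n : ℕ} {M : Type*} [TopologicalSpace M] [ChartedSpace (𝔼 n) M]
  [IsManifold (𝓡 n) ∞ M] [RiemannianBundle (fun x : M => 𝕋 n x)]
  [IsContMDiffRiemannianBundle (𝓡 n) ∞ (𝔼 n) (fun x : M => 𝕋 n x)]
  [MeasurableSpace M] [BorelSpace M]

lemma measurableSet_target_inter (x₀ : M) {A : Set M} (hA : MeasurableSet A) :
    MeasurableSet ((ℰ n x₀).target ∩ (ℰ n x₀).symm ⁻¹' A) := by
  have hT := (isOpen_extChartAt_target (I := 𝓡 n) x₀).measurableSet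
  have h := (continuousOn_iff_continuous_domRestrict.1
    (continuousOn_extChartAt_symm (I := 𝓡 n) x₀)).measurable hA
  have h2 := hT.subtype_image h
  convert h2 using 1
  ext y
  constructor
  · rintro ⟨h1, h2⟩
    exact ⟨⟨y, h1⟩, h2, rfl⟩
  · rintro ⟨⟨z, hz⟩, h1, rfl⟩
    exact ⟨hz, h1⟩

lemma lintegral_chartVolume (x₀ : M) {f : M → ℝ≥0∞} (hf : Measurable f) :
    ∫⁻ x, f x ∂(chartVolume n x₀) = ∫⁻ y in (ℰ n x₀).target,
      ENNReal.ofReal (rho (n := n) x₀ ((ℰ n x₀).symm y)) *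
        f ((ℰ n x₀).symm y) := by
  have hm := aemeasurable_chart_symm (n := n) x₀
  rw [chartVolume, lintegral_map' hf.aemeasurable
    (hm.mono_ac (withDensity_absolutelyContinuous _ _)),
    show (fun y => f ((ℰ n x₀).symm y)) = f ∘ (ℰ n x₀).symm from rfl,
    lintegral_withDensity_eq_lintegral_mul₀ (aemeasurable_rho x₀) (hf.comp_aemeasurable hm)]
  refine setLIntegral_congr_fun (isOpen_extChartAt_target (I := 𝓡 n) x₀).measurableSet
    fun y hy => ?_
  simp only [Pi.mul_apply, rho_symm hy, Function.comp_apply]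

/-- The Euclidean change of variables for the chart expression of `g`; `rho_mul_det` converts the
Euclidean determinant and the two densities into the Riemannian Jacobian. -/
lemma chartVolume_image {g g' : M → M} (hg : ContMDiff (𝓡 n) (𝓡 n) ∞ g) (hg' : Continuous g')
    (hl : ∀ x, g' (g x) = x) (hr : ∀ x, g (g' x) = x)
    (hJ : Continuous fun x => jacobian (𝒟 n g x)) {x₁ x₀ : M} {A : Set M}
    (hA : MeasurableSet A) (h1 : A ⊆ (ℰ n x₁).source)
    (h0 : ∀ x ∈ A, g x ∈ (ℰ n x₀).source) :
    chartVolume n x₀ (g' ⁻¹' A) =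
      ∫⁻ x in A, ENNReal.ofReal (jacobian (𝒟 n g x)) ∂(chartVolume n x₁) := by
  have hT := (isOpen_extChartAt_target (I := 𝓡 n) x₁).measurableSet
  have hS := measurableSet_target_inter (n := n) x₁ hA
  set S := (ℰ n x₁).target ∩ (ℰ n x₁).symm ⁻¹' A with hSdef
  have hgA := hg'.measurable hA
  have himg : coordMap x₁ x₀ g '' S =
      (ℰ n x₀).target ∩ (ℰ n x₀).symm ⁻¹' (g' ⁻¹' A) := by
    ext z
    constructor
    · rintro ⟨y, ⟨hy, hyA⟩, rfl⟩
      have := h0 _ hyA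
      refine ⟨(ℰ n x₀).map_source this, ?_⟩
      simp only [mem_preimage, coordMap, (ℰ n x₀).left_inv this, hl]
      exact hyA
    · rintro ⟨hz, hzA⟩
      have hzA' : g' ((ℰ n x₀).symm z) ∈ A := hzA
      refine ⟨ℰ n x₁ (g' ((ℰ n x₀).symm z)),
        ⟨(ℰ n x₁).map_source (h1 hzA'), ?_⟩, ?_⟩
      · simp only [mem_preimage, (ℰ n x₁).left_inv (h1 hzA')]
        exact hzA'
      · rw [coordMap_chart (h1 hzA'), hr, (ℰ n x₀).right_inv hz]
  rw [chartVolume_apply x₀ hgA, ← himg,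
    lintegral_image_eq_lintegral_abs_det_fderiv_mul volume hS
      (f' := fun y => fderiv ℝ (coordMap x₁ x₀ g) y)]
  · rw [← lintegral_indicator hA, lintegral_chartVolume x₁
      (hJ.measurable.ennreal_ofReal.indicator hA), ← lintegral_indicator hT,
      ← lintegral_indicator hS]
    refine lintegral_congr fun y => ?_
    by_cases hy : y ∈ (ℰ n x₁).target
    · by_cases hyA : (ℰ n x₁).symm y ∈ A
      · rw [indicator_of_mem (show y ∈ S from ⟨hy, hyA⟩), indicator_of_mem hy,
          indicator_of_mem hyA, ← ENNReal.ofReal_mul (abs_nonneg _),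
          ← ENNReal.ofReal_mul (rho_pos (h1 hyA)).le]
        congr 1
        have h3 := rho_mul_det (h1 hyA) (h0 _ hyA) (hg.mdifferentiable (by simp) _)
        rw [(ℰ n x₁).right_inv hy] at h3
        rw [coordMap, (ℰ n x₀).left_inv (h0 _ hyA), mul_comm, mul_comm (rho x₁ _)]
        exact h3
      · rw [indicator_of_notMem (fun h : y ∈ S => hyA h.2), indicator_of_mem hy,
          indicator_of_notMem hyA, mul_zero]
    · rw [indicator_of_notMem (fun h : y ∈ S => hy h.1), indicator_of_notMem hy]
  · rintro y ⟨hy, hyA⟩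
    have h3 := contDiffAt_coordMap hg (h1 hyA) (h0 _ hyA)
    rw [(ℰ n x₁).right_inv hy] at h3
    exact (h3.differentiableAt (by simp)).hasFDerivAt.hasFDerivWithinAt
  · rintro y ⟨hy, hyA⟩ z ⟨hz, hzA⟩ h
    have h3 := (ℰ n x₀).injOn (h0 _ hyA) (h0 _ hzA) h
    have h4 : (ℰ n x₁).symm y = (ℰ n x₁).symm z := by
      rw [← hl ((ℰ n x₁).symm y), h3, hl]
    exact (ℰ n x₁).symm.injOn hy hz h4

omit [IsContMDiffRiemannianBundle (𝓡 n) ∞ (𝔼 n) (fun x : M => TangentSpace (𝓡 n) x)] [MeasurableSpace M] [BorelSpace M]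
  [IsManifold (𝓡 n) ∞ M] in
lemma jacobian_mfderiv_id (x : M) : jacobian (𝒟 n (id : M → M) x) = 1 := by
  rw [mfderiv_id]
  exact jacobian_id (V := 𝕋 n x)

lemma chartVolume_eq {x₁ x₀ : M} {A : Set M} (hA : MeasurableSet A)
    (h1 : A ⊆ (ℰ n x₁).source) (h0 : A ⊆ (ℰ n x₀).source) :
    chartVolume n x₀ A = chartVolume n x₁ A := by
  have h := chartVolume_image (n := n) (g := id) (g' := id) contMDiff_id continuous_id
    (fun _ => rfl) (fun _ => rfl)
    (by simp only [jacobian_mfderiv_id]; exact continuous_const) hA h1 h0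
  simpa only [preimage_id, jacobian_mfderiv_id, ENNReal.ofReal_one, lintegral_const,
    Measure.restrict_apply MeasurableSet.univ, univ_inter, one_mul] using h

lemma chartVolume_compl_source (x₀ : M) :
    chartVolume n x₀ (ℰ n x₀).sourceᶜ = 0 := by
  rw [chartVolume_apply x₀ (isOpen_extChartAt_source x₀).measurableSet.compl]
  have : (ℰ n x₀).target ∩
      (ℰ n x₀).symm ⁻¹' (ℰ n x₀).sourceᶜ = ∅ := by
    ext y
    simp only [mem_inter_iff, mem_preimage, mem_compl_iff, mem_empty_iff_false, iff_false, not_and,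
      not_not]
    exact fun hy => (ℰ n x₀).map_target hy
  rw [this, setLIntegral_empty]

/-- Gives an upper bound for the supremum that defines the Riemannian volume: the infinite mass off
the chart domain absorbs whatever other charts see there, while on the domain all chart volumes are
controlled by that of `x₀`. -/
lemma chartVolume_le (x₁ x₀ : M) : chartVolume n x₁ ≤ chartVolume n x₀ +
    ((⊤ : ℝ≥0∞) • Measure.count).restrict (ℰ n x₀).sourceᶜ := by
  have hS := (isOpen_extChartAt_source (I := 𝓡 n) x₀).measurableSet
  have hS1 := (isOpen_extChartAt_source (I := 𝓡 n) x₁).measurableSet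
  refine Measure.le_iff.2 fun A hA => ?_
  rw [← measure_inter_add_sdiff A hS, Measure.add_apply]
  refine add_le_add ?_ ?_
  · have h1 : chartVolume n x₁ (A ∩ (ℰ n x₀).source) =
        chartVolume n x₁ (A ∩ (ℰ n x₀).source ∩ (ℰ n x₁).source) := by
      rw [← measure_inter_add_sdiff (A ∩ (ℰ n x₀).source) hS1,
        measure_mono_null (s := _ \ _) (t := (ℰ n x₁).sourceᶜ)
          (fun x (hx : x ∈ _ \ _) => hx.2) (chartVolume_compl_source x₁), add_zero]
    rw [h1, ← chartVolume_eq ((hA.inter hS).inter hS1) (fun x hx => hx.2) (fun x hx => hx.1.2)]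
    exact measure_mono fun x hx => hx.1.1
  · rw [Measure.restrict_apply hA]
    by_cases h : (A ∩ (ℰ n x₀).sourceᶜ).Nonempty
    · rw [Measure.smul_apply, smul_eq_mul, ENNReal.top_mul]
      · exact le_top
      · exact Measure.count_ne_zero h
    · rw [not_nonempty_iff_eq_empty] at h
      rw [Set.sdiff_eq, h]
      simp

/-- On a chart domain, the Riemannian volume is the chart volume. -/
lemma riemannianVolume_apply {x₀ : M} {A : Set M} (hA : MeasurableSet A)
    (h : A ⊆ (ℰ n x₀).source) : riemannianVolume n M A = chartVolume n x₀ A := by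
  refine le_antisymm ?_ (Measure.le_iff.1 (le_iSup (fun x₀ : M => chartVolume n x₀) x₀) A hA)
  have h1 : riemannianVolume n M ≤ chartVolume n x₀ +
      ((⊤ : ℝ≥0∞) • Measure.count).restrict (ℰ n x₀).sourceᶜ :=
    iSup_le fun x₁ => chartVolume_le x₁ x₀
  refine (Measure.le_iff.1 h1 A hA).trans ?_
  rw [Measure.add_apply, Measure.restrict_apply hA, (disjoint_compl_right_iff_subset.2 h).inter_eq]
  simp

lemma riemannianVolume_restrict (x₀ : M) :
    (riemannianVolume n M).restrict (ℰ n x₀).source = chartVolume n x₀ := by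
  have hS := (isOpen_extChartAt_source (I := 𝓡 n) x₀).measurableSet
  refine Measure.ext fun A hA => ?_
  rw [Measure.restrict_apply hA, riemannianVolume_apply (hA.inter hS) inter_subset_right,
    ← measure_inter_add_sdiff A hS (μ := chartVolume n x₀),
    measure_mono_null (s := A \ _) (t := (ℰ n x₀).sourceᶜ)
      (fun x (hx : x ∈ _ \ _) => hx.2) (chartVolume_compl_source x₀), add_zero]

instance : IsLocallyFiniteMeasure (riemannianVolume n M) := by
  refine ⟨fun x => ?_⟩
  have hxs := mem_extChartAt_source (I := 𝓡 n) x
  have hT := (isOpen_extChartAt_target (I := 𝓡 n) x).mem_nhds ((ℰ n x).map_source hxs)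
  obtain ⟨K, hK, hKT, hKc⟩ := local_compact_nhds hT
  obtain ⟨U, hUK, hU, hxU⟩ := mem_nhds_iff.1 hK
  have hopen : IsOpen ((ℰ n x).source ∩ ℰ n x ⁻¹' U) :=
    isOpen_extChartAt_preimage' x hU
  refine ⟨_, hopen.mem_nhds ⟨hxs, hxU⟩, ?_⟩
  rw [riemannianVolume_apply hopen.measurableSet inter_subset_left,
    chartVolume_apply x hopen.measurableSet]
  have hc : ContinuousOn (fun y : 𝔼 n => rho (n := n) x ((ℰ n x).symm y)) K :=
    ((continuousOn_rho x).congr fun y hy => (rho_symm hy).symm).mono hKT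
  have hint := hc.integrableOn_compact (μ := volume) hKc
  refine (lintegral_mono_set (t := K) ?_).trans_lt ?_
  · rintro y ⟨hy, -, hy'⟩
    rw [mem_preimage, (ℰ n x).right_inv hy] at hy'
    exact hUK hy'
  · refine lt_of_le_of_lt (lintegral_mono fun y => ?_) hint.2
    exact Real.ofReal_le_enorm _

variable [SecondCountableTopology M]

/-- Change of variables for a diffeomorphism. -/
lemma map_withDensity_jacobian {g g' : M → M} (hg : ContMDiff (𝓡 n) (𝓡 n) ∞ g)
    (hg' : Continuous g') (hl : ∀ x, g' (g x) = x) (hr : ∀ x, g (g' x) = x)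
    (hJ : Continuous fun x => jacobian (𝒟 n g x)) :
    Measure.map g ((riemannianVolume n M).withDensity
      (fun x => ENNReal.ofReal (jacobian (𝒟 n g x)))) = riemannianVolume n M := by
  -- Open sets that lie in one chart domain and whose preimages under `g` also lie in one; countably
  -- many of them cover `M`, so the equality of measures is checked on each.
  let V : M → Set M := fun z => (ℰ n z).source ∩
    g' ⁻¹' (ℰ n (g' z)).source
  have hVo : ∀ z, IsOpen (V z) := fun z =>
    (isOpen_extChartAt_source z).inter ((isOpen_extChartAt_source (g' z)).preimage hg')
  obtain ⟨c, hc, hcu⟩ := TopologicalSpace.countable_cover_nhds (f := V)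
    (fun z => (hVo z).mem_nhds ⟨mem_extChartAt_source z, mem_extChartAt_source (g' z)⟩)
  refine (Measure.ext_iff_of_biUnion_eq_univ hc hcu).2 fun z _ => Measure.ext fun B hB => ?_
  have hBV := hB.inter (hVo z).measurableSet
  have hA := hg.continuous.measurable hBV
  rw [Measure.restrict_apply hB, Measure.restrict_apply hB,
    Measure.map_apply hg.continuous.measurable hBV, withDensity_apply _ hA,
    riemannianVolume_apply (x₀ := z) hBV (fun x hx => hx.2.1)]
  have hAs : g ⁻¹' (B ∩ V z) ⊆ (ℰ n (g' z)).source := by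
    intro x hx
    have := hx.2.2
    rwa [mem_preimage, hl] at this
  have h1 := chartVolume_image hg hg' hl hr hJ (x₁ := g' z) (x₀ := z) hA hAs
    (fun x hx => hx.2.1)
  have h2 : g' ⁻¹' (g ⁻¹' (B ∩ V z)) = B ∩ V z := by
    ext x
    simp only [mem_preimage, hr]
  rw [h2] at h1
  rw [h1, ← riemannianVolume_restrict, Measure.restrict_restrict hA, inter_eq_left.2 hAs]

end VolumeChange

/-! ### Pull-back by the flow, transposed to test fields. -/

section FlowTest

variable {n : ℕ} {M : Type*} [TopologicalSpace M] [ChartedSpace (𝔼 n) M]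
  [IsManifold (𝓡 n) ∞ M] [RiemannianBundle (fun x : M => 𝕋 n x)]
  {φ : ℝ → M → M} {ξ : (x : M) → 𝕋 n x}

lemma IsFlowOf.neg_apply (hφ : IsFlowOf φ ξ) (s : ℝ) (x : M) : φ (-s) (φ s x) = x := by
  rw [← hφ.add, neg_add_cancel, hφ.zero]

lemma IsFlowOf.apply_neg (hφ : IsFlowOf φ ξ) (s : ℝ) (x : M) : φ s (φ (-s) x) = x := by
  rw [← hφ.add, add_neg_cancel, hφ.zero]

lemma IsFlowOf.mfderiv_neg_comp (hφ : IsFlowOf φ ξ) (s : ℝ) (x : M)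
    (v : 𝕋 n x) :
    𝒟 n (φ (-s)) (φ s x) (𝒟 n (φ s) x v) = v := by
  have h : (φ (-s) ∘ φ s) = id := funext fun x => hφ.neg_apply s x
  have h1 := mfderiv_comp (I' := 𝓡 n) x (hφ.mdifferentiableAt (-s) (φ s x))
    (hφ.mdifferentiableAt s x)
  rw [h, mfderiv_id] at h1
  exact (DFunLike.congr_fun h1 v).symm

lemma IsFlowOf.pullback_add (hφ : IsFlowOf φ ξ) {k : ℕ} (s t : ℝ) (θ : DiffForm n M k) :
    pullbackForm (φ (s + t)) θ = pullbackForm (φ t) (pullbackForm (φ s) θ) := by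
  have h : φ (s + t) = φ s ∘ φ t := funext fun x => hφ.add s t x
  funext x
  rw [h, pullbackForm, mfderiv_comp (I' := 𝓡 n) x (hφ.mdifferentiableAt s _)
    (hφ.mdifferentiableAt t x)]
  rfl

lemma IsFlowOf.jacobian_add (hφ : IsFlowOf φ ξ) (s t : ℝ) (x : M) :
    jacobian (𝒟 n (φ (s + t)) x) =
      jacobian (𝒟 n (φ s) (φ t x)) * jacobian (𝒟 n (φ t) x) := by
  have h : φ (s + t) = φ s ∘ φ t := funext fun x => hφ.add s t x
  rw [h, mfderiv_comp (I' := 𝓡 n) x (hφ.mdifferentiableAt s _) (hφ.mdifferentiableAt t x)]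
  exact jacobian_comp (U := 𝕋 n x) (V := 𝕋 n (φ t x))
    (W := 𝕋 n (φ s (φ t x))) rfl _ _

lemma IsFlowOf.jacobian_pos (hφ : IsFlowOf φ ξ) (s : ℝ) (x : M) :
    0 < jacobian (𝒟 n (φ s) x) := by
  have h := hφ.jacobian_add (-s) s x
  have h0 : φ (-s + s) = id := by
    funext x
    rw [neg_add_cancel, hφ.zero, id]
  rw [h0, jacobian_mfderiv_id] at h
  rcases (jacobian_nonneg (𝒟 n (φ s) x)).lt_or_eq with h1 | h1
  · exact h1
  · rw [← h1, mul_zero] at h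
    exact absurd h one_ne_zero

lemma IsFlowOf.mfderiv_comp_neg (hφ : IsFlowOf φ ξ) (s : ℝ) (x : M)
    (v : 𝕋 n x) :
    𝒟 n (φ s) (φ (-s) x) (𝒟 n (φ (-s)) x v) = v := by
  have h := hφ.mfderiv_neg_comp (-s) x v
  rwa [neg_neg] at h

/-- The differential of the inverse of `φ s` at `φ s x`. -/
def flowInv (φ : ℝ → M → M) (s : ℝ) (x : M) :
    𝕋 n (φ s x) →L[ℝ] 𝕋 n x :=
  𝒟 n (φ (-s)) (φ s x)

lemma IsFlowOf.flowInv_apply (hφ : IsFlowOf φ ξ) (s : ℝ) (x : M) (v : 𝕋 n x) :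
    flowInv φ s x (𝒟 n (φ s) x v) = v := hφ.mfderiv_neg_comp s x v

lemma IsFlowOf.apply_flowInv (hφ : IsFlowOf φ ξ) (s : ℝ) (x : M)
    (v : 𝕋 n (φ s x)) :
    𝒟 n (φ s) x (flowInv φ s x v) = v := by
  have h := hφ.mfderiv_comp_neg s (φ s x) v
  rw [hφ.neg_apply s x] at h
  exact h

lemma IsFlowOf.mfderiv_isInvertible (hφ : IsFlowOf φ ξ) (s : ℝ) (x : M) :
    (𝒟 n (φ s) x).IsInvertible :=
  ContinuousLinearMap.IsInvertible.of_inverse (g := flowInv φ s x)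
    (ContinuousLinearMap.ext fun v => hφ.apply_flowInv s x v)
    (ContinuousLinearMap.ext fun v => hφ.flowInv_apply s x v)

lemma IsFlowOf.inverse_mfderiv (hφ : IsFlowOf φ ξ) (s : ℝ) (x : M) :
    (𝒟 n (φ s) x).inverse = flowInv φ s x :=
  ContinuousLinearMap.inverse_eq
    (ContinuousLinearMap.ext fun v => hφ.apply_flowInv s x v)
    (ContinuousLinearMap.ext fun v => hφ.flowInv_apply s x v)

/-- The push-forward by the flow of a field of multivectors, as a vector-valued density. -/
def pushFlow {k : ℕ} (φ : ℝ → M → M) (s : ℝ) (X : MultivectorField n M k) :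
    MultivectorField n M k :=
  pushField (fun y => jacobian (𝒟 n (φ (-s)) y)) (φ (-s)) X

/-- The Jacobian factor is chosen so that integrating this identity over `M` and changing variables
turns pairing with `φ_s^*θ` into pairing `θ` with the pushed field. -/
lemma IsFlowOf.pushFlow_apply (hφ : IsFlowOf φ ξ) {k : ℕ} (s : ℝ) (X : MultivectorField n M k)
    (θ : DiffForm n M k) (y : M) :
    pushFlow φ s X y (θ y) = jacobian (𝒟 n (φ (-s)) y) *
      X (φ (-s) y) (pullbackForm (φ s) θ (φ (-s) y)) := by
  rw [pushFlow, pushField, smul_apply, smul_eq_mul, hφ.inverse_mfderiv,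
    ContinuousLinearMap.comp_apply]
  congr 2
  ext v
  -- The fibres over `φ s (φ (-s) y)` and over `y` are different types; the two sides are compared
  -- on the common model space, where equality of base points can be substituted.
  have h1 : ∀ z, z = y → ∀ w : Fin k → 𝔼 n, (θ z) w = (θ y) w := by
    rintro _ rfl w
    rfl
  have h2 : ∀ r, r = s → ∀ z, (𝒟 n (φ r) z : (𝔼 n) → (𝔼 n)) =
      𝒟 n (φ s) z := by
    rintro _ rfl z
    rfl
  refine Eq.trans ?_ (h1 _ (hφ.apply_neg s y) _).symm
  change (θ y) (fun i => (𝒟 n (φ (- -s)) (φ (-s) y) : (𝔼 n) → (𝔼 n)) (v i)) =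
    (θ y) (fun i => (𝒟 n (φ s) (φ (-s) y) : (𝔼 n) → (𝔼 n)) (v i))
  rw [h2 _ (neg_neg s)]

variable [IsContMDiffRiemannianBundle (𝓡 n) ∞ (𝔼 n) (fun x : M => 𝕋 n x)]

lemma IsFlowOf.smooth_neg (hφ : IsFlowOf φ ξ) :
    ContMDiff (𝓘(ℝ, ℝ).prod (𝓡 n)) (𝓡 n) ∞ (fun q : ℝ × M => φ (-q.1) q.2) := by
  have h : ContMDiff (𝓘(ℝ, ℝ).prod (𝓡 n)) (𝓘(ℝ, ℝ).prod (𝓡 n)) ∞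
      (fun q : ℝ × M => (-q.1, q.2)) :=
    ContMDiff.prodMk ((contMDiff_iff_contDiff.2 contDiff_neg).comp contMDiff_fst) contMDiff_snd
  exact hφ.smooth.comp h

lemma IsFlowOf.continuous_jacobian (hφ : IsFlowOf φ ξ) :
    Continuous (fun q : ℝ × M => jacobian (𝒟 n (φ q.1) q.2)) :=
  continuous_jacobian_family hφ.smooth hφ.jacobian_pos

/-- Joint smoothness of the push-forwards of a test field. -/
lemma IsFlowOf.contDiffAt_pushFlow (hφ : IsFlowOf φ ξ) {k : ℕ} (X : testFields n M k)
    {x₁ x : M} (hx : x ∈ (ℰ n x₁).source) (s : ℝ) :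
    ContDiffAt ℝ ∞ (fun q : ℝ × (𝔼 n) => coordField x₁ (pushFlow φ q.1 X.1) q.2)
      (s, ℰ n x₁ x) := by
  set f : ℝ → M → M := fun s => φ (-s) with hf
  have hfs : ContMDiff (𝓘(ℝ, ℝ).prod (𝓡 n)) (𝓡 n) ∞ (fun q : ℝ × M => f q.1 q.2) := hφ.smooth_neg
  set x₀ := f s x
  have hfx : f s x ∈ (ℰ n x₀).source := mem_extChartAt_source (f s x)
  have h1 := contDiffAt_coordMap_family hfs hx hfx
  have h2 := contDiffAt_fderiv_coordMap_family hfs hx hfx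
  have h3 := contDiffAt_jacobian_family hfs (fun s x => hφ.jacobian_pos (-s) x) (s := s) hx
  have h4 : ContDiffAt ℝ ∞ (fun q : ℝ × (𝔼 n) => coordField x₀ X.1 (coordMap x₁ x₀ (f q.1) q.2))
      (s, ℰ n x₁ x) := by
    refine ContDiffAt.comp (g := coordField x₀ X.1) (s, ℰ n x₁ x) ?_ h1
    simp only [coordMap_chart hx]
    exact contDiffOn_target_iff.1 (X.2.1 x₀) _ hfx
  have hinv : (fderiv ℝ (coordMap x₁ x₀ (f s)) (ℰ n x₁ x)).IsInvertible := by
    rw [fderiv_coordMap hx hfx (hφ.mdifferentiableAt (-s) x)]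
    obtain ⟨a, ha⟩ := chartDeriv_isInvertible hx
    obtain ⟨b, hb⟩ := chartDeriv_isInvertible hfx
    obtain ⟨c, hc⟩ := hφ.mfderiv_isInvertible (-s) x
    refine ⟨(a.symm.trans c).trans b, ?_⟩
    rw [chartInvAt, ← ha, ← hb, ← hc, ContinuousLinearMap.inverse_equiv]
    rfl
  have h5 : ContDiffAt ℝ ∞ (fun q : ℝ × (𝔼 n) =>
      (fderiv ℝ (coordMap x₁ x₀ (f q.1)) q.2).inverse) (s, ℰ n x₁ x) := by
    obtain ⟨a, ha⟩ := hinv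
    refine ContDiffAt.comp (g := ContinuousLinearMap.inverse) (s, ℰ n x₁ x) ?_ h2
    simp only [← ha]
    exact contDiffAt_map_inverse a
  have h6 : ContDiffAt ℝ ∞ (fun q : ℝ × (𝔼 n) =>
      ContinuousAlternatingMap.compContinuousLinearMapCLM (F := ℝ) (ι := Fin k)
        (fderiv ℝ (coordMap x₁ x₀ (f q.1)) q.2).inverse) (s, ℰ n x₁ x) :=
    (contDiff_compContinuousLinearMapCLM (k := k) (V := 𝔼 n) (W := 𝔼 n)).contDiffAt.comp
      (s, ℰ n x₁ x) h5
  have h7 := h3.smul (h4.clm_comp h6)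
  refine h7.congr_of_eventuallyEq ?_
  have hev : ∀ᶠ q : ℝ × (𝔼 n) in 𝓝 (s, ℰ n x₁ x),
      q.2 ∈ (ℰ n x₁).target ∧
      f q.1 ((ℰ n x₁).symm q.2) ∈ (ℰ n x₀).source :=
    eventually_family_mem hfs hx hfx
  filter_upwards [hev] with q hq
  have hqx := (ℰ n x₁).map_target hq.1
  have h8 := coordField_push hqx hq.2 (hφ.mdifferentiableAt (-q.1) _)
    (hφ.mfderiv_isInvertible (-q.1) _)
    (fun y => jacobian (𝒟 n (φ (-q.1)) y)) X.1
  rw [(ℰ n x₁).right_inv hq.1] at h8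
  exact h8

/-- The push-forward of a test field by the flow. -/
def pushTest (hφ : IsFlowOf φ ξ) {k : ℕ} (s : ℝ) (X : testFields n M k) : testFields n M k :=
  ⟨pushFlow φ s X.1, fun x₀ => contDiffOn_target_iff.2 fun x hx =>
      ContDiffAt.comp (g := fun q : ℝ × (𝔼 n) => coordField x₀ (pushFlow φ q.1 X.1) q.2)
        (f := fun y => (s, y)) (ℰ n x₀ x) (hφ.contDiffAt_pushFlow X hx s) (by fun_prop),
    by
      obtain ⟨K, hK, hXK⟩ := X.2.2
      refine ⟨φ s '' K, hK.image (hφ.contMDiff s).continuous, fun x hx => ?_⟩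
      have h : φ (-s) x ∉ K := fun h => hx ⟨_, h, hφ.apply_neg s x⟩
      rw [pushFlow, pushField, hXK _ h, ContinuousLinearMap.zero_comp, smul_zero]⟩

variable [MeasurableSpace M] [BorelSpace M] [SecondCountableTopology M]

omit [MeasurableSpace M] [BorelSpace M] [SecondCountableTopology M] in
lemma IsFlowOf.continuous_jacobian_at (hφ : IsFlowOf φ ξ) (s : ℝ) :
    Continuous fun x => jacobian (𝒟 n (φ s) x) := by
  have h : Continuous fun x : M => (s, x) := by fun_prop
  have h1 := hφ.continuous_jacobian.comp h
  simp only [Function.comp_def] at h1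
  exact h1

lemma IsFlowOf.map_withDensity (hφ : IsFlowOf φ ξ) (s : ℝ) :
    Measure.map (φ s) ((riemannianVolume n M).withDensity
      (fun x => ENNReal.ofReal (jacobian (𝒟 n (φ s) x)))) = riemannianVolume n M :=
  map_withDensity_jacobian (g := φ s) (g' := φ (-s)) (hφ.contMDiff s)
    (hφ.contMDiff (-s)).continuous (hφ.neg_apply s) (hφ.apply_neg s) (hφ.continuous_jacobian_at s)

lemma IsFlowOf.measurable_jacobian (hφ : IsFlowOf φ ξ) (s : ℝ) :
    Measurable fun x => jacobian (𝒟 n (φ s) x) :=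
  (hφ.continuous_jacobian_at s).measurable

lemma IsFlowOf.measurableEmbedding (hφ : IsFlowOf φ ξ) (s : ℝ) : MeasurableEmbedding (φ s) :=
  MeasurableEquiv.measurableEmbedding
    { toFun := φ s
      invFun := φ (-s)
      left_inv := hφ.neg_apply s
      right_inv := hφ.apply_neg s
      measurable_toFun := (hφ.contMDiff s).continuous.measurable
      measurable_invFun := (hφ.contMDiff (-s)).continuous.measurable }

lemma IsFlowOf.lintegral_comp (hφ : IsFlowOf φ ξ) (s : ℝ) (f : M → ℝ≥0∞) :
    ∫⁻ x, ENNReal.ofReal (jacobian (𝒟 n (φ s) x)) * f (φ s x)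
      ∂(riemannianVolume n M) = ∫⁻ x, f x ∂(riemannianVolume n M) := by
  conv_rhs => rw [← hφ.map_withDensity s]
  rw [(hφ.measurableEmbedding s).lintegral_map,
    lintegral_withDensity_eq_lintegral_mul_non_measurable _
      (hφ.measurable_jacobian s).ennreal_ofReal (Eventually.of_forall fun x => ENNReal.ofReal_lt_top)]
  rfl

lemma IsFlowOf.integral_comp (hφ : IsFlowOf φ ξ) (s : ℝ) (f : M → ℝ) :
    ∫ x, jacobian (𝒟 n (φ s) x) * f (φ s x)
      ∂(riemannianVolume n M) = ∫ x, f x ∂(riemannianVolume n M) := by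
  conv_rhs => rw [← hφ.map_withDensity s]
  rw [(hφ.measurableEmbedding s).integral_map,
    integral_withDensity_eq_integral_toReal_smul
      (hφ.measurable_jacobian s).ennreal_ofReal (Eventually.of_forall fun x => ENNReal.ofReal_lt_top)]
  simp only [ENNReal.toReal_ofReal (jacobian_nonneg _), smul_eq_mul]

/-- Pairing with the pull-back of a form is pairing with the push-forward of the test field. -/
lemma IsFlowOf.pairing_pullback (hφ : IsFlowOf φ ξ) {k : ℕ} (s : ℝ) (θ : DiffForm n M k)
    (X : testFields n M k) : pairing (pullbackForm (φ s) θ) X = pairing θ (pushTest hφ s X) := by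
  rw [pairing, pairing, ← hφ.integral_comp (-s)]
  exact integral_congr_ae (Eventually.of_forall fun y => (hφ.pushFlow_apply s X.1 θ y).symm)

end FlowTest

/-! ### Measurable frames and measurable families of forms. -/

section Measurability

variable {n : ℕ} {M : Type*} [TopologicalSpace M] [ChartedSpace (𝔼 n) M]
  [MeasurableSpace M] [BorelSpace M] [SecondCountableTopology M]

/-- Enumerate a countable cover by chart domains and send each point to the first chart containing
it. -/
lemma exists_selector (n : ℕ) (M : Type*) [TopologicalSpace M]
    [ChartedSpace (𝔼 n) M]
    [MeasurableSpace M] [BorelSpace M] [SecondCountableTopology M] :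
    ∃ c : M → M, (∀ x, x ∈ (ℰ n (c x)).source) ∧
      (range c).Countable ∧ ∀ z, MeasurableSet (c ⁻¹' {z}) := by
  classical
  rcases isEmpty_or_nonempty M with hM | hM
  · exact ⟨id, fun x => (hM.false x).elim, Set.to_countable _, fun z => (hM.false z).elim⟩
  obtain ⟨s, hs, hsu⟩ := TopologicalSpace.countable_cover_nhds
    (f := fun z : M => (ℰ n z).source) (fun z => extChartAt_source_mem_nhds z)
  have hne : s.Nonempty := by
    rw [nonempty_iff_ne_empty]
    rintro rfl
    simp only [mem_empty_iff_false, iUnion_of_empty, iUnion_empty] at hsu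
    exact empty_ne_univ hsu
  obtain ⟨e, he⟩ := hs.exists_eq_range hne
  have hex : ∀ x : M, ∃ i, x ∈ (ℰ n (e i)).source := by
    intro x
    have hx : x ∈ ⋃ z ∈ s, (ℰ n z).source := hsu ▸ mem_univ x
    rw [mem_iUnion₂] at hx
    obtain ⟨z, hz, hxz⟩ := hx
    rw [he] at hz
    obtain ⟨i, rfl⟩ := hz
    exact ⟨i, hxz⟩
  have hm : Measurable fun x => Nat.find (hex x) :=
    measurable_find hex fun i => (isOpen_extChartAt_source (e i)).measurableSet
  refine ⟨fun x => e (Nat.find (hex x)), fun x => Nat.find_spec (hex x), ?_, fun z => ?_⟩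
  · exact (countable_range e).mono (range_comp_subset_range _ e)
  · exact hm (MeasurableSet.of_discrete (s := e ⁻¹' {z}))

/-- A measurable choice of a chart around each point, with countably many values. -/
def sel (n : ℕ) (M : Type*) [TopologicalSpace M] [ChartedSpace (𝔼 n) M]
    [MeasurableSpace M] [BorelSpace M] [SecondCountableTopology M] : M → M :=
  (exists_selector n M).choose

lemma mem_sel (x : M) : x ∈ (ℰ n (sel n M x)).source :=
  (exists_selector n M).choose_spec.1 x

lemma measurableSet_sel (z : M) : MeasurableSet (sel n M ⁻¹' {z}) :=
  (exists_selector n M).choose_spec.2.2 z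

/-- A countable measurable partition allows measurability to be checked separately on each set where
the selected chart is constant. -/
lemma measurable_of_sel {T G : Type*} [MeasurableSpace T] [MeasurableSpace G] {b : T → M}
    (hb : Measurable b) {h : T → G} (H : ∀ z, ∃ h' : T → G, Measurable h' ∧
      ∀ t, sel n M (b t) = z → h t = h' t) : Measurable h := by
  choose h' hh' hE using H
  intro B hB
  have : h ⁻¹' B = ⋃ z ∈ range (sel n M), (b ⁻¹' (sel n M ⁻¹' {z}) ∩ h' z ⁻¹' B) := by
    ext t
    simp only [mem_preimage, mem_iUnion, mem_inter_iff, mem_singleton_iff, exists_prop]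
    constructor
    · intro ht
      exact ⟨sel n M (b t), mem_range_self _, rfl, by rwa [← hE _ t rfl]⟩
    · rintro ⟨z, -, hz, ht⟩
      rwa [hE z t hz]
  rw [this]
  exact MeasurableSet.biUnion (exists_selector n M).choose_spec.2.1 fun z _ =>
    (hb (measurableSet_sel z)).inter (hh' z hB)

/-- Functions which are continuous on the chart domains, composed with a measurable map. -/
lemma measurable_of_sel_continuousOn {T G : Type*} [MeasurableSpace T] [MeasurableSpace G]
    [TopologicalSpace G] [BorelSpace G] [Zero G] {b : T → M}
    (hb : Measurable b) {h : M → G} {h' : M → M → G}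
    (H : ∀ z, ContinuousOn (h' z) (ℰ n z).source)
    (hE : ∀ x, h x = h' (sel n M x) x) : Measurable fun t => h (b t) := by
  classical
  refine measurable_of_sel (n := n) hb fun z => ?_
  refine ⟨fun t => (ℰ n z).source.piecewise (h' z) 0 (b t), ?_, ?_⟩
  · exact (ContinuousOn.measurable_piecewise (H z) continuousOn_const
      (isOpen_extChartAt_source z).measurableSet).comp hb
  · intro t ht
    have hs := mem_sel (n := n) (b t)
    rw [ht] at hs
    simp only [hE, ht, piecewise_eq_of_mem _ _ _ hs]

/-- The measurable frame. -/
def frame (x : M) : (𝔼 n) →L[ℝ] 𝕋 n x := chartInvAt (sel n M x) x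

/-- The measurable coframe. -/
def coframe (x : M) : 𝕋 n x →L[ℝ] 𝔼 n := chartDeriv (sel n M x) x

variable [IsManifold (𝓡 n) ∞ M]

lemma frame_coframe (x : M) (v : 𝕋 n x) : frame x (coframe (n := n) x v) = v :=
  chartInvAt_chartDeriv_apply (mem_sel x) v

lemma coframe_frame (x : M) (v : 𝔼 n) : coframe (n := n) x (frame x v) = v :=
  chartDeriv_chartInvAt_apply (mem_sel x) v

/-- A family of alternating forms on tangent spaces is measurable along a map. -/
def MeasAlong {T : Type*} [MeasurableSpace T] {k : ℕ} (b : T → M)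
    (β : (t : T) → (𝕋 n (b t)) [⋀^Fin k]→L[ℝ] ℝ) : Prop :=
  ∀ v : Fin k → 𝔼 n, Measurable fun t => β t (fun i => frame (b t) (v i))

/-- A form is measurable. -/
def MeasForm {k : ℕ} (θ : DiffForm n M k) : Prop := MeasAlong (fun x => x) θ

/-- Functions which are continuous on a chart, in coordinates. -/
lemma continuousOn_source_of_coord {G : Type*} [TopologicalSpace G] {z : M} {f : (𝔼 n) → G}
    (hf : ContinuousOn f (ℰ n z).target) :
    ContinuousOn (fun x => f (ℰ n z x)) (ℰ n z).source :=
  hf.comp (continuousOn_extChartAt z) fun _ hx => (ℰ n z).map_source hx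

/-- Pairing of a smooth field with a measurable family. -/
lemma MeasAlong.field {T : Type*} [MeasurableSpace T] {k : ℕ} {b : T → M} (hb : Measurable b)
    {β : (t : T) → (𝕋 n (b t)) [⋀^Fin k]→L[ℝ] ℝ} (hβ : MeasAlong b β)
    {Z : MultivectorField n M k}
    (hZ : ∀ z, ContinuousOn (coordField z Z) (ℰ n z).target) :
    Measurable fun t => Z (b t) (β t) := by
  obtain ⟨g, hg⟩ := exists_recover (𝔼 n) k
  have hG : ∀ f, g f = ∑ I, f I • g (Pi.single I 1) := by
    intro f
    conv_lhs => rw [← Finset.univ_sum_single f]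
    rw [map_sum]
    refine Finset.sum_congr rfl fun I _ => ?_
    rw [← map_smul, ← Pi.single_smul, smul_eq_mul, mul_one]
  -- The pairing becomes a finite sum of products: coefficients of the field, continuous in each
  -- chart, times values of the family on frame vectors, measurable by hypothesis.
  have key : ∀ t, Z (b t) (β t) = ∑ I, coordField (sel n M (b t)) Z
      (ℰ n (sel n M (b t)) (b t)) (g (Pi.single I 1)) *
      β t (fun i => frame (b t) (Module.finBasis ℝ (𝔼 n) (I i))) := by
    intro t
    have h1 : (β t).compContinuousLinearMap (chartInvAt (sel n M (b t)) (b t)) =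
        ∑ I, β t (fun i => frame (b t) (Module.finBasis ℝ (𝔼 n) (I i))) • g (Pi.single I 1) := by
      exact (hg _).symm.trans (hG _)
    rw [field_apply_eq (mem_sel (n := n) (b t)), h1, map_sum]
    refine Finset.sum_congr rfl fun I _ => ?_
    rw [map_smul, smul_eq_mul, mul_comm]
  simp only [key]
  refine Finset.measurable_sum _ fun I _ => Measurable.mul ?_ (hβ _)
  refine measurable_of_sel_continuousOn hb
    (h := fun x => coordField (sel n M x) Z (ℰ n (sel n M x) x) (g (Pi.single I 1)))
    (h' := fun z x => coordField z Z (ℰ n z x) (g (Pi.single I 1))) (fun z => ?_)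
    (fun x => rfl)
  exact continuousOn_source_of_coord (f := fun y => coordField z Z y (g (Pi.single I 1)))
    ((hZ z).clm_apply continuousOn_const)

section Norm

variable [RiemannianBundle (fun x : M => 𝕋 n x)]
  [IsContMDiffRiemannianBundle (𝓡 n) ∞ (𝔼 n) (fun x : M => 𝕋 n x)]

lemma continuousOn_norm_chartInvAt (z : M) (v : 𝔼 n) :
    ContinuousOn (fun x => ‖chartInvAt z x v‖) (ℰ n z).source := by
  have h : ContDiffOn ℝ ∞ (coordFun (n := n) z
      (fun x' => inner ℝ (chartInvAt z x' v) (chartInvAt z x' v))) (ℰ n z).target :=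
    contDiffOn_target_iff.2 fun x hx => contDiffAt_inner_chart hx v v
  have h1 := (continuousOn_source_of_coord h.continuousOn).sqrt
  refine h1.congr fun x hx => ?_
  simp only [coordFun_chart hx]
  rw [real_inner_self_eq_norm_sq, Real.sqrt_sq (norm_nonneg _)]

/-- By continuity the operator norm inequality need only be tested on a countable dense set of
vectors; this writes the sublevel sets of the norm as countable intersections of measurable sets. -/
lemma norm_le_of_dense {V W : Type*} [NormedAddCommGroup V] [NormedSpace ℝ V]
    [NormedAddCommGroup W] [NormedSpace ℝ W] {k : ℕ} {e : V → W} (he : Continuous e)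
    (hs : Function.Surjective e) {d : ℕ → V} (hd : DenseRange d) (f : W [⋀^Fin k]→L[ℝ] ℝ) {a : ℝ}
    (ha : 0 ≤ a) : ‖f‖ ≤ a ↔ ∀ I : Fin k → ℕ, |f (fun i => e (d (I i)))| ≤
      a * ∏ i, ‖e (d (I i))‖ := by
  constructor
  · intro h I
    refine (f.le_opNorm _).trans ?_
    gcongr
  · intro h
    refine f.opNorm_le_bound ha fun w => ?_
    choose u hu using fun i => hs (w i)
    have hw : w = fun i => e (u i) := funext fun i => (hu i).symm
    have hD : DenseRange (fun (I : Fin k → ℕ) (i : Fin k) => d (I i)) := DenseRange.piMap fun _ => hd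
    have hcl : IsClosed {u : Fin k → V | |f (fun i => e (u i))| ≤ a * ∏ i, ‖e (u i)‖} := by
      refine isClosed_le ?_ ?_
      · exact (f.cont.comp (continuous_pi fun i => he.comp (continuous_apply i))).abs
      · exact continuous_const.mul (continuous_finsetProd _ fun i _ =>
          (he.comp (continuous_apply i)).norm)
    have := hcl.closure_subset_iff.2 (range_subset_iff.2 h)
    rw [hD.closure_range] at this
    rw [hw, Real.norm_eq_abs]
    exact this (mem_univ u)

lemma MeasAlong.norm {T : Type*} [MeasurableSpace T] {k : ℕ} {b : T → M} (hb : Measurable b)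
    {β : (t : T) → (𝕋 n (b t)) [⋀^Fin k]→L[ℝ] ℝ} (hβ : MeasAlong b β) :
    Measurable fun t => ‖β t‖ := by
  refine measurable_of_Iic fun a => ?_
  rcases lt_or_ge a 0 with ha | ha
  · have : (fun t => ‖β t‖) ⁻¹' Iic a = ∅ := by
      ext t
      simp only [mem_preimage, mem_Iic, mem_empty_iff_false, iff_false, not_le]
      exact lt_of_lt_of_le ha (norm_nonneg (β t))
    rw [this]
    exact MeasurableSet.empty
  have : (fun t => ‖β t‖) ⁻¹' Iic a = ⋂ I : Fin k → ℕ, {t |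
      |β t (fun i => frame (b t) (TopologicalSpace.denseSeq (𝔼 n) (I i)))| ≤
        a * ∏ i, ‖frame (b t) (TopologicalSpace.denseSeq (𝔼 n) (I i))‖} := by
    ext t
    simp only [mem_preimage, mem_Iic, mem_iInter, mem_ofPred_eq]
    exact norm_le_of_dense (e := fun v => frame (n := n) (b t) v)
      (frame (n := n) (b t)).continuous (fun w => ⟨_, frame_coframe (b t) w⟩)
      (TopologicalSpace.denseRange_denseSeq (𝔼 n)) (β t) ha
  rw [this]
  refine MeasurableSet.iInter fun I => measurableSet_le (hβ _).abs ?_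
  refine Measurable.mul measurable_const (Finset.measurable_prod _ fun i _ => ?_)
  exact measurable_of_sel_continuousOn hb (h := fun x => ‖frame (n := n) x _‖)
    (h' := fun z x => ‖chartInvAt (n := n) z x _‖) (fun z => continuousOn_norm_chartInvAt z _)
    fun x => rfl

lemma form_sum {k : ℕ} {x : M} (β : (𝕋 n x) [⋀^Fin (k + 1)]→L[ℝ] ℝ)
    (w : 𝔼 n) (v : Fin k → 𝕋 n x) :
    β (Matrix.vecCons (frame x w) v) =
      ∑ j, w j * β (Matrix.vecCons (frame x (EuclideanSpace.basisFun (Fin n) ℝ j)) v) := by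
  have h : ∀ u : 𝕋 n x, β (Matrix.vecCons u v) = (β.curryLeft u) v := fun u => rfl
  have hw : frame x w = ∑ j, w j • frame x (EuclideanSpace.basisFun (Fin n) ℝ j) := by
    conv_lhs => rw [← (EuclideanSpace.basisFun (Fin n) ℝ).sum_repr w]
    simp [map_sum]
  rw [h, hw, map_sum, ContinuousAlternatingMap.sum_apply]
  refine Finset.sum_congr rfl fun j _ => ?_
  rw [map_smul, ContinuousAlternatingMap.smul_apply, smul_eq_mul, h]

end Norm

end Measurability

/-! ### Measurability under pull-back and contraction; measurable representatives. -/

section MeasurableForms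

variable {n : ℕ} {M : Type*} [TopologicalSpace M] [ChartedSpace (𝔼 n) M]
  [MeasurableSpace M] [BorelSpace M] [SecondCountableTopology M] [IsManifold (𝓡 n) ∞ M]

lemma stronglyMeasurable_alternating {V Z : Type*} [NormedAddCommGroup V] [NormedSpace ℝ V]
    [FiniteDimensional ℝ V] {k : ℕ} [MeasurableSpace Z]
    {f : Z → V [⋀^Fin k]→L[ℝ] ℝ} (h : ∀ v, Measurable (fun z => f z v)) :
    StronglyMeasurable f := by
  obtain ⟨g, hg⟩ := exists_recover V k
  have : f = fun z => g (fun I => f z (fun j => (Module.finBasis ℝ V) (I j))) := by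
    funext z
    exact (hg (f z)).symm
  rw [this]
  exact g.continuous.comp_stronglyMeasurable
    (measurable_pi_lambda _ fun I => h _).stronglyMeasurable

lemma aestronglyMeasurable_alternating {V Z : Type*} [NormedAddCommGroup V] [NormedSpace ℝ V]
    [FiniteDimensional ℝ V] {k : ℕ} [MeasurableSpace Z] {μ : Measure Z}
    {f : Z → V [⋀^Fin k]→L[ℝ] ℝ} (h : ∀ v, AEMeasurable (fun z => f z v) μ) :
    AEStronglyMeasurable f μ := by
  obtain ⟨g, hg⟩ := exists_recover V k
  have : f = fun z => g (fun I => f z (fun j => (Module.finBasis ℝ V) (I j))) := by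
    funext z
    exact (hg (f z)).symm
  rw [this]
  exact g.continuous.comp_aestronglyMeasurable
    (aemeasurable_pi_lambda _ fun I => h _).aestronglyMeasurable

/-- The expression of a family of forms in the measurable frame. -/
def inFrame {k : ℕ} {x : M} (β : (𝕋 n x) [⋀^Fin k]→L[ℝ] ℝ) :
    (𝔼 n) [⋀^Fin k]→L[ℝ] ℝ := β.compContinuousLinearMap (frame x)

omit [IsManifold (𝓡 n) ∞ M] in
lemma MeasAlong.eval {T : Type*} [MeasurableSpace T] {k : ℕ} {b : T → M}
    {β : (t : T) → (𝕋 n (b t)) [⋀^Fin k]→L[ℝ] ℝ} (hβ : MeasAlong b β)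
    {w : T → Fin k → 𝔼 n} (hw : Measurable w) :
    Measurable fun t => β t (fun i => frame (b t) (w t i)) := by
  have h1 : StronglyMeasurable fun t => inFrame (β t) := stronglyMeasurable_alternating hβ
  have h2 : Continuous fun q : ((𝔼 n) [⋀^Fin k]→L[ℝ] ℝ) × (Fin k → 𝔼 n) => q.1 q.2 := by
    have h3 : Continuous fun q : ((𝔼 n) [⋀^Fin k]→L[ℝ] ℝ) × (Fin k → 𝔼 n) =>
      (ContinuousAlternatingMap.toContinuousMultilinearMapCLM ℝ q.1) q.2 := by fun_prop
    exact h3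
  exact (h2.comp_stronglyMeasurable (h1.prodMk hw.stronglyMeasurable)).measurable

lemma MeasAlong.compLin {T : Type*} [MeasurableSpace T] {k : ℕ} {b b' : T → M}
    {β : (t : T) → (𝕋 n (b' t)) [⋀^Fin k]→L[ℝ] ℝ} (hβ : MeasAlong b' β)
    {A : (t : T) → 𝕋 n (b t) →L[ℝ] 𝕋 n (b' t)}
    (hA : ∀ v, Measurable fun t => coframe (b' t) (A t (frame (b t) v))) :
    MeasAlong b (fun t => (β t).compContinuousLinearMap (A t)) := by
  intro v
  have h := hβ.eval (w := fun t i => coframe (b' t) (A t (frame (b t) (v i))))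
    (measurable_pi_lambda _ fun i => hA _)
  simp only [frame_coframe] at h
  exact h

lemma measurable_piecewise_coord {T G : Type*} [TopologicalSpace T] [MeasurableSpace T]
    [OpensMeasurableSpace T] [MeasurableSpace G]
    [TopologicalSpace G] [BorelSpace G] {U : Set T} (hU : IsOpen U) {f : T → G} (g : G)
    (hf : ContinuousOn f U) : ∃ f' : T → G, Measurable f' ∧ ∀ t ∈ U, f t = f' t := by
  classical
  exact ⟨U.piecewise f fun _ => g, ContinuousOn.measurable_piecewise hf continuousOn_const
    hU.measurableSet, fun t ht => (piecewise_eq_of_mem _ _ _ ht).symm⟩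

/-- Joint measurability of the pull-backs of a measurable form. -/
lemma MeasForm.pullback {φ : ℝ → M → M} {ξ : (x : M) → 𝕋 n x} (hφ : IsFlowOf φ ξ)
    {k : ℕ} {θ : DiffForm n M k} (hθ : MeasForm θ) :
    MeasAlong (fun q : ℝ × M => q.2) (fun q => pullbackForm (φ q.1) θ q.2) := by
  have hm : Measurable fun q : ℝ × M => φ q.1 q.2 := hφ.smooth.continuous.measurable
  have h1 : MeasAlong (fun q : ℝ × M => φ q.1 q.2) (fun q : ℝ × M => θ (φ q.1 q.2)) :=
    fun v => (hθ v).comp hm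
  refine h1.compLin (A := fun q => 𝒟 n (φ q.1) q.2) fun v => ?_
  refine measurable_of_sel (n := n) measurable_snd fun z => ?_
  have hd : ∀ q : ℝ × M, MDifferentiableAt (𝓡 n) (𝓡 n) (φ q.1) q.2 := fun q =>
    (hφ.smooth.comp (contMDiff_const.prodMk contMDiff_id)).mdifferentiable
      (by simp) (f := fun x => φ q.1 x) q.2
  -- Charts are selected both at `q.2` and at its image; for each fixed pair of charts the
  -- coefficients of the differential are continuous on an open set and extended by zero outside it.
  have key : ∀ z z', ∃ f' : ℝ × M → 𝔼 n, Measurable f' ∧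
      ∀ q : ℝ × M, q.2 ∈ (ℰ n z).source →
        φ q.1 q.2 ∈ (ℰ n z').source →
        chartDeriv z' (φ q.1 q.2) (𝒟 n (φ q.1) q.2 (chartInvAt z q.2 v)) =
          f' q := by
    intro z z'
    have hU : IsOpen {q : ℝ × M | q.2 ∈ (ℰ n z).source ∧
        φ q.1 q.2 ∈ (ℰ n z').source} :=
      ((isOpen_extChartAt_source z).preimage continuous_snd).inter
        ((isOpen_extChartAt_source z').preimage hφ.smooth.continuous)
    obtain ⟨f', hf', hE⟩ := measurable_piecewise_coord hU (0 : 𝔼 n)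
      (f := fun q : ℝ × M => fderiv ℝ (coordMap z z' (φ q.1)) (ℰ n z q.2) v) (by
        rintro ⟨s, x⟩ ⟨hx, hfx⟩
        have h2 := (contDiffAt_fderiv_coordMap_family hφ.smooth hx hfx).continuousAt
        have h3 : ContinuousAt (fun q : ℝ × M => (q.1, ℰ n z q.2)) (s, x) :=
          continuousAt_fst.prodMk (ContinuousAt.comp (g := ℰ n z)
            (f := fun q : ℝ × M => q.2) (continuousAt_extChartAt' hx) continuousAt_snd)
        have h4 := ContinuousAt.comp (f := fun q : ℝ × M => (q.1, ℰ n z q.2))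
          h2 h3
        exact (h4.clm_apply continuousAt_const).continuousWithinAt)
    refine ⟨f', hf', fun q hq hq' => ?_⟩
    beta_reduce
    rw [← hE q ⟨hq, hq'⟩, fderiv_coordMap hq hq' (hd q)]
    rfl
  choose f' hf' hE using key
  refine ⟨fun q => f' z (sel n M (φ q.1 q.2)) q, ?_, fun q hq => ?_⟩
  · exact measurable_of_sel (n := n) hm fun z' => ⟨f' z z', hf' z z', fun q hq => by rw [hq]⟩
  · have h5 := mem_sel (n := n) q.2
    rw [hq] at h5
    beta_reduce
    rw [← hE z _ q h5 (mem_sel _), coframe, frame, hq]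

lemma measurable_indicator_form {k : ℕ} {θ : DiffForm n M k} (hθ : MeasForm θ) (x₀ : M)
    (v : Fin k → 𝔼 n) : Measurable ((ℰ n x₀).source.indicator
      fun x => θ x (fun i => chartInvAt x₀ x (v i))) := by
  have hS := (isOpen_extChartAt_source (I := 𝓡 n) x₀)
  have hw : ∀ u : 𝔼 n, ∃ w : M → 𝔼 n, Measurable w ∧ ∀ x ∈ (ℰ n x₀).source,
      coframe x (chartInvAt x₀ x u) = w x := by
    intro u
    have key : ∀ z, ∃ f' : M → 𝔼 n, Measurable f' ∧ ∀ x, x ∈ (ℰ n x₀).source ∧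
        x ∈ (ℰ n z).source → fderiv ℝ (coordMap x₀ z id) (ℰ n x₀ x) u =
          f' x := by
      intro z
      refine measurable_piecewise_coord (hS.inter (isOpen_extChartAt_source z)) (0 : 𝔼 n) ?_
      rintro x ⟨hx, hx'⟩
      have h2 := ((contDiffAt_coordMap contMDiff_id hx hx').fderiv_right (m := ∞)
        (by simp)).continuousAt
      have h4 := ContinuousAt.comp (f := fun x => ℰ n x₀ x) h2
        (continuousAt_extChartAt' hx)
      exact (h4.clm_apply continuousAt_const).continuousWithinAt
    choose f' hf' hE using key
    refine ⟨fun x => f' (sel n M x) x, ?_, fun x hx => ?_⟩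
    · exact measurable_of_sel (n := n) measurable_id fun z => ⟨f' z, hf' z, fun q hq => by
        rw [id] at hq; rw [hq]⟩
    · beta_reduce
      rw [← hE (sel n M x) x ⟨hx, mem_sel x⟩, fderiv_coordMap hx (mem_sel x) mdifferentiableAt_id,
        mfderiv_id]
      rfl
  choose w hwm hwE using hw
  have h := (MeasAlong.eval (b := fun x => x) hθ (w := fun x i => w (v i) x)
    (measurable_pi_lambda _ fun i => hwm _)).indicator hS.measurableSet
  convert h using 1
  funext x
  by_cases hx : x ∈ (ℰ n x₀).source
  · rw [indicator_of_mem hx, indicator_of_mem hx]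
    congr 1
    funext i
    rw [← hwE _ x hx, frame_coframe]
  · rw [indicator_of_notMem hx, indicator_of_notMem hx]

lemma MeasForm.coordForm {k : ℕ} {θ : DiffForm n M k} (hθ : MeasForm θ) (x₀ : M) :
    AEStronglyMeasurable (LpForms.coordForm x₀ θ)
      (volume.restrict (ℰ n x₀).target) := by
  refine aestronglyMeasurable_alternating fun v => ?_
  have h := (measurable_indicator_form hθ x₀ v).comp_aemeasurable (aemeasurable_chart_symm (n := n) x₀)
  refine h.congr ?_
  filter_upwards [ae_restrict_mem (isOpen_extChartAt_target (I := 𝓡 n) x₀).measurableSet] with y hy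
  rw [Function.comp_apply, indicator_of_mem ((ℰ n x₀).map_target hy),
    chartInvAt_symm hy]
  rfl

section Inter

variable [RiemannianBundle (fun x : M => 𝕋 n x)]
  [IsContMDiffRiemannianBundle (𝓡 n) ∞ (𝔼 n) (fun x : M => 𝕋 n x)]

lemma MeasAlong.inter {T : Type*} [MeasurableSpace T] {k : ℕ} {b : T → M} (hb : Measurable b)
    {β : (t : T) → (𝕋 n (b t)) [⋀^Fin (k + 1)]→L[ℝ] ℝ} (hβ : MeasAlong b β)
    {ξ : (x : M) → 𝕋 n x} (hξ : IsSmoothVec ξ) :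
    MeasAlong b (fun t => LpForms.inter (ξ (b t)) (β t)) := by
  intro v
  have h1 : ∀ t, LpForms.inter (ξ (b t)) (β t) (fun i => frame (b t) (v i)) =
      ∑ j, coframe (b t) (ξ (b t)) j * β t (fun i => frame (b t)
        ((Matrix.vecCons (EuclideanSpace.basisFun (Fin n) ℝ j) v : Fin (k + 1) → 𝔼 n) i)) := by
    intro t
    rw [inter_apply]
    conv_lhs => rw [← frame_coframe (b t) (ξ (b t))]
    rw [form_sum]
    refine Finset.sum_congr rfl fun j _ => ?_
    congr 2
    funext i
    refine Fin.cases ?_ (fun l => ?_) i <;> rfl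
  simp only [h1]
  refine Finset.measurable_sum _ fun j _ => Measurable.mul ?_ (hβ _)
  have h2 : Measurable fun t => coframe (b t) (ξ (b t)) := by
    refine measurable_of_sel_continuousOn hb (h := fun x => coframe x (ξ x))
      (h' := fun z x => coordVec z ξ (ℰ n z x)) (fun z => ?_)
      fun x => (coordVec_chart (mem_sel x) ξ).symm
    exact continuousOn_source_of_coord (contDiffOn_target_iff.2 (hξ z)).continuousOn
  exact (by fun_prop : Continuous fun v : 𝔼 n => v j).measurable.comp h2

lemma MeasForm.dwedge {k : ℕ} {θ : DiffForm n M k} (hθ : MeasForm θ) {h : M → ℝ}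
    (hh : 𝒞 n h) : MeasForm (LpForms.dwedge (n := n) h θ) := by
  intro v
  simp only [LpForms.dwedge, wedge_apply]
  refine Finset.measurable_sum _ fun j _ => ?_
  have h1 : Measurable fun x => dfun (n := n) h x (frame (n := n) x (v j)) := by
    refine measurable_of_sel_continuousOn (n := n) measurable_id
      (h := fun x => dfun (n := n) h x (frame (n := n) x (v j)))
      (h' := fun z x => fderiv ℝ (coordFun (n := n) z h) (ℰ n z x) (v j)) (fun z => ?_)
      fun x => ?_
    · have h2 : ContDiffOn ℝ ∞ (fderiv ℝ (coordFun (n := n) z h)) (ℰ n z).target :=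
        contDiffOn_target_iff.2 fun x hx => (contDiffAt_coordFun hh hx).fderiv_right (by simp)
      exact (continuousOn_source_of_coord h2.continuousOn).clm_apply continuousOn_const
    · rw [fderiv_coordFun (mem_sel x) (hh.mdifferentiable (by simp) x)]
      rfl
  have h2 : Measurable fun x => θ x (fun i => frame (n := n) x (Fin.removeNth j v i)) :=
    hθ (Fin.removeNth j v)
  exact measurable_const.mul (h1.mul h2)

lemma MeasForm.smul {k : ℕ} {θ : DiffForm n M k} (hθ : MeasForm θ) {h : M → ℝ}
    (hh : Measurable h) : MeasForm (h • θ) := fun v => hh.mul (hθ v)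

lemma MeasForm.add {k : ℕ} {θ θ' : DiffForm n M k} (hθ : MeasForm θ) (hθ' : MeasForm θ') :
    MeasForm (θ + θ') := fun v => (hθ v).add (hθ' v)

end Inter

section Representative

variable [RiemannianBundle (fun x : M => 𝕋 n x)]
  [IsContMDiffRiemannianBundle (𝓡 n) ∞ (𝔼 n) (fun x : M => 𝕋 n x)]

/-- The Riemannian volume has a density in the chart, so Lebesgue-null sets of coordinates
correspond to null sets of points. -/
lemma ae_of_ae_chart {z : M} {P : (𝔼 n) → Prop}
    (h : ∀ᵐ y ∂((volume : Measure (𝔼 n)).restrict (ℰ n z).target), P y) :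
    ∀ᵐ x ∂((riemannianVolume n M).restrict (ℰ n z).source), P (ℰ n z x) := by
  classical
  have hS := (isOpen_extChartAt_source (I := 𝓡 n) z).measurableSet
  obtain ⟨t, ht, htm, ht0⟩ := exists_measurable_superset_of_null h
  have hA : MeasurableSet ((ℰ n z).source ∩ ℰ n z ⁻¹' t) := by
    have h1 : Measurable ((ℰ n z).source.piecewise (ℰ n z) fun _ => 0) := by
      exact ContinuousOn.measurable_piecewise (continuousOn_extChartAt z) continuousOn_const hS
    convert hS.inter (h1 htm) using 1
    ext x
    constructor
    · rintro ⟨hx, hx'⟩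
      exact ⟨hx, by rw [mem_preimage, piecewise_eq_of_mem _ _ _ hx]; exact hx'⟩
    · rintro ⟨hx, hx'⟩
      rw [mem_preimage, piecewise_eq_of_mem _ _ _ hx] at hx'
      exact ⟨hx, hx'⟩
  rw [riemannianVolume_restrict]
  refine measure_mono_null (t := ((ℰ n z).source ∩ ℰ n z ⁻¹' t) ∪
    (ℰ n z).sourceᶜ) ?_ (measure_union_null ?_ (chartVolume_compl_source z))
  · intro x hx
    by_cases hxs : x ∈ (ℰ n z).source
    · exact Or.inl ⟨hxs, ht hx⟩
    · exact Or.inr hxs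
  · rw [chartVolume_apply z hA]
    refine setLIntegral_measure_zero _ _ (measure_mono_null (t := t ∩ (ℰ n z).target)
      ?_ ?_)
    · rintro y ⟨hy, hy1, hy2⟩
      rw [mem_preimage, (ℰ n z).right_inv hy] at hy2
      exact ⟨hy2, hy⟩
    · rwa [Measure.restrict_apply htm] at ht0

lemma lpNorm_congr {k : ℕ} {p : ℝ} {θ θ' : DiffForm n M k}
    (h : ∀ᵐ x ∂(riemannianVolume n M), θ x = θ' x) : lpNorm p θ = lpNorm p θ' := by
  refine eLpNorm_congr_ae ?_
  filter_upwards [h] with x hx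
  rw [hx]

lemma MeasForm.isLpForm {k : ℕ} {p : ℝ} {θ : DiffForm n M k} (hθ : MeasForm θ)
    (h : lpNorm p θ < ⊤) : IsLpForm p θ := ⟨hθ.coordForm, h⟩

/-- An `Lᵖ` form has a measurable representative. -/
lemma IsLpForm.exists_rep {k : ℕ} {p : ℝ} {θ : DiffForm n M k} (hθ : IsLpForm p θ) :
    ∃ θ' : DiffForm n M k, MeasForm θ' ∧ IsLpForm p θ' ∧
      ∀ᵐ x ∂(riemannianVolume n M), θ x = θ' x := by
  classical
  let G : M → (𝔼 n) → (𝔼 n) [⋀^Fin k]→L[ℝ] ℝ := fun z => (hθ.1 z).mk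
  let θ' : DiffForm n M k := fun x =>
    (G (sel n M x) (ℰ n (sel n M x) x)).compContinuousLinearMap (coframe x)
  have hm : MeasForm θ' := by
    intro v
    have h1 : ∀ x, θ' x (fun i => frame x (v i)) =
        G (sel n M x) (ℰ n (sel n M x) x) v := by
      intro x
      simp only [θ', ContinuousAlternatingMap.compContinuousLinearMap_apply, Function.comp_def,
        coframe_frame]
    simp only [h1]
    refine measurable_of_sel (n := n) measurable_id fun z => ?_
    obtain ⟨f, hf, hE⟩ := measurable_piecewise_coord (isOpen_extChartAt_source (I := 𝓡 n) z)
      (0 : 𝔼 n) (continuousOn_extChartAt z)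
    refine ⟨fun x => G z (f x) v, ?_, fun x hx => ?_⟩
    · have h2 : StronglyMeasurable (G z) := (hθ.1 z).stronglyMeasurable_mk
      have h3 : Continuous fun β : (𝔼 n) [⋀^Fin k]→L[ℝ] ℝ => β v := by fun_prop
      exact (h3.comp_stronglyMeasurable h2).measurable.comp hf
    · have hx' := mem_sel (n := n) x
      rw [id] at hx
      rw [hx] at hx' ⊢
      rw [hE x hx']
  have hae : ∀ᵐ x ∂(riemannianVolume n M), θ x = θ' x := by
    have h1 : ∀ z, ∀ᵐ x ∂(riemannianVolume n M), x ∈ (ℰ n z).source →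
        coordForm z θ (ℰ n z x) = G z (ℰ n z x) := fun z =>
      (ae_restrict_iff' (isOpen_extChartAt_source z).measurableSet).1
        (ae_of_ae_chart (hθ.1 z).ae_eq_mk)
    -- Only countably many charts are ever selected, so their exceptional null sets add up to a null
    -- set.
    have h2 := (ae_ball_iff (exists_selector n M).choose_spec.2.1).2 fun z _ => h1 z
    filter_upwards [h2] with x hx
    have h3 := hx (sel n M x) (mem_range_self _) (mem_sel x)
    rw [form_eq_coordForm (mem_sel x) θ, h3]
    rfl
  exact ⟨θ', hm, hm.isLpForm (by rw [← lpNorm_congr hae]; exact hθ.2), hae⟩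

end Representative

end MeasurableForms

/-! ### Uniform bounds on compact sets; smooth families of fields. -/

section LocalBounds

variable {n : ℕ} {M : Type*} [TopologicalSpace M] [ChartedSpace (𝔼 n) M]
  [IsManifold (𝓡 n) ∞ M] [RiemannianBundle (fun x : M => 𝕋 n x)]
  [IsContMDiffRiemannianBundle (𝓡 n) ∞ (𝔼 n) (fun x : M => 𝕋 n x)]

/-- The form in which compactness is used for quantities living in varying fibres: `P q C` says that
`C` is a valid bound at `q`, so no continuous real function is needed. -/
lemma exists_bound_of_locally {Z : Type*} [TopologicalSpace Z] {P : Z → ℝ → Prop} {Q : Set Z}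
    (hQ : IsCompact Q) (hP : ∀ q C C', C ≤ C' → P q C → P q C')
    (h : ∀ q ∈ Q, ∃ C, ∀ᶠ q' in 𝓝 q, P q' C) :
    ∃ C : ℝ, 0 ≤ C ∧ ∀ q ∈ Q, P q C := by
  refine hQ.induction_on (p := fun S => ∃ C : ℝ, 0 ≤ C ∧ ∀ q ∈ S, P q C) ⟨0, le_rfl, by simp⟩
    ?_ ?_ ?_
  · rintro s t hst ⟨C, hC, h⟩
    exact ⟨C, hC, fun q hq => h q (hst hq)⟩
  · rintro s t ⟨C, hC, h⟩ ⟨C', hC', h'⟩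
    refine ⟨max C C', hC.trans (le_max_left _ _), ?_⟩
    rintro q (hq | hq)
    · exact hP _ _ _ (le_max_left _ _) (h q hq)
    · exact hP _ _ _ (le_max_right _ _) (h' q hq)
  · intro q hq
    obtain ⟨C, hC⟩ := h q hq
    exact ⟨_, mem_nhdsWithin_of_mem_nhds hC, max C 0, le_max_right _ _, fun q' hq' =>
      hP _ _ _ (le_max_left _ _) hq'⟩

lemma isContinuousRiemannianBundle :
    IsContinuousRiemannianBundle (𝔼 n) (fun x : M => 𝕋 n x) := by
  obtain ⟨g, hg, h⟩ := IsContMDiffRiemannianBundle.exists_contMDiff (IB := 𝓡 n) (n := ∞)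
    (F := 𝔼 n) (E := fun x : M => 𝕋 n x)
  exact ⟨g, hg.continuous, h⟩

lemma exists_norm_chart_bound (x : M) : ∃ C : ℝ, 0 < C ∧ ∀ᶠ x' in 𝓝 x,
    x' ∈ (ℰ n x).source ∧ ‖chartDeriv (n := n) x x'‖ ≤ C ∧
      ‖chartInvAt (n := n) x x'‖ ≤ C := by
  haveI := isManifold_one (n := n) (M := M)
  haveI := isContinuousRiemannianBundle (n := n) (M := M)
  obtain ⟨C, hC, h⟩ := eventually_norm_mfderiv_extChartAt_lt (𝓡 n) x
  obtain ⟨C', hC', h'⟩ := eventually_norm_mfderivWithin_symm_extChartAt_comp_lt (𝓡 n) x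
  refine ⟨max C C', lt_max_of_lt_left hC, ?_⟩
  filter_upwards [h, h', extChartAt_source_mem_nhds (I := 𝓡 n) x] with x' h1 h2 h3
  refine ⟨h3, h1.le.trans (le_max_left _ _), ?_⟩
  have h4 : ∀ v, ‖chartInvAt (n := n) x x' v‖ ≤ C' * ‖v‖ := by
    intro v
    have h5 := chartInvAt_symm ((ℰ n x).map_source h3)
    rw [chartInvDeriv_eq_mfderivWithin] at h5
    obtain ⟨y, hy, rfl⟩ : ∃ y ∈ (ℰ n x).target, (ℰ n x).symm y = x' :=
      ⟨_, (ℰ n x).map_source h3, (ℰ n x).left_inv h3⟩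
    rw [(ℰ n x).right_inv hy] at h2
    rw [chartInvAt_symm hy, chartInvDeriv_eq_mfderivWithin]
    exact (ContinuousLinearMap.le_opNorm _ v).trans (mul_le_mul_of_nonneg_right h2.le (norm_nonneg _))
  exact (ContinuousLinearMap.opNorm_le_bound _ hC'.le h4).trans (le_max_right _ _)

lemma norm_compCLM_le {V W : Type*} [NormedAddCommGroup V] [NormedSpace ℝ V]
    [NormedAddCommGroup W] [NormedSpace ℝ W] {k : ℕ} (β : W [⋀^Fin k]→L[ℝ] ℝ) (L : V →L[ℝ] W)
    {C : ℝ} (hL : ‖L‖ ≤ C) : ‖β.compContinuousLinearMap L‖ ≤ C ^ k * ‖β‖ := by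
  refine (β.norm_compContinuousLinearMap_le L).trans ?_
  rw [Fintype.card_fin, mul_comm]
  gcongr

/-- Smooth families of multivector fields. -/
def SmoothFamily {k : ℕ} (Z : ℝ → MultivectorField n M k) : Prop :=
  ∀ x₁ x : M, x ∈ (ℰ n x₁).source → ∀ s : ℝ,
    ContDiffAt ℝ ∞ (fun q : ℝ × (𝔼 n) => coordField x₁ (Z q.1) q.2) (s, ℰ n x₁ x)

/-- The derivative of a family of multivector fields. -/
def derivFamily {k : ℕ} (Z : ℝ → MultivectorField n M k) (s : ℝ) : MultivectorField n M k :=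
  fun x => (fderiv ℝ (fun q : ℝ × (𝔼 n) => coordField x (Z q.1) q.2) (s, ℰ n x x)
      (1, 0)).comp
    (ContinuousAlternatingMap.compContinuousLinearMapCLM (chartInvAt x x))

omit [IsManifold (𝓡 n) ∞ M] [RiemannianBundle (fun x : M => TangentSpace (𝓡 n) x)]
  [IsContMDiffRiemannianBundle (𝓡 n) ∞ (𝔼 n) (fun x : M => TangentSpace (𝓡 n) x)] in
lemma SmoothFamily.hasDerivAt_coord {k : ℕ} {Z : ℝ → MultivectorField n M k} (hZ : SmoothFamily Z)
    {x₁ x : M} (hx : x ∈ (ℰ n x₁).source) (s : ℝ) :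
    HasDerivAt (fun t => coordField x₁ (Z t) (ℰ n x₁ x))
      (fderiv ℝ (fun q : ℝ × (𝔼 n) => coordField x₁ (Z q.1) q.2) (s, ℰ n x₁ x)
        (1, 0)) s := by
  have h := ((hZ x₁ x hx s).differentiableAt (by simp)).hasFDerivAt
  have h1 := (HasFDerivAt.comp (g := fun q : ℝ × (𝔼 n) => coordField x₁ (Z q.1) q.2)
      (f := fun s : ℝ => (s, ℰ n x₁ x)) s h
      (hasFDerivAt_prodMk_left s _)).hasDerivAt
  refine h1.congr_deriv ?_
  simp

lemma SmoothFamily.hasDerivAt {k : ℕ} {Z : ℝ → MultivectorField n M k} (hZ : SmoothFamily Z)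
    (x : M) (β : (𝕋 n x) [⋀^Fin k]→L[ℝ] ℝ) (s : ℝ) :
    HasDerivAt (fun t => Z t x β) (derivFamily Z s x β) s := by
  have hx := mem_extChartAt_source (I := 𝓡 n) x
  have h := hZ.hasDerivAt_coord hx s
  have h1 := h.clm_apply (hasDerivAt_const s (β.compContinuousLinearMap (chartInvAt x x)))
  rw [map_zero, add_zero] at h1
  refine (h1.congr_of_eventuallyEq (Eventually.of_forall fun t => ?_)).congr_deriv ?_
  · exact field_apply_eq hx (Z t) β
  · rfl

/-- `derivFamily` is defined at each point through the chart centred there; since it is the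
pointwise derivative of the pairings, it agrees with the derivative taken in any other chart. -/
lemma SmoothFamily.coordField_deriv {k : ℕ} {Z : ℝ → MultivectorField n M k} (hZ : SmoothFamily Z)
    {x₁ x : M} (hx : x ∈ (ℰ n x₁).source) (s : ℝ) :
    coordField x₁ (derivFamily Z s) (ℰ n x₁ x) =
      fderiv ℝ (fun q : ℝ × (𝔼 n) => coordField x₁ (Z q.1) q.2) (s, ℰ n x₁ x)
        (1, 0) := by
  ext β
  have h1 := (hZ.hasDerivAt_coord hx s).clm_apply (hasDerivAt_const s β)
  rw [map_zero, add_zero] at h1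
  refine HasDerivAt.unique ?_ h1
  have h2 := hZ.hasDerivAt x (β.compContinuousLinearMap (chartDeriv x₁ x)) s
  rw [coordField_chart hx]
  refine h2.congr_of_eventuallyEq (Eventually.of_forall fun t => ?_)
  beta_reduce
  rw [coordField_chart hx]
  rfl

lemma SmoothFamily.deriv {k : ℕ} {Z : ℝ → MultivectorField n M k} (hZ : SmoothFamily Z) :
    SmoothFamily (derivFamily Z) := by
  intro x₁ x hx s
  have h1 := ((hZ x₁ x hx s).fderiv_right (m := ∞) (by simp)).clm_apply
    (contDiffAt_const (c := ((1 : ℝ), (0 : 𝔼 n))))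
  refine h1.congr_of_eventuallyEq ?_
  filter_upwards [continuousAt_snd.eventually (eventually_mem_source hx univ_mem)] with q hq
  have := hZ.coordField_deriv ((ℰ n x₁).map_target hq.1) q.1
  rwa [(ℰ n x₁).right_inv hq.1] at this

lemma SmoothFamily.exists_bound {k : ℕ} {Z : ℝ → MultivectorField n M k} (hZ : SmoothFamily Z)
    {Q : Set (ℝ × M)} (hQ : IsCompact Q) : ∃ C, 0 ≤ C ∧ ∀ q ∈ Q,
      ∀ β : (𝕋 n q.2) [⋀^Fin k]→L[ℝ] ℝ, |Z q.1 q.2 β| ≤ C * ‖β‖ := by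
  refine exists_bound_of_locally (P := fun (q : ℝ × M) C => ∀ β : (𝕋 n q.2) [⋀^Fin k]→L[ℝ] ℝ,
    |Z q.1 q.2 β| ≤ C * ‖β‖) hQ (fun q C C' hC h β => (h β).trans
      (mul_le_mul_of_nonneg_right hC (norm_nonneg β))) ?_
  rintro ⟨s, x⟩ -
  obtain ⟨C, hC, h⟩ := exists_norm_chart_bound (n := n) x
  have hx := mem_extChartAt_source (I := 𝓡 n) x
  have h1 := ContinuousAt.norm (E := ((𝔼 n) [⋀^Fin k]→L[ℝ] ℝ) →L[ℝ] ℝ) (hZ x x hx s).continuousAt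
  have h2 : ContinuousAt (fun q : ℝ × M => (q.1, ℰ n x q.2)) (s, x) :=
    continuousAt_fst.prodMk (ContinuousAt.comp (g := ℰ n x)
      (f := fun q : ℝ × M => q.2) (continuousAt_extChartAt' hx) continuousAt_snd)
  have h3 := ContinuousAt.comp (f := fun q : ℝ × M => (q.1, ℰ n x q.2)) h1 h2
  refine ⟨(‖coordField x (Z s) (ℰ n x x)‖ + 1) * C ^ k, ?_⟩
  filter_upwards [h3.eventually_lt_const (lt_add_one _), continuousAt_snd.eventually h]
    with q h4 h5
  intro β
  rw [field_apply_eq h5.1]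
  rw [← Real.norm_eq_abs]
  refine (ContinuousLinearMap.le_opNorm _ _).trans ?_
  rw [mul_assoc]
  exact mul_le_mul h4.le (norm_compCLM_le _ _ h5.2.2) (norm_nonneg _) (by positivity)

lemma smoothFamily_const {k : ℕ} (X : testFields n M k) : SmoothFamily fun _ : ℝ => X.1 :=
  fun x₁ _ hx _ => ContDiffAt.comp (g := coordField x₁ X.1) _
    (contDiffOn_target_iff.1 (X.2.1 x₁) _ hx) contDiffAt_snd

lemma exists_bound_field {k : ℕ} (X : testFields n M k) : ∃ C, 0 ≤ C ∧ ∀ x,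
    ∀ β : (𝕋 n x) [⋀^Fin k]→L[ℝ] ℝ, |X.1 x β| ≤ C * ‖β‖ := by
  obtain ⟨K, hK, hX⟩ := X.2.2
  obtain ⟨C, hC, h⟩ := (smoothFamily_const X).exists_bound ((isCompact_singleton (x := (0 : ℝ))).prod hK)
  refine ⟨C, hC, fun x β => ?_⟩
  by_cases hx : x ∈ K
  · exact h (0, x) ⟨rfl, hx⟩ β
  · rw [hX x hx, zero_apply, abs_zero]
    positivity

lemma SmoothFamily.continuousOn {k : ℕ} {Z : ℝ → MultivectorField n M k} (hZ : SmoothFamily Z)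
    (s : ℝ) (z : M) : ContinuousOn (coordField z (Z s)) (ℰ n z).target :=
  (contDiffOn_target_iff.2 fun x hx =>
      ContDiffAt.comp (g := fun q : ℝ × (𝔼 n) => coordField z (Z q.1) q.2)
        (f := fun y => (s, y)) (ℰ n z x) (hZ z x hx s) (by fun_prop)).continuousOn

lemma IsFlowOf.smoothFamily {φ : ℝ → M → M} {ξ : (x : M) → 𝕋 n x}
    (hφ : IsFlowOf φ ξ) {k : ℕ} (X : testFields n M k) :
    SmoothFamily fun s => pushFlow φ s X.1 := fun _ _ hx s => hφ.contDiffAt_pushFlow X hx s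

lemma IsSmoothForm.exists_bound {k : ℕ} {α : DiffForm n M k} (hα : IsSmoothForm α) {K : Set M}
    (hK : IsCompact K) : ∃ C, 0 ≤ C ∧ ∀ x ∈ K, ‖α x‖ ≤ C := by
  refine exists_bound_of_locally (P := fun x C => ‖α x‖ ≤ C) hK (fun q C C' h h' => h'.trans h)
    fun x _ => ?_
  obtain ⟨C, hC, h⟩ := exists_norm_chart_bound (n := n) x
  have hx := mem_extChartAt_source (I := 𝓡 n) x
  have h1 := ContinuousAt.norm (E := (𝔼 n) [⋀^Fin k]→L[ℝ] ℝ)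
    (isSmoothForm_iff.1 hα x x hx).continuousAt
  have h3 := ContinuousAt.comp (f := ℰ n x) h1 (continuousAt_extChartAt' hx)
  refine ⟨C ^ k * (‖coordForm x α (ℰ n x x)‖ + 1), ?_⟩
  filter_upwards [h3.eventually_lt_const (lt_add_one _), h] with q h4 h5
  rw [form_eq_coordForm h5.1 α]
  refine (norm_compCLM_le _ _ h5.2.1).trans ?_
  exact mul_le_mul_of_nonneg_left h4.le (by positivity)

end LocalBounds

/-! ### Multiplication, contraction and wedge for test fields; differentiation along the flow. -/

section TestOperations

variable {n : ℕ} {M : Type*} [TopologicalSpace M] [ChartedSpace (𝔼 n) M]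
  [IsManifold (𝓡 n) ∞ M] [RiemannianBundle (fun x : M => 𝕋 n x)]
  [IsContMDiffRiemannianBundle (𝓡 n) ∞ (𝔼 n) (fun x : M => 𝕋 n x)]

lemma coordField_smul {k : ℕ} {x₀ x : M} (hx : x ∈ (ℰ n x₀).source) (h : M → ℝ)
    (X : MultivectorField n M k) : coordField x₀ (fun x => h x • X x) (ℰ n x₀ x) =
      coordFun x₀ h (ℰ n x₀ x) • coordField x₀ X (ℰ n x₀ x) := by
  rw [coordField_chart hx, coordField_chart hx, coordFun_chart hx]
  rfl

lemma contDiffAt_smul_dual {V G : Type*} [NormedAddCommGroup V] [NormedSpace ℝ V]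
    [NormedAddCommGroup G] [NormedSpace ℝ G] {f : G → ℝ} {g : G → V →L[ℝ] ℝ} {x : G}
    (hf : ContDiffAt ℝ ∞ f x) (hg : ContDiffAt ℝ ∞ g x) :
    ContDiffAt ℝ ∞ (fun y => f y • g y) x := hf.smul hg

/-- The product of a test field by a smooth function. -/
def smulTest {k : ℕ} {h : M → ℝ} (hh : 𝒞 n h) (X : testFields n M k) :
    testFields n M k :=
  ⟨fun x => h x • X.1 x, fun x₀ => contDiffOn_target_iff.2 fun _ hx => by
      have h1 : ContDiffAt ℝ ∞ (fun y => coordField x₀ X.1 y) _ :=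
        contDiffOn_target_iff.1 (X.2.1 x₀) _ hx
      have h2 := contDiffAt_smul_dual (contDiffAt_coordFun hh hx) h1
      exact h2.congr_of_eventuallyEq
        (eventually_chart hx univ_mem fun _ hx' _ => coordField_smul hx' h X.1),
    by
      obtain ⟨K, hK, hX⟩ := X.2.2
      exact ⟨K, hK, fun x hx => by beta_reduce; rw [hX x hx, smul_zero]⟩⟩

/-- The contraction of a multivector field by the differential of a function. -/
def contrField {k : ℕ} (h : M → ℝ) (X : MultivectorField n M (k + 1)) : MultivectorField n M k :=
  fun x => (X x).comp (wedgeCLM _ k (dfun h x))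

lemma coordField_wedge {k : ℕ} {x₀ x : M} (hx : x ∈ (ℰ n x₀).source) {h : M → ℝ}
    (hh : MDifferentiableAt (𝓡 n) 𝓘(ℝ, ℝ) h x) (X : MultivectorField n M (k + 1)) :
    coordField x₀ (contrField h X) (ℰ n x₀ x) =
      (coordField x₀ X (ℰ n x₀ x)).comp
        (wedgeCLM _ k (fderiv ℝ (coordFun x₀ h) (ℰ n x₀ x))) := by
  rw [coordField_chart hx, coordField_chart hx, fderiv_coordFun hx hh]
  ext β
  change X x (wedge (dfun h x) (β.compContinuousLinearMap (chartDeriv x₀ x))) =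
    X x ((wedge ((dfun h x).comp (chartInvAt x₀ x)) β).compContinuousLinearMap (chartDeriv x₀ x))
  rw [wedge_comp, ContinuousLinearMap.comp_assoc, chartInvAt_comp_chartDeriv hx,
    ContinuousLinearMap.comp_id]

/-- The contraction of a test field by the differential of a smooth function. -/
def contrTest {k : ℕ} {h : M → ℝ} (hh : 𝒞 n h) (X : testFields n M (k + 1)) :
    testFields n M k :=
  ⟨contrField h X.1, fun x₀ => contDiffOn_target_iff.2 fun x hx => by
      have h1 : ContDiffAt ℝ ∞ (fun y => wedgeCLM (𝔼 n) k (fderiv ℝ (coordFun x₀ h) y))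
          (ℰ n x₀ x) :=
        ContDiffAt.comp (g := fun μ => wedgeCLM (𝔼 n) k μ) _
          (ContinuousLinearMap.contDiff (𝕜 := ℝ) (E := (𝔼 n) →L[ℝ] ℝ)
            (F := ((𝔼 n) [⋀^Fin k]→L[ℝ] ℝ) →L[ℝ] (𝔼 n) [⋀^Fin (k + 1)]→L[ℝ] ℝ)
            (wedgeCLM (𝔼 n) k)).contDiffAt
          ((contDiffAt_coordFun hh hx).fderiv_right (m := ∞) (by simp))
      exact ((contDiffOn_target_iff.1 (X.2.1 x₀) _ hx).clm_comp h1).congr_of_eventuallyEq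
        (eventually_chart hx univ_mem fun _ hx' _ =>
          coordField_wedge hx' (hh.mdifferentiable (by simp) _) X.1),
    by
      obtain ⟨K, hK, hX⟩ := X.2.2
      exact ⟨K, hK, fun x hx => by
        rw [contrField, hX x hx, ContinuousLinearMap.zero_comp]⟩⟩

/-- The exterior product of a multivector field and a vector field. -/
def interField {k : ℕ} (ξ : (x : M) → 𝕋 n x) (X : MultivectorField n M k) :
    MultivectorField n M (k + 1) := fun x => (X x).comp (interCLM _ k (ξ x))

lemma coordField_inter {k : ℕ} {x₀ x : M} (hx : x ∈ (ℰ n x₀).source)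
    (ξ : (x : M) → 𝕋 n x) (X : MultivectorField n M k) :
    coordField x₀ (interField ξ X) (ℰ n x₀ x) =
      (coordField x₀ X (ℰ n x₀ x)).comp
        (interCLM _ k (coordVec x₀ ξ (ℰ n x₀ x))) := by
  rw [coordField_chart hx, coordField_chart hx, coordVec_chart hx]
  ext β
  change X x (inter (ξ x) (β.compContinuousLinearMap (chartDeriv x₀ x))) =
    X x ((inter (chartDeriv x₀ x (ξ x)) β).compContinuousLinearMap (chartDeriv x₀ x))
  rw [inter_comp]

/-- The exterior product of a test field and a smooth vector field. -/
def interTest {k : ℕ} {ξ : (x : M) → 𝕋 n x} (hξ : IsSmoothVec ξ)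
    (X : testFields n M k) : testFields n M (k + 1) :=
  ⟨interField ξ X.1, fun x₀ => contDiffOn_target_iff.2 fun x hx => by
      have h1 : ContDiffAt ℝ ∞ (fun y => interCLM (𝔼 n) k (coordVec x₀ ξ y))
          (ℰ n x₀ x) :=
        ContDiffAt.comp (g := fun μ => interCLM (𝔼 n) k μ) _
          (ContinuousLinearMap.contDiff (𝕜 := ℝ) (E := 𝔼 n)
            (F := ((𝔼 n) [⋀^Fin (k + 1)]→L[ℝ] ℝ) →L[ℝ] (𝔼 n) [⋀^Fin k]→L[ℝ] ℝ)
            (interCLM (𝔼 n) k)).contDiffAt (hξ x₀ x hx)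
      exact ((contDiffOn_target_iff.1 (X.2.1 x₀) _ hx).clm_comp h1).congr_of_eventuallyEq
        (eventually_chart hx univ_mem fun _ hx' _ => coordField_inter hx' ξ X.1),
    by
      obtain ⟨K, hK, hX⟩ := X.2.2
      exact ⟨K, hK, fun x hx => by
        rw [interField, hX x hx, ContinuousLinearMap.zero_comp]⟩⟩

variable {φ : ℝ → M → M} {ξ : (x : M) → 𝕋 n x}

lemma exists_compact_flow (hφ : IsFlowOf φ ξ) {K : Set M} (hK : IsCompact K) {I : Set ℝ}
    (hI : IsCompact I) : ∃ L : Set M, IsCompact L ∧ ∀ s ∈ I, ∀ x ∈ K, φ s x ∈ L :=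
  ⟨(fun q : ℝ × M => φ q.1 q.2) '' (I ×ˢ K), (hI.prod hK).image hφ.continuous,
    fun s hs x hx => ⟨(s, x), ⟨hs, hx⟩, rfl⟩⟩

lemma exists_support_flow (hφ : IsFlowOf φ ξ) {k : ℕ} (X : testFields n M k) {I : Set ℝ}
    (hI : IsCompact I) : ∃ L : Set M, IsCompact L ∧ ∀ s ∈ I, ∀ x ∉ L, pushFlow φ s X.1 x = 0 := by
  obtain ⟨K, hK, hX⟩ := X.2.2
  obtain ⟨L, hL, h⟩ := exists_compact_flow hφ hK hI
  refine ⟨L, hL, fun s hs x hx => ?_⟩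
  have h1 : φ (-s) x ∉ K := fun h1 => hx (by simpa only [hφ.apply_neg] using h s hs _ h1)
  rw [pushFlow, pushField, hX _ h1, ContinuousLinearMap.zero_comp, smul_zero]

lemma SmoothFamily.deriv_eq_zero {k : ℕ} {Z : ℝ → MultivectorField n M k} (hZ : SmoothFamily Z)
    {s : ℝ} {x : M} (h : ∀ᶠ t in 𝓝 s, Z t x = 0) : derivFamily Z s x = 0 := by
  ext β
  refine (hZ.hasDerivAt x β s).unique ((hasDerivAt_const s (0 : ℝ)).congr_of_eventuallyEq ?_)
  filter_upwards [h] with t ht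
  rw [ht, zero_apply]

/-- The derivative of the push-forwards of a test field by the flow. -/
def derivTest (hφ : IsFlowOf φ ξ) {k : ℕ} (X : testFields n M k) : testFields n M k :=
  ⟨derivFamily (fun s => pushFlow φ s X.1) 0, fun x₀ => contDiffOn_target_iff.2 fun x hx =>
      ContDiffAt.comp (g := fun q : ℝ × (𝔼 n) => coordField x₀
          (derivFamily (fun s => pushFlow φ s X.1) q.1) q.2)
        (f := fun y => (0, y)) (ℰ n x₀ x) ((hφ.smoothFamily X).deriv x₀ x hx 0)
        (by fun_prop),
    by
      obtain ⟨L, hL, h⟩ := exists_support_flow hφ X (isCompact_Icc (a := (-1 : ℝ)) (b := 1))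
      refine ⟨L, hL, fun x hx => (hφ.smoothFamily X).deriv_eq_zero ?_⟩
      filter_upwards [Icc_mem_nhds (a := (-1 : ℝ)) (b := 1) (x := 0) (by norm_num) (by norm_num)]
        with t ht
      exact h t ht x hx⟩

/-- Differentiate `φ (s + t) x = φ s (φ t x)` at `t = 0`. This invariance makes `ι_ξ` commute with
pull-back by the flow, so pull-backs of forms annihilated by `ι_ξ` are again annihilated. -/
lemma IsFlowOf.mfderiv_apply_field (hφ : IsFlowOf φ ξ) (s : ℝ) (x : M) :
    𝒟 n (φ s) x (ξ x) = ξ (φ s x) := by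
  have hx := mem_extChartAt_source (I := 𝓡 n) x
  have hsx := mem_extChartAt_source (I := 𝓡 n) (φ s x)
  have h0x : φ 0 x ∈ (ℰ n x).source := by rwa [hφ.zero]
  have h1 := hφ.hasDerivAt_chart h0x
  rw [hφ.zero] at h1
  have h2 := ((contDiffAt_coordMap (hφ.contMDiff s) hx hsx).differentiableAt (by simp)).hasFDerivAt
  have h3 : HasDerivAt (fun t => coordMap x (φ s x) (φ s) (ℰ n x (φ t x))) _ 0 :=
    HasFDerivAt.comp_hasDerivAt_of_eq (l := coordMap x (φ s x) (φ s))
      (f := fun t => ℰ n x (φ t x)) (0 : ℝ) h2 h1 (by rw [hφ.zero])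
  have h4 : HasDerivAt (fun t => ℰ n (φ s x) (φ (s + t) x))
      (chartDeriv (φ s x) (φ s x) (ξ (φ s x))) 0 := by
    have h5 := hφ.hasDerivAt_chart hsx
    refine HasDerivAt.comp_const_add s 0 (f := fun t => ℰ n (φ s x) (φ t x)) ?_
    rwa [add_zero]
  have h6 := h4.unique (h3.congr_of_eventuallyEq (by
    have hc : ContinuousAt (fun t => φ t x) 0 :=
      (hφ.continuous.comp (by fun_prop : Continuous fun t : ℝ => (t, x))).continuousAt
    filter_upwards [hc.eventually ((isOpen_extChartAt_source (I := 𝓡 n) x).mem_nhds h0x)] with t ht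
    rw [coordMap_chart ht, hφ.add]))
  rw [fderiv_coordMap hx hsx (hφ.mdifferentiableAt s x)] at h6
  simp only [ContinuousLinearMap.comp_apply, chartInvAt_chartDeriv_apply hx] at h6
  have h7 := congrArg (chartInvAt (φ s x) (φ s x)) h6
  rw [chartInvAt_chartDeriv_apply hsx, chartInvAt_chartDeriv_apply hsx] at h7
  exact h7.symm

lemma IsFlowOf.inter_pullback (hφ : IsFlowOf φ ξ) {k : ℕ} (s : ℝ) (α : DiffForm n M (k + 1)) :
    interForm ξ (pullbackForm (φ s) α) = pullbackForm (φ s) (interForm ξ α) := by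
  funext x
  rw [interForm, pullbackForm, inter_comp, hφ.mfderiv_apply_field]
  rfl

lemma IsFlowOf.lieForm_pullback (hφ : IsFlowOf φ ξ) {k : ℕ} (s : ℝ) {α : DiffForm n M (k + 1)}
    (hα : IsSmoothForm α) : lieForm ξ (pullbackForm (φ s) α) = pullbackForm (φ s) (lieForm ξ α) := by
  rw [lieForm, hφ.inter_pullback, extDerivForm_pullback (hα.inter hφ.isSmoothVec) (hφ.contMDiff s),
    extDerivForm_pullback hα (hφ.contMDiff s), hφ.inter_pullback]
  rfl

/-- The group law reduces time `s` to time `0` for the form `φ_s^* α`, and the Lie derivative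
commutes with this pull-back. -/
lemma IsFlowOf.hasDerivAt_pullback (hφ : IsFlowOf φ ξ) {k : ℕ} {α : DiffForm n M (k + 1)}
    (hα : IsSmoothForm α) (x : M) (L : ((𝕋 n x) [⋀^Fin (k + 1)]→L[ℝ] ℝ) →L[ℝ] ℝ)
    (s : ℝ) : HasDerivAt (fun s => L (pullbackForm (φ s) α x))
      (L (pullbackForm (φ s) (lieForm ξ α) x)) s := by
  have h := hφ.hasDerivAt_pullback_zero (hα.pullback (hφ.contMDiff s)) x L
  rw [hφ.lieForm_pullback s hα] at h
  simp only [← hφ.pullback_add] at h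
  rw [← sub_self s] at h
  have h1 := HasDerivAt.comp_sub_const s s h
  simpa only [add_sub_cancel] using h1

lemma IsFlowOf.apply_pullback (hφ : IsFlowOf φ ξ) {k : ℕ} (X : MultivectorField n M k) (s : ℝ)
    (θ : DiffForm n M k) (x : M) : X x (pullbackForm (φ s) θ x) =
      jacobian (𝒟 n (φ s) x) * pushFlow φ s X (φ s x) (θ (φ s x)) := by
  have h := hφ.jacobian_add (-s) s x
  have h0 : φ (-s + s) = id := by
    funext x
    rw [neg_add_cancel, hφ.zero, id]
  rw [h0, jacobian_mfderiv_id] at h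
  have key : ∀ a b c : ℝ, 1 = b * a → c = a * (b * c) := fun a b c h => by
    rw [← mul_assoc, mul_comm a, ← h, one_mul]
  have h2 : X (φ (-s) (φ s x)) (pullbackForm (φ s) θ (φ (-s) (φ s x))) =
      X x (pullbackForm (φ s) θ x) := by rw [hφ.neg_apply]
  rw [hφ.pushFlow_apply, h2]
  exact key _ _ _ h

end TestOperations

/-! ### Weak Cartan formula for locally integrable forms. -/

section MasterIdentity

variable {n : ℕ} {M : Type*} [TopologicalSpace M] [T2Space M]
  [ChartedSpace (𝔼 n) M] [IsManifold (𝓡 n) ∞ M]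
  [RiemannianBundle (fun x : M => 𝕋 n x)]
  [IsContMDiffRiemannianBundle (𝓡 n) ∞ (𝔼 n) (fun x : M => 𝕋 n x)]
  [MeasurableSpace M] [BorelSpace M] [SecondCountableTopology M]

/-- Measurable locally integrable forms. -/
structure LocIntForm {k : ℕ} (γ : DiffForm n M k) : Prop where
  meas : MeasForm γ
  int : ∀ K : Set M, IsCompact K → IntegrableOn (fun x => ‖γ x‖) K (riemannianVolume n M)

lemma integrable_of_le_indicator {f g : M → ℝ} {μ : Measure M} {K : Set M} (hK : IsCompact K)
    (hg : IntegrableOn g K μ) (hf : Measurable f) (hfK : ∀ x ∉ K, f x = 0)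
    (h : ∀ x ∈ K, |f x| ≤ g x) : Integrable f μ := by
  refine (hg.integrable_indicator hK.measurableSet).mono' hf.aestronglyMeasurable
    (Eventually.of_forall fun x => ?_)
  by_cases hx : x ∈ K
  · rw [indicator_of_mem hx]
    exact h x hx
  · rw [indicator_of_notMem hx, hfK x hx, norm_zero]

lemma LocIntForm.integrable {k : ℕ} {γ : DiffForm n M k} (hγ : LocIntForm γ)
    (X : testFields n M k) : Integrable (fun x => X.1 x (γ x)) (riemannianVolume n M) := by
  obtain ⟨K, hK, hX⟩ := X.2.2
  obtain ⟨C, -, hC⟩ := exists_bound_field X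
  refine integrable_of_le_indicator hK ((hγ.int K hK).const_mul C)
    (MeasAlong.field measurable_id hγ.meas fun z => (X.2.1 z).continuousOn) (fun x hx => ?_)
    fun x _ => hC x _
  rw [hX x hx, zero_apply]

lemma LocIntForm.pairing_add {k : ℕ} {γ : DiffForm n M k} (hγ : LocIntForm γ)
    (X Y : testFields n M k) : pairing γ (X + Y) = pairing γ X + pairing γ Y :=
  integral_add (hγ.integrable X) (hγ.integrable Y)

lemma pairing_const_smul {k : ℕ} (γ : DiffForm n M k) (c : ℝ)
    (X : testFields n M k) : pairing γ (c • X) = c * pairing γ X :=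
  integral_const_mul c _

/-- The difference of test fields. -/
def subTest {k : ℕ} (X Y : testFields n M k) : testFields n M k := X + (-1 : ℝ) • Y

lemma LocIntForm.pairing_sub {k : ℕ} {γ : DiffForm n M k} (hγ : LocIntForm γ)
    (X Y : testFields n M k) : pairing γ (subTest X Y) = pairing γ X - pairing γ Y := by
  rw [subTest, hγ.pairing_add, pairing_const_smul, neg_one_mul, sub_eq_add_neg]

lemma IsSmoothForm.locIntForm {k : ℕ} {α : DiffForm n M k} (hα : IsSmoothForm α) :
    LocIntForm α := by
  have hm : MeasForm α := by
    intro v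
    refine measurable_of_sel_continuousOn (n := n) measurable_id
      (h := fun x => α x (fun i => frame x (v i)))
      (h' := fun z x => coordForm z α (ℰ n z x) v) (fun z => ?_) fun x => ?_
    · have h3 : Continuous fun β : (𝔼 n) [⋀^Fin k]→L[ℝ] ℝ => β v := by fun_prop
      exact h3.comp_continuousOn (continuousOn_source_of_coord (hα z).continuousOn)
    · rw [coordForm_chart (mem_sel x)]
      rfl
  refine ⟨hm, fun K hK => ?_⟩
  obtain ⟨C, -, hC⟩ := hα.exists_bound hK
  refine IntegrableOn.of_bound hK.measure_lt_top ?_ C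
    ((ae_restrict_mem hK.measurableSet).mono fun x hx => ?_)
  · exact (MeasAlong.norm measurable_id hm).aestronglyMeasurable
  · rw [norm_norm]
    exact hC x hx

/-- Dominated differentiation: for `|s| ≤ 1` all fields are supported in one compact set, on which
`γ` is integrable and the derivatives of the fields are uniformly bounded. -/
lemma SmoothFamily.hasDerivAt_integral {k : ℕ} {Z : ℝ → MultivectorField n M k}
    (hZ : SmoothFamily Z) {K : Set M} (hK : IsCompact K)
    (hZK : ∀ s ∈ Icc (-1 : ℝ) 1, ∀ x ∉ K, Z s x = 0) {γ : DiffForm n M k} (hγ : LocIntForm γ) :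
    HasDerivAt (fun s => ∫ x, Z s x (γ x) ∂(riemannianVolume n M))
      (∫ x, derivFamily Z 0 x (γ x) ∂(riemannianVolume n M)) 0 := by
  obtain ⟨C, hC, hb⟩ := hZ.deriv.exists_bound ((isCompact_Icc (a := (-1 : ℝ)) (b := 1)).prod hK)
  obtain ⟨C', hC', hb'⟩ := hZ.exists_bound ((isCompact_singleton (x := (0 : ℝ))).prod hK)
  have hm : ∀ s, Measurable fun x => Z s x (γ x) := fun s =>
    MeasAlong.field measurable_id hγ.meas (hZ.continuousOn s)
  have hm' : ∀ s, Measurable fun x => derivFamily Z s x (γ x) := fun s =>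
    MeasAlong.field measurable_id hγ.meas (hZ.deriv.continuousOn s)
  refine (hasDerivAt_integral_of_dominated_loc_of_deriv_le (F := fun s x => Z s x (γ x))
    (F' := fun s x => derivFamily Z s x (γ x)) (s := Ioo (-1) 1)
    (bound := K.indicator fun x => C * ‖γ x‖) (Ioo_mem_nhds (by norm_num) (by norm_num))
    (Eventually.of_forall fun s => (hm s).aestronglyMeasurable) ?_ (hm' 0).aestronglyMeasurable
    (Eventually.of_forall fun x s hs => ?_) ((integrable_indicator_iff hK.measurableSet).2
      ((hγ.int K hK).const_mul C)) (Eventually.of_forall fun x s _ => hZ.hasDerivAt x (γ x) s)).2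
  · refine integrable_of_le_indicator hK ((hγ.int K hK).const_mul C') (hm 0) (fun x hx => ?_)
      fun x hx => hb' (0, x) ⟨rfl, hx⟩ _
    rw [hZK 0 (by simp) x hx, zero_apply]
  · by_cases hx : x ∈ K
    · rw [indicator_of_mem hx]
      exact hb (s, x) ⟨Ioo_subset_Icc_self hs, hx⟩ _
    · rw [indicator_of_notMem hx, hZ.deriv_eq_zero, zero_apply, norm_zero]
      filter_upwards [Ioo_mem_nhds hs.1 hs.2] with t ht
      exact hZK t (Ioo_subset_Icc_self ht) x hx

variable {φ : ℝ → M → M} {ξ : (x : M) → 𝕋 n x}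

lemma IsFlowOf.hasDerivAt_pairing_zero (hφ : IsFlowOf φ ξ) {k : ℕ} {γ : DiffForm n M k}
    (hγ : LocIntForm γ) (X : testFields n M k) :
    HasDerivAt (fun s => pairing γ (pushTest hφ s X)) (pairing γ (derivTest hφ X)) 0 := by
  obtain ⟨L, hL, h⟩ := exists_support_flow hφ X (isCompact_Icc (a := (-1 : ℝ)) (b := 1))
  exact (hφ.smoothFamily X).hasDerivAt_integral hL h hγ

lemma IsFlowOf.pairing_pushTest_add (hφ : IsFlowOf φ ξ) {k : ℕ} (γ : DiffForm n M k) (s t : ℝ)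
    (X : testFields n M k) :
    pairing γ (pushTest hφ (s + t) X) = pairing γ (pushTest hφ t (pushTest hφ s X)) := by
  rw [← hφ.pairing_pullback, ← hφ.pairing_pullback, ← hφ.pairing_pullback, add_comm,
    hφ.pullback_add]

lemma IsFlowOf.hasDerivAt_pairing (hφ : IsFlowOf φ ξ) {k : ℕ} {γ : DiffForm n M k}
    (hγ : LocIntForm γ) (X : testFields n M k) (s : ℝ) :
    HasDerivAt (fun s => pairing γ (pushTest hφ s X))
      (pairing γ (derivTest hφ (pushTest hφ s X))) s := by
  have h := hφ.hasDerivAt_pairing_zero hγ (pushTest hφ s X)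
  simp only [← hφ.pairing_pushTest_add] at h
  rw [← sub_self s] at h
  have h1 := HasDerivAt.comp_sub_const s s h
  simpa only [add_sub_cancel] using h1

/-- `derivTest` is the transpose of the Lie derivative: the pairing of `φ_s^* α` with `X` is
differentiated at `0`, once with the flow acting on the field and once with it acting on the form.
-/
lemma IsFlowOf.pairing_derivTest (hφ : IsFlowOf φ ξ) {k : ℕ} {α : DiffForm n M (k + 1)}
    (hα : IsSmoothForm α) (X : testFields n M (k + 1)) :
    pairing α (derivTest hφ X) = pairing (lieForm ξ α) X := by
  have hl : IsSmoothForm (lieForm ξ α) := by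
    intro x₀
    exact ((hα.inter hφ.isSmoothVec).extDeriv x₀).add ((hα.extDeriv.inter hφ.isSmoothVec) x₀)
  obtain ⟨K, hK, hX⟩ := X.2.2
  obtain ⟨L, hL, hKL⟩ := exists_compact_flow hφ hK (isCompact_Icc (a := (-1 : ℝ)) (b := 1))
  obtain ⟨C₁, hC₁, h₁⟩ := hl.exists_bound hL
  obtain ⟨C₂, hC₂, h₂⟩ := (hφ.smoothFamily X).exists_bound
    ((isCompact_Icc (a := (-1 : ℝ)) (b := 1)).prod hL)
  obtain ⟨C₃, hC₃⟩ := ((isCompact_Icc (a := (-1 : ℝ)) (b := 1)).prod hK).exists_bound_of_continuousOn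
    hφ.continuous_jacobian.continuousOn
  have hm : ∀ {θ : DiffForm n M (k + 1)}, IsSmoothForm θ → ∀ s, Measurable fun x =>
      X.1 x (pullbackForm (φ s) θ x) := fun hθ s =>
    MeasAlong.field measurable_id (hθ.pullback (hφ.contMDiff s)).locIntForm.meas
      fun z => (X.2.1 z).continuousOn
  have h := (hasDerivAt_integral_of_dominated_loc_of_deriv_le (μ := riemannianVolume n M)
    (F := fun s x => X.1 x (pullbackForm (φ s) α x)) (x₀ := (0 : ℝ))
    (F' := fun s x => X.1 x (pullbackForm (φ s) (lieForm ξ α) x)) (s := Ioo (-1) 1)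
    (bound := K.indicator fun _ => C₃ * (C₂ * C₁)) (Ioo_mem_nhds (by norm_num) (by norm_num))
    (Eventually.of_forall fun s => (hm hα s).aestronglyMeasurable)
    ((hα.pullback (hφ.contMDiff 0)).locIntForm.integrable X) (hm hl 0).aestronglyMeasurable
    (Eventually.of_forall fun x s hs => ?_) ((integrableOn_const hK.measure_lt_top.ne
      ).integrable_indicator hK.measurableSet)
    (Eventually.of_forall fun x s _ => hφ.hasDerivAt_pullback hα x (X.1 x) s)).2
  · have h3 : φ 0 = id := funext hφ.zero
    rw [h3, pullbackForm_id] at h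
    refine (hφ.hasDerivAt_pairing_zero hα.locIntForm X).unique ?_
    simp only [← hφ.pairing_pullback]
    exact h
  · by_cases hx : x ∈ K
    · have hs' := Ioo_subset_Icc_self hs
      -- The pull-back is rewritten through the pushed field, so that domination follows from
      -- compactness of `[-1, 1] × L` and `[-1, 1] × K`.
      rw [indicator_of_mem hx, hφ.apply_pullback, norm_mul]
      refine mul_le_mul (hC₃ (s, x) ⟨hs', hx⟩) ((h₂ (s, φ s x) ⟨hs', hKL s hs' x hx⟩ _).trans
        (mul_le_mul_of_nonneg_left (h₁ _ (hKL s hs' x hx)) hC₂)) (norm_nonneg _)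
        ((norm_nonneg _).trans (hC₃ (s, x) ⟨hs', hx⟩))
    · rw [indicator_of_notMem hx, hX x hx, zero_apply, norm_zero]

lemma IsTranspose.push (hφ : IsFlowOf φ ξ) {k : ℕ} {X : testFields n M (k + 1)}
    {Y : testFields n M k} (h : IsTranspose X Y) (s : ℝ) :
    IsTranspose (pushTest hφ s X) (pushTest hφ s Y) := by
  intro α hα
  rw [← hφ.pairing_pullback, ← hφ.pairing_pullback, ← extDerivForm_pullback hα (hφ.contMDiff s)]
  exact h _ (hα.pullback (hφ.contMDiff s))

lemma pairing_smulTest {k : ℕ} {h : M → ℝ} (hh : 𝒞 n h)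
    (γ : DiffForm n M k) (X : testFields n M k) :
    pairing γ (smulTest hh X) = pairing (h • γ) X := by
  refine integral_congr_ae (Eventually.of_forall fun x => ?_)
  exact ((X.1 x).map_smul (h x) (γ x)).symm

lemma pairing_contrTest {k : ℕ} {h : M → ℝ} (hh : 𝒞 n h)
    (γ : DiffForm n M k) (X : testFields n M (k + 1)) :
    pairing γ (contrTest hh X) = pairing (dwedge h γ) X := rfl

lemma pairing_interTest {k : ℕ} (hξ : IsSmoothVec ξ) (γ : DiffForm n M (k + 1))
    (X : testFields n M k) : pairing γ (interTest hξ X) = pairing (interForm ξ γ) X := rfl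

/-- The Leibniz rule `d(hα) = h dα + dh ∧ α`, transposed. -/
lemma IsTranspose.smul {k : ℕ} {h : M → ℝ} (hh : 𝒞 n h)
    {X : testFields n M (k + 1)} {Y : testFields n M k} (hXY : IsTranspose X Y) :
    IsTranspose (smulTest hh X) (subTest (smulTest hh Y) (contrTest hh X)) := by
  intro α hα
  have h1 := hXY _ (hα.smul hh)
  rw [extDerivForm_smul hα hh, ← pairing_smulTest hh] at h1
  rw [hα.locIntForm.pairing_sub, ← h1, pairing_contrTest, pairing_smulTest, eq_sub_iff_add_eq]
  refine (integral_add ((hα.extDeriv.smul hh).locIntForm.integrable X)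
    ((hα.dwedge hh).locIntForm.integrable X)).symm.trans ?_
  refine integral_congr_ae (Eventually.of_forall fun x => ?_)
  exact ((X.1 x).map_add _ _).symm

/-- Cartan's formula `L_ξ = d ι_ξ + ι_ξ d`, transposed: it identifies the field dual to `d` after
wedging with `ξ`. -/
lemma IsTranspose.inter (hφ : IsFlowOf φ ξ) {k : ℕ} {X : testFields n M (k + 1)}
    {Y : testFields n M k} (hXY : IsTranspose X Y) :
    IsTranspose (interTest hφ.isSmoothVec X) (subTest (derivTest hφ X) (interTest hφ.isSmoothVec Y)) := by
  intro α hα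
  have h1 := hXY _ (hα.inter hφ.isSmoothVec)
  rw [hα.locIntForm.pairing_sub, hφ.pairing_derivTest hα, pairing_interTest, pairing_interTest, ← h1,
    eq_sub_iff_add_eq, add_comm]
  refine (integral_add ((hα.inter hφ.isSmoothVec).extDeriv.locIntForm.integrable X)
    ((hα.extDeriv.inter hφ.isSmoothVec).locIntForm.integrable X)).symm.trans ?_
  refine integral_congr_ae (Eventually.of_forall fun x => ?_)
  exact ((X.1 x).map_add _ _).symm

/-- Cartan's formula for weak differentials, in integrated form. -/
lemma IsFlowOf.hasDerivAt_pairing_of_isDifferential (hφ : IsFlowOf φ ξ) {k : ℕ}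
    {γ : DiffForm n M (k + 1)} {ζ : DiffForm n M (k + 2)} (hγ : LocIntForm γ)
    (hd : IsDifferential (pairing γ) (pairing ζ)) {X : testFields n M (k + 1)}
    {Y : testFields n M k} (hXY : IsTranspose X Y) (s : ℝ) :
    HasDerivAt (fun s => pairing (pullbackForm (φ s) γ) X)
      (pairing (pullbackForm (φ s) (interForm ξ γ)) Y +
        pairing (pullbackForm (φ s) (interForm ξ ζ)) X) s := by
  have h := hφ.hasDerivAt_pairing hγ X s
  -- The weak differential is tested against `ξ` wedged with the pushed field; by the transposed
  -- Cartan formula this yields exactly the derivative along the flow.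
  have h1 := hd _ _ ((hXY.push hφ s).inter hφ)
  rw [hγ.pairing_sub, pairing_interTest, pairing_interTest, eq_sub_iff_add_eq] at h1
  simp only [hφ.pairing_pullback]
  rw [← h1] at h
  exact h.congr_deriv (add_comm _ _)

end MasterIdentity

/-! ### Integration by parts in Euclidean space. -/

section IntegrationByParts

open Module

lemma integrable_pair {E F : Type*} [NormedAddCommGroup E] [NormedSpace ℝ E] [MeasurableSpace E]
    [BorelSpace E] {μ : Measure E} [IsLocallyFiniteMeasure μ] [NormedAddCommGroup F]
    [NormedSpace ℝ F] {U K : Set E} (hK : IsCompact K) (hKU : K ⊆ U) {Q : E → F →L[ℝ] ℝ} {a : E → F}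
    (hQ : ContinuousOn Q U) (hQ0 : ∀ y ∉ K, Q y = 0) (ha : ContinuousOn a U) :
    Integrable (fun y => Q y (a y)) μ := by
  have h : ContinuousOn (fun y => Q y (a y)) K := (hQ.mono hKU).clm_apply (ha.mono hKU)
  refine (integrableOn_iff_integrable_of_support_subset fun y hy => ?_).1
    (h.integrableOn_compact hK)
  by_contra hyK
  exact hy (by beta_reduce; rw [hQ0 y hyK, zero_apply])

/-- `a` is smooth only on `U`, but `P` vanishes off the compact `K ⊆ U`, so every integrand is zero
where `a` is uncontrolled and there is no boundary term. -/
lemma integral_pair_fderiv {E F F' : Type*} [NormedAddCommGroup E] [NormedSpace ℝ E]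
    [MeasurableSpace E] [BorelSpace E] [FiniteDimensional ℝ E] {μ : Measure E}
    [μ.IsAddHaarMeasure] [NormedAddCommGroup F] [NormedSpace ℝ F] [NormedAddCommGroup F']
    [NormedSpace ℝ F'] {U K : Set E} (hU : IsOpen U) (hK : IsCompact K) (hKU : K ⊆ U)
    {P : E → F' →L[ℝ] ℝ} {a : E → F} (hP : ContDiffOn ℝ ∞ P U) (hP0 : ∀ y ∉ K, P y = 0)
    (ha : ContDiffOn ℝ ∞ a U) (w : F →L[ℝ] F') (e : E) :
    Integrable (fun y => P y (w (fderiv ℝ a y e))) μ ∧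
    Integrable (fun y => fderiv ℝ P y e (w (a y))) μ ∧
    ∫ y, P y (w (fderiv ℝ a y e)) ∂μ = -∫ y, fderiv ℝ P y e (w (a y)) ∂μ := by
  have hPd : ∀ y, DifferentiableAt ℝ P y := by
    intro y
    by_cases hy : y ∈ U
    · exact ((hP y hy).contDiffAt (hU.mem_nhds hy)).differentiableAt (by simp)
    · have h1 : P =ᶠ[𝓝 y] fun _ => 0 := by
        filter_upwards [hK.isClosed.isOpen_compl.mem_nhds fun h => hy (hKU h)] with z hz
        exact hP0 z hz
      exact h1.differentiableAt_iff.2 (differentiableAt_const _)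
  have hPf0 : ∀ y ∉ K, fderiv ℝ P y e = 0 := by
    intro y hy
    have h1 : P =ᶠ[𝓝 y] fun _ => 0 := by
      filter_upwards [hK.isClosed.isOpen_compl.mem_nhds hy] with z hz
      exact hP0 z hz
    rw [h1.fderiv_eq, fderiv_fun_const]
    rfl
  have hPf : ContinuousOn (fun y => fderiv ℝ P y e) U :=
    (hP.continuousOn_fderiv_of_isOpen hU (by simp)).clm_apply continuousOn_const
  have haf : ContinuousOn (fun y => w (fderiv ℝ a y e)) U :=
    w.continuous.comp_continuousOn
      ((ha.continuousOn_fderiv_of_isOpen hU (by simp)).clm_apply continuousOn_const)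
  have hwa : ContinuousOn (fun y => w (a y)) U := w.continuous.comp_continuousOn ha.continuousOn
  have hts : tsupport P ⊆ K := closure_minimal (fun y hy => by
    by_contra h
    exact hy (hP0 y h)) hK.isClosed
  have i1 : Integrable (fun y => P y (w (fderiv ℝ a y e))) μ :=
    integrable_pair hK hKU hP.continuousOn hP0 haf
  have i2 : Integrable (fun y => fderiv ℝ P y e (w (a y))) μ :=
    integrable_pair hK hKU hPf hPf0 hwa
  have i3 : Integrable (fun y => P y (w (a y))) μ := integrable_pair hK hKU hP.continuousOn hP0 hwa
  refine ⟨i1, i2, ?_⟩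
  have hfd : ∀ y ∈ U, HasFDerivAt (fun y => w (a y)) (w.comp (fderiv ℝ a y)) y := fun y hy =>
    w.hasFDerivAt.comp y
      (((ha y hy).contDiffAt (hU.mem_nhds hy)).differentiableAt (by simp)).hasFDerivAt
  exact integral_bilinear_hasFDerivAt_right_eq_neg_left_of_integrable (v := e)
    (B := ContinuousLinearMap.id ℝ (F' →L[ℝ] ℝ)) (f := P) (f' := fun y => fderiv ℝ P y)
    (g := fun y => w (a y)) (g' := fun y => w.comp (fderiv ℝ a y)) i2 i1 i3
    (fun y _ => (hPd y).hasFDerivAt) fun y hy => hfd y (hKU (hts hy))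

lemma norm_fderiv_smul_le {V G : Type*} [NormedAddCommGroup V] [NormedSpace ℝ V]
    [NormedAddCommGroup G] [NormedSpace ℝ G] {f : G → ℝ} {g : G → V →L[ℝ] ℝ} {x : G}
    (hf : DifferentiableAt ℝ f x) (hg : DifferentiableAt ℝ g x) (e : G) :
    ‖fderiv ℝ (fun y => f y • g y) x e‖ ≤
      |f x| * ‖fderiv ℝ g x e‖ + ‖fderiv ℝ f x‖ * ‖e‖ * ‖g x‖ := by
  rw [fderiv_fun_smul hf hg, add_apply, smul_apply,
    ContinuousLinearMap.smulRight_apply]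
  refine (norm_add_le _ _).trans ?_
  rw [norm_smul, norm_smul, Real.norm_eq_abs]
  gcongr
  exact (fderiv ℝ f x).le_opNorm e

lemma norm_smul_dual {V : Type*} [NormedAddCommGroup V] [NormedSpace ℝ V] (c : ℝ)
    (g : V →L[ℝ] ℝ) : ‖c • g‖ = |c| * ‖g‖ := norm_smul c g

variable {n : ℕ}

lemma extDeriv_eq_sum {k : ℕ} (a : (𝔼 n) → (𝔼 n) [⋀^Fin k]→L[ℝ] ℝ) (y : 𝔼 n) :
    extDeriv a y = ∑ i, wedgeCLM (𝔼 n) k (EuclideanSpace.proj i)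
      (fderiv ℝ a y (EuclideanSpace.basisFun (Fin n) ℝ i)) := by
  have h : fderiv ℝ a y = ∑ i, (EuclideanSpace.proj i : (𝔼 n) →L[ℝ] ℝ).smulRight
      (fderiv ℝ a y (EuclideanSpace.basisFun (Fin n) ℝ i)) := by
    ext1 v
    conv_lhs => rw [← (EuclideanSpace.basisFun (Fin n) ℝ).sum_repr v]
    rw [map_sum, sum_apply]
    refine Finset.sum_congr rfl fun i _ => ?_
    rw [map_smul, ContinuousLinearMap.smulRight_apply]
    rfl
  rw [extDeriv]
  conv_lhs => rw [h]
  have h2 := map_sum (ContinuousAlternatingMap.alternatizeUncurryFinCLM ℝ (𝔼 n) ℝ (n := k))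
    (fun i => (EuclideanSpace.proj i : (𝔼 n) →L[ℝ] ℝ).smulRight
      (fderiv ℝ a y (EuclideanSpace.basisFun (Fin n) ℝ i))) Finset.univ
  exact h2

end IntegrationByParts

/-! ### Test fields supported in one chart. -/

section LocalFields

variable {n : ℕ} {M : Type*} [TopologicalSpace M]
  [ChartedSpace (𝔼 n) M] [IsManifold (𝓡 n) ∞ M]

/-- A change of charts is the identity map in two charts, so this is the push-forward formula for
the identity. -/
lemma contDiffAt_coordField_change {k : ℕ} {X : MultivectorField n M k} {x₀ x₁ x : M}
    (hx₀ : x ∈ (ℰ n x₀).source) (hx₁ : x ∈ (ℰ n x₁).source)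
    (h : ContDiffAt ℝ ∞ (coordField x₀ X) (ℰ n x₀ x)) :
    ContDiffAt ℝ ∞ (coordField x₁ X) (ℰ n x₁ x) := by
  have h1 := contDiffAt_coordMap (n := n) (M := M) contMDiff_id hx₁ hx₀
  have h2 := h1.fderiv_right (m := ∞) (by simp)
  have h4 : ContDiffAt ℝ ∞ (fun y => coordField x₀ X (coordMap x₁ x₀ id y))
      (ℰ n x₁ x) := by
    refine ContDiffAt.comp (g := coordField x₀ X) (ℰ n x₁ x) ?_ h1
    rwa [coordMap_chart hx₁]
  have hid : ∀ x' : M, (𝒟 n (id : M → M) x').IsInvertible := fun x' => by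
    rw [mfderiv_id]
    exact ⟨ContinuousLinearEquiv.refl ℝ _, rfl⟩
  have hinv : (fderiv ℝ (coordMap x₁ x₀ (id : M → M)) (ℰ n x₁ x)).IsInvertible := by
    rw [fderiv_coordMap hx₁ hx₀ mdifferentiableAt_id]
    obtain ⟨a, ha⟩ := chartDeriv_isInvertible hx₁
    obtain ⟨b, hb⟩ := chartDeriv_isInvertible hx₀
    obtain ⟨c, hc⟩ := hid x
    refine ⟨(a.symm.trans c).trans b, ?_⟩
    rw [chartInvAt, ← ha, ← hc, ContinuousLinearMap.inverse_equiv]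
    change _ = (chartDeriv x₀ x).comp _
    rw [← hb]
    rfl
  have h5 : ContDiffAt ℝ ∞ (fun y : 𝔼 n =>
      (fderiv ℝ (coordMap x₁ x₀ (id : M → M)) y).inverse) (ℰ n x₁ x) := by
    obtain ⟨a, ha⟩ := hinv
    refine ContDiffAt.comp (g := ContinuousLinearMap.inverse) (ℰ n x₁ x) ?_ h2
    rw [← ha]
    exact contDiffAt_map_inverse a
  have h6 : ContDiffAt ℝ ∞ (fun y : 𝔼 n =>
      ContinuousAlternatingMap.compContinuousLinearMapCLM (F := ℝ) (ι := Fin k)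
        (fderiv ℝ (coordMap x₁ x₀ (id : M → M)) y).inverse) (ℰ n x₁ x) :=
    (contDiff_compContinuousLinearMapCLM (k := k) (V := 𝔼 n) (W := 𝔼 n)).contDiffAt.comp
      (ℰ n x₁ x) h5
  refine (h4.clm_comp h6).congr_of_eventuallyEq
    (eventually_chart hx₁ ((isOpen_extChartAt_source x₀).mem_nhds hx₀) fun x' hx' hx'' => ?_)
  have h8 := coordField_push hx' hx'' mdifferentiableAt_id (hid x') 1 X
  rw [pushField_id] at h8
  rw [h8, Pi.one_apply, one_smul]

open Classical in
/-- The multivector field with a given expression in a chart, extended by zero. -/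
def localField {k : ℕ} (x₀ : M) (A : (𝔼 n) → ((𝔼 n) [⋀^Fin k]→L[ℝ] ℝ) →L[ℝ] ℝ) :
    MultivectorField n M k :=
  fun x => if x ∈ (ℰ n x₀).source then (A (ℰ n x₀ x)).comp
    (ContinuousAlternatingMap.compContinuousLinearMapCLM (chartInvAt x₀ x)) else 0

lemma coordField_localField {k : ℕ} {x₀ x : M} (hx : x ∈ (ℰ n x₀).source)
    (A : (𝔼 n) → ((𝔼 n) [⋀^Fin k]→L[ℝ] ℝ) →L[ℝ] ℝ) :
    coordField x₀ (localField x₀ A) (ℰ n x₀ x) = A (ℰ n x₀ x) := by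
  rw [coordField_chart hx, localField, if_pos hx]
  ext β
  change A _ ((β.compContinuousLinearMap (chartDeriv x₀ x)).compContinuousLinearMap
    (chartInvAt x₀ x)) = _
  congr 1
  ext v
  simp only [ContinuousAlternatingMap.compContinuousLinearMap_apply, Function.comp_def,
    chartDeriv_chartInvAt_apply hx]

lemma localField_eq_zero {k : ℕ} {x₀ : M} {A : (𝔼 n) → ((𝔼 n) [⋀^Fin k]→L[ℝ] ℝ) →L[ℝ] ℝ}
    {K : Set (𝔼 n)} (hA0 : ∀ y ∉ K, A y = 0) {x : M} (hx : x ∉ (ℰ n x₀).symm '' K) :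
    localField x₀ A x = 0 := by
  rw [localField]
  split_ifs with h
  · rw [hA0, ContinuousLinearMap.zero_comp]
    exact fun h' => hx ⟨_, h', (ℰ n x₀).left_inv h⟩
  · rfl

lemma isCompact_symm_image {x₀ : M} {K : Set (𝔼 n)} (hK : IsCompact K)
    (hKt : K ⊆ (ℰ n x₀).target) : IsCompact ((ℰ n x₀).symm '' K) :=
  hK.image_of_continuousOn ((continuousOn_extChartAt_symm x₀).mono hKt)

/-- The test field with a given expression in a chart. -/
def localTest [T2Space M] {k : ℕ} (x₀ : M) {A : (𝔼 n) → ((𝔼 n) [⋀^Fin k]→L[ℝ] ℝ) →L[ℝ] ℝ}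
    {K : Set (𝔼 n)} (hK : IsCompact K) (hKt : K ⊆ (ℰ n x₀).target)
    (hA : ContDiffOn ℝ ∞ A (ℰ n x₀).target) (hA0 : ∀ y ∉ K, A y = 0) :
    testFields n M k :=
  ⟨localField x₀ A, fun x₁ => contDiffOn_target_iff.2 fun x hx => by
      by_cases hx₀ : x ∈ (ℰ n x₀).source
      · refine contDiffAt_coordField_change hx₀ hx ?_
        exact (contDiffOn_target_iff.1 hA x hx₀).congr_of_eventuallyEq
          (eventually_chart hx₀ univ_mem fun x' hx' _ => coordField_localField hx' A)
      · have hxK : x ∉ (ℰ n x₀).symm '' K := by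
          rintro ⟨y, hy, rfl⟩
          exact hx₀ ((ℰ n x₀).map_target (hKt hy))
        have h0 : coordField x₁ (localField x₀ A) =ᶠ[𝓝 (ℰ n x₁ x)] fun _ => 0 :=
          eventually_chart hx ((isCompact_symm_image hK hKt).isClosed.isOpen_compl.mem_nhds hxK)
            fun x' hx' hx'' => by
              rw [coordField_chart hx', localField_eq_zero hA0 hx'', ContinuousLinearMap.zero_comp]
        exact contDiffAt_const.congr_of_eventuallyEq h0,
    _, isCompact_symm_image hK hKt, fun _ hx => localField_eq_zero hA0 hx⟩

end LocalFields

/-! ### The divergence of a field in a chart. -/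

section ChartTranspose

variable {n : ℕ} {M : Type*} [TopologicalSpace M] [T2Space M]
  [ChartedSpace (𝔼 n) M] [IsManifold (𝓡 n) ∞ M]
  [RiemannianBundle (fun x : M => 𝕋 n x)]
  [IsContMDiffRiemannianBundle (𝓡 n) ∞ (𝔼 n) (fun x : M => 𝕋 n x)]
  [MeasurableSpace M] [BorelSpace M] [SecondCountableTopology M]

lemma integral_chart (x₀ : M) {f : M → ℝ} (hf : Measurable f)
    (h0 : ∀ x ∉ (ℰ n x₀).source, f x = 0) :
    ∫ x, f x ∂(riemannianVolume n M) = ∫ y in (ℰ n x₀).target,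
      coordFun (n := n) x₀ (rho (n := n) x₀) y * f ((ℰ n x₀).symm y) := by
  have hT := (isOpen_extChartAt_target (I := 𝓡 n) x₀).measurableSet
  rw [← setIntegral_eq_integral_of_forall_compl_eq_zero h0, riemannianVolume_restrict, chartVolume,
    integral_map ((aemeasurable_chart_symm x₀).mono_ac (withDensity_absolutelyContinuous _ _))
      hf.aestronglyMeasurable,
    integral_withDensity_eq_integral_toReal_smul₀ (aemeasurable_rho x₀)
      (Eventually.of_forall fun x => ENNReal.ofReal_lt_top)]
  refine setIntegral_congr_fun hT fun y hy => ?_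
  beta_reduce
  rw [ENNReal.toReal_ofReal (jacobian_nonneg _), smul_eq_mul, rho_symm hy]
  rfl

open Classical in
/-- The expression of a multivector field in a chart, multiplied by the Riemannian density. -/
def density {k : ℕ} (x₀ : M) (K : Set (𝔼 n)) (X : MultivectorField n M k) :
    (𝔼 n) → ((𝔼 n) [⋀^Fin k]→L[ℝ] ℝ) →L[ℝ] ℝ :=
  fun y => if y ∈ K then coordFun (n := n) x₀ (rho (n := n) x₀) y • coordField x₀ X y else 0

variable {x₀ : M} {K : Set (𝔼 n)} {k : ℕ}

lemma density_eq (hKt : K ⊆ (ℰ n x₀).target) {X : MultivectorField n M k}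
    (hX : ∀ x ∉ (ℰ n x₀).symm '' K, X x = 0) {y : 𝔼 n}
    (hy : y ∈ (ℰ n x₀).target) :
    density x₀ K X y = coordFun (n := n) x₀ (rho (n := n) x₀) y • coordField x₀ X y := by
  rw [density]
  split_ifs with h
  · rfl
  · have hz : X ((ℰ n x₀).symm y) = 0 := by
      refine hX _ ?_
      rintro ⟨z, hz, hzy⟩
      exact h ((ℰ n x₀).symm.injOn (hKt hz) hy hzy ▸ hz)
    rw [coordField, hz, ContinuousLinearMap.zero_comp, smul_zero]

lemma pairing_chart (hKt : K ⊆ (ℰ n x₀).target) {X : testFields n M k}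
    (hX : ∀ x ∉ (ℰ n x₀).symm '' K, X.1 x = 0) {β : DiffForm n M k}
    (hβ : MeasForm β) : pairing β X = ∫ y, density x₀ K X.1 y (coordForm x₀ β y) := by
  have hT := (isOpen_extChartAt_target (I := 𝓡 n) x₀).measurableSet
  have h0 : ∀ x ∉ (ℰ n x₀).source, X.1 x (β x) = 0 := by
    intro x hx
    rw [hX, zero_apply]
    rintro ⟨y, hy, rfl⟩
    exact hx ((ℰ n x₀).map_target (hKt hy))
  rw [pairing, integral_chart x₀ (f := fun x => X.1 x (β x))
    (MeasAlong.field measurable_id hβ fun z => (X.2.1 z).continuousOn) h0,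
    ← setIntegral_eq_integral_of_forall_compl_eq_zero (s := (ℰ n x₀).target)
      (f := fun y => density x₀ K X.1 y (coordForm x₀ β y))]
  · refine setIntegral_congr_fun hT fun y hy => ?_
    beta_reduce
    have hy' := (ℰ n x₀).map_target hy
    have h1 := pair_eq_coord hy' X.1 β
    rw [(ℰ n x₀).right_inv hy] at h1
    rw [density_eq hKt hX hy, h1]
    rfl
  · intro y hy
    rw [density, if_neg fun h => hy (hKt h), zero_apply]

lemma contDiffOn_coordFun_rho : ContDiffOn ℝ ∞ (coordFun (n := n) x₀ (rho (n := n) x₀))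
    (ℰ n x₀).target := contDiffOn_target_iff.2 fun _ hx => contDiffAt_rho hx

lemma contDiffOn_density (hKt : K ⊆ (ℰ n x₀).target) {X : testFields n M k}
    (hX : ∀ x ∉ (ℰ n x₀).symm '' K, X.1 x = 0) :
    ContDiffOn ℝ ∞ (density x₀ K X.1) (ℰ n x₀).target := by
  intro y hy
  have hU := (isOpen_extChartAt_target (I := 𝓡 n) x₀).mem_nhds hy
  have h1 : ContDiffAt ℝ ∞ (fun y => coordField x₀ X.1 y) y := (X.2.1 x₀ y hy).contDiffAt hU
  refine ((contDiffAt_smul_dual ((contDiffOn_coordFun_rho y hy).contDiffAt hU) h1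
    ).congr_of_eventuallyEq ?_).contDiffWithinAt
  filter_upwards [hU] with z hz
  exact density_eq hKt hX hz

/-- Minus the divergence of a field, in a chart. -/
def divDensity (x₀ : M) (K : Set (𝔼 n)) (X : MultivectorField n M (k + 1)) :
    (𝔼 n) → ((𝔼 n) [⋀^Fin k]→L[ℝ] ℝ) →L[ℝ] ℝ :=
  fun y => ∑ i, (fderiv ℝ (density x₀ K X) y (EuclideanSpace.basisFun (Fin n) ℝ i)).comp
    (wedgeCLM (𝔼 n) k (EuclideanSpace.proj i))

lemma fderiv_density_eq_zero (hK : IsCompact K) {X : MultivectorField n M k} {y : 𝔼 n} (hy : y ∉ K)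
    (e : 𝔼 n) : fderiv ℝ (density x₀ K X) y e = 0 := by
  have h1 : density x₀ K X =ᶠ[𝓝 y] fun _ => 0 := by
    filter_upwards [hK.isClosed.isOpen_compl.mem_nhds hy] with z hz
    exact if_neg hz
  rw [h1.fderiv_eq, fderiv_fun_const]
  rfl

/-- In coordinates `d = Σ dx_i ∧ ∂_i`, and each partial derivative is moved onto the density of the
field. -/
lemma integral_divDensity (hK : IsCompact K) (hKt : K ⊆ (ℰ n x₀).target)
    {X : testFields n M (k + 1)} (hX : ∀ x ∉ (ℰ n x₀).symm '' K, X.1 x = 0)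
    {α : DiffForm n M k} (hα : IsSmoothForm α) :
    pairing (extDerivForm α) X = -∫ y, divDensity x₀ K X.1 y (coordForm x₀ α y) := by
  have h := fun i : Fin n => integral_pair_fderiv (μ := volume)
    (isOpen_extChartAt_target (I := 𝓡 n) x₀) hK hKt
    (contDiffOn_density hKt hX) (fun y hy => if_neg hy) (hα x₀)
    (wedgeCLM (𝔼 n) k (EuclideanSpace.proj i)) (EuclideanSpace.basisFun (Fin n) ℝ i)
  rw [pairing_chart hKt hX hα.extDeriv.locIntForm.meas]
  have e1 : ∀ y, density x₀ K X.1 y (coordForm x₀ (extDerivForm α) y) =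
      ∑ i, density x₀ K X.1 y (wedgeCLM (𝔼 n) k (EuclideanSpace.proj i)
      (fderiv ℝ (coordForm x₀ α) y (EuclideanSpace.basisFun (Fin n) ℝ i))) := by
    intro y
    by_cases hy : y ∈ K
    · have h1 := coordForm_extDerivForm hα ((ℰ n x₀).map_target (hKt hy))
      rw [(ℰ n x₀).right_inv (hKt hy)] at h1
      rw [h1, extDeriv_eq_sum, map_sum]
    · simp only [density, if_neg hy, zero_apply, Finset.sum_const_zero]
  simp only [e1]
  have e2 : ∀ y, divDensity x₀ K X.1 y (coordForm x₀ α y) =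
      ∑ i, fderiv ℝ (density x₀ K X.1) y (EuclideanSpace.basisFun (Fin n) ℝ i)
        (wedgeCLM (𝔼 n) k (EuclideanSpace.proj i) (coordForm x₀ α y)) := by
    intro y
    rw [divDensity, sum_apply]
    rfl
  simp only [e2]
  rw [integral_finsetSum _ fun i _ => (h i).1, integral_finsetSum _ fun i _ => (h i).2.1,
    ← Finset.sum_neg_distrib]
  exact Finset.sum_congr rfl fun i _ => (h i).2.2

lemma contDiffOn_divDensity (hKt : K ⊆ (ℰ n x₀).target)
    {X : testFields n M (k + 1)} (hX : ∀ x ∉ (ℰ n x₀).symm '' K, X.1 x = 0) :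
    ContDiffOn ℝ ∞ (divDensity x₀ K X.1) (ℰ n x₀).target := by
  intro y hy
  have hU := (isOpen_extChartAt_target (I := 𝓡 n) x₀).mem_nhds hy
  refine ContDiffAt.contDiffWithinAt (ContDiffAt.sum fun i _ => ?_)
  have h1 := ((contDiffOn_density hKt hX y hy).contDiffAt hU).fderiv_right (m := ∞) (by simp)
  exact (h1.clm_apply contDiffAt_const).clm_comp contDiffAt_const

lemma coordFun_rho_pos {y : 𝔼 n} (hy : y ∈ (ℰ n x₀).target) :
    0 < coordFun (n := n) x₀ (rho (n := n) x₀) y := rho_pos ((ℰ n x₀).map_target hy)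

lemma exists_bound_chartInvAt {L : Set M} (hL : IsCompact L)
    (hLs : L ⊆ (ℰ n x₀).source) :
    ∃ C, 0 ≤ C ∧ ∀ x ∈ L, ‖chartInvAt (n := n) x₀ x‖ ≤ C := by
  have h := fun i : Fin n => hL.exists_bound_of_continuousOn
    ((continuousOn_norm_chartInvAt x₀ (EuclideanSpace.basisFun (Fin n) ℝ i)).mono hLs)
  choose C hC using h
  refine ⟨∑ i, |C i|, by positivity, fun x hx => ?_⟩
  refine ContinuousLinearMap.opNorm_le_bound _ (by positivity) fun v => ?_
  have hv : chartInvAt (n := n) x₀ x v =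
      ∑ i, v i • chartInvAt (n := n) x₀ x (EuclideanSpace.basisFun (Fin n) ℝ i) := by
    conv_lhs => rw [← (EuclideanSpace.basisFun (Fin n) ℝ).sum_repr v, map_sum]
    exact Finset.sum_congr rfl fun i _ => by rw [map_smul]; rfl
  rw [hv, Finset.sum_mul]
  refine (norm_sum_le _ _).trans (Finset.sum_le_sum fun i _ => ?_)
  rw [norm_smul, mul_comm]
  have h1 := hC i x hx
  rw [norm_norm] at h1
  exact mul_le_mul (h1.trans (le_abs_self _)) (PiLp.norm_apply_le v i) (norm_nonneg _) (abs_nonneg _)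

/-- Bound of a field by its expression in a chart. -/
lemma exists_bound_of_coordField (hK : IsCompact K) (hKt : K ⊆ (ℰ n x₀).target)
    (k : ℕ) : ∃ C, 0 ≤ C ∧ ∀ (X : MultivectorField n M k) (B : ℝ),
      (∀ x ∉ (ℰ n x₀).symm '' K, X x = 0) → 0 ≤ B →
      (∀ y ∈ K, ‖coordField x₀ X y‖ ≤ B) → ∀ x β, |X x β| ≤ C * B * ‖β‖ := by
  have hL := isCompact_symm_image hK hKt
  have hLs : (ℰ n x₀).symm '' K ⊆ (ℰ n x₀).source := by
    rintro _ ⟨y, hy, rfl⟩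
    exact (ℰ n x₀).map_target (hKt hy)
  obtain ⟨C, hC, h⟩ := exists_bound_chartInvAt hL hLs
  refine ⟨C ^ k, by positivity, fun X B hX hB hXB x β => ?_⟩
  by_cases hx : x ∈ (ℰ n x₀).symm '' K
  · rw [field_apply_eq (hLs hx)]
    obtain ⟨y, hy, rfl⟩ := hx
    rw [(ℰ n x₀).right_inv (hKt hy)]
    rw [← Real.norm_eq_abs]
    refine (ContinuousLinearMap.le_opNorm _ _).trans ?_
    calc _ ≤ B * (C ^ k * ‖β‖) := mul_le_mul (hXB y hy) (norm_compCLM_le _ _ (h _ ⟨y, hy, rfl⟩))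
          (norm_nonneg _) hB
      _ = _ := by ring
  · rw [hX x hx, zero_apply, abs_zero]
    positivity

/-- The transpose is `-ρ⁻¹ Σ ∂_i(ρ X)` contracted with `dx_i`. The bound by `X` and its first
derivatives, uniform for fields supported in `K`, is what later makes the boundary value a
distribution. -/
lemma exists_transpose_chart (hK : IsCompact K) (hKt : K ⊆ (ℰ n x₀).target)
    (k : ℕ) : ∃ C, 0 ≤ C ∧ ∀ (X : testFields n M (k + 1)),
      (∀ x ∉ (ℰ n x₀).symm '' K, X.1 x = 0) →
      ∃ Y : testFields n M k, IsTranspose X Y ∧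
        (∀ x ∉ (ℰ n x₀).symm '' K, Y.1 x = 0) ∧
        ∀ B : ℝ, 0 ≤ B → (∀ y ∈ K, ‖coordField x₀ X.1 y‖ ≤ B) →
          (∀ y ∈ K, ∀ e, ‖fderiv ℝ (coordField x₀ X.1) y e‖ ≤ B * ‖e‖) →
          ∀ y ∈ K, ‖coordField x₀ Y.1 y‖ ≤ C * B := by
  set r := coordFun (n := n) x₀ (rho (n := n) x₀) with hr
  have hrs := contDiffOn_coordFun_rho (n := n) (x₀ := x₀)
  have hT := isOpen_extChartAt_target (I := 𝓡 n) x₀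
  obtain ⟨C₁, hC₁⟩ := hK.exists_bound_of_continuousOn (hrs.continuousOn.mono hKt)
  obtain ⟨C₂, hC₂⟩ := hK.exists_bound_of_continuousOn
    ((hrs.continuousOn_fderiv_of_isOpen hT (by simp)).mono hKt)
  obtain ⟨C₃, hC₃⟩ := hK.exists_bound_of_continuousOn
    ((hrs.continuousOn.inv₀ fun y hy => (coordFun_rho_pos hy).ne').mono hKt)
  set w := fun i : Fin n => ‖wedgeCLM (𝔼 n) k (EuclideanSpace.proj i)‖ with hw
  refine ⟨|C₃| * ∑ i, (|C₁| + |C₂|) * w i, by positivity, fun X hX => ?_⟩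
  have hA : ContDiffOn ℝ ∞ (fun y => (-(r y)⁻¹) • divDensity x₀ K X.1 y)
      (ℰ n x₀).target := fun y hy => by
    have h1 : ContDiffAt ℝ ∞ (fun y => -(r y)⁻¹) y :=
      (((hrs y hy).contDiffAt (hT.mem_nhds hy)).inv (coordFun_rho_pos hy).ne').neg
    exact (contDiffAt_smul_dual h1
      ((contDiffOn_divDensity hKt hX y hy).contDiffAt (hT.mem_nhds hy))).contDiffWithinAt
  have hA0 : ∀ y ∉ K, (-(r y)⁻¹) • divDensity x₀ K X.1 y = 0 := fun y hy => by
    rw [divDensity, Finset.sum_eq_zero, smul_zero]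
    intro i _
    rw [fderiv_density_eq_zero hK hy, ContinuousLinearMap.zero_comp]
  have hYc : ∀ y ∈ (ℰ n x₀).target, coordField x₀ (localTest x₀ hK hKt hA hA0).1 y =
      (-(r y)⁻¹) • divDensity x₀ K X.1 y := fun y hy => by
    have h1 := coordField_localField ((ℰ n x₀).map_target hy)
      (fun y => (-(r y)⁻¹) • divDensity x₀ K X.1 y)
    rwa [(ℰ n x₀).right_inv hy] at h1
  have hY0 : ∀ x ∉ (ℰ n x₀).symm '' K, (localTest x₀ hK hKt hA hA0).1 x = 0 :=
    fun x hx => localField_eq_zero hA0 hx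
  refine ⟨localTest x₀ hK hKt hA hA0, fun α hα => ?_, hY0, fun B hB hB0 hB1 y hy => ?_⟩
  · rw [integral_divDensity hK hKt hX hα, pairing_chart hKt hY0 hα.locIntForm.meas, ← integral_neg]
    refine integral_congr_ae (Eventually.of_forall fun y => ?_)
    beta_reduce
    by_cases hy : y ∈ K
    · rw [density_eq hKt hY0 (hKt hy), hYc y (hKt hy), smul_smul, mul_neg,
        mul_inv_cancel₀ (coordFun_rho_pos (hKt hy)).ne', smul_apply, smul_eq_mul, neg_one_mul]
    · rw [density, if_neg hy, divDensity, Finset.sum_eq_zero, zero_apply, neg_zero]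
      intro i _
      rw [fderiv_density_eq_zero hK hy, ContinuousLinearMap.zero_comp]
  · have hU := hT.mem_nhds (hKt hy)
    have h1 := hC₃ y hy
    rw [hYc y (hKt hy), norm_smul_dual, abs_neg, mul_assoc]
    refine mul_le_mul (h1.trans (le_abs_self _)) ?_
      (norm_nonneg (E := ((𝔼 n) [⋀^Fin k]→L[ℝ] ℝ) →L[ℝ] ℝ) _) (abs_nonneg _)
    rw [divDensity, Finset.sum_mul]
    refine (norm_sum_le _ _).trans (Finset.sum_le_sum fun i _ => ?_)
    refine (ContinuousLinearMap.opNorm_comp_le _ _).trans ?_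
    have h2 : density x₀ K X.1 =ᶠ[𝓝 y] fun y => r y • coordField x₀ X.1 y := by
      filter_upwards [hU] with z hz
      exact density_eq hKt hX hz
    have h3 := norm_fderiv_smul_le (f := r) (g := coordField x₀ X.1) (x := y)
      (((hrs y (hKt hy)).contDiffAt hU).differentiableAt (by simp))
      (((X.2.1 x₀ y (hKt hy)).contDiffAt hU).differentiableAt (by simp))
      (EuclideanSpace.basisFun (Fin n) ℝ i)
    have h6 := hB1 y hy (EuclideanSpace.basisFun (Fin n) ℝ i)
    rw [← h2.fderiv_eq, OrthonormalBasis.norm_eq_one, mul_one] at h3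
    rw [OrthonormalBasis.norm_eq_one, mul_one] at h6
    have h4 : ‖fderiv ℝ (density x₀ K X.1) y (EuclideanSpace.basisFun (Fin n) ℝ i)‖ ≤
        (|C₁| + |C₂|) * B := by
      refine h3.trans ?_
      rw [add_mul]
      have h5 := hC₁ y hy
      rw [Real.norm_eq_abs] at h5
      exact add_le_add
        (mul_le_mul (h5.trans (le_abs_self _)) h6 (norm_nonneg _) (abs_nonneg _))
        (mul_le_mul ((hC₂ y hy).trans (le_abs_self _)) (hB0 y hy) (norm_nonneg _) (abs_nonneg _))
    calc _ ≤ (|C₁| + |C₂|) * B * w i := mul_le_mul_of_nonneg_right h4 (ContinuousLinearMap.opNorm_nonneg _)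
      _ = _ := by ring

end ChartTranspose

/-! ### Globalisation by partitions of unity. -/

section TransposeExistence

variable {n : ℕ} {M : Type*} [TopologicalSpace M] [T2Space M]
  [ChartedSpace (𝔼 n) M] [IsManifold (𝓡 n) ∞ M]
  [SecondCountableTopology M]

lemma sigmaCompact (n : ℕ) (M : Type*) [TopologicalSpace M]
    [ChartedSpace (𝔼 n) M] [SecondCountableTopology M] :
    SigmaCompactSpace M := by
  haveI := Manifold.locallyCompact_of_finiteDimensional (M := M) (𝓡 n)
  infer_instance

/-- A partition of unity subordinate to the chart domains splits a test field into finitely many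
pieces, each supported in a compact part of one chart. -/
lemma testField_induction {k : ℕ} [RiemannianBundle (fun x : M => 𝕋 n x)]
    [IsContMDiffRiemannianBundle (𝓡 n) ∞ (𝔼 n) (fun x : M => 𝕋 n x)] {P : testFields n M k → Prop} (h0 : P 0)
    (hadd : ∀ X Y, P X → P Y → P (X + Y))
    (hloc : ∀ (x₀ : M) (K : Set (𝔼 n)) (X : testFields n M k), IsCompact K →
      K ⊆ (ℰ n x₀).target → (∀ x ∉ (ℰ n x₀).symm '' K, X.1 x = 0) → P X)
    (X : testFields n M k) : P X := by
  haveI := sigmaCompact n M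
  obtain ⟨K, hK, hX⟩ := X.2.2
  obtain ⟨f, hf⟩ := SmoothPartitionOfUnity.exists_isSubordinate (𝓡 n) hK.isClosed
    (fun x : M => (ℰ n x).source) (fun x => isOpen_extChartAt_source x)
    (fun x _ => mem_iUnion.2 ⟨x, mem_extChartAt_source x⟩)
  set S := (f.locallyFinite.finite_nonempty_inter_compact hK).toFinset with hS
  have hsum : X = ∑ i ∈ S, smulTest (f i).contMDiff X := by
    have hval : ∀ T : Finset M, ∀ x, (∑ i ∈ T, smulTest (f i).contMDiff X).1 x =
        (∑ i ∈ T, f i x) • X.1 x := by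
      intro T x
      induction T using Finset.cons_induction with
      | empty => simp only [Finset.sum_empty, zero_smul]; rfl
      | cons i T hi ih =>
        rw [Finset.sum_cons, Finset.sum_cons, add_smul, ← ih]
        rfl
    refine Subtype.ext (funext fun x => ?_)
    rw [hval]
    by_cases hx : x ∈ K
    · have h1 := f.sum_eq_one hx
      rw [finsum_eq_sum_of_support_subset (s := S)] at h1
      · rw [h1, one_smul]
      · intro i hi
        rw [hS, Finite.coe_toFinset]
        exact ⟨x, hi, hx⟩
    · rw [hX x hx, smul_zero]
  rw [hsum]
  refine Finset.sum_induction _ P hadd h0 fun i _ => ?_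
  have hc : IsCompact (tsupport (f i) ∩ K) := hK.inter_left (isClosed_tsupport _)
  have hcs : tsupport (f i) ∩ K ⊆ (ℰ n i).source := fun x hx => hf i hx.1
  refine hloc i (ℰ n i '' (tsupport (f i) ∩ K)) _
    (hc.image_of_continuousOn ((continuousOn_extChartAt i).mono hcs)) ?_ fun x hx => ?_
  · rintro _ ⟨x, hx, rfl⟩
    exact (ℰ n i).map_source (hcs hx)
  · change f i x • X.1 x = 0
    by_cases hxK : x ∈ K
    · rw [image_eq_zero_of_notMem_tsupport (f := f i) (x := x), zero_smul]
      intro hxt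
      exact hx ⟨_, ⟨x, ⟨hxt, hxK⟩, rfl⟩, (ℰ n i).left_inv (hcs ⟨hxt, hxK⟩)⟩
    · rw [hX x hxK, smul_zero]

variable [RiemannianBundle (fun x : M => 𝕋 n x)]
  [IsContMDiffRiemannianBundle (𝓡 n) ∞ (𝔼 n) (fun x : M => 𝕋 n x)]
  [MeasurableSpace M] [BorelSpace M]

lemma pairing_zero_right {k : ℕ} (γ : DiffForm n M k) : pairing γ 0 = 0 := integral_zero _ _

lemma IsTranspose.add {k : ℕ} {X X' : testFields n M (k + 1)} {Y Y' : testFields n M k}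
    (h : IsTranspose X Y) (h' : IsTranspose X' Y') : IsTranspose (X + X') (Y + Y') := by
  intro α hα
  rw [hα.extDeriv.locIntForm.pairing_add, hα.locIntForm.pairing_add, h α hα, h' α hα]

/-- Every test field has an image under the transpose of the exterior derivative. -/
lemma exists_transpose {k : ℕ} (X : testFields n M (k + 1)) :
    ∃ Y : testFields n M k, IsTranspose X Y := by
  refine testField_induction (P := fun X => ∃ Y : testFields n M k, IsTranspose X Y) ?_ ?_ ?_ X
  · exact ⟨0, fun α _ => by rw [pairing_zero_right, pairing_zero_right]⟩
  · rintro X X' ⟨Y, h⟩ ⟨Y', h'⟩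
    exact ⟨Y + Y', h.add h'⟩
  · intro x₀ K X hK hKt hX
    obtain ⟨C, -, h⟩ := exists_transpose_chart hK hKt k
    obtain ⟨Y, hY, -⟩ := h X hX
    exact ⟨Y, hY⟩

end TransposeExistence

/-! ### `Lᵖ` estimates along the flow and the boundary value. -/

section Estimates

variable {n : ℕ} {M : Type*} [TopologicalSpace M] [T2Space M]
  [ChartedSpace (𝔼 n) M] [IsManifold (𝓡 n) ∞ M]
  [RiemannianBundle (fun x : M => 𝕋 n x)]
  [IsContMDiffRiemannianBundle (𝓡 n) ∞ (𝔼 n) (fun x : M => 𝕋 n x)]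
  [MeasurableSpace M] [BorelSpace M] [SecondCountableTopology M]
  {φ : ℝ → M → M} {ξ : (x : M) → 𝕋 n x} {p : ℝ} {k : ℕ}

omit [T2Space M] in
lemma MeasForm.norm {γ : DiffForm n M k} (hγ : MeasForm γ) : Measurable fun x => ‖γ x‖ :=
  MeasAlong.norm measurable_id hγ

omit [T2Space M] [IsManifold (𝓡 n) ∞ M] [BorelSpace M] [SecondCountableTopology M]
  [IsContMDiffRiemannianBundle (𝓡 n) ∞ (𝔼 n) (fun x : M => TangentSpace (𝓡 n) x)] in
lemma lpNorm_eq (hp : 1 < p) (γ : DiffForm n M k) :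
    lpNorm p γ = (∫⁻ x, ‖γ x‖ₑ ^ p ∂(riemannianVolume n M)) ^ (1 / p) := by
  have h0 : 0 < p := by linarith
  rw [lpNorm, eLpNorm_eq_lintegral_rpow_enorm_toReal (by simpa using h0) ENNReal.ofReal_ne_top,
    ENNReal.toReal_ofReal h0.le]
  simp only [enorm_norm]

lemma LocIntForm.of_lp (hp : 1 < p) {γ : DiffForm n M k} (hγ : MeasForm γ) (h : lpNorm p γ < ⊤) :
    LocIntForm γ := by
  refine ⟨hγ, fun K hK => ?_⟩
  have h1 : MemLp (fun x => ‖γ x‖) (ENNReal.ofReal p) (riemannianVolume n M) :=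
    ⟨hγ.norm.aestronglyMeasurable, h⟩
  haveI : IsFiniteMeasure ((riemannianVolume n M).restrict K) :=
    ⟨by rw [Measure.restrict_apply_univ]; exact hK.measure_lt_top⟩
  exact (h1.restrict K).integrable (by rw [← ENNReal.ofReal_one]; exact ENNReal.ofReal_le_ofReal hp.le)

lemma LocIntForm.abs_pairing_le {γ : DiffForm n M k} (hγ : LocIntForm γ) {L : Set M}
    (hL : IsCompact L) {X : testFields n M k} (hX : ∀ x ∉ L, X.1 x = 0) {D : ℝ}
    (hD : ∀ x β, |X.1 x β| ≤ D * ‖β‖) :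
    |pairing γ X| ≤ D * ∫ x in L, ‖γ x‖ ∂(riemannianVolume n M) := by
  have h0 : ∀ x, x ∉ L → X.1 x (γ x) = 0 := fun x hx => by
    rw [hX x hx]
    rfl
  have h1 : pairing γ X = ∫ x in L, X.1 x (γ x) ∂(riemannianVolume n M) :=
    (setIntegral_eq_integral_of_forall_compl_eq_zero h0).symm
  rw [h1, ← integral_const_mul]
  refine abs_integral_le_integral_abs.trans ?_
  refine integral_mono_of_nonneg (Eventually.of_forall fun x => abs_nonneg _)
    ((hγ.int L hL).const_mul D) (Eventually.of_forall fun x => ?_)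
  exact hD x _

/-- This is why the exponent `1/p` occurs in the contraction condition: raised to the power `p`, the
weight is exactly the Jacobian of the change of variables. -/
lemma IsFlowOf.lintegral_rpow_comp (hφ : IsFlowOf φ ξ) (hp : 1 < p) (γ : DiffForm n M k) (s : ℝ) :
    ∫⁻ x, (ENNReal.ofReal (jacobian (𝒟 n (φ s) x) ^ (1 / p)) * ‖γ (φ s x)‖ₑ) ^ p
      ∂(riemannianVolume n M) = ∫⁻ x, ‖γ x‖ₑ ^ p ∂(riemannianVolume n M) := by
  have h0 : 0 < p := by linarith
  refine Eq.trans (lintegral_congr fun x => ?_) (hφ.lintegral_comp s fun x => ‖γ x‖ₑ ^ p)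
  rw [ENNReal.mul_rpow_of_nonneg _ _ h0.le,
    ENNReal.ofReal_rpow_of_nonneg (Real.rpow_nonneg (jacobian_nonneg _) _) h0.le,
    ← Real.rpow_mul (jacobian_nonneg _), one_div_mul_cancel h0.ne', Real.rpow_one]

lemma IsFlowOf.measurable_weight (hφ : IsFlowOf φ ξ) {γ : DiffForm n M k} (hγ : MeasForm γ)
    (p : ℝ) (s : ℝ) : Measurable fun x =>
      ENNReal.ofReal (jacobian (𝒟 n (φ s) x) ^ (1 / p)) * ‖γ (φ s x)‖ₑ := by
  have h := (hγ.norm.comp (hφ.contMDiff s).continuous.measurable).enorm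
  simp only [Function.comp_def, enorm_norm] at h
  exact ((hφ.measurable_jacobian s).pow_const _).ennreal_ofReal.mul h

/-- The factor `vol(K)^{1 - 1/p}`. -/
def volFactor (n : ℕ) {M : Type*} [TopologicalSpace M]
    [ChartedSpace (𝔼 n) M]
    [RiemannianBundle (fun x : M => 𝕋 n x)] [MeasurableSpace M] (p : ℝ)
    (K : Set M) : ℝ≥0∞ := (riemannianVolume n M K) ^ (1 - 1 / p)

lemma volFactor_lt_top (hp : 1 < p) {K : Set M} (hK : IsCompact K) : volFactor n p K < ⊤ :=
  ENNReal.rpow_lt_top_of_nonneg (by rw [sub_nonneg, div_le_one] <;> linarith) hK.measure_lt_top.ne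

/-- Hölder's inequality against the indicator of `K`; the conjugate exponent gives the power `1 -
1/p` of the volume. -/
lemma IsFlowOf.setLIntegral_weight_le (hφ : IsFlowOf φ ξ) (hp : 1 < p) {γ : DiffForm n M k}
    (hγ : MeasForm γ) (s : ℝ) {K : Set M} (hK : MeasurableSet K) :
    ∫⁻ x in K, ENNReal.ofReal (jacobian (𝒟 n (φ s) x) ^ (1 / p)) * ‖γ (φ s x)‖ₑ
      ∂(riemannianVolume n M) ≤ lpNorm p γ * volFactor n p K := by
  have h0 : 0 < p := by linarith
  set q := p.conjExponent with hq
  have hpq : p.HolderConjugate q := Real.HolderConjugate.conjExponent hp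
  have h := ENNReal.lintegral_mul_le_Lp_mul_Lq (riemannianVolume n M) hpq
    (hφ.measurable_weight hγ p s).aemeasurable
    ((measurable_const (a := (1 : ℝ≥0∞))).indicator hK).aemeasurable
  have e1 : ∫⁻ x in K, ENNReal.ofReal (jacobian (𝒟 n (φ s) x) ^ (1 / p)) *
      ‖γ (φ s x)‖ₑ ∂(riemannianVolume n M) = ∫⁻ x, ((fun x => ENNReal.ofReal
        (jacobian (𝒟 n (φ s) x) ^ (1 / p)) * ‖γ (φ s x)‖ₑ) *
          K.indicator (fun _ => (1 : ℝ≥0∞))) x ∂(riemannianVolume n M) := by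
    rw [← lintegral_indicator hK]
    refine lintegral_congr fun x => ?_
    by_cases hx : x ∈ K <;> simp [hx]
  have e2 : ∫⁻ x, (K.indicator (fun _ => (1 : ℝ≥0∞)) x) ^ q ∂(riemannianVolume n M) =
      riemannianVolume n M K := by
    rw [← lintegral_indicator_one hK]
    refine lintegral_congr fun x => ?_
    by_cases hx : x ∈ K
    · simp [hx]
    · simp [hx, hpq.symm.pos]
  rw [e1]
  refine h.trans_eq ?_
  rw [hφ.lintegral_rpow_comp hp, e2, lpNorm_eq hp, volFactor, one_div q, ← hpq.one_sub_inv, one_div]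

/-- The basic estimate of the pairing of a test field and a form dominated by a pull-back. -/
lemma IsFlowOf.abs_pairing_le (hφ : IsFlowOf φ ξ) (hp : 1 < p) {m : ℕ} {γ : DiffForm n M m}
    (hγ : MeasForm γ) (hγp : lpNorm p γ < ⊤) (s : ℝ) {K : Set M} (hK : IsCompact K)
    {X : testFields n M k} (hX : ∀ x ∉ K, X.1 x = 0) {θ : DiffForm n M k} {A : ℝ} (hA : 0 ≤ A)
    (h : ∀ x ∈ K, |X.1 x (θ x)| ≤
      A * (jacobian (𝒟 n (φ s) x) ^ (1 / p) * ‖γ (φ s x)‖)) :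
    |pairing θ X| ≤ A * ((lpNorm p γ).toReal * (volFactor n p K).toReal) := by
  have hfin : lpNorm p γ * volFactor n p K ≠ ⊤ :=
    ENNReal.mul_ne_top hγp.ne (volFactor_lt_top hp hK).ne
  have h0 : ∀ x, x ∉ K → X.1 x (θ x) = 0 := fun x hx => by
    rw [hX x hx]
    rfl
  have h2 : pairing θ X = ∫ x in K, X.1 x (θ x) ∂(riemannianVolume n M) :=
    (setIntegral_eq_integral_of_forall_compl_eq_zero h0).symm
  rw [h2, ← Real.norm_eq_abs]
  have h1 : ∫⁻ x in K, ‖X.1 x (θ x)‖ₑ ∂(riemannianVolume n M) ≤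
      ENNReal.ofReal A * (lpNorm p γ * volFactor n p K) := by
    calc _ ≤ ∫⁻ x in K, ENNReal.ofReal A * (ENNReal.ofReal
          (jacobian (𝒟 n (φ s) x) ^ (1 / p)) * ‖γ (φ s x)‖ₑ)
          ∂(riemannianVolume n M) := by
          refine setLIntegral_mono' hK.measurableSet fun x hx => ?_
          rw [← ofReal_norm, ← ofReal_norm, ← ENNReal.ofReal_mul
            (Real.rpow_nonneg (jacobian_nonneg _) _), ← ENNReal.ofReal_mul hA]
          exact ENNReal.ofReal_le_ofReal (h x hx)
      _ = ENNReal.ofReal A * ∫⁻ x in K, (ENNReal.ofReal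
          (jacobian (𝒟 n (φ s) x) ^ (1 / p)) * ‖γ (φ s x)‖ₑ)
          ∂(riemannianVolume n M) := lintegral_const_mul _ (hφ.measurable_weight hγ p s)
      _ ≤ _ := by
          gcongr
          exact hφ.setLIntegral_weight_le hp hγ s hK.measurableSet
  refine (norm_integral_le_lintegral_norm _).trans ?_
  simp only [ofReal_norm]
  refine (ENNReal.toReal_mono (ENNReal.mul_ne_top ENNReal.ofReal_ne_top hfin) h1).trans_eq ?_
  rw [ENNReal.toReal_mul, ENNReal.toReal_mul, ENNReal.toReal_ofReal hA]

lemma IsFlowOf.continuous_pairing (hφ : IsFlowOf φ ξ) {γ : DiffForm n M k} (hγ : LocIntForm γ)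
    (X : testFields n M k) : Continuous fun s => pairing (pullbackForm (φ s) γ) X := by
  simp only [hφ.pairing_pullback]
  exact continuous_iff_continuousAt.2 fun s => (hφ.hasDerivAt_pairing hγ X s).continuousAt

lemma pushTest_add (hφ : IsFlowOf φ ξ) (s : ℝ) (X Y : testFields n M k) :
    pushTest hφ s (X + Y) = pushTest hφ s X + pushTest hφ s Y := by
  refine Subtype.ext (funext fun x => ?_)
  refine ContinuousLinearMap.ext fun β => ?_
  exact mul_add _ _ _

lemma pushTest_smul (hφ : IsFlowOf φ ξ) (s c : ℝ) (X : testFields n M k) :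
    pushTest hφ s (c • X) = c • pushTest hφ s X := by
  refine Subtype.ext (funext fun x => ?_)
  refine ContinuousLinearMap.ext fun β => ?_
  exact mul_left_comm _ _ _

omit [T2Space M] in
lemma MeasForm.inter {γ : DiffForm n M (k + 1)} (hγ : MeasForm γ) (hξ : IsSmoothVec ξ) :
    MeasForm (interForm ξ γ) := MeasAlong.inter measurable_id hγ hξ

omit [T2Space M] [IsManifold (𝓡 n) ∞ M] [BorelSpace M] [SecondCountableTopology M]
  [IsContMDiffRiemannianBundle (𝓡 n) ∞ (𝔼 n) (fun x : M => TangentSpace (𝓡 n) x)] in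
lemma lpNorm_inter_lt_top {B : ℝ} (hξ : ∀ x, ‖ξ x‖ ≤ B) {γ : DiffForm n M (k + 1)}
    (hγ : lpNorm p γ < ⊤) : lpNorm p (interForm ξ γ) < ⊤ := by
  refine lt_of_le_of_lt (eLpNorm_le_mul_eLpNorm_of_ae_le_mul (c := B)
    (Eventually.of_forall fun x => ?_) _) (ENNReal.mul_lt_top ENNReal.ofReal_lt_top hγ)
  rw [norm_norm, norm_norm]
  exact (norm_inter_le _ _).trans (mul_le_mul_of_nonneg_right (hξ x) (norm_nonneg _))

/-- The contraction property for contracted forms. -/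
lemma norm_pullback_inter_le {C η : ℝ}
    (hC : ∀ t : ℝ, 0 ≤ t → ∀ (x : M) (β : (𝕋 n (φ t x)) [⋀^Fin k]→L[ℝ] ℝ),
      (∀ v : Fin k → 𝕋 n (φ t x), (∃ i, v i = ξ (φ t x)) → β v = 0) →
      ‖β.compContinuousLinearMap (𝒟 n (φ t) x)‖ ≤
        C * Real.exp (-η * t) * jacobian (𝒟 n (φ t) x) ^ (1 / p) * ‖β‖)
    (γ : DiffForm n M (k + 1)) {t : ℝ} (ht : 0 ≤ t) (x : M) :
    ‖pullbackForm (φ t) (interForm ξ γ) x‖ ≤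
      C * Real.exp (-η * t) * jacobian (𝒟 n (φ t) x) ^ (1 / p) *
        ‖interForm ξ γ (φ t x)‖ := by
  refine hC t ht x _ ?_
  cases k with
  | zero => rintro v ⟨i, -⟩; exact i.elim0
  | succ k =>
    intro v hv
    exact eq_zero_of_inter_eq_zero (inter_inter_self _ _) v hv

/-- The integral of a measurable family of forms. -/
def integralForm (μ : Measure ℝ) (G : ℝ → DiffForm n M k) : DiffForm n M k :=
  fun x => (∫ s, inFrame (G s x) ∂μ).compContinuousLinearMap (coframe x)

lemma exists_bound_comp {V W : Type*} [NormedAddCommGroup V] [NormedSpace ℝ V]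
    [NormedAddCommGroup W] [NormedSpace ℝ W] (k : ℕ) (L : V →L[ℝ] W) :
    ∃ C, 0 ≤ C ∧ ∀ β : W [⋀^Fin k]→L[ℝ] ℝ, ‖β.compContinuousLinearMap L‖ ≤ C * ‖β‖ :=
  ⟨‖L‖ ^ k, by positivity, fun β => norm_compCLM_le β L le_rfl⟩

section Integral

variable {μ : Measure ℝ} [SFinite μ] {G : ℝ → DiffForm n M k}
  (hG : MeasAlong (fun q : ℝ × M => q.2) (fun q => G q.1 q.2))
include hG

lemma MeasAlong.stronglyMeasurable_slice (x : M) : StronglyMeasurable fun s => inFrame (G s x) :=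
  stronglyMeasurable_alternating fun v => (hG v).comp (measurable_prodMk_right (y := x))

lemma MeasAlong.measurable_enorm : Measurable fun q : ℝ × M => ‖G q.1 q.2‖ₑ := by
  have h := (MeasAlong.norm measurable_snd hG).enorm
  simpa only [enorm_norm] using h

lemma MeasAlong.integrable_slice {x : M} (hx : ∫⁻ s, ‖G s x‖ₑ ∂μ < ⊤) :
    Integrable (fun s => inFrame (G s x)) μ := by
  refine ⟨(hG.stronglyMeasurable_slice x).aestronglyMeasurable, ?_⟩
  obtain ⟨C, hC, h⟩ := exists_bound_comp (V := 𝔼 n) (W := 𝕋 n x) k (frame x)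
  refine lt_of_le_of_lt (b := ENNReal.ofReal C * ∫⁻ s, ‖G s x‖ₑ ∂μ) ?_
    (ENNReal.mul_lt_top ENNReal.ofReal_lt_top hx)
  rw [← lintegral_const_mul' _ _ ENNReal.ofReal_ne_top]
  refine lintegral_mono fun s => ?_
  rw [← ofReal_norm, ← ofReal_norm, ← ENNReal.ofReal_mul hC]
  exact ENNReal.ofReal_le_ofReal (h _)

lemma MeasAlong.apply_integralForm {x : M} (hx : ∫⁻ s, ‖G s x‖ₑ ∂μ < ⊤)
    (L : ((𝕋 n x) [⋀^Fin k]→L[ℝ] ℝ) →L[ℝ] ℝ) :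
    L (integralForm μ G x) = ∫ s, L (G s x) ∂μ := by
  refine ((L.comp (ContinuousAlternatingMap.compContinuousLinearMapCLM
    (coframe x))).integral_comp_comm (hG.integrable_slice hx)).symm.trans ?_
  refine integral_congr_ae (Eventually.of_forall fun s => ?_)
  change L ((inFrame (G s x)).compContinuousLinearMap (coframe x)) = L (G s x)
  congr 1
  ext v
  simp [inFrame, frame_coframe, Function.comp_def]

lemma MeasAlong.enorm_integralForm_le (x : M) :
    ‖integralForm μ G x‖ₑ ≤ ∫⁻ s, ‖G s x‖ₑ ∂μ := by
  by_cases hx : ∫⁻ s, ‖G s x‖ₑ ∂μ < ⊤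
  · rw [← ofReal_norm]
    refine ENNReal.ofReal_le_of_le_toReal ?_
    refine ContinuousAlternatingMap.opNorm_le_bound _ ENNReal.toReal_nonneg fun v => ?_
    have h := hG.apply_integralForm hx (ContinuousAlternatingMap.apply ℝ (𝕋 n x) ℝ v)
    change integralForm μ G x v = ∫ s, G s x v ∂μ at h
    rw [h, ← ENNReal.toReal_ofReal (Finset.prod_nonneg fun i _ => norm_nonneg (v i)),
      ← ENNReal.toReal_mul, ← lintegral_mul_const' _ _ ENNReal.ofReal_ne_top]
    refine (norm_integral_le_lintegral_norm _).trans (ENNReal.toReal_mono ?_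
      (lintegral_mono fun s => ?_))
    · rw [lintegral_mul_const' _ _ ENNReal.ofReal_ne_top]
      exact (ENNReal.mul_lt_top hx ENNReal.ofReal_lt_top).ne
    · rw [← ofReal_norm, ← ENNReal.ofReal_mul (norm_nonneg _)]
      exact ENNReal.ofReal_le_ofReal ((G s x).le_opNorm v)
  -- Where the integral of the norms diverges the bound is infinite, so nothing is to be proved.
  · rw [not_lt, top_le_iff] at hx
    rw [hx]
    exact le_top

/-- Where the family is not integrable in `s`, the Bochner integral is `0` by convention, so the
form is the indicator of the measurable set of convergence times a measurable integral. -/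
lemma MeasAlong.measForm_integralForm : MeasForm (integralForm μ G) := by
  intro v
  classical
  have hN : MeasurableSet {x : M | ∫⁻ s, ‖G s x‖ₑ ∂μ < ⊤} :=
    measurableSet_lt (hG.measurable_enorm.lintegral_prod_left') measurable_const
  have h1 : StronglyMeasurable fun x : M => ∫ s, G s x (fun i => frame x (v i)) ∂μ :=
    StronglyMeasurable.integral_prod_left' (f := fun q : ℝ × M => G q.1 q.2 fun i => frame q.2 (v i))
      (hG v).stronglyMeasurable
  have h2 : (fun x : M => integralForm μ G x (fun i => frame x (v i))) =
      {x : M | ∫⁻ s, ‖G s x‖ₑ ∂μ < ⊤}.indicator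
        fun x : M => ∫ s, G s x (fun i => frame x (v i)) ∂μ := by
    funext x
    by_cases hx : ∫⁻ s, ‖G s x‖ₑ ∂μ < ⊤
    · rw [indicator_of_mem (by exact hx)]
      exact hG.apply_integralForm hx (ContinuousAlternatingMap.apply ℝ (𝕋 n x) ℝ
        fun i => frame x (v i))
    · rw [indicator_of_notMem (by exact hx)]
      have : ¬ Integrable (fun s => inFrame (G s x)) μ := by
        refine fun h => hx ?_
        obtain ⟨C, hC, hb⟩ := exists_bound_comp (V := 𝕋 n x) (W := 𝔼 n) k
          (coframe x)
        refine lt_of_le_of_lt (b := ENNReal.ofReal C * ∫⁻ s, ‖inFrame (G s x)‖ₑ ∂μ) ?_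
          (ENNReal.mul_lt_top ENNReal.ofReal_lt_top h.2)
        rw [← lintegral_const_mul' _ _ ENNReal.ofReal_ne_top]
        refine lintegral_mono fun s => ?_
        rw [← ofReal_norm, ← ofReal_norm, ← ENNReal.ofReal_mul hC]
        refine ENNReal.ofReal_le_ofReal (le_of_eq_of_le ?_ (hb (inFrame (G s x))))
        congr 1
        ext v
        simp [inFrame, frame_coframe, Function.comp_def]
      rw [integralForm, integral_undef this]
      rfl
  rw [h2]
  exact h1.measurable.indicator hN

/-- Fubini for the pairing with an integral of forms. -/
lemma MeasAlong.pairing_integralForm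
    (hfin : ∀ K : Set M, IsCompact K → ∫⁻ s, ∫⁻ x in K, ‖G s x‖ₑ ∂(riemannianVolume n M) ∂μ < ⊤)
    (Y : testFields n M k) :
    pairing (integralForm μ G) Y = ∫ s, pairing (G s) Y ∂μ := by
  obtain ⟨K, hK, hY⟩ := Y.2.2
  obtain ⟨D, hD, hD'⟩ := exists_bound_field Y
  have h0 : ∀ (θ : DiffForm n M k) x, x ∉ K → Y.1 x (θ x) = 0 := fun θ x hx => by
    rw [hY x hx]
    rfl
  have hp : ∀ θ : DiffForm n M k, pairing θ Y = ∫ x in K, Y.1 x (θ x) ∂(riemannianVolume n M) :=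
    fun θ => (setIntegral_eq_integral_of_forall_compl_eq_zero (h0 θ)).symm
  simp only [hp]
  have hm : Measurable fun q : ℝ × M => Y.1 q.2 (G q.1 q.2) :=
    MeasAlong.field measurable_snd hG fun z => (Y.2.1 z).continuousOn
  have hint : Integrable (Function.uncurry fun s x => Y.1 x (G s x))
      (μ.prod ((riemannianVolume n M).restrict K)) := by
    refine ⟨hm.aestronglyMeasurable, ?_⟩
    rw [HasFiniteIntegral]
    simp only [Function.uncurry_def]
    rw [lintegral_prod _ hm.enorm.aemeasurable]
    refine lt_of_le_of_lt (b := ∫⁻ s, ENNReal.ofReal D *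
      ∫⁻ x in K, ‖G s x‖ₑ ∂(riemannianVolume n M) ∂μ) ?_ ?_
    · refine lintegral_mono fun s => ?_
      rw [← lintegral_const_mul' _ _ ENNReal.ofReal_ne_top]
      refine lintegral_mono fun x => ?_
      rw [← ofReal_norm, ← ofReal_norm, ← ENNReal.ofReal_mul hD]
      exact ENNReal.ofReal_le_ofReal (hD' x _)
    · rw [lintegral_const_mul' _ _ ENNReal.ofReal_ne_top]
      exact ENNReal.mul_lt_top ENNReal.ofReal_lt_top (hfin K hK)
  rw [integral_integral_swap hint]
  refine integral_congr_ae ?_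
  have hae : ∀ᵐ x ∂((riemannianVolume n M).restrict K), ∫⁻ s, ‖G s x‖ₑ ∂μ < ⊤ := by
    refine ae_lt_top (hG.measurable_enorm.lintegral_prod_left') ?_
    rw [lintegral_lintegral_swap hG.measurable_enorm.aemeasurable.prod_swap]
    exact (hfin K hK).ne
  filter_upwards [hae] with x hx
  exact hG.apply_integralForm hx (Y.1 x)

end Integral

/-- A bound of contraction type on the pull-backs of a form. -/
def PullbackBound (φ : ℝ → M → M) (p C η : ℝ) (γ : DiffForm n M k) : Prop :=
  ∀ t : ℝ, 0 ≤ t → ∀ x, ‖pullbackForm (φ t) γ x‖ ≤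
    C * Real.exp (-η * t) * (jacobian (𝒟 n (φ t) x) ^ (1 / p) * ‖γ (φ t x)‖)

lemma IsContracting.pullbackBound_inter (h : IsContracting φ ξ k p) :
    ∃ C η : ℝ, 0 ≤ C ∧ 0 < η ∧ ∀ γ : DiffForm n M (k + 1),
      PullbackBound φ p C η (interForm ξ γ) := by
  obtain ⟨C, η, hη, h⟩ := h
  refine ⟨|C|, η, abs_nonneg C, hη, fun γ t ht x => ?_⟩
  refine (norm_pullback_inter_le h γ ht x).trans ?_
  rw [mul_assoc]
  refine mul_le_mul_of_nonneg_right ?_ (mul_nonneg (Real.rpow_nonneg (jacobian_nonneg _) _)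
    (norm_nonneg (E := (𝕋 n (φ t x)) [⋀^Fin k]→L[ℝ] ℝ) _))
  exact mul_le_mul_of_nonneg_right (le_abs_self C) (Real.exp_nonneg _)

lemma PullbackBound.enorm_le {C η : ℝ} (hC : 0 ≤ C) {γ : DiffForm n M k}
    (h : PullbackBound φ p C η γ) {t : ℝ} (ht : 0 ≤ t) (x : M) :
    ‖pullbackForm (φ t) γ x‖ₑ ≤ ENNReal.ofReal C * (ENNReal.ofReal (Real.exp (-η * t)) *
      (ENNReal.ofReal (jacobian (𝒟 n (φ t) x) ^ (1 / p)) * ‖γ (φ t x)‖ₑ)) := by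
  rw [← ofReal_norm, ← ofReal_norm, ← ENNReal.ofReal_mul (Real.rpow_nonneg (jacobian_nonneg _) _),
    ← ENNReal.ofReal_mul (Real.exp_nonneg _), ← ENNReal.ofReal_mul hC, ← mul_assoc]
  exact ENNReal.ofReal_le_ofReal (h t ht x)

/-- The finite measure `e^{-η s} ds` on the half-line. -/
def expMeasure (η : ℝ) : Measure ℝ :=
  (volume.restrict (Ioi 0)).withDensity fun s => ENNReal.ofReal (Real.exp (-η * s))

lemma measurable_exp_weight (η : ℝ) : Measurable fun s : ℝ => ENNReal.ofReal (Real.exp (-η * s)) := by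
  fun_prop

lemma expMeasure_univ_lt_top {η : ℝ} (hη : 0 < η) : expMeasure η univ < ⊤ := by
  rw [expMeasure, withDensity_apply _ MeasurableSet.univ, Measure.restrict_univ]
  have h := (exp_neg_integrableOn_Ioi 0 hη).2
  refine lt_of_le_of_lt (lintegral_mono fun s => ?_) h
  rw [← ofReal_norm]
  exact ENNReal.ofReal_le_ofReal (le_abs_self _)

lemma lintegral_expMeasure (η : ℝ) {f : ℝ → ℝ≥0∞} (hf : Measurable f) :
    ∫⁻ s, f s ∂(expMeasure η) = ∫⁻ s in Ioi 0, ENNReal.ofReal (Real.exp (-η * s)) * f s :=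
  lintegral_withDensity_eq_lintegral_mul _ (measurable_exp_weight η) hf

instance (η : ℝ) : SFinite (expMeasure η) := by
  unfold expMeasure
  infer_instance

/-- Hölder against the constant `1`. Applied to the finite measure `e^{-ηs} ds`, it replaces
Minkowski's integral inequality. -/
lemma lintegral_rpow_le_measure_univ {T : Type*} [MeasurableSpace T] {μ : Measure T} {f : T → ℝ≥0∞}
    (hf : AEMeasurable f μ) (hp : 1 < p) :
    (∫⁻ t, f t ∂μ) ^ p ≤ μ univ ^ (p - 1) * ∫⁻ t, f t ^ p ∂μ := by
  have h0 : 0 < p := by linarith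
  have hpq : p.HolderConjugate p.conjExponent := Real.HolderConjugate.conjExponent hp
  have h := ENNReal.lintegral_mul_le_Lp_mul_Lq μ hpq hf (aemeasurable_const (b := 1))
  simp only [Pi.mul_apply, mul_one, ENNReal.one_rpow, lintegral_const, one_mul] at h
  refine (ENNReal.rpow_le_rpow h h0.le).trans_eq ?_
  rw [ENNReal.mul_rpow_of_nonneg _ _ h0.le, ← ENNReal.rpow_mul, ← ENNReal.rpow_mul,
    one_div_mul_cancel h0.ne', ENNReal.rpow_one, mul_comm]
  congr 2
  rw [one_div, ← hpq.one_sub_inv, sub_mul, one_mul, inv_mul_cancel₀ h0.ne']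

section Flow

variable (hφ : IsFlowOf φ ξ) (hp : 1 < p) {C η : ℝ} (hC : 0 ≤ C) (hη : 0 < η)
  {γ : DiffForm n M k} (hγ : MeasForm γ) (hγp : lpNorm p γ < ⊤) (h : PullbackBound φ p C η γ)

include hφ hγ in
lemma IsFlowOf.measurable_weight_joint (p : ℝ) : Measurable fun q : ℝ × M =>
    ENNReal.ofReal (jacobian (𝒟 n (φ q.1) q.2) ^ (1 / p)) *
      ‖γ (φ q.1 q.2)‖ₑ := by
  have h := (hγ.norm.comp hφ.smooth.continuous.measurable).enorm
  simp only [Function.comp_def, enorm_norm] at h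
  exact (hφ.continuous_jacobian.measurable.pow_const _).ennreal_ofReal.mul h

include hφ hp hC hη hγ hγp h

lemma PullbackBound.lintegral_lt_top {K : Set M} (hK : IsCompact K) :
    ∫⁻ s in Ioi 0, ∫⁻ x in K, ‖pullbackForm (φ s) γ x‖ₑ ∂(riemannianVolume n M) < ⊤ := by
  have hfin : lpNorm p γ * volFactor n p K < ⊤ := ENNReal.mul_lt_top hγp (volFactor_lt_top hp hK)
  calc _ ≤ ∫⁻ s in Ioi 0, ENNReal.ofReal (Real.exp (-η * s)) *
        (ENNReal.ofReal C * (lpNorm p γ * volFactor n p K)) := by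
        refine setLIntegral_mono' measurableSet_Ioi fun s hs => ?_
        calc _ ≤ ∫⁻ x in K, ENNReal.ofReal C * (ENNReal.ofReal (Real.exp (-η * s)) *
              (ENNReal.ofReal (jacobian (𝒟 n (φ s) x) ^ (1 / p)) *
                ‖γ (φ s x)‖ₑ)) ∂(riemannianVolume n M) :=
              lintegral_mono fun x => h.enorm_le hC (le_of_lt hs) x
          _ ≤ _ := by
              rw [lintegral_const_mul' _ _ ENNReal.ofReal_ne_top,
                lintegral_const_mul' _ _ ENNReal.ofReal_ne_top, mul_left_comm]
              gcongr
              exact hφ.setLIntegral_weight_le hp hγ s hK.measurableSet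
    _ = expMeasure η univ * (ENNReal.ofReal C * (lpNorm p γ * volFactor n p K)) := by
        rw [lintegral_mul_const _ (measurable_exp_weight η), expMeasure,
          withDensity_apply _ MeasurableSet.univ, Measure.restrict_univ]
    _ < ⊤ := ENNReal.mul_lt_top (expMeasure_univ_lt_top hη)
        (ENNReal.mul_lt_top ENNReal.ofReal_lt_top hfin)

/-- The decay is absorbed into the finite measure `e^{-ηs} ds`. Hölder puts the power `p` inside the
time integral, Tonelli exchanges the integrals, and for each `s` the integral over `M` is that of
`‖γ‖ₑ ^ p`, independently of `s`. -/
lemma PullbackBound.lpNorm_integralForm_lt_top :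
    lpNorm p (integralForm (volume.restrict (Ioi 0)) fun s => pullbackForm (φ s) γ) < ⊤ := by
  have h0 : 0 < p := by linarith
  set w : ℝ × M → ℝ≥0∞ := fun q => ENNReal.ofReal (jacobian (𝒟 n (φ q.1) q.2) ^
    (1 / p)) * ‖γ (φ q.1 q.2)‖ₑ with hw
  have hwm : Measurable w := hφ.measurable_weight_joint hγ p
  have h1 : ∀ x, ‖integralForm (volume.restrict (Ioi 0)) (fun s => pullbackForm (φ s) γ) x‖ₑ ^ p ≤
      (ENNReal.ofReal C ^ p * expMeasure η univ ^ (p - 1)) *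
        ∫⁻ s, w (s, x) ^ p ∂(expMeasure η) := by
    intro x
    have h2 : ∫⁻ s in Ioi 0, ‖pullbackForm (φ s) γ x‖ₑ ≤
        ENNReal.ofReal C * ∫⁻ s, w (s, x) ∂(expMeasure η) := by
      rw [lintegral_expMeasure η (f := fun s => w (s, x)) (hwm.comp measurable_prodMk_right),
        ← lintegral_const_mul' _ _ ENNReal.ofReal_ne_top]
      exact setLIntegral_mono' measurableSet_Ioi fun s hs => h.enorm_le hC (le_of_lt hs) x
    refine (ENNReal.rpow_le_rpow ((MeasAlong.enorm_integralForm_le (MeasForm.pullback hφ hγ) x).trans h2) h0.le).trans ?_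
    rw [ENNReal.mul_rpow_of_nonneg _ _ h0.le, mul_assoc]
    gcongr
    exact lintegral_rpow_le_measure_univ (hwm.comp measurable_prodMk_right).aemeasurable hp
  rw [lpNorm_eq hp]
  refine ENNReal.rpow_lt_top_of_nonneg (by positivity) (lt_of_le_of_lt (lintegral_mono h1) ?_).ne
  have hE := expMeasure_univ_lt_top hη
  rw [lintegral_const_mul' _ _ (ENNReal.mul_ne_top (ENNReal.rpow_ne_top_of_nonneg h0.le
    ENNReal.ofReal_ne_top) (ENNReal.rpow_ne_top_of_nonneg (by linarith) hE.ne)),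
    lintegral_lintegral_swap (hwm.pow_const p).aemeasurable.prod_swap]
  refine ENNReal.mul_lt_top (ENNReal.mul_lt_top (ENNReal.rpow_lt_top_of_nonneg h0.le
    ENNReal.ofReal_ne_top) (ENNReal.rpow_lt_top_of_nonneg (by linarith) hE.ne)) ?_
  simp only [hw, hφ.lintegral_rpow_comp hp, lintegral_const]
  refine ENNReal.mul_lt_top ?_ hE
  rw [lpNorm_eq hp] at hγp
  by_contra htop
  rw [not_lt, top_le_iff] at htop
  rw [htop, ENNReal.top_rpow_of_pos (by positivity)] at hγp
  exact hγp.false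

/-- The integral of the pull-backs, paired with a test field. -/
lemma PullbackBound.pairing_integralForm (Y : testFields n M k) :
    pairing (integralForm (volume.restrict (Ioi 0)) fun s => pullbackForm (φ s) γ) Y =
      ∫ s in Ioi 0, pairing (pullbackForm (φ s) γ) Y :=
  MeasAlong.pairing_integralForm (MeasForm.pullback hφ hγ)
    (fun _ hK => h.lintegral_lt_top hφ hp hC hη hγ hγp hK) Y

lemma PullbackBound.integrable_pairing (Y : testFields n M k) :
    IntegrableOn (fun s => pairing (pullbackForm (φ s) γ) Y) (Ioi 0) := by
  obtain ⟨K, hK, hY⟩ := Y.2.2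
  obtain ⟨D, hD, hD'⟩ := exists_bound_field Y
  refine Integrable.mono' (g := fun s => Real.exp (-η * s) *
    (D * C * ((lpNorm p γ).toReal * (volFactor n p K).toReal)))
    ((exp_neg_integrableOn_Ioi 0 hη).mul_const _)
    (hφ.continuous_pairing (LocIntForm.of_lp hp hγ hγp) Y).aestronglyMeasurable ?_
  filter_upwards [ae_restrict_mem measurableSet_Ioi] with s hs
  rw [Real.norm_eq_abs, ← mul_assoc]
  refine hφ.abs_pairing_le hp hγ hγp s hK hY
    (mul_nonneg (Real.exp_nonneg _) (mul_nonneg hD hC)) fun x _ => ?_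
  refine (hD' x _).trans ((mul_le_mul_of_nonneg_left (h s (le_of_lt hs) x) hD).trans_eq ?_)
  ring

end Flow

lemma pairing_congr {θ θ' : DiffForm n M k} (h : ∀ᵐ x ∂(riemannianVolume n M), θ x = θ' x)
    (X : testFields n M k) : pairing θ X = pairing θ' X := by
  refine integral_congr_ae ?_
  filter_upwards [h] with x hx
  rw [hx]

lemma IsFlowOf.pairing_pullback_congr (hφ : IsFlowOf φ ξ) {θ θ' : DiffForm n M k}
    (h : ∀ᵐ x ∂(riemannianVolume n M), θ x = θ' x) (s : ℝ) (X : testFields n M k) :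
    pairing (pullbackForm (φ s) θ) X = pairing (pullbackForm (φ s) θ') X := by
  rw [hφ.pairing_pullback, hφ.pairing_pullback, pairing_congr h]

lemma pairing_zero_left (X : testFields n M k) : pairing 0 X = 0 := by
  have h : ∀ x, X.1 x ((0 : DiffForm n M k) x) = 0 := fun x => map_zero _
  rw [pairing]
  simp only [h, integral_zero]

lemma pairing_neg_left (θ : DiffForm n M k) (X : testFields n M k) :
    pairing (-θ) X = - pairing θ X := by
  rw [pairing, pairing, ← integral_neg]
  exact integral_congr_ae (Eventually.of_forall fun x => map_neg _ _)

lemma IsFlowOf.pullback_inter_zero (s : ℝ) (X : testFields n M k) :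
    pairing (pullbackForm (φ s) (interForm ξ (0 : DiffForm n M (k + 1)))) X = 0 := by
  have h : pullbackForm (φ s) (interForm ξ (0 : DiffForm n M (k + 1))) = 0 := by
    funext x
    ext v
    rfl
  rw [h, pairing_zero_left]

/-- The derivative of the pull-backs of a closed form along the flow. -/
lemma IsFlowOf.hasDerivAt_pairing_of_closed (hφ : IsFlowOf φ ξ) {γ : DiffForm n M (k + 1)}
    (hγ : LocIntForm γ) (hd : IsDifferential (pairing γ) fun _ => 0) {X : testFields n M (k + 1)}
    {Y : testFields n M k} (hXY : IsTranspose X Y) (s : ℝ) :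
    HasDerivAt (fun s => pairing (pullbackForm (φ s) γ) X)
      (pairing (pullbackForm (φ s) (interForm ξ γ)) Y) s := by
  have hd' : IsDifferential (pairing γ) (pairing (0 : DiffForm n M (k + 2))) := fun X Y h => by
    rw [pairing_zero_left]
    exact hd X Y h
  have h := hφ.hasDerivAt_pairing_of_isDifferential hγ hd' hXY s
  rwa [IsFlowOf.pullback_inter_zero, add_zero] at h

lemma IsFlowOf.pullback_zero_time (hφ : IsFlowOf φ ξ) (γ : DiffForm n M k) :
    pullbackForm (φ 0) γ = γ := by
  have h0 : φ 0 = id := funext hφ.zero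
  funext x
  rw [h0]
  ext v
  change γ x _ = γ x v
  congr 1
  funext i
  simp [mfderiv_id]

lemma norm_le_of_iteratedFDeriv {V W : Type*} [NormedAddCommGroup V] [NormedSpace ℝ V]
    [NormedAddCommGroup W] [NormedSpace ℝ W] {f : V → W} {y : V} {B : ℝ}
    (h : ‖iteratedFDeriv ℝ 0 f y‖ ≤ B) : ‖f y‖ ≤ B := by
  rwa [norm_iteratedFDeriv_zero] at h

lemma norm_fderiv_le_of_iteratedFDeriv {V W : Type*} [NormedAddCommGroup V] [NormedSpace ℝ V]
    [NormedAddCommGroup W] [NormedSpace ℝ W] {f : V → W} {y : V} {B : ℝ}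
    (h : ‖iteratedFDeriv ℝ 1 f y‖ ≤ B) (e : V) : ‖fderiv ℝ f y e‖ ≤ B * ‖e‖ := by
  rw [norm_iteratedFDeriv_one] at h
  exact (ContinuousLinearMap.le_opNorm _ _).trans (mul_le_mul_of_nonneg_right h (norm_nonneg e))

/-- The homotopy form of a closed form. -/
def homotopyForm (φ : ℝ → M → M) (ξ : (x : M) → 𝕋 n x)
    (θ : DiffForm n M (k + 1)) : DiffForm n M k :=
  integralForm (volume.restrict (Ioi 0)) fun s => pullbackForm (φ s) (interForm ξ θ)

section Limit

variable (hφ : IsFlowOf φ ξ) (hp : 1 < p) {C η : ℝ} (hC : 0 ≤ C) (hη : 0 < η)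
  {θ : DiffForm n M (k + 1)} (hθ : MeasForm θ) (hθp : lpNorm p θ < ⊤)
  (hγp : lpNorm p (interForm ξ θ) < ⊤) (h : PullbackBound φ p C η (interForm ξ θ))
  (hd : IsDifferential (pairing θ) fun _ => 0)

include hφ hp hC hη hθ hθp hγp h hd

/-- The derivative in `t` of the pairing is integrable on the half-line, so the limit exists; the
integral of the derivative is, by Fubini, the pairing of the homotopy form with `Y`. -/
lemma IsFlowOf.tendsto_pairing {X : testFields n M (k + 1)} {Y : testFields n M k}
    (hXY : IsTranspose X Y) : Tendsto (fun t => pairing (pullbackForm (φ t) θ) X) atTop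
      (𝓝 (pairing θ X + pairing (homotopyForm φ ξ θ) Y)) := by
  have hγ := hθ.inter hφ.isSmoothVec
  have hder := hφ.hasDerivAt_pairing_of_closed (LocIntForm.of_lp hp hθ hθp) hd hXY
  have hint := h.integrable_pairing hφ hp hC hη hγ hγp Y
  have hlim := tendsto_limUnder_of_hasDerivAt_of_integrableOn_Ioi (a := 0)
    (fun s _ => hder s) hint
  have h2 := integral_Ioi_of_hasDerivAt_of_tendsto' (fun s _ => hder s) hint hlim
  rw [homotopyForm, h.pairing_integralForm hφ hp hC hη hγ hγp, h2, hφ.pullback_zero_time,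
    add_sub_cancel]
  exact hlim

lemma IsFlowOf.locIntForm_homotopyForm : LocIntForm (homotopyForm φ ξ θ) :=
  LocIntForm.of_lp hp (MeasAlong.measForm_integralForm
    (MeasForm.pullback hφ (hθ.inter hφ.isSmoothVec)))
    (h.lpNorm_integralForm_lt_top hφ hp hC hη (hθ.inter hφ.isSmoothVec) hγp)

/-- The functional is defined through an arbitrary choice of transpose `Y`; as its value is a limit
of pairings that do not involve `Y`, it is linear and independent of the choice. -/
lemma IsFlowOf.exists_distForm : ∃ T : DistForm n M (k + 1), ∀ X Y, IsTranspose X Y →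
    T.toLinearMap X = pairing θ X + pairing (homotopyForm φ ξ θ) Y := by
  classical
  choose Y hY using fun X : testFields n M (k + 1) => exists_transpose X
  have hlim := fun {X Y} hXY => hφ.tendsto_pairing hp hC hη hθ hθp hγp h hd (X := X) (Y := Y) hXY
  have hθl := LocIntForm.of_lp hp hθ hθp
  have hβl := hφ.locIntForm_homotopyForm hp hC hη hθ hθp hγp h hd
  let T : testFields n M (k + 1) →ₗ[ℝ] ℝ :=
    { toFun := fun X => pairing θ X + pairing (homotopyForm φ ξ θ) (Y X)
      map_add' := fun X X' => by
        refine tendsto_nhds_unique (hlim (hY (X + X'))) ?_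
        refine ((hlim (hY X)).add (hlim (hY X'))).congr fun t => ?_
        simp only [hφ.pairing_pullback]
        rw [pushTest_add, hθl.pairing_add]
      map_smul' := fun c X => by
        refine tendsto_nhds_unique (hlim (hY (c • X))) ?_
        refine ((hlim (hY X)).const_mul c).congr fun t => ?_
        simp only [hφ.pairing_pullback]
        rw [pushTest_smul, pairing_const_smul] }
  have hT : ∀ X Y', IsTranspose X Y' → T X = pairing θ X + pairing (homotopyForm φ ξ θ) Y' :=
    fun X Y' h' => tendsto_nhds_unique (hlim (hY X)) (hlim h')
  refine ⟨⟨T, fun x₀ K hK hKt => ?_⟩, hT⟩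
  obtain ⟨C₀, hC₀, hb₀⟩ := exists_bound_of_coordField (n := n) (M := M) hK hKt (k + 1)
  obtain ⟨C₁, hC₁, hb₁⟩ := exists_bound_of_coordField (n := n) (M := M) hK hKt k
  obtain ⟨C₂, hC₂, hb₂⟩ := exists_transpose_chart (n := n) (M := M) hK hKt k
  have hL := isCompact_symm_image (n := n) hK hKt
  set L := (ℰ n x₀).symm '' K with hLdef
  -- One derivative suffices: `θ` is paired with the field itself and the homotopy form with the
  -- transpose, which involves first derivatives of the field.
  refine ⟨1, C₀ * (∫ x in L, ‖θ x‖ ∂(riemannianVolume n M)) +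
    C₁ * C₂ * ∫ x in L, ‖homotopyForm φ ξ θ x‖ ∂(riemannianVolume n M), fun X B hX hB => ?_⟩
  -- When `K` is empty nothing forces `B` to be nonnegative, so this case is treated apart.
  rcases K.eq_empty_or_nonempty with rfl | ⟨y₀, hy₀⟩
  · have hX0 : X = 0 := by
      refine Subtype.ext (funext fun x => hX x ?_)
      simp [hLdef]
    have hL0 : L = ∅ := by simp [hLdef]
    change |T X| ≤ _
    rw [hX0, map_zero, hL0]
    simp
  have hB0 : 0 ≤ B := (norm_nonneg _).trans (hB 0 (by norm_num) y₀ hy₀)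
  have hX0 : ∀ y ∈ K, ‖coordField x₀ X.1 y‖ ≤ B := fun y hy => by
    exact norm_le_of_iteratedFDeriv (hB 0 (by norm_num) y hy)
  have hX1 : ∀ y ∈ K, ∀ e, ‖fderiv ℝ (coordField x₀ X.1) y e‖ ≤ B * ‖e‖ := fun y hy e => by
    exact norm_fderiv_le_of_iteratedFDeriv (hB 1 le_rfl y hy) e
  obtain ⟨Y', hXY, hY0, hYB⟩ := hb₂ X hX
  change |T X| ≤ _
  rw [hT X Y' hXY]
  refine (abs_add_le _ _).trans ?_
  rw [add_mul]
  refine add_le_add ?_ ?_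
  · refine (hθl.abs_pairing_le hL hX (hb₀ X.1 B hX hB0 hX0)).trans_eq ?_
    ring
  · refine (hβl.abs_pairing_le hL hY0 (hb₁ Y'.1 (C₂ * B) hY0 (by positivity)
      (hYB B hB0 hX0 hX1))).trans_eq ?_
    ring

end Limit

lemma lpNorm_neg (θ : DiffForm n M k) : lpNorm p (-θ) = lpNorm p θ := by
  rw [lpNorm, lpNorm]
  congr 1
  funext x
  exact norm_neg (E := (𝕋 n x) [⋀^Fin k]→L[ℝ] ℝ) _

/-- The boundary value of a closed form for a contracting vector field. -/
theorem IsFlowOf.exists_boundaryValue (hφ : IsFlowOf φ ξ) (hξ : ∃ B : ℝ, ∀ x, ‖ξ x‖ ≤ B)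
    (hp : 1 < p) (hc : IsContracting φ ξ k p) {θ : DiffForm n M (k + 1)}
    (hθ : θ ∈ lpClosed n M p (k + 1)) :
    ∃ T : DistForm n M (k + 1), IsBoundaryValue φ θ T ∧
      ∃ β : DiffForm n M k, IsLpForm p β ∧ IsDifferential (pairing β)
        (fun X => pairing θ X - T.toLinearMap X) := by
  obtain ⟨B, hB⟩ := hξ
  obtain ⟨θ', hm, hL, hae⟩ := hθ.1.exists_rep
  obtain ⟨C, η, hC, hη, h⟩ := hc.pullbackBound_inter
  have hd : IsDifferential (pairing θ') fun _ => 0 := fun X Y hXY => by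
    rw [← pairing_congr hae]
    exact hθ.2 X Y hXY
  have hγp := lpNorm_inter_lt_top hB hL.2
  obtain ⟨T, hT⟩ := hφ.exists_distForm hp hC hη hm hL.2 hγp (h θ') hd
  -- The minus sign comes from `θ_∞ = θ + d(homotopyForm)`.
  refine ⟨T, fun X => ?_, -homotopyForm φ ξ θ', ?_, fun X Y hXY => ?_⟩
  · obtain ⟨Y, hY⟩ := exists_transpose X
    rw [hT X Y hY]
    simp only [hφ.pairing_pullback_congr hae]
    exact hφ.tendsto_pairing hp hC hη hm hL.2 hγp (h θ') hd hY
  · have h1 : MeasForm (homotopyForm φ ξ θ') := MeasAlong.measForm_integralForm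
      (MeasForm.pullback hφ (hm.inter hφ.isSmoothVec))
    refine MeasForm.isLpForm (fun v => (h1 v).neg) ?_
    rw [lpNorm_neg]
    exact (h θ').lpNorm_integralForm_lt_top hφ hp hC hη (hm.inter hφ.isSmoothVec) hγp
  · beta_reduce
    rw [hT X Y hXY, pairing_congr hae, pairing_neg_left]
    ring

end Estimates

/-! ### From forms annihilated by a vector to all forms, by compactness. -/

section LinearBound

variable {V W Z : Type*} [NormedAddCommGroup V] [NormedSpace ℝ V] [NormedAddCommGroup W]
  [NormedSpace ℝ W] [FiniteDimensional ℝ W] [TopologicalSpace Z] {k : ℕ}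

/-- A bound on the pull-backs of the forms annihilated by a vector extends to all forms and to
nearby maps, up to a multiple of the interior product. -/
lemma eventually_norm_comp_le {E : Z → V →L[ℝ] W} {w : Z → W} {a : Z → ℝ} {z₀ : Z}
    (hE : ContinuousAt E z₀) (hw : ContinuousAt w z₀) (ha : ContinuousAt a z₀) (ha0 : 0 < a z₀)
    (h : ∀ b : W [⋀^Fin (k + 1)]→L[ℝ] ℝ, inter (w z₀) b = 0 →
      ‖b.compContinuousLinearMap (E z₀)‖ ≤ a z₀ * ‖b‖) :
    ∃ K, 0 ≤ K ∧ ∀ᶠ z in 𝓝 z₀, ∀ b : W [⋀^Fin (k + 1)]→L[ℝ] ℝ,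
      ‖b.compContinuousLinearMap (E z)‖ ≤ 3 / 2 * a z * ‖b‖ + K * ‖inter (w z) b‖ := by
  let S : Set (Z × (W [⋀^Fin (k + 1)]→L[ℝ] ℝ)) := {z₀} ×ˢ Metric.sphere 0 1
  have hG : ∀ b, ContinuousAt (fun q : Z × (W [⋀^Fin (k + 1)]→L[ℝ] ℝ) =>
      ‖q.2.compContinuousLinearMap (E q.1)‖) (z₀, b) := fun b => by
    have h1 : ContinuousAt (fun q : Z × (W [⋀^Fin (k + 1)]→L[ℝ] ℝ) =>
        ContinuousAlternatingMap.compContinuousLinearMapCLM (F := ℝ) (ι := Fin (k + 1)) (E q.1) q.2)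
        (z₀, b) :=
      ((ContinuousAlternatingMap.continuous_compContinuousLinearMapCLM.continuousAt).comp
        (hE.comp (f := Prod.fst) (x := (z₀, b)) continuousAt_fst)).clm_apply continuousAt_snd
    exact h1.norm
  have hN : ∀ b, ContinuousAt (fun q : Z × (W [⋀^Fin (k + 1)]→L[ℝ] ℝ) =>
      ‖inter (w q.1) q.2‖) (z₀, b) := fun b => by
    have h1 : ContinuousAt (fun q : Z × (W [⋀^Fin (k + 1)]→L[ℝ] ℝ) =>
        interCLM W k (w q.1) q.2) (z₀, b) :=
      ((interCLM W k).continuous.continuousAt.comp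
        (hw.comp (f := Prod.fst) (x := (z₀, b)) continuousAt_fst)).clm_apply continuousAt_snd
    exact h1.norm
  -- Compactness of the unit sphere of forms: each unit form has a constant that works for nearby
  -- forms and nearby parameters.
  obtain ⟨K, hK, hKS⟩ := exists_bound_of_locally (Q := S)
    (P := fun q K => ∀ᶠ q' in 𝓝 q, ‖q'.2.compContinuousLinearMap (E q'.1)‖ ≤
      3 / 2 * a q'.1 + K * ‖inter (w q'.1) q'.2‖)
    (isCompact_singleton.prod (isCompact_sphere _ _)) (by
      intro q C C' hC hq
      filter_upwards [hq] with q' hq'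
      exact hq'.trans (by gcongr)) (by
      rintro ⟨z, b⟩ ⟨rfl, hb⟩
      rw [mem_sphere_zero_iff_norm] at hb
      simp only [eventually_eventually_nhds]
      have ha' : ContinuousAt (fun q : Z × (W [⋀^Fin (k + 1)]→L[ℝ] ℝ) => a q.1) (z, b) :=
        ha.comp (f := Prod.fst) (x := (z, b)) continuousAt_fst
      -- If the contraction vanishes, the hypothesis holds with constant `1`, and the slack up to
      -- `3/2` persists nearby. Otherwise the contraction stays bounded below, and a large multiple
      -- of it dominates.
      by_cases h0 : inter (w z) b = 0
      · refine ⟨0, ?_⟩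
        have h1 : ‖b.compContinuousLinearMap (E z)‖ < 3 / 2 * a z := by
          have := h b h0
          rw [hb, mul_one] at this
          linarith
        filter_upwards [(hG b).eventually_lt (continuousAt_const.mul ha') h1] with q' hq'
        rw [zero_mul, add_zero]
        exact hq'.le
      · have hc : 0 < ‖inter (w z) b‖ := norm_pos_iff.2 h0
        refine ⟨(‖b.compContinuousLinearMap (E z)‖ + 1) / (‖inter (w z) b‖ / 2), ?_⟩
        filter_upwards [(hG b).eventually_lt continuousAt_const (lt_add_one _),
          continuousAt_const.eventually_lt (hN b) (half_lt_self hc),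
          continuousAt_const.eventually_lt ha' ha0] with q' h1 h2 h3
        have h4 : ‖b.compContinuousLinearMap (E z)‖ + 1 ≤
            (‖b.compContinuousLinearMap (E z)‖ + 1) / (‖inter (w z) b‖ / 2) *
              ‖inter (w q'.1) q'.2‖ := by
          rw [div_mul_eq_mul_div, le_div_iff₀ (by positivity)]
          gcongr
        linarith)
  refine ⟨K, hK, ?_⟩
  have hev := (isCompact_sphere (0 : W [⋀^Fin (k + 1)]→L[ℝ] ℝ) 1).eventually_forall_of_forall_eventually
    (x₀ := z₀) (P := fun z b => ‖b.compContinuousLinearMap (E z)‖ ≤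
      3 / 2 * a z + K * ‖inter (w z) b‖) fun b hb => hKS (z₀, b) ⟨rfl, hb⟩
  filter_upwards [hev] with z hz b
  rcases eq_or_ne b 0 with rfl | hb
  · have h1 : (0 : W [⋀^Fin (k + 1)]→L[ℝ] ℝ).compContinuousLinearMap (E z) = 0 := rfl
    rw [h1, norm_zero, norm_zero, mul_zero, zero_add]
    positivity
  · have hb' : ‖b‖ ≠ 0 := norm_ne_zero_iff.2 hb
    have hpos : 0 < ‖b‖ := norm_pos_iff.2 hb
    have h1 := hz (‖b‖⁻¹ • b) (by
      rw [mem_sphere_zero_iff_norm, norm_smul, norm_inv, norm_norm, inv_mul_cancel₀ hb'])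
    have h2 : (‖b‖⁻¹ • b).compContinuousLinearMap (E z) =
      ‖b‖⁻¹ • b.compContinuousLinearMap (E z) := rfl
    have h3 : inter (w z) (‖b‖⁻¹ • b) = ‖b‖⁻¹ • inter (w z) b := by
      simp only [← interCLM_apply, map_smul]
    rw [h2, h3, norm_smul, norm_smul, norm_inv, norm_norm] at h1
    calc _ = ‖b‖ * (‖b‖⁻¹ * ‖b.compContinuousLinearMap (E z)‖) := by field_simp
      _ ≤ ‖b‖ * (3 / 2 * a z + K * (‖b‖⁻¹ * ‖inter (w z) b‖)) := by gcongr
      _ = _ := by field_simp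

end LinearBound

/-! ### The extended contraction bound on compact sets of times and points. -/

section CompactBound

variable {n : ℕ} {M : Type*} [TopologicalSpace M]
  [ChartedSpace (𝔼 n) M] [IsManifold (𝓡 n) ∞ M]
  [RiemannianBundle (fun x : M => 𝕋 n x)]
  [IsContMDiffRiemannianBundle (𝓡 n) ∞ (𝔼 n) (fun x : M => 𝕋 n x)]
  {φ : ℝ → M → M} {ξ : (x : M) → 𝕋 n x} {p : ℝ} {k : ℕ}

/-- The identification of the tangent space at `x'` with the one at `x`, in the chart at `x`. -/
def toCenter (x x' : M) : 𝕋 n x' →L[ℝ] 𝕋 n x :=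
  (chartInvAt x x).comp (chartDeriv x x')

/-- The identification of the tangent space at `x` with the one at `x'`, in the chart at `x`. -/
def fromCenter (x x' : M) : 𝕋 n x →L[ℝ] 𝕋 n x' :=
  (chartInvAt x x').comp (chartDeriv x x)

/-- By continuity of the metric, the identifications of nearby tangent spaces through a chart are
almost isometric, so a bound can be transported with a loss as close to `1` as desired. -/
lemma eventually_norm_center_le (x : M) {r : ℝ} (hr : 1 < r) : ∀ᶠ x' in 𝓝 x,
    x' ∈ (ℰ n x).source ∧ ‖toCenter (n := n) x x'‖ ≤ r ∧
      ‖fromCenter (n := n) x x'‖ ≤ r := by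
  haveI := isManifold_one (n := n) (M := M)
  haveI := isContinuousRiemannianBundle (n := n) (M := M)
  have key : ∀ x', x' ∈ (ℰ n x).source →
      mfderivWithin 𝓘(ℝ, 𝔼 n) (𝓡 n) (ℰ n x).symm (range (𝓡 n))
        (ℰ n x x') = chartInvDeriv x (ℰ n x x') := fun x' _ =>
    (chartInvDeriv_eq_mfderivWithin _ _).symm
  filter_upwards [eventually_norm_symmL_trivializationAt_self_comp_lt (𝔼 n)
      (fun x : M => 𝕋 n x) x hr,
    eventually_norm_symmL_trivializationAt_comp_self_lt (𝔼 n)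
      (fun x : M => 𝕋 n x) x hr, extChartAt_source_mem_nhds (I := 𝓡 n) x]
    with x' h1 h2 h3
  have hx := mem_extChartAt_source (I := 𝓡 n) x
  have e : ∀ x' (_ : x' ∈ (ℰ n x).source) v, chartInvAt (n := n) x x' v =
      (trivializationAt (𝔼 n) (𝕋 n) x).symmL ℝ x' v := by
    intro x' h3 v
    obtain ⟨u, rfl⟩ : ∃ u, v = (trivializationAt (𝔼 n) (𝕋 n) x).continuousLinearMapAt
        ℝ x' u := by
      have hb : x' ∈ (trivializationAt (𝔼 n) (𝕋 n) x).baseSet := by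
        simpa using h3
      exact ⟨_, ((trivializationAt (𝔼 n) (𝕋 n) x).continuousLinearMapAt_symmL hb v).symm⟩
    have hb : x' ∈ (trivializationAt (𝔼 n) (𝕋 n) x).baseSet := by
      simpa using h3
    rw [Bundle.Trivialization.symmL_continuousLinearMapAt _ hb,
      TangentBundle.continuousLinearMapAt_trivializationAt (by simpa using h3)]
    exact chartInvAt_chartDeriv_apply h3 u
  have e' : ∀ x' (_ : x' ∈ (ℰ n x).source) v, chartDeriv (n := n) x x' v =
      (trivializationAt (𝔼 n) (𝕋 n) x).continuousLinearMapAt ℝ x' v := by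
    intro x' h3 v
    rw [TangentBundle.continuousLinearMapAt_trivializationAt (by simpa using h3)]
    rfl
  refine ⟨h3, ?_, ?_⟩
  · refine ContinuousLinearMap.opNorm_le_bound _ (by linarith) fun v => ?_
    refine le_trans (le_of_eq ?_) ((ContinuousLinearMap.le_opNorm _ v).trans
      (mul_le_mul_of_nonneg_right h1.le (norm_nonneg v)))
    congr 1
    rw [toCenter, ContinuousLinearMap.comp_apply, e x hx, e' x' h3]
    rfl
  · refine ContinuousLinearMap.opNorm_le_bound _ (by linarith) fun v => ?_
    refine le_trans (le_of_eq ?_) ((ContinuousLinearMap.le_opNorm _ v).trans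
      (mul_le_mul_of_nonneg_right h2.le (norm_nonneg v)))
    congr 1
    rw [fromCenter, ContinuousLinearMap.comp_apply, e x' h3, e' x hx]
    rfl

/-- The weight `Jac(φ_t)^{1/p}`. -/
def weight (φ : ℝ → M → M) (p t : ℝ) (x : M) : ℝ :=
  jacobian (𝒟 n (φ t) x) ^ (1 / p)

/-- The contraction property of a vector field with given constants. -/
def ContractBound (φ : ℝ → M → M) (ξ : (x : M) → 𝕋 n x) (k : ℕ) (p C η : ℝ) : Prop :=
  ∀ t : ℝ, 0 ≤ t → ∀ (x : M) (β : (𝕋 n (φ t x)) [⋀^Fin k]→L[ℝ] ℝ),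
    (∀ v : Fin k → 𝕋 n (φ t x), (∃ i, v i = ξ (φ t x)) → β v = 0) →
    ‖β.compContinuousLinearMap (𝒟 n (φ t) x)‖ ≤
      C * Real.exp (-η * t) * weight (n := n) φ p t x * ‖β‖

lemma weight_nonneg (φ : ℝ → M → M) (p t : ℝ) (x : M) : 0 ≤ weight (n := n) φ p t x :=
  Real.rpow_nonneg (jacobian_nonneg _) _

lemma IsContracting.exists_contractBound (h : IsContracting φ ξ k p) :
    ∃ C η : ℝ, 0 < C ∧ 0 < η ∧ ContractBound φ ξ k p C η := by
  obtain ⟨C, η, hη, h⟩ := h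
  refine ⟨|C| + 1, η, by positivity, hη, fun t ht x β hβ => (h t ht x β hβ).trans ?_⟩
  refine mul_le_mul_of_nonneg_right ?_
    (norm_nonneg (E := (𝕋 n (φ t x)) [⋀^Fin k]→L[ℝ] ℝ) _)
  refine mul_le_mul_of_nonneg_right ?_ (weight_nonneg φ p t x)
  exact mul_le_mul_of_nonneg_right ((le_abs_self C).trans (by linarith)) (Real.exp_nonneg _)

lemma IsFlowOf.weight_pos (hφ : IsFlowOf φ ξ) (p t : ℝ) (x : M) : 0 < weight (n := n) φ p t x :=
  Real.rpow_pos_of_pos (hφ.jacobian_pos t x) _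

lemma IsFlowOf.weight_add (hφ : IsFlowOf φ ξ) (p s t : ℝ) (x : M) :
    weight (n := n) φ p (s + t) x = weight (n := n) φ p s (φ t x) * weight (n := n) φ p t x := by
  rw [weight, weight, weight, hφ.jacobian_add, Real.mul_rpow (jacobian_nonneg _) (jacobian_nonneg _)]

lemma IsFlowOf.continuous_weight (hφ : IsFlowOf φ ξ) (p : ℝ) :
    Continuous fun q : ℝ × M => weight (n := n) φ p q.1 q.2 :=
  hφ.continuous_jacobian.rpow_const fun q => Or.inl (hφ.jacobian_pos q.1 q.2).ne'

lemma continuousAt_comp_comp {V W U : Type*} [NormedAddCommGroup V] [NormedSpace ℝ V]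
    [NormedAddCommGroup W] [NormedSpace ℝ W] [NormedAddCommGroup U] [NormedSpace ℝ U]
    {Z : Type*} [TopologicalSpace Z] {A : Z → U →L[ℝ] U} {z : Z} (hA : ContinuousAt A z)
    (P : U →L[ℝ] W) (Q : V →L[ℝ] U) : ContinuousAt (fun z => P.comp ((A z).comp Q)) z := by
  have h1 : Continuous fun A : U →L[ℝ] U => P.comp (A.comp Q) := by fun_prop
  exact h1.continuousAt.comp hA

lemma continuousAt_clm_comp {W U : Type*} [NormedAddCommGroup W] [NormedSpace ℝ W]
    [NormedAddCommGroup U] [NormedSpace ℝ U] {Z : Type*} [TopologicalSpace Z] {w : Z → U} {z : Z}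
    (hw : ContinuousAt w z) (P : U →L[ℝ] W) : ContinuousAt (fun z => P (w z)) z :=
  P.continuous.continuousAt.comp hw

/-- The value `4 / 3` is chosen so that the `3 / 2` obtained by compactness becomes `2` after
transport between tangent spaces. -/
lemma exists_pow_lt (m : ℕ) : ∃ r : ℝ, 1 < r ∧ r ^ m < 4 / 3 := by
  have h : ∀ᶠ r : ℝ in 𝓝[>] 1, r ^ m < 4 / 3 := by
    refine (((continuous_pow m).tendsto' (1 : ℝ) 1 (one_pow m)).eventually
      (Iio_mem_nhds (by norm_num))).filter_mono nhdsWithin_le_nhds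
  obtain ⟨r, hr, hr'⟩ := (h.and self_mem_nhdsWithin).exists
  exact ⟨r, hr', hr⟩

lemma norm_comp_transport_le {V V₀ W W₀ : Type*} [NormedAddCommGroup V] [NormedSpace ℝ V]
    [NormedAddCommGroup W] [NormedSpace ℝ W] [NormedAddCommGroup V₀] [NormedSpace ℝ V₀]
    [NormedAddCommGroup W₀] [NormedSpace ℝ W₀] {L : V →L[ℝ] W} {L₀ : V₀ →L[ℝ] W₀}
    {Q : V →L[ℝ] V₀} {P : W₀ →L[ℝ] W} (hL : ∀ v, L v = P (L₀ (Q v))) {w : W} {w₀ : W₀}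
    (hw : P w₀ = w) {r a K : ℝ} (hr1 : 1 < r) (hr : r ^ (2 * (k + 1)) < 4 / 3) (hQ : ‖Q‖ ≤ r)
    (hP : ‖P‖ ≤ r) (ha : 0 ≤ a) (hK : 0 ≤ K) (h : ∀ b : W₀ [⋀^Fin (k + 1)]→L[ℝ] ℝ,
      ‖b.compContinuousLinearMap L₀‖ ≤ 3 / 2 * a * ‖b‖ + K * ‖inter w₀ b‖)
    (b : W [⋀^Fin (k + 1)]→L[ℝ] ℝ) :
    ‖b.compContinuousLinearMap L‖ ≤ 2 * a * ‖b‖ + 2 * K * ‖inter w b‖ := by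
  have e : b.compContinuousLinearMap L =
      ((b.compContinuousLinearMap P).compContinuousLinearMap L₀).compContinuousLinearMap Q := by
    ext v
    simp [Function.comp_def, hL]
  have h1 := norm_compCLM_le ((b.compContinuousLinearMap P).compContinuousLinearMap L₀) Q hQ
  have h2 := norm_compCLM_le b P hP
  have h3 : ‖inter w₀ (b.compContinuousLinearMap P)‖ ≤ r ^ (k + 1) * ‖inter w b‖ := by
    rw [inter_comp, hw]
    refine (norm_compCLM_le _ P hP).trans ?_
    exact mul_le_mul_of_nonneg_right (pow_le_pow_right₀ hr1.le (Nat.le_succ k)) (norm_nonneg _)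
  have hr0 : 0 ≤ r ^ (k + 1) := by positivity
  have hrr : r ^ (k + 1) * r ^ (k + 1) ≤ 4 / 3 := by
    rw [← pow_add]
    refine le_trans (le_of_eq ?_) hr.le
    congr 1
    ring
  rw [e]
  calc _ ≤ r ^ (k + 1) * (3 / 2 * a * ‖b.compContinuousLinearMap P‖ +
        K * ‖inter w₀ (b.compContinuousLinearMap P)‖) :=
        h1.trans (mul_le_mul_of_nonneg_left (h _) hr0)
    _ ≤ r ^ (k + 1) * (3 / 2 * a * (r ^ (k + 1) * ‖b‖) + K * (r ^ (k + 1) * ‖inter w b‖)) := by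
        gcongr
    _ = (r ^ (k + 1) * r ^ (k + 1)) * (3 / 2 * a * ‖b‖ + K * ‖inter w b‖) := by ring
    _ ≤ 4 / 3 * (3 / 2 * a * ‖b‖ + K * ‖inter w b‖) := by gcongr
    _ ≤ _ := by
        have := mul_nonneg hK (norm_nonneg (inter w b))
        linarith

/-- The tangent spaces vary with `q`, so the differentials are first read in the fixed tangent
spaces at `x₀` and `φ t₀ x₀`. There the linear bound applies, and it is carried back by the almost
isometric identifications. -/
lemma ContractBound.eventually_le (hφ : IsFlowOf φ ξ) {C η : ℝ} (hC : 0 < C)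
    (h : ContractBound φ ξ (k + 1) p C η) {t₀ : ℝ} (ht₀ : 0 ≤ t₀) (x₀ : M) :
    ∃ K, 0 ≤ K ∧ ∀ᶠ q : ℝ × M in 𝓝 (t₀, x₀),
      ∀ b : (𝕋 n (φ q.1 q.2)) [⋀^Fin (k + 1)]→L[ℝ] ℝ,
        ‖b.compContinuousLinearMap (𝒟 n (φ q.1) q.2)‖ ≤
          2 * (C * Real.exp (-η * q.1) * weight (n := n) φ p q.1 q.2) * ‖b‖ +
            K * ‖inter (ξ (φ q.1 q.2)) b‖ := by
  set y₀ := φ t₀ x₀ with hy₀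
  have hx₀s := mem_extChartAt_source (I := 𝓡 n) x₀
  have hy₀s := mem_extChartAt_source (I := 𝓡 n) y₀
  let A : ℝ × M → (𝔼 n) →L[ℝ] (𝔼 n) := fun q =>
    fderiv ℝ (coordMap (n := n) x₀ y₀ (φ q.1)) (ℰ n x₀ q.2)
  let u : ℝ × M → 𝔼 n := fun q => coordVec y₀ ξ (ℰ n y₀ (φ q.1 q.2))
  have hcφ : ContinuousAt (fun q : ℝ × M => φ q.1 q.2) (t₀, x₀) := hφ.smooth.continuous.continuousAt
  have hA : ContinuousAt A (t₀, x₀) :=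
    ContinuousAt.comp (f := fun q : ℝ × M => (q.1, ℰ n x₀ q.2))
      (g := fun q : ℝ × (𝔼 n) => fderiv ℝ (coordMap (n := n) x₀ y₀ (φ q.1)) q.2)
      (contDiffAt_fderiv_coordMap_family hφ.smooth hx₀s hy₀s).continuousAt
      (continuousAt_fst.prodMk ((continuousAt_extChartAt (I := 𝓡 n) x₀).comp
        (f := Prod.snd) (x := (t₀, x₀)) continuousAt_snd))
  have hu : ContinuousAt u (t₀, x₀) :=
    ContinuousAt.comp (f := fun q : ℝ × M => ℰ n y₀ (φ q.1 q.2))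
      (g := coordVec y₀ ξ) (hφ.isSmoothVec y₀ y₀ hy₀s).continuousAt
      ((continuousAt_extChartAt (I := 𝓡 n) y₀).comp (f := fun q : ℝ × M => φ q.1 q.2)
        (x := (t₀, x₀)) hcφ)
  have ha : Continuous fun q : ℝ × M => C * Real.exp (-η * q.1) * weight (n := n) φ p q.1 q.2 :=
    (by fun_prop : Continuous fun q : ℝ × M => C * Real.exp (-η * q.1)).mul (hφ.continuous_weight p)
  have hapos : ∀ q : ℝ × M, 0 < C * Real.exp (-η * q.1) * weight (n := n) φ p q.1 q.2 := fun q =>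
    mul_pos (mul_pos hC (Real.exp_pos _)) (hφ.weight_pos p _ _)
  have hAeq : ∀ q : ℝ × M, q.2 ∈ (ℰ n x₀).source →
      φ q.1 q.2 ∈ (ℰ n y₀).source → ∀ v, A q v = chartDeriv y₀ (φ q.1 q.2)
        (𝒟 n (φ q.1) q.2 (chartInvAt x₀ q.2 v)) := by
    intro q h1 h2 v
    simp only [A, fderiv_coordMap h1 h2 (hφ.mdifferentiableAt q.1 q.2)]
    rfl
  obtain ⟨K, hK, hev⟩ := eventually_norm_comp_le (V := 𝕋 n x₀)
    (W := 𝕋 n y₀) (k := k) (z₀ := ((t₀, x₀) : ℝ × M))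
    (E := fun q => (chartInvAt y₀ y₀).comp ((A q).comp (chartDeriv x₀ x₀)))
    (w := fun q => chartInvAt y₀ y₀ (u q))
    (continuousAt_comp_comp (V := 𝕋 n x₀) (W := 𝕋 n y₀) hA _ _)
    (continuousAt_clm_comp (W := 𝕋 n y₀) hu _) ha.continuousAt (hapos _) (by
      intro b hb
      have e1 : chartInvAt y₀ y₀ (u (t₀, x₀)) = ξ y₀ := by
        simp only [u]
        rw [← hy₀, coordVec_chart hy₀s, chartInvAt_chartDeriv_apply hy₀s]
      have e2 : (chartInvAt y₀ y₀).comp ((A (t₀, x₀)).comp (chartDeriv x₀ x₀)) =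
          𝒟 n (φ t₀) x₀ := by
        ext1 v
        simp only [ContinuousLinearMap.comp_apply]
        rw [hAeq (t₀, x₀) hx₀s hy₀s, chartInvAt_chartDeriv_apply hx₀s,
          chartInvAt_chartDeriv_apply hy₀s]
      rw [e1] at hb
      rw [e2]
      exact h t₀ ht₀ x₀ b (eq_zero_of_inter_eq_zero hb))
  obtain ⟨r, hr1, hr⟩ := exists_pow_lt (2 * (k + 1))
  refine ⟨2 * K, by positivity, ?_⟩
  have hx := (continuousAt_snd : ContinuousAt Prod.snd ((t₀, x₀) : ℝ × M)).eventually
    (eventually_norm_center_le (n := n) x₀ hr1)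
  have hy := hcφ.eventually (eventually_norm_center_le (n := n) y₀ hr1)
  filter_upwards [hev, hx, hy] with q hq hqx hqy b
  refine norm_comp_transport_le (V := 𝕋 n q.2) (V₀ := 𝕋 n x₀)
    (W := 𝕋 n (φ q.1 q.2)) (W₀ := 𝕋 n y₀)
    (Q := toCenter x₀ q.2) (P := fromCenter y₀ (φ q.1 q.2)) ?_ ?_ hr1 hr hqx.2.1 hqy.2.2
    (hapos q).le hK hq b
  · intro v
    simp only [ContinuousLinearMap.comp_apply, toCenter, fromCenter,
      chartDeriv_chartInvAt_apply hx₀s, chartDeriv_chartInvAt_apply hy₀s]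
    rw [hAeq q hqx.1 hqy.1, chartInvAt_chartDeriv_apply hqx.1, chartInvAt_chartDeriv_apply hqy.1]
  · simp only [u, fromCenter, ContinuousLinearMap.comp_apply, chartDeriv_chartInvAt_apply hy₀s]
    rw [coordVec_chart hqy.1, chartInvAt_chartDeriv_apply hqy.1]

/-- A bound on the pull-backs of all forms in terms of their interior products. -/
def InterBound (φ : ℝ → M → M) (ξ : (x : M) → 𝕋 n x) (k : ℕ) (p C η : ℝ) (q : ℝ × M)
    (K : ℝ) : Prop :=
  ∀ b : (𝕋 n (φ q.1 q.2)) [⋀^Fin (k + 1)]→L[ℝ] ℝ,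
    ‖b.compContinuousLinearMap (𝒟 n (φ q.1) q.2)‖ ≤
      weight (n := n) φ p q.1 q.2 * (2 * C * Real.exp (-η * q.1) * ‖b‖ +
        K * ‖inter (ξ (φ q.1 q.2)) b‖)

lemma InterBound.mono {C η : ℝ} {q : ℝ × M} {K K' : ℝ} (h : InterBound φ ξ k p C η q K)
    (hK : K ≤ K') : InterBound φ ξ k p C η q K' := by
  intro b
  refine (h b).trans (mul_le_mul_of_nonneg_left ?_ (weight_nonneg _ _ _ _))
  have := mul_le_mul_of_nonneg_right hK
    (norm_nonneg (E := (𝕋 n (φ q.1 q.2)) [⋀^Fin k]→L[ℝ] ℝ) (inter (ξ (φ q.1 q.2)) b))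
  linarith

/-- On compact sets, the contraction property extends to all forms up to a multiple of the
interior product. -/
lemma ContractBound.exists_bound (hφ : IsFlowOf φ ξ) {C η : ℝ} (hC : 0 < C)
    (h : ContractBound φ ξ (k + 1) p C η) {Q : Set (ℝ × M)} (hQ : IsCompact Q)
    (hQ0 : ∀ q ∈ Q, 0 ≤ q.1) : ∃ K, 0 ≤ K ∧ ∀ q ∈ Q, InterBound φ ξ k p C η q K := by
  refine exists_bound_of_locally hQ (fun q K K' hK hq => hq.mono hK) fun q hq => ?_
  obtain ⟨K, hK, hev⟩ := h.eventually_le hφ hC (hQ0 q hq) q.2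
  have hw := hφ.weight_pos p q.1 q.2
  refine ⟨K / (weight (n := n) φ p q.1 q.2 / 2), ?_⟩
  have hc := (hφ.continuous_weight p).continuousAt (x := q)
  filter_upwards [hev, continuousAt_const.eventually_lt hc (half_lt_self hw)] with q' h1 h2 b
  refine (h1 b).trans ?_
  rw [mul_add]
  refine add_le_add (le_of_eq (by ring)) ?_
  rw [← mul_assoc]
  refine mul_le_mul_of_nonneg_right ?_
    (norm_nonneg (E := (𝕋 n (φ q'.1 q'.2)) [⋀^Fin k]→L[ℝ] ℝ) _)
  rw [mul_div_assoc', le_div_iff₀ (by positivity), mul_comm]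
  exact mul_le_mul_of_nonneg_right h2.le hK

end CompactBound

/-! ### Derivatives of functions along the flow. -/

section FlowFunctions

variable {n : ℕ} {M : Type*} [TopologicalSpace M]
  [ChartedSpace (𝔼 n) M] [IsManifold (𝓡 n) ∞ M]
  [RiemannianBundle (fun x : M => 𝕋 n x)]
  [IsContMDiffRiemannianBundle (𝓡 n) ∞ (𝔼 n) (fun x : M => 𝕋 n x)]
  {φ : ℝ → M → M} {ξ : (x : M) → 𝕋 n x} {k : ℕ}

lemma IsFlowOf.dfun_comp (hφ : IsFlowOf φ ξ) {F : M → ℝ} (hF : 𝒞 n F)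
    (r : ℝ) (x : M) : dfun (n := n) (fun x => F (φ r x)) x =
      (dfun F (φ r x)).comp (𝒟 n (φ r) x) := by
  rw [dfun, dfun]
  exact mfderiv_comp (I' := 𝓡 n) x (hF.mdifferentiable (by simp) _) (hφ.mdifferentiableAt r x)

lemma IsFlowOf.hasDerivAt_comp (hφ : IsFlowOf φ ξ) {F : M → ℝ} (hF : 𝒞 n F)
    (s : ℝ) (x : M) :
    HasDerivAt (fun s => F (φ s x)) (dfun (n := n) F (φ s x) (ξ (φ s x))) s := by
  have h1 : HasMFDerivAt (𝓡 n) 𝓘(ℝ, ℝ) F (φ s x) (dfun F (φ s x)) :=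
    (hF.mdifferentiable (by simp) _).hasMFDerivAt
  have h2 := hφ.integralCurve x s
  have h3 := h1.comp s h2
  rw [hasMFDerivAt_iff_hasFDerivAt] at h3
  have h4 : HasDerivAt (fun s => F (φ s x)) _ s := HasFDerivAt.hasDerivAt h3
  refine h4.congr_deriv ?_
  change (dfun F (φ s x)) ((1 : ℝ) • (ξ (φ s x))) = _
  congr 1
  exact one_smul ℝ _

lemma contMDiff_dfun_apply {F : M → ℝ} (hF : 𝒞 n F) (hξ : IsSmoothVec ξ) :
    𝒞 n fun x => dfun (n := n) F x (ξ x) := by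
  intro x
  have hx := mem_extChartAt_source (I := 𝓡 n) x
  have h1 : ContDiffAt ℝ ∞ (fun y => fderiv ℝ (coordFun x F) y (coordVec x ξ y))
      (ℰ n x x) :=
    ((contDiffAt_coordFun hF hx).fderiv_right (m := ∞) (by simp)).clm_apply (hξ x x hx)
  have h2 := h1.contMDiffAt.comp x (contMDiffAt_extChartAt (I := 𝓡 n) (n := ∞))
  refine h2.congr_of_eventuallyEq ?_
  filter_upwards [extChartAt_source_mem_nhds (I := 𝓡 n) x] with x' hx'
  rw [Function.comp_apply, fderiv_coordFun hx' (hF.mdifferentiable (by simp) _), coordVec_chart hx',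
    ContinuousLinearMap.comp_apply, chartInvAt_chartDeriv_apply hx']

lemma dfun_eq_zero {F : M → ℝ} {x : M} {c : ℝ} (h : F =ᶠ[𝓝 x] fun _ => c) :
    dfun (n := n) F x = 0 := by
  rw [dfun, h.mfderiv_eq, mfderiv_const]
  rfl

lemma exists_bound_flow_deriv (hξ : IsSmoothVec ξ) {F : M → ℝ}
    (hF : 𝒞 n F) {L : Set M} (hL : IsCompact L) (hLc : IsClosed L) {c : ℝ}
    (hFL : ∀ x ∉ L, F x = c) :
    ∃ A, 0 ≤ A ∧ ∀ x, |dfun (n := n) F x (ξ x)| ≤ A := by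
  obtain ⟨A, hA⟩ := hL.exists_bound_of_continuousOn
    (contMDiff_dfun_apply hF hξ).continuous.continuousOn
  refine ⟨max A 0, le_max_right _ _, fun x => ?_⟩
  by_cases hx : x ∈ L
  · exact (hA x hx).trans (le_max_left _ _)
  · rw [dfun_eq_zero (c := c) (by
      filter_upwards [hLc.isOpen_compl.mem_nhds hx] with y hy
      exact hFL y hy)]
    change |(0 : ℝ)| ≤ _
    rw [abs_zero]
    exact le_max_right _ _

end FlowFunctions

/-! ### Decay along orbits in a compact set; wedging with `d(F ∘ φ_r)`. -/

section Contraction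

variable {n : ℕ} {M : Type*} [TopologicalSpace M] [T2Space M]
  [ChartedSpace (𝔼 n) M] [IsManifold (𝓡 n) ∞ M]
  [RiemannianBundle (fun x : M => 𝕋 n x)]
  [IsContMDiffRiemannianBundle (𝓡 n) ∞ (𝔼 n) (fun x : M => 𝕋 n x)]
  [MeasurableSpace M] [BorelSpace M] [SecondCountableTopology M]
  {φ : ℝ → M → M} {ξ : (x : M) → 𝕋 n x} {p C η : ℝ} {k : ℕ}

lemma ContractBound.mono {C' η' : ℝ} (h : ContractBound φ ξ k p C η) (hC : 0 ≤ C) (hCC : C ≤ C')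
    (hη : η' ≤ η) : ContractBound φ ξ k p C' η' := by
  intro t ht x β hβ
  refine (h t ht x β hβ).trans ?_
  refine mul_le_mul_of_nonneg_right ?_
    (norm_nonneg (E := (𝕋 n (φ t x)) [⋀^Fin k]→L[ℝ] ℝ) _)
  refine mul_le_mul_of_nonneg_right ?_ (weight_nonneg φ p t x)
  refine mul_le_mul hCC (Real.exp_le_exp.2 ?_) (Real.exp_nonneg _) (hC.trans hCC)
  have := mul_le_mul_of_nonneg_right hη ht
  linarith

lemma ContractBound.pullbackBound_inter (h : ContractBound φ ξ k p C η) (γ : DiffForm n M (k + 1)) :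
    PullbackBound φ p C η (interForm ξ γ) := by
  intro t ht x
  refine (h t ht x (interForm ξ γ (φ t x)) ?_).trans_eq (by rw [mul_assoc]; rfl)
  cases k with
  | zero => rintro v ⟨i, -⟩; exact i.elim0
  | succ k =>
    intro v hv
    exact eq_zero_of_inter_eq_zero (inter_inter_self _ _) v hv

/-- Pull-backs along orbits which remain in a compact set decay. -/
lemma norm_pullback_iterate_le (hφ : IsFlowOf φ ξ) (hC : 0 ≤ C) {T B K : ℝ} (hT0 : 0 ≤ T)
    (hB : ∀ x, ‖ξ x‖ ≤ B) (hT : 2 * C * Real.exp (-η * T) ≤ 1 / 2)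
    (hT' : Real.exp (-η * T) ≤ 1 / 2) {L : Set M} (hK : 0 ≤ K)
    (hL : ∀ z ∈ L, InterBound φ ξ k p C η (T, z) K) {γ : DiffForm n M (k + 1)}
    (hγ : PullbackBound φ p C η (interForm ξ γ)) (j : ℕ) : ∀ z, (∀ i < j, φ (i * T) z ∈ L) →
      ‖pullbackForm (φ (j * T)) γ z‖ ≤ (1 + 2 * (K * C * B) * j) * (1 / 2) ^ j *
        (weight (n := n) φ p (j * T) z * ‖γ (φ (j * T) z)‖) := by
  induction j with
  | zero =>
    intro z _
    have h0 : ((0 : ℕ) : ℝ) * T = 0 := by simp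
    have h1 : weight (n := n) φ p 0 z = 1 := by
      have := hφ.weight_add p 0 0 z
      rw [add_zero, hφ.zero] at this
      exact (mul_eq_left₀ (hφ.weight_pos p 0 z).ne').1 this.symm
    rw [h0, hφ.pullback_zero_time, h1, hφ.zero]
    simp
  | succ j ih =>
    intro z hz
    have e1 : ((j + 1 : ℕ) : ℝ) * T = j * T + T := by push_cast; ring
    have hz0 : z ∈ L := by
      have := hz 0 (Nat.succ_pos j)
      rwa [Nat.cast_zero, zero_mul, hφ.zero] at this
    have h1 := ih (φ T z) fun i hi => by
      have := hz (i + 1) (by omega)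
      rw [← hφ.add]
      convert this using 2
      push_cast
      ring
    have h2 := hL z hz0 (pullbackForm (φ (j * T)) γ (φ T z))
    -- The contracted form is annihilated by `ι_ξ`, so genuine contraction over the time `j * T`
    -- gives it the factor `2^{-j}`.
    have h3 : ‖inter (ξ (φ T z)) (pullbackForm (φ (j * T)) γ (φ T z))‖ ≤
        C * (1 / 2) ^ j * (weight (n := n) φ p (j * T) (φ T z) * (B * ‖γ (φ (j * T) (φ T z))‖)) := by
      have e2 := congrFun (hφ.inter_pullback (j * T) γ) (φ T z)
      rw [interForm] at e2
      rw [e2]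
      refine (hγ _ (by positivity) _).trans ?_
      have e3 : Real.exp (-η * (j * T)) ≤ (1 / 2) ^ j := by
        have : -η * (j * T) = j * (-η * T) := by ring
        rw [this, Real.exp_nat_mul]
        exact pow_le_pow_left₀ (Real.exp_nonneg _) hT' j
      have e4 : ‖interForm ξ γ (φ (j * T) (φ T z))‖ ≤ B * ‖γ (φ (j * T) (φ T z))‖ :=
        (norm_inter_le _ _).trans (mul_le_mul_of_nonneg_right (hB _)
          (norm_nonneg (E := (𝕋 n (φ (j * T) (φ T z))) [⋀^Fin (k + 1)]→L[ℝ] ℝ) _))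
      exact mul_le_mul (mul_le_mul_of_nonneg_left e3 hC) (mul_le_mul_of_nonneg_left e4
        (weight_nonneg _ _ _ _)) (mul_nonneg (weight_nonneg _ _ _ _) (norm_nonneg (E :=
          (𝕋 n (φ (j * T) (φ T z))) [⋀^Fin k]→L[ℝ] ℝ) _)) (by positivity)
    have hw := weight_nonneg (n := n) φ p T z
    set G := ‖γ (φ (j * T) (φ T z))‖ with hG
    rw [e1, hφ.pullback_add, hφ.weight_add, hφ.add]
    refine (show _ ≤ _ from h2).trans ?_
    set w := weight (n := n) φ p (j * T) (φ T z) with hw'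
    have h4 : 2 * C * Real.exp (-η * T) * ‖pullbackForm (φ (j * T)) γ (φ T z)‖ ≤
        1 / 2 * ((1 + 2 * (K * C * B) * j) * (1 / 2) ^ j * (w * G)) :=
      mul_le_mul hT h1 (norm_nonneg (E := (𝕋 n (φ T z)) [⋀^Fin (k + 1)]→L[ℝ] ℝ) _)
        (by norm_num)
    have h5 := mul_le_mul_of_nonneg_left h3 hK
    -- The recursion `u_{j+1} ≤ u_j / 2 + (K C B) 2^{-j}` is solved by `(1 + 2 K C B j) 2^{-j}`,
    -- whence the linear factor.
    calc _ ≤ weight (n := n) φ p T z * (1 / 2 * ((1 + 2 * (K * C * B) * j) * (1 / 2) ^ j * (w * G)) +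
          K * (C * (1 / 2) ^ j * (w * (B * G)))) :=
          mul_le_mul_of_nonneg_left (add_le_add h4 h5) hw
      _ = _ := by
          push_cast
          rw [pow_succ]
          ring

lemma inter_wedge_of_eq_zero {V : Type*} [NormedAddCommGroup V] [NormedSpace ℝ V] (v : V)
    (μ : V →L[ℝ] ℝ) (β : V [⋀^Fin k]→L[ℝ] ℝ)
    (hβ : ∀ w : Fin k → V, (∃ i, w i = v) → β w = 0) : inter v (wedge μ β) = μ v • β := by
  cases k with
  | zero =>
    ext w
    rw [inter_apply, wedge_apply]
    simp
  | succ k =>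
    have h0 : inter v β = 0 := by
      ext w
      rw [inter_apply]
      exact hβ _ ⟨0, rfl⟩
    rw [inter_wedge, h0, ← wedgeCLM_apply, map_zero, sub_zero]

/-- Write the form as `φ_r^*(dF ∧ ν)` with `ν = φ_{s-r}^* ι_ξ γ`, and apply the extended bound at
time `r`. Since `ι_ξ ν = 0`, contracting `dF ∧ ν` leaves only `dF(ξ) ν`. The first term decays like
`e^{-ηs}`; the second does not, but it is proportional to the derivative of `F` along the orbit at
time `r`. -/
lemma norm_dwedge_comp_le (hφ : IsFlowOf φ ξ) (hC : 0 ≤ C) {K ε : ℝ} (hε : 0 ≤ ε)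
    (h : ContractBound φ ξ k p C η) {F : M → ℝ} (hF : 𝒞 n F)
    (hFε : ∀ x, ‖dfun (n := n) F x‖ ≤ ε) (γ : DiffForm n M (k + 1)) {r s : ℝ}
    (hrs : r ≤ s) {x : M} (hK : 0 ≤ K) (hKx : InterBound φ ξ k p C η (r, x) K) :
    ‖dwedge (n := n) (fun x => F (φ r x)) (pullbackForm (φ s) (interForm ξ γ)) x‖ ≤
      (2 * C ^ 2 * (k + 1) * ε * Real.exp (-η * s) +
        C * K * |dfun (n := n) F (φ r x) (ξ (φ r x))| * Real.exp (-η * (s - r))) *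
        (weight (n := n) φ p s x * ‖interForm ξ γ (φ s x)‖) := by
  set y := φ r x with hy
  set ν := pullbackForm (φ (s - r)) (interForm ξ γ) y with hν
  have hsr : s - r + r = s := by ring
  have e1 : dwedge (n := n) (fun x => F (φ r x)) (pullbackForm (φ s) (interForm ξ γ)) x =
      (wedge (dfun F y) ν).compContinuousLinearMap (𝒟 n (φ r) x) := by
    rw [dwedge, hφ.dfun_comp hF, wedge_comp]
    congr 1
    conv_lhs => rw [← hsr, hφ.pullback_add]
    rfl
  have h1 : ‖ν‖ ≤ C * Real.exp (-η * (s - r)) *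
      (weight (n := n) φ p (s - r) y * ‖interForm ξ γ (φ s x)‖) := by
    have h2 := h.pullbackBound_inter γ (s - r) (by linarith) y
    have e0 : φ (s - r) y = φ s x := by rw [hy, ← hφ.add, hsr]
    have e3 : ‖interForm ξ γ (φ (s - r) y)‖ = ‖interForm ξ γ (φ s x)‖ := by rw [e0]
    rw [e3] at h2
    exact h2
  have e2 : inter (ξ y) (wedge (dfun F y) ν) = (dfun F y (ξ y)) • ν := by
    refine inter_wedge_of_eq_zero _ _ _ ?_
    cases k with
    | zero => rintro v ⟨i, -⟩; exact i.elim0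
    | succ k =>
      have e3 := congrFun (hφ.inter_pullback (s - r) (interForm ξ γ)) y
      intro v hv
      refine eq_zero_of_inter_eq_zero (e3.trans ?_) v hv
      have e4 : interForm ξ (interForm ξ γ) = 0 := funext fun x => inter_inter_self _ _
      rw [e4]
      rfl
  have h3 : ‖wedge (dfun F y) ν‖ ≤ (k + 1) * (ε * ‖ν‖) :=
    (norm_wedge_le _ _).trans (mul_le_mul_of_nonneg_left (mul_le_mul_of_nonneg_right (hFε y)
      (norm_nonneg (E := (𝕋 n y) [⋀^Fin k]→L[ℝ] ℝ) _)) (by positivity))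
  have h4 : ‖inter (ξ y) (wedge (dfun F y) ν)‖ = |dfun (n := n) F y (ξ y)| * ‖ν‖ := by
    rw [e2, norm_smul, Real.norm_eq_abs]
  have h5 := hKx (wedge (dfun F y) ν)
  rw [e1]
  have hν0 := norm_nonneg (E := (𝕋 n y) [⋀^Fin k]→L[ℝ] ℝ) ν
  have hw := weight_nonneg (n := n) φ p r x
  have hexp : Real.exp (-η * r) * Real.exp (-η * (s - r)) = Real.exp (-η * s) := by
    rw [← Real.exp_add]
    congr 1
    ring
  have hws : weight (n := n) φ p s x = weight (n := n) φ p (s - r) y * weight (n := n) φ p r x := by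
    rw [← hφ.weight_add, hsr]
  set a := |dfun (n := n) F y (ξ y)| with ha
  have ha0 : 0 ≤ a := abs_nonneg _
  calc _ ≤ weight (n := n) φ p r x * (2 * C * Real.exp (-η * r) * ((k + 1) * (ε * ‖ν‖)) +
        K * (a * ‖ν‖)) := by
        refine (show _ ≤ _ from h5).trans (mul_le_mul_of_nonneg_left (add_le_add
          (mul_le_mul_of_nonneg_left h3 (by positivity)) (le_of_eq ?_)) hw)
        rw [← h4]
    _ = weight (n := n) φ p r x * (2 * C * Real.exp (-η * r) * (k + 1) * ε + K * a) * ‖ν‖ := by ring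
    _ ≤ weight (n := n) φ p r x * (2 * C * Real.exp (-η * r) * (k + 1) * ε + K * a) *
        (C * Real.exp (-η * (s - r)) *
          (weight (n := n) φ p (s - r) y * ‖interForm ξ γ (φ s x)‖)) :=
        mul_le_mul_of_nonneg_left h1 (by positivity)
    _ = _ := by
        rw [← hexp, hws]
        ring

end Contraction

/-! ### Soft maxima only see points of small derivative. -/

section Softmax

/-- The soft maximum of a finite family of reals. -/
def softMax (q : ℝ) (P : ℕ) (u : ℕ → ℝ) : ℝ := Real.log (∑ j ∈ Finset.range P, Real.exp (q * u j)) / q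

/-- The weights of the soft maximum, which are its partial derivatives. -/
def softWeight (q : ℝ) (P : ℕ) (u : ℕ → ℝ) (j : ℕ) : ℝ :=
  Real.exp (q * u j) / ∑ i ∈ Finset.range P, Real.exp (q * u i)

variable {q : ℝ} {P : ℕ} {u : ℕ → ℝ}

lemma sum_exp_pos (hP : 0 < P) : 0 < ∑ j ∈ Finset.range P, Real.exp (q * u j) :=
  Finset.sum_pos (fun _ _ => Real.exp_pos _) ⟨0, Finset.mem_range.2 hP⟩

lemma le_softMax (hq : 0 < q) {j : ℕ} (hj : j < P) : u j ≤ softMax q P u := by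
  rw [softMax, le_div_iff₀ hq, Real.le_log_iff_exp_le (sum_exp_pos (by omega)), mul_comm]
  exact Finset.single_le_sum (f := fun j => Real.exp (q * u j)) (fun i _ => Real.exp_nonneg _)
    (Finset.mem_range.2 hj)

lemma softMax_of_zero (h : ∀ j < P, u j = 0) : softMax q P u = Real.log P / q := by
  rw [softMax, Finset.sum_congr rfl fun j hj => by rw [h j (Finset.mem_range.1 hj), mul_zero,
    Real.exp_zero]]
  simp

lemma softWeight_nonneg (j : ℕ) : 0 ≤ softWeight q P u j :=
  div_nonneg (Real.exp_nonneg _) (Finset.sum_nonneg fun _ _ => Real.exp_nonneg _)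

lemma sum_softWeight (hP : 0 < P) : ∑ j ∈ Finset.range P, softWeight q P u j = 1 := by
  simp only [softWeight]
  rw [← Finset.sum_div, div_self (sum_exp_pos hP).ne']

/-- Keep only the term `i` of the denominator: the weight of an index far below another value is
exponentially small. -/
lemma softWeight_le {i : ℕ} (hi : i < P) (j : ℕ) :
    softWeight q P u j ≤ Real.exp (q * (u j - u i)) := by
  rw [softWeight, div_le_iff₀ (sum_exp_pos (by omega)), mul_sub, Real.exp_sub, div_mul_eq_mul_div,
    le_div_iff₀ (Real.exp_pos _)]
  exact mul_le_mul_of_nonneg_left (Finset.single_le_sum (f := fun j => Real.exp (q * u j))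
    (fun i _ => Real.exp_nonneg _) (Finset.mem_range.2 hi)) (Real.exp_nonneg _)

lemma hasFDerivAt_softMax {V : Type*} [NormedAddCommGroup V] [NormedSpace ℝ V] (hq : q ≠ 0)
    (hP : 0 < P) {f : ℕ → V → ℝ} {f' : ℕ → V →L[ℝ] ℝ} {y : V}
    (hf : ∀ j < P, HasFDerivAt (f j) (f' j) y) :
    HasFDerivAt (fun y => softMax q P fun j => f j y)
      (∑ j ∈ Finset.range P, softWeight q P (fun j => f j y) j • f' j) y := by
  have h1 : HasFDerivAt (fun y => ∑ j ∈ Finset.range P, Real.exp (q * f j y))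
      (∑ j ∈ Finset.range P, Real.exp (q * f j y) • (q • f' j)) y :=
    HasFDerivAt.fun_sum fun j hj => ((hf j (Finset.mem_range.1 hj)).const_mul q).exp
  have h2 := (h1.log (sum_exp_pos hP).ne').mul_const q⁻¹
  simp only [← div_eq_mul_inv] at h2
  refine h2.congr_fderiv ?_
  simp only [Finset.smul_sum, smul_smul, softWeight]
  refine Finset.sum_congr rfl fun j _ => ?_
  congr 1
  field_simp

lemma contDiffAt_softMax {V : Type*} [NormedAddCommGroup V] [NormedSpace ℝ V]
    (hP : 0 < P) {f : ℕ → V → ℝ} {y : V} (hf : ∀ j < P, ContDiffAt ℝ ∞ (f j) y) :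
    ContDiffAt ℝ ∞ (fun y => softMax q P fun j => f j y) y := by
  have h1 : ContDiffAt ℝ ∞ (fun y => ∑ j ∈ Finset.range P, Real.exp (q * f j y)) y :=
    ContDiffAt.sum fun j hj => (contDiffAt_const.mul (hf j (Finset.mem_range.1 hj))).exp
  exact (h1.log (sum_exp_pos hP).ne').div_const q

/-- A point where the derivative is large is far from being a maximum. -/
lemma exists_ge_of_abs_deriv {v v' v'' : ℝ → ℝ} (hv : ∀ r, HasDerivAt v (v' r) r)
    (hv' : ∀ r, HasDerivAt v' (v'' r) r) {A δ : ℝ} (hA : 0 < A) (hv'' : ∀ r, |v'' r| ≤ A)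
    (hδ : 0 < δ) (hδA : δ ≤ 2 * A) {r : ℝ} (hr : δ < |v' r|) :
    ∃ t ∈ Icc (r - 1) (r + 1), v r + δ ^ 2 / (4 * A) ≤ v t := by
  -- Within distance `h` the derivative changes by at most `A h = δ / 2`, so it keeps its sign and
  -- exceeds `δ / 2` in size: moving by `h` uphill gains `h δ / 2 = δ² / (4 A)`.
  set h := δ / (2 * A) with hh
  have h0 : 0 < h := by positivity
  have h1 : h ≤ 1 := by rw [hh, div_le_one (by positivity)]; exact hδA
  have hAh : A * h = δ / 2 := by rw [hh]; field_simp
  have hq : h * (δ / 2) = δ ^ 2 / (4 * A) := by rw [hh]; field_simp; ring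
  have hlip : ∀ a b, |v' a - v' b| ≤ A * |a - b| := fun a b => by
    have := convex_univ.norm_image_sub_le_of_norm_hasDerivWithin_le (f := v') (f' := v'') (C := A)
      (fun x _ => (hv' x).hasDerivWithinAt) (fun x _ => hv'' x) (mem_univ b) (mem_univ a)
    simpa using this
  have hcont : Continuous v := continuous_iff_continuousAt.2 fun r => (hv r).continuousAt
  rcases lt_abs.1 hr with hr | hr
  · obtain ⟨c, hc, hc'⟩ := exists_hasDerivAt_eq_slope v v' (show r < r + h by linarith)
      hcont.continuousOn fun x _ => hv x
    refine ⟨r + h, ⟨by linarith, by linarith⟩, ?_⟩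
    have h2 := (abs_le.1 (hlip c r)).1
    rw [abs_of_pos (by linarith [hc.1])] at h2
    have h3 : A * (c - r) ≤ A * h := mul_le_mul_of_nonneg_left (by linarith [hc.2]) hA.le
    have h4 : δ / 2 ≤ v' c := by linarith
    rw [hc', add_sub_cancel_left, le_div_iff₀ h0] at h4
    linarith
  · obtain ⟨c, hc, hc'⟩ := exists_hasDerivAt_eq_slope v v' (show r - h < r by linarith)
      hcont.continuousOn fun x _ => hv x
    refine ⟨r - h, ⟨by linarith, by linarith⟩, ?_⟩
    have h2 := (abs_le.1 (hlip c r)).2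
    rw [abs_of_neg (by linarith [hc.2])] at h2
    have h3 : A * -(c - r) ≤ A * h := mul_le_mul_of_nonneg_left (by linarith [hc.1]) hA.le
    have h4 : v' c ≤ -(δ / 2) := by linarith
    rw [hc', sub_sub_cancel, div_le_iff₀ h0] at h4
    linarith

/-- The soft maximum of the values of a function at the points of a grid only sees points where
the derivative is small. -/
lemma sum_softWeight_deriv_le {v v' v'' : ℝ → ℝ} (hv : ∀ r, HasDerivAt v (v' r) r)
    (hv' : ∀ r, HasDerivAt v' (v'' r) r) {A A' δ : ℝ} (hA : 0 < A) (hv'' : ∀ r, |v'' r| ≤ A)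
    (hA' : ∀ r, |v' r| ≤ A') (hδ : 0 < δ) (hδA : δ ≤ 2 * A) (hv0 : ∀ r, 0 ≤ v r) {N i m : ℕ}
    (hi : i ≤ N) (hm : 0 < m) (h1 : ∀ r ∈ Icc (-1 : ℝ) 0, v r = 0)
    (h2 : ∀ r ∈ Icc (i : ℝ) (i + 1), v r = 0) (hmA : A' / m ≤ δ ^ 2 / (8 * A)) (hq : 0 < q)
    (hqP : (N * m + 1 : ℕ) * (A' * Real.exp (-(q * (δ ^ 2 / (8 * A))))) ≤ δ)
    (hu : u = fun j => if j ≤ i * m then v (j / m) else 0) :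
    ∑ j ∈ Finset.range (N * m + 1), softWeight q (N * m + 1) u j *
      (if j ≤ i * m then |v' (j / m)| else 0) ≤ 2 * δ := by
  have hm' : (0 : ℝ) < m := by exact_mod_cast hm
  have hA'0 : 0 ≤ A' := (abs_nonneg _).trans (hA' 0)
  have key : ∀ j ∈ Finset.range (N * m + 1), softWeight q (N * m + 1) u j *
      (if j ≤ i * m then |v' (j / m)| else 0) ≤ softWeight q (N * m + 1) u j * δ +
        A' * Real.exp (-(q * (δ ^ 2 / (8 * A)))) := by
    intro j _
    have hw := softWeight_nonneg (q := q) (P := N * m + 1) (u := u) j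
    have hpos : 0 ≤ A' * Real.exp (-(q * (δ ^ 2 / (8 * A)))) := by positivity
    split_ifs with hj
    -- Either the derivative is at most `δ`, or a nearby time has a larger value and the soft weight
    -- is negligible.
    · rcases le_or_gt |v' (j / m)| δ with hle | hlt
      · exact (mul_le_mul_of_nonneg_left hle hw).trans (by linarith)
      · obtain ⟨t, ht, htv⟩ := exists_ge_of_abs_deriv hv hv' hA hv'' hδ hδA hlt
        have hκ : 0 < δ ^ 2 / (8 * A) := by positivity
        have hκ2 : δ ^ 2 / (4 * A) = δ ^ 2 / (8 * A) + δ ^ 2 / (8 * A) := by field_simp; ring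
        have hvj := hv0 (j / m)
        have hj0 : (0 : ℝ) ≤ j / m := by positivity
        have hji : (j : ℝ) / m ≤ i := by
          rw [div_le_iff₀ hm']
          exact_mod_cast hj
        -- The better time stays in the range of the grid: beyond either end `v` vanishes, whereas
        -- `v t` is positive.
        have ht0 : 0 ≤ t := by
          by_contra hneg
          have := h1 t ⟨by linarith [ht.1], by linarith⟩
          linarith
        have hti : t ≤ i := by
          by_contra hneg
          have := h2 t ⟨by linarith, by linarith [ht.2]⟩
          linarith
        -- Rounding to the grid costs at most `A' / m ≤ δ² / (8 A)`, half of the gain; the other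
        -- half enters the exponential.
        set j₀ := ⌊t * m⌋₊ with hj₀
        have htm : 0 ≤ t * m := by positivity
        have hj₀i : j₀ ≤ i * m := by
          have : (j₀ : ℝ) ≤ (i * m : ℕ) := (Nat.floor_le htm).trans (by
            push_cast
            exact mul_le_mul_of_nonneg_right hti hm'.le)
          exact_mod_cast this
        have hj₀P : j₀ < N * m + 1 := by
          have := Nat.mul_le_mul_right m hi
          omega
        have hdist : |t - j₀ / m| ≤ 1 / m := by
          have e1 : t - j₀ / m = (t * m - j₀) / m := by field_simp
          rw [e1, abs_div, abs_of_pos hm']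
          refine div_le_div_of_nonneg_right ?_ hm'.le
          rw [abs_of_nonneg (sub_nonneg.2 (Nat.floor_le htm))]
          linarith [Nat.lt_floor_add_one (t * m)]
        have hlip : |v t - v (j₀ / m)| ≤ A' * |t - j₀ / m| := by
          have := convex_univ.norm_image_sub_le_of_norm_hasDerivWithin_le (f := v) (f' := v')
            (C := A') (fun x _ => (hv x).hasDerivWithinAt) (fun x _ => hA' x)
            (mem_univ ((j₀ : ℝ) / m)) (mem_univ t)
          simpa using this
        have hlip2 : A' * |t - j₀ / m| ≤ δ ^ 2 / (8 * A) := by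
          refine (mul_le_mul_of_nonneg_left hdist hA'0).trans ?_
          rwa [mul_one_div]
        have huj : u j = v (j / m) := by rw [hu]; simp [hj]
        have huj₀ : u j₀ = v (j₀ / m) := by rw [hu]; simp [hj₀i]
        have hwj : softWeight q (N * m + 1) u j ≤ Real.exp (-(q * (δ ^ 2 / (8 * A)))) := by
          refine (softWeight_le hj₀P j).trans (Real.exp_le_exp.2 ?_)
          rw [huj, huj₀, ← mul_neg]
          refine mul_le_mul_of_nonneg_left ?_ hq.le
          have := (abs_le.1 hlip).2
          linarith
        have hmul := mul_le_mul hwj (hA' (j / m)) (abs_nonneg _) (Real.exp_nonneg _)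
        have := mul_nonneg hw hδ.le
        rw [mul_comm A']
        linarith
    · rw [mul_zero]
      positivity
  refine (Finset.sum_le_sum key).trans ?_
  rw [Finset.sum_add_distrib, ← Finset.sum_mul, sum_softWeight (Nat.succ_pos _), one_mul,
    Finset.sum_const, Finset.card_range, nsmul_eq_mul]
  linarith

/-- A smooth cut-off of the real line, `1` on `(-∞, 1/4]` and `0` on `[1/2, ∞)`. -/
def lineCut (t : ℝ) : ℝ := Real.smoothTransition (2 - 4 * t)

lemma contDiff_lineCut : ContDiff ℝ ∞ lineCut :=
  Real.smoothTransition.contDiff.comp (by fun_prop)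

lemma lineCut_nonneg (t : ℝ) : 0 ≤ lineCut t := Real.smoothTransition.nonneg _

lemma lineCut_le_one (t : ℝ) : lineCut t ≤ 1 := Real.smoothTransition.le_one _

lemma lineCut_of_le {t : ℝ} (h : t ≤ 1 / 4) : lineCut t = 1 :=
  Real.smoothTransition.one_of_one_le (by linarith)

lemma lineCut_of_ge {t : ℝ} (h : 1 / 2 ≤ t) : lineCut t = 0 :=
  Real.smoothTransition.zero_of_nonpos (by linarith)

lemma exists_bound_deriv_lineCut : ∃ c, 0 ≤ c ∧ ∀ t, |deriv lineCut t| ≤ c := by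
  obtain ⟨c, hc⟩ := (isCompact_Icc (a := (0 : ℝ)) (b := 1)).exists_bound_of_continuousOn
    (contDiff_lineCut.continuous_deriv (by simp)).continuousOn
  refine ⟨max c 0, le_max_right _ _, fun t => ?_⟩
  by_cases ht : t ∈ Icc (0 : ℝ) 1
  · exact (hc t ht).trans (le_max_left _ _)
  · have h0 : deriv lineCut t = 0 := by
      rcases lt_or_ge t 0 with h | h
      · have : lineCut =ᶠ[𝓝 t] fun _ => 1 := by
          filter_upwards [Iio_mem_nhds h] with s hs
          rw [mem_Iio] at hs
          exact lineCut_of_le (by linarith)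
        rw [this.deriv_eq, deriv_const]
      · have h1 : 1 < t := not_le.1 fun h1 => ht ⟨h, h1⟩
        have : lineCut =ᶠ[𝓝 t] fun _ => 0 := by
          filter_upwards [Ioi_mem_nhds h1] with s hs
          rw [mem_Ioi] at hs
          exact lineCut_of_ge (by linarith)
        rw [this.deriv_eq, deriv_const]
    rw [h0, abs_zero]
    exact le_max_right _ _

end Softmax

/-! ### Cut-offs built from soft maxima. -/

section SoftCut

variable {n : ℕ} {M : Type*} [TopologicalSpace M]
  [ChartedSpace (𝔼 n) M] [IsManifold (𝓡 n) ∞ M]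
  [RiemannianBundle (fun x : M => 𝕋 n x)]
  [IsContMDiffRiemannianBundle (𝓡 n) ∞ (𝔼 n) (fun x : M => 𝕋 n x)]
  {q : ℝ} {P k : ℕ} {V : ℕ → M → ℝ}

/-- The cut-off of the soft maximum of functions. -/
def softCut (q : ℝ) (P : ℕ) (V : ℕ → M → ℝ) (x : M) : ℝ := lineCut (softMax q P fun j => V j x)

lemma contMDiff_softCut (hP : 0 < P) (hV : ∀ j < P, 𝒞 n (V j)) :
    𝒞 n (softCut q P V) := by
  intro x
  have hx := mem_extChartAt_source (I := 𝓡 n) x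
  have h1 : ContDiffAt ℝ ∞ (fun y => lineCut (softMax q P fun j => coordFun (n := n) x (V j) y))
      (ℰ n x x) :=
    contDiff_lineCut.contDiffAt.comp _
      (contDiffAt_softMax hP fun j hj => contDiffAt_coordFun (hV j hj) hx)
  have h2 := h1.contMDiffAt.comp x (contMDiffAt_extChartAt (I := 𝓡 n) (n := ∞))
  refine h2.congr_of_eventuallyEq ?_
  filter_upwards [extChartAt_source_mem_nhds (I := 𝓡 n) x] with x' hx'
  simp only [Function.comp_apply, coordFun_chart hx']
  rfl

lemma dfun_softCut (hq : q ≠ 0) (hP : 0 < P) (hV : ∀ j < P, 𝒞 n (V j)) (x : M) :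
    dfun (n := n) (softCut q P V) x = ∑ j ∈ Finset.range P,
      (deriv lineCut (softMax q P fun j => V j x) * softWeight q P (fun j => V j x) j) •
        dfun (n := n) (V j) x := by
  have hx := mem_extChartAt_source (I := 𝓡 n) x
  have h1 := hasFDerivAt_softMax (y := ℰ n x x) hq hP fun j hj =>
    ((contDiffAt_coordFun (n := n) (hV j hj) hx).differentiableAt (by simp)).hasFDerivAt
  have h2 : HasDerivAt lineCut (deriv lineCut (softMax q P fun j =>
      coordFun (n := n) x (V j) (ℰ n x x))) _ :=
    (contDiff_lineCut.differentiable (by simp) _).hasDerivAt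
  have h3 := (HasDerivAt.comp_hasFDerivAt
    (f := fun y => softMax q P fun j => coordFun (n := n) x (V j) y) (ℰ n x x) h2
    h1).fderiv
  have h4 : (lineCut ∘ fun y => softMax q P fun j => coordFun (n := n) x (V j) y) =
    coordFun x (softCut q P V) := rfl
  rw [h4, fderiv_coordFun hx ((contMDiff_softCut hP hV).mdifferentiable (by simp) x)] at h3
  ext1 v
  have h5 := DFunLike.congr_fun h3 (chartDeriv x x v)
  rw [ContinuousLinearMap.comp_apply, chartInvAt_chartDeriv_apply hx] at h5
  rw [h5]
  simp only [coordFun_chart hx, smul_apply, sum_apply,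
    Finset.smul_sum, smul_eq_mul]
  refine Finset.sum_congr rfl fun j hj => ?_
  rw [fderiv_coordFun hx ((hV j (Finset.mem_range.1 hj)).mdifferentiable (by simp) x),
    ContinuousLinearMap.comp_apply, chartInvAt_chartDeriv_apply hx, mul_assoc]

lemma norm_sum_wedge_le {U : Type*} [NormedAddCommGroup U] [NormedSpace ℝ U] {ι : Type*}
    (s : Finset ι) (a : ι → ℝ) (μ : ι → U →L[ℝ] ℝ) (β : U [⋀^Fin k]→L[ℝ] ℝ) :
    ‖wedge (∑ j ∈ s, a j • μ j) β‖ ≤ ∑ j ∈ s, |a j| * ‖wedge (μ j) β‖ := by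
  have h : wedge (∑ j ∈ s, a j • μ j) β = ∑ j ∈ s, a j • wedge (μ j) β := by
    simp only [← wedgeCLM_apply, map_sum, map_smul, sum_apply,
      smul_apply]
  rw [h]
  refine (norm_sum_le _ _).trans_eq (Finset.sum_congr rfl fun j _ => ?_)
  rw [norm_smul, Real.norm_eq_abs]

lemma norm_dwedge_softCut_le (hq : q ≠ 0) (hP : 0 < P)
    (hV : ∀ j < P, 𝒞 n (V j)) {c : ℝ} (hc : ∀ t, |deriv lineCut t| ≤ c)
    (γ : DiffForm n M k) (x : M) :
    ‖dwedge (n := n) (softCut q P V) γ x‖ ≤ c * ∑ j ∈ Finset.range P,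
      softWeight q P (fun j => V j x) j * ‖dwedge (n := n) (V j) γ x‖ := by
  rw [dwedge, dfun_softCut hq hP hV, Finset.mul_sum]
  refine (norm_sum_wedge_le (U := 𝕋 n x) _ _ _ _).trans
    (Finset.sum_le_sum fun j _ => ?_)
  rw [abs_mul, abs_of_nonneg (softWeight_nonneg j), ← mul_assoc]
  exact mul_le_mul_of_nonneg_right (mul_le_mul_of_nonneg_right (hc _) (softWeight_nonneg j))
    (norm_nonneg (E := (𝕋 n x) [⋀^Fin (k + 1)]→L[ℝ] ℝ) _)

end SoftCut

/-! ### Convolution of Lipschitz functions. -/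

section Mollify

open Convolution

/-- A Lipschitz function is uniformly approximated by smooth functions with the same Lipschitz
constant. -/
lemma exists_contDiff_lipschitz_approx {V : Type*} [NormedAddCommGroup V] [NormedSpace ℝ V]
    [FiniteDimensional ℝ V] {L : NNReal} {g : V → ℝ} (hg : LipschitzWith L g) {δ : ℝ} (hδ : 0 < δ) :
    ∃ h : V → ℝ, ContDiff ℝ ∞ h ∧ LipschitzWith L h ∧ ∀ v, |h v - g v| ≤ δ := by
  letI : MeasurableSpace V := borel V
  haveI : BorelSpace V := ⟨rfl⟩
  set μ : Measure V := Measure.addHaar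
  have hr : 0 < δ / (L + 1) := by positivity
  let b : ContDiffBump (0 : V) := ⟨δ / (L + 1) / 2, δ / (L + 1), by positivity, by linarith⟩
  have hint : ∀ x, Integrable (fun t => b.normed μ t * g (x - t)) μ := fun x => by
    refine Continuous.integrable_of_hasCompactSupport ?_ (b.hasCompactSupport_normed.mul_right)
    exact b.continuous_normed.mul (hg.continuous.comp (by fun_prop))
  have hval : ∀ x, (b.normed μ ⋆[ContinuousLinearMap.lsmul ℝ ℝ, μ] g : V → ℝ) x =
      ∫ t, b.normed μ t * g (x - t) ∂μ := fun x => rfl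
  refine ⟨b.normed μ ⋆[ContinuousLinearMap.lsmul ℝ ℝ, μ] g,
    b.hasCompactSupport_normed.contDiff_convolution_left _ b.contDiff_normed
      hg.continuous.locallyIntegrable, LipschitzWith.of_dist_le_mul fun x y => ?_, fun v => ?_⟩
  · rw [hval, hval, Real.dist_eq, ← integral_sub (hint x) (hint y)]
    have h1 : Integrable (fun t => b.normed μ t * (L * dist x y)) μ := b.integrable_normed.mul_const _
    have h2 : ∫ t, b.normed μ t * (L * dist x y) ∂μ = L * dist x y := by
      rw [integral_mul_const, b.integral_normed, one_mul]
    rw [← h2, ← Real.norm_eq_abs]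
    refine norm_integral_le_of_norm_le h1 (Eventually.of_forall fun t => ?_)
    rw [← mul_sub, norm_mul, Real.norm_of_nonneg (b.nonneg_normed t)]
    refine mul_le_mul_of_nonneg_left ?_ (b.nonneg_normed t)
    have := hg.dist_le_mul (x - t) (y - t)
    rwa [dist_sub_right, Real.dist_eq] at this
  · rw [← Real.dist_eq]
    refine ContDiffBump.dist_normed_convolution_le hg.continuous.aestronglyMeasurable fun x hx => ?_
    refine (hg.dist_le_mul x v).trans ?_
    have h3 : dist x v < δ / (L + 1) := hx
    have h4 : (L : ℝ) * dist x v ≤ (L + 1) * (δ / (L + 1)) := by gcongr; linarith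
    rwa [mul_div_cancel₀ _ (by positivity)] at h4

end Mollify

/-! ### Length spaces and the compactness of closed neighbourhoods. -/

section HopfRinow

/-- Points can be interpolated at prescribed distances, up to an arbitrarily small error. -/
def IsLengthSpace (M : Type*) [EMetricSpace M] : Prop :=
  ∀ (x y : M) (a b : ℝ≥0∞), a ≠ ⊤ → 0 < b → edist x y < a + b →
    ∃ z : M, edist x z ≤ a ∧ edist z y ≤ b

/-- Take a path of length less than `a + b` and, on it, a point at distance exactly `a` from `x`.
The first piece has length at least `a`, so less than `b` remains. -/
lemma isLengthSpace (n : ℕ) (M : Type*) [EMetricSpace M]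
    [ChartedSpace (𝔼 n) M] [IsManifold (𝓡 n) ∞ M]
    [RiemannianBundle (fun x : M => 𝕋 n x)]
    [IsContMDiffRiemannianBundle (𝓡 n) ∞ (𝔼 n) (fun x : M => 𝕋 n x)]
    [IsRiemannianManifold (𝓡 n) M] : IsLengthSpace M := by
  intro x y a b ha hb h
  haveI := isManifold_one (n := n) (M := M)
  rcases le_or_gt (edist x y) a with hle | hlt
  · exact ⟨y, hle, by simp⟩
  rw [IsRiemannianManifold.out (I := 𝓡 n)] at h
  obtain ⟨γ, h0, h1, hγ, hlen⟩ := Manifold.exists_lt_of_riemannianEDist_lt h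
  have hc : ContinuousOn (fun t => edist x (γ t)) (Icc 0 1) :=
    (continuous_const.edist continuous_id).comp_continuousOn hγ.continuousOn
  obtain ⟨t, ht, hta⟩ := intermediate_value_Icc (zero_le_one (α := ℝ)) hc
    (show a ∈ Icc (edist x (γ 0)) (edist x (γ 1)) by rw [h0, h1]; exact ⟨by simp, hlt.le⟩)
  refine ⟨γ t, hta.le, ?_⟩
  have e1 : edist x (γ t) ≤ Manifold.pathELength (𝓡 n) γ 0 t := by
    rw [IsRiemannianManifold.out (I := 𝓡 n)]
    exact Manifold.riemannianEDist_le_pathELength (hγ.mono (Icc_subset_Icc le_rfl ht.2)) h0 rfl ht.1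
  have e2 : edist (γ t) y ≤ Manifold.pathELength (𝓡 n) γ t 1 := by
    rw [IsRiemannianManifold.out (I := 𝓡 n)]
    exact Manifold.riemannianEDist_le_pathELength (hγ.mono (Icc_subset_Icc ht.1 le_rfl)) rfl h1 ht.2
  have e3 : a + edist (γ t) y ≤ a + b := by
    refine le_trans (add_le_add ?_ e2) ((Manifold.pathELength_add ht.1 ht.2).trans_le hlen.le)
    rw [← hta]
    exact e1
  exact (ENNReal.add_le_add_iff_left ha).1 e3

variable {M : Type*} [EMetricSpace M]

/-- Each point slightly outside a neighbourhood of `K` is close to that neighbourhood; this fails in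
general metric spaces and is the only use of the length property. -/
lemma IsLengthSpace.exists_mem_cthickening (hM : IsLengthSpace M) {K : Set M} {s δ : ℝ} (hs : 0 ≤ s) (hδ : 0 < δ) {y : M}
    (hy : y ∈ Metric.thickening (s + δ) K) :
    ∃ z ∈ Metric.cthickening s K, edist z y ≤ ENNReal.ofReal δ := by
  rw [Metric.mem_thickening_iff_exists_edist_lt] at hy
  obtain ⟨x, hx, hxy⟩ := hy
  rw [edist_comm, ENNReal.ofReal_add hs hδ.le] at hxy
  obtain ⟨z, h1, h2⟩ := hM _ _ _ _ ENNReal.ofReal_ne_top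
    (ENNReal.ofReal_pos.2 hδ) hxy
  refine ⟨z, Metric.mem_cthickening_of_edist_le z x s K hx ?_, h2⟩
  rwa [edist_comm]

/-- The Hopf–Rinow theorem: closed neighbourhoods of compact sets are compact. -/
theorem IsLengthSpace.isCompact_cthickening [LocallyCompactSpace M] [CompleteSpace M]
    (hM : IsLengthSpace M) {K : Set M} (hK : IsCompact K) (r : ℝ) :
    IsCompact (Metric.cthickening r K) := by
  by_contra hr
  set S : Set ℝ := {r | IsCompact (Metric.cthickening r K)}
  have hmono : ∀ a b : ℝ, a ≤ b → IsCompact (Metric.cthickening b K) →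
      IsCompact (Metric.cthickening a K) := fun a b h hb =>
    hb.of_isClosed_subset Metric.isClosed_cthickening (Metric.cthickening_mono h K)
  have hbdd : BddAbove S := ⟨r, fun s hs => not_lt.1 fun h => hr (hmono r s h.le hs)⟩
  obtain ⟨δ₀, hδ₀, hS₀⟩ := hK.exists_isCompact_cthickening
  set R := sSup S
  have hR : 0 < R := hδ₀.trans_le (le_csSup hbdd hS₀)
  have hlt : ∀ s < R, IsCompact (Metric.cthickening s K) := fun s hs => by
    obtain ⟨t, ht, hst⟩ := exists_lt_of_lt_csSup ⟨δ₀, hS₀⟩ hs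
    exact hmono s t hst.le ht
  -- At the supremum radius the neighbourhood is totally bounded, because it is within `δ'` of a
  -- smaller, compact one; completeness then gives compactness. Local compactness enlarges the
  -- radius, a contradiction.
  have hRc : IsCompact (Metric.cthickening R K) := by
    refine TotallyBounded.isCompact_of_isClosed ?_ Metric.isClosed_cthickening
    rw [EMetric.totallyBounded_iff]
    intro ε hε
    obtain ⟨δ, hδ, hδε⟩ : ∃ δ : ℝ, 0 < δ ∧ ENNReal.ofReal δ < ε / 2 := by
      obtain ⟨c, h1, h2⟩ := ENNReal.lt_iff_exists_nnreal_btwn.1 (ENNReal.half_pos hε.ne')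
      exact ⟨c, by exact_mod_cast h1, by rwa [ENNReal.ofReal_coe_nnreal]⟩
    set δ' := min δ R
    have hδ' : 0 < δ' := lt_min hδ hR
    obtain ⟨t, ht, hcov⟩ := EMetric.totallyBounded_iff.1
      (hlt (R - δ' / 2) (by linarith)).totallyBounded (ε / 2) (ENNReal.half_pos hε.ne')
    refine ⟨t, ht, fun y hy => ?_⟩
    obtain ⟨z, hz, hzy⟩ := hM.exists_mem_cthickening (K := K) (s := R - δ' / 2) (δ := δ')
      (y := y) (by linarith [min_le_right δ R]) hδ'
      (Metric.cthickening_subset_thickening' (by linarith [min_le_right δ R]) (by linarith) K hy)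
    obtain ⟨w, hw, hzw⟩ := mem_iUnion₂.1 (hcov hz)
    refine mem_iUnion₂.2 ⟨w, hw, ?_⟩
    rw [Metric.mem_eball] at hzw ⊢
    calc edist y w ≤ edist z y + edist z w := by rw [edist_comm z y]; exact edist_triangle y z w
      _ < ε / 2 + ε / 2 := ENNReal.add_lt_add (hzy.trans_lt
          ((ENNReal.ofReal_le_ofReal (min_le_left _ _)).trans_lt hδε)) hzw
      _ = ε := ENNReal.add_halves ε
  obtain ⟨δ, hδ, hc⟩ := hRc.exists_isCompact_cthickening
  have hmem : R + δ / 2 ∈ S := by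
    refine hc.of_isClosed_subset Metric.isClosed_cthickening fun y hy => ?_
    obtain ⟨z, hz, hzy⟩ := hM.exists_mem_cthickening (K := K) (s := R) (δ := δ) (y := y) hR.le hδ
      (Metric.cthickening_subset_thickening' (by linarith) (by linarith) K hy)
    refine Metric.mem_cthickening_of_edist_le y z δ _ hz ?_
    rwa [edist_comm]
  linarith [le_csSup hbdd hmem]

end HopfRinow

/-! ### Smooth cut-offs with small differential on complete manifolds. -/

section SmoothApprox

variable {n : ℕ} {M : Type*} [EMetricSpace M]
  [ChartedSpace (𝔼 n) M] [IsManifold (𝓡 n) ∞ M]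
  [RiemannianBundle (fun x : M => 𝕋 n x)]
  [IsContMDiffRiemannianBundle (𝓡 n) ∞ (𝔼 n) (fun x : M => 𝕋 n x)]

/-- The parametrisation of a neighbourhood of `x` by the tangent space at `x`, in the chart at
`x`. -/
def paramAt (x : M) (v : 𝕋 n x) : M :=
  (ℰ n x).symm (ℰ n x x + chartDeriv x x v)

lemma norm_chartInvDeriv_le {x : M} {y : 𝔼 n} (hy : y ∈ (ℰ n x).target)
    (h : ‖fromCenter (n := n) x ((ℰ n x).symm y)‖ ≤ 2) (v : 𝕋 n x) :
    ‖chartInvDeriv x y (chartDeriv x x v)‖ ≤ 2 * ‖v‖ := by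
  rw [← chartInvAt_symm hy]
  have h1 := ContinuousLinearMap.le_of_opNorm_le _ h v
  rw [fromCenter, ContinuousLinearMap.comp_apply] at h1
  exact h1

/-- The image of a segment is a path whose speed is at most `2 ‖w - v‖`. The parameter space is the
tangent space at `x` with its Riemannian norm, so that this constant does not depend on the chart.
-/
lemma edist_paramAt_le [IsRiemannianManifold (𝓡 n) M] {x : M} {v w : 𝕋 n x}
    (h : ∀ t ∈ Icc (0 : ℝ) 1,
      ℰ n x x + chartDeriv x x (v + t • (w - v)) ∈ (ℰ n x).target ∧
      ‖fromCenter (n := n) x (paramAt x (v + t • (w - v)))‖ ≤ 2) :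
    edist (paramAt x v) (paramAt x w) ≤ ENNReal.ofReal (2 * ‖w - v‖) := by
  haveI := isManifold_one (n := n) (M := M)
  set l : ℝ → 𝔼 n := fun t => ℰ n x x + chartDeriv x x (v + t • (w - v)) with hl
  have hl2 : ∀ t, l t = (ℰ n x x + chartDeriv x x v) + t • chartDeriv x x (w - v) :=
    fun t => by rw [hl]; simp only [map_add, map_smul, add_assoc]
  have hlc : ContDiff ℝ 1 l := by
    rw [show l = _ from funext hl2]
    exact contDiff_const.add (contDiff_id.smul contDiff_const)
  have hld : ∀ t, HasDerivAt l (chartDeriv x x (w - v)) t := fun t => by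
    rw [show l = _ from funext hl2]
    simpa using ((hasDerivAt_id t).smul_const (chartDeriv x x (w - v))).const_add
      (ℰ n x x + chartDeriv x x v)
  set γ : ℝ → M := fun t => (ℰ n x).symm (l t) with hγ
  have hγs : ContMDiffOn 𝓘(ℝ, ℝ) (𝓡 n) 1 γ (Icc 0 1) :=
    (contMDiffOn_extChartAt_symm (n := 1) x).comp hlc.contMDiff.contMDiffOn fun t ht => (h t ht).1
  have h0 : γ 0 = paramAt x v := by simp [hγ, hl, paramAt]
  have h1 : γ 1 = paramAt x w := by simp [hγ, hl, paramAt]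
  rw [IsRiemannianManifold.out (I := 𝓡 n)]
  refine (Manifold.riemannianEDist_le_pathELength hγs h0 h1 zero_le_one).trans ?_
  rw [Manifold.pathELength_eq_lintegral_mfderiv_Icc]
  have hb : ∀ t ∈ Icc (0 : ℝ) 1, ‖mfderiv 𝓘(ℝ, ℝ) (𝓡 n) γ t 1‖ₑ ≤ ENNReal.ofReal (2 * ‖w - v‖) := by
    intro t ht
    have e1 : HasMFDerivAt 𝓘(ℝ, 𝔼 n) (𝓡 n) (ℰ n x).symm (l t) (chartInvDeriv x (l t)) :=
      (((contMDiffOn_extChartAt_symm (n := 1) x).contMDiffAt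
        ((isOpen_extChartAt_target x).mem_nhds (h t ht).1)).mdifferentiableAt (by simp)).hasMFDerivAt
    have e2 := (e1.comp t (hld t).hasFDerivAt.hasMFDerivAt).mfderiv
    have e3 : mfderiv 𝓘(ℝ, ℝ) (𝓡 n) γ t 1 = chartInvDeriv x (l t) (chartDeriv x x (w - v)) := by
      refine (DFunLike.congr_fun e2 (1 : ℝ)).trans ?_
      refine congrArg (chartInvDeriv x (l t)) (one_smul ℝ _)
    rw [e3, ← ofReal_norm]
    exact ENNReal.ofReal_le_ofReal (norm_chartInvDeriv_le (h t ht).1 (h t ht).2 _)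
  refine (setLIntegral_mono measurable_const hb).trans ?_
  simp

/-- Around each point, Lipschitz functions are approximated by smooth functions with comparable
Lipschitz constants. -/
lemma exists_local_approx [IsRiemannianManifold (𝓡 n) M] (x : M) : ∃ U ∈ 𝓝 x,
    ∀ (f : M → ℝ) (L : NNReal), LipschitzWith L f → ∀ δ > 0, ∃ g : M → ℝ, ∀ x' ∈ U,
      ContMDiffAt (𝓡 n) 𝓘(ℝ, ℝ) ∞ g x' ∧ |g x' - f x'| ≤ δ ∧ ‖dfun (n := n) g x'‖ ≤ 4 * L := by
  haveI := isManifold_one (n := n) (M := M)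
  have hx := mem_extChartAt_source (I := 𝓡 n) x
  have hW := eventually_norm_center_le (n := n) x one_lt_two
  set a : 𝕋 n x → 𝔼 n := fun v => ℰ n x x + chartDeriv x x v with ha
  have hac : Continuous a := continuous_const.add (chartDeriv x x).continuous
  have ha0 : a 0 = ℰ n x x := by rw [ha]; simp
  have ht : ∀ᶠ v in 𝓝 (0 : 𝕋 n x), a v ∈ (ℰ n x).target :=
    hac.continuousAt.eventually ((isOpen_extChartAt_target x).mem_nhds
      (by rw [ha0]; exact mem_extChartAt_target x))
  have hp : ContinuousAt (paramAt (n := n) x) 0 := by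
    refine ContinuousAt.comp (g := (ℰ n x).symm) (f := a) ?_ hac.continuousAt
    rw [ha0]
    exact continuousAt_extChartAt_symm x
  have hp0 : paramAt (n := n) x 0 = x := by
    rw [paramAt, map_zero, add_zero, (ℰ n x).left_inv hx]
  obtain ⟨ρ, hρ, hball⟩ := Metric.eventually_nhds_iff_ball.1 (ht.and (hp.eventually (by rwa [hp0])))
  set b : M → 𝕋 n x := fun x' =>
    chartInvAt x x (ℰ n x x' - ℰ n x x) with hb
  have hbc : ContinuousAt b x := (chartInvAt x x).continuous.continuousAt.comp
    ((continuousAt_extChartAt x).sub continuousAt_const)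
  have hb0 : b x = 0 := by rw [hb]; simp
  have hbρ : ∀ᶠ x' in 𝓝 x, b x' ∈ Metric.ball 0 ρ :=
    hbc.eventually (by rw [hb0]; exact Metric.ball_mem_nhds _ hρ)
  have hpb : ∀ x' ∈ (ℰ n x).source, paramAt x (b x') = x' := fun x' hx' => by
    rw [paramAt, hb, chartDeriv_chartInvAt_apply hx, add_sub_cancel, (ℰ n x).left_inv hx']
  refine ⟨_, hW.and hbρ, fun f L hf δ hδ => ?_⟩
  -- One factor `2` is lost when passing to the tangent space and another when differentiating back
  -- on `M`, whence the `4 * L`.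
  have hlip : LipschitzOnWith (2 * L) (fun v => f (paramAt x v))
      (Metric.ball (0 : 𝕋 n x) ρ) := by
    refine LipschitzOnWith.of_dist_le_mul fun v hv w hw => ?_
    have h1 := edist_paramAt_le (n := n) (x := x) (v := v) (w := w) fun t ht => by
      have := hball _ ((convex_ball (0 : 𝕋 n x) ρ).add_smul_sub_mem hv hw ht)
      exact ⟨this.1, this.2.2.2⟩
    have h2 := (hf (paramAt x v) (paramAt x w)).trans (mul_le_mul_right h1 _)
    rw [edist_dist, ← ENNReal.ofReal_coe_nnreal, ← ENNReal.ofReal_mul (by positivity),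
      ENNReal.ofReal_le_ofReal_iff (by positivity)] at h2
    rw [dist_comm v w, dist_eq_norm w v]
    push_cast
    linarith
  -- The function is extended from the ball to the whole tangent space with the same constant, so
  -- that convolution needs no care near the boundary.
  obtain ⟨g₁, hg₁, hgf⟩ := hlip.extend_real
  obtain ⟨h, hh, hhL, hhg⟩ := exists_contDiff_lipschitz_approx hg₁ hδ
  set H : (𝔼 n) → ℝ := fun y => h (chartInvAt x x (y - ℰ n x x)) with hH
  have hHc : ContDiff ℝ ∞ H :=
    hh.comp (ContDiff.comp (g := chartInvAt (n := n) x x)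
      (ContinuousLinearMap.contDiff (F := 𝕋 n x) (chartInvAt x x))
      (contDiff_id.sub contDiff_const))
  refine ⟨fun x' => H (ℰ n x x'), fun x' hx' => ?_⟩
  have hs : x' ∈ (ℰ n x).source := hx'.1.1
  have hs' : x' ∈ (chartAt (𝔼 n) x).source := by rwa [extChartAt_source] at hs
  refine ⟨hHc.contMDiff.contMDiffAt.comp x' (contMDiffAt_extChartAt' hs'), ?_, ?_⟩
  · have e1 : f x' = g₁ (b x') := by
      rw [← hgf hx'.2]
      exact congrArg f (hpb x' hs).symm
    rw [e1]
    exact hhg _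
  · have e1 : HasFDerivAt H ((fderiv ℝ h (b x')).comp (chartInvAt x x)) (ℰ n x x') := by
      refine HasFDerivAt.comp (ℰ n x x') (hh.differentiable (by simp) (b x')).hasFDerivAt ?_
      exact (chartInvAt x x).hasFDerivAt.comp _ ((hasFDerivAt_id _).sub_const _)
    have e2 := (e1.hasMFDerivAt.comp x' (mdifferentiableAt_extChartAt hs').hasMFDerivAt).mfderiv
    have e3 : dfun (n := n) (fun x' => H (ℰ n x x')) x' =
      (fderiv ℝ h (b x')).comp (toCenter x x') := e2
    rw [e3]
    refine (ContinuousLinearMap.opNorm_comp_le _ _).trans ?_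
    have e4 := norm_fderiv_le_of_lipschitz ℝ hhL (x₀ := b x')
    calc _ ≤ ((2 * L : NNReal) : ℝ) * 2 := mul_le_mul e4 hx'.1.2.1 (norm_nonneg
          (E := 𝕋 n x' →L[ℝ] 𝕋 n x) _) (by positivity)
      _ = 4 * L := by push_cast; ring

lemma exists_bound_dfun {F : M → ℝ} (hF : 𝒞 n F) {K : Set M}
    (hK : IsCompact K) : ∃ C, 0 ≤ C ∧ ∀ x ∈ K, ‖dfun (n := n) F x‖ ≤ C := by
  refine exists_bound_of_locally (P := fun x C => ‖dfun (n := n) F x‖ ≤ C) hK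
    (fun q C C' h h' => h'.trans h) fun x _ => ?_
  obtain ⟨C, hC, h⟩ := exists_norm_chart_bound (n := n) x
  have hx := mem_extChartAt_source (I := 𝓡 n) x
  have h1 : ContinuousAt (fun y => ‖fderiv ℝ (coordFun (n := n) x F) y‖) (ℰ n x x) :=
    ((contDiffAt_coordFun hF hx).fderiv_right (m := ∞) (by simp)).continuousAt.norm
  have h3 := ContinuousAt.comp (f := ℰ n x) h1 (continuousAt_extChartAt' hx)
  refine ⟨(‖fderiv ℝ (coordFun (n := n) x F) (ℰ n x x)‖ + 1) * C, ?_⟩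
  filter_upwards [h3.eventually_lt_const (lt_add_one _), h] with x' h4 h5
  have e1 : dfun (n := n) F x' =
      (fderiv ℝ (coordFun (n := n) x F) (ℰ n x x')).comp (chartDeriv x x') := by
    rw [fderiv_coordFun h5.1 (hF.mdifferentiable (by simp) x')]
    ext v
    simp only [ContinuousLinearMap.comp_apply, chartInvAt_chartDeriv_apply h5.1]
  rw [e1]
  refine (ContinuousLinearMap.opNorm_comp_le _ _).trans ?_
  exact mul_le_mul h4.le h5.2.1 (norm_nonneg (E := 𝕋 n x' →L[ℝ] 𝔼 n) _) (by positivity)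

lemma hasMFDerivAt_sum {ι : Type*} (s : Finset ι) {f : ι → M → ℝ} {x : M}
    {f' : ι → 𝕋 n x →L[ℝ] ℝ} (h : ∀ i, HasMFDerivAt (𝓡 n) 𝓘(ℝ, ℝ) (f i) x (f' i)) :
    HasMFDerivAt (𝓡 n) 𝓘(ℝ, ℝ) (∑ i ∈ s, f i) x (∑ i ∈ s, f' i) := by
  classical
  induction s using Finset.induction_on with
  | empty => exact hasMFDerivAt_const (I := 𝓡 n) (I' := 𝓘(ℝ, ℝ)) (0 : ℝ) x
  | insert i s hi ih =>
    have e1 : ∑ j ∈ insert i s, f j = f i + ∑ j ∈ s, f j := Finset.sum_insert hi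
    have e2 : ∑ j ∈ insert i s, f' j = f' i + ∑ j ∈ s, f' j := Finset.sum_insert hi
    rw [e1]
    exact ((h i).add ih).congr_mfderiv e2.symm

lemma norm_smul_le_mul {V : Type*} [NormedAddCommGroup V] [NormedSpace ℝ V] {a b d : ℝ}
    {l : V →L[ℝ] ℝ} (ha : |a| ≤ b) (hl : ‖l‖ ≤ d) : ‖a • l‖ ≤ b * d := by
  rw [norm_smul]
  exact mul_le_mul ha hl (norm_nonneg l) ((abs_nonneg a).trans ha)

lemma hasMFDerivAt_mul_sub {ψ g : M → ℝ} {x : M} (hψ : MDifferentiableAt (𝓡 n) 𝓘(ℝ, ℝ) ψ x)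
    (hg : MDifferentiableAt (𝓡 n) 𝓘(ℝ, ℝ) g x) (c : ℝ) :
    HasMFDerivAt (𝓡 n) 𝓘(ℝ, ℝ) (fun x => ψ x * (g x - c)) x
      (ψ x • dfun (n := n) g x + (g x - c) • dfun ψ x) := by
  have h1 : HasMFDerivAt (𝓡 n) 𝓘(ℝ, ℝ) (fun x => g x - c) x (dfun (n := n) g x) := by
    have := hg.hasMFDerivAt.sub (hasMFDerivAt_const (I := 𝓡 n) (I' := 𝓘(ℝ, ℝ)) c x)
    refine this.congr_mfderiv ?_
    exact sub_zero _
  exact hψ.hasMFDerivAt.mul h1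

/-- Compactly supported Lipschitz functions are uniformly approximated by smooth compactly
supported functions with comparable Lipschitz constants. -/
lemma exists_smooth_approx [IsRiemannianManifold (𝓡 n) M] [SecondCountableTopology M]
    {f : M → ℝ} {L : NNReal} (hf : LipschitzWith L f) {Q : Set M} (hQ : IsCompact Q)
    (hfQ : ∀ x ∉ Q, f x = 0) {ε : ℝ} (hε : 0 < ε) :
    ∃ g : M → ℝ, 𝒞 n g ∧ HasCompactSupport g ∧ (∀ x, |g x - f x| ≤ ε) ∧
      ∀ x, ‖dfun (n := n) g x‖ ≤ 4 * L + ε := by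
  haveI : LocallyCompactSpace M := Manifold.locallyCompact_of_finiteDimensional (𝓡 n)
  haveI := sigmaCompact n M
  choose U₀ hU₀ happ using fun x : M => exists_local_approx (n := n) x
  choose Kx hKx hKx' using fun x : M => exists_compact_mem_nhds x
  set U : M → Set M := fun x => interior (U₀ x ∩ Kx x) with hU
  have hUx : ∀ x, x ∈ U x := fun x =>
    mem_interior_iff_mem_nhds.2 (inter_mem (hU₀ x) (hKx' x))
  obtain ⟨t, ht⟩ := hQ.elim_finite_subcover U (fun x => isOpen_interior) fun x _ =>
    mem_iUnion.2 ⟨x, hUx x⟩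
  obtain ⟨ψ, hψ⟩ := SmoothPartitionOfUnity.exists_isSubordinate (𝓡 n) hQ.isClosed
    (fun i : t => U i) (fun i => isOpen_interior) (by simpa [iUnion_subtype] using ht)
  have hψU : ∀ i, tsupport (ψ i) ⊆ U i := hψ
  have hψc : ∀ i, IsCompact (tsupport (ψ i)) := fun i =>
    (hKx i).of_isClosed_subset (isClosed_tsupport _) ((hψU i).trans
      (interior_subset.trans inter_subset_right))
  have hψs : ∀ i, 𝒞 n (ψ i) := fun i => (ψ i).contMDiff
  have hD : ∀ i : t, ∃ D, 0 ≤ D ∧ ∀ x, ‖dfun (n := n) (ψ i) x‖ ≤ D := fun i => by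
    obtain ⟨D, hD, h⟩ := exists_bound_dfun (hψs i) (hψc i)
    refine ⟨D, hD, fun x => ?_⟩
    by_cases hx : x ∈ tsupport (ψ i)
    · exact h x hx
    · rw [dfun_eq_zero (c := 0) (notMem_tsupport_iff_eventuallyEq.1 hx)]
      exact (norm_zero (E := 𝕋 n x →L[ℝ] ℝ)).trans_le hD
  choose D hD0 hD using hD
  set S := ∑ i, D i with hS
  have hS0 : 0 ≤ S := Finset.sum_nonneg fun i _ => hD0 i
  -- The local errors are multiplied by the differentials of the partition functions, whose norms
  -- sum to at most `S`.
  set δ := ε / (S + 1) with hδ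
  have hδ0 : 0 < δ := by positivity
  have hδε : δ ≤ ε := div_le_self hε.le (by linarith)
  have hδS : δ * S ≤ ε := by
    rw [hδ, div_mul_eq_mul_div, div_le_iff₀ (by positivity)]
    nlinarith
  choose G hG using fun i : t => happ i f L hf δ hδ0
  have hGU : ∀ (i : t) (x : M), x ∈ U i → x ∈ U₀ i := fun i x hx => (interior_subset hx).1
  have hsum1 : ∀ x, ∑ i, ψ i x ≤ 1 := fun x => by
    have := ψ.sum_le_one x
    rwa [finsum_eq_sum_of_fintype] at this
  have hsumQ : ∀ x ∈ Q, ∑ i, ψ i x = 1 := fun x hx => by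
    have := ψ.sum_eq_one hx
    rwa [finsum_eq_sum_of_fintype] at this
  have hfψ : ∀ x, f x * ∑ i, ψ i x = f x := fun x => by
    by_cases hx : x ∈ Q
    · rw [hsumQ x hx, mul_one]
    · rw [hfQ x hx, zero_mul]
  set g : M → ℝ := fun x => ∑ i, ψ i x * G i x with hg
  have hzero : ∀ (i : t) (x : M), x ∉ tsupport (ψ i) → ψ i =ᶠ[𝓝 x] 0 := fun i x hx =>
    notMem_tsupport_iff_eventuallyEq.1 hx
  have hterm : ∀ i : t, 𝒞 n fun x => ψ i x * G i x := fun i x => by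
    by_cases hx : x ∈ tsupport (ψ i)
    · exact (hψs i x).mul (hG i x (hGU i x (hψU i hx))).1
    · refine contMDiffAt_const (c := (0 : ℝ)) |>.congr_of_eventuallyEq ?_
      filter_upwards [hzero i x hx] with y hy
      rw [hy, Pi.zero_apply, zero_mul]
  refine ⟨g, contMDiff_finsetSum fun i _ => hterm i, ?_, fun x => ?_, fun x => ?_⟩
  · refine HasCompactSupport.intro (K := ⋃ i, tsupport (ψ i)) (isCompact_iUnion hψc) fun x hx => ?_
    refine Finset.sum_eq_zero fun i _ => ?_
    rw [image_eq_zero_of_notMem_tsupport fun h => hx (mem_iUnion.2 ⟨i, h⟩), zero_mul]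
  · have e1 : g x - f x = ∑ i, ψ i x * (G i x - f x) := by
      simp only [mul_sub, Finset.sum_sub_distrib, ← Finset.sum_mul]
      rw [mul_comm _ (f x), hfψ]
    rw [e1]
    refine (Finset.abs_sum_le_sum_abs _ _).trans ?_
    have e2 : ∀ i : t, |ψ i x * (G i x - f x)| ≤ ψ i x * δ := fun i => by
      rw [abs_mul, abs_of_nonneg (ψ.nonneg i x)]
      by_cases hx : x ∈ tsupport (ψ i)
      · exact mul_le_mul_of_nonneg_left (hG i x (hGU i x (hψU i hx))).2.1 (ψ.nonneg i x)
      · rw [image_eq_zero_of_notMem_tsupport hx, zero_mul, zero_mul]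
    refine (Finset.sum_le_sum fun i _ => e2 i).trans ?_
    rw [← Finset.sum_mul]
    exact (mul_le_of_le_one_left hδ0.le (hsum1 x)).trans hδε
  -- Subtracting the constant `f x` from each local approximation makes the coefficient of `dψ_i` at
  -- `x` at most `δ` in size.
  · have hd : ∀ i : t, ∃ d : 𝕋 n x →L[ℝ] ℝ,
        HasMFDerivAt (𝓡 n) 𝓘(ℝ, ℝ) (fun y => ψ i y * (G i y - f x)) x d ∧
        ‖d‖ ≤ ψ i x * (4 * L) + δ * D i := fun i => by
      by_cases hx : x ∈ tsupport (ψ i)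
      · obtain ⟨h1, h2, h3⟩ := hG i x (hGU i x (hψU i hx))
        refine ⟨_, hasMFDerivAt_mul_sub ((hψs i).mdifferentiable (by simp) x)
          (h1.mdifferentiableAt (by simp)) (f x), ?_⟩
        refine (norm_add_le (E := 𝕋 n x →L[ℝ] ℝ) _ _).trans (add_le_add ?_ ?_)
        · exact norm_smul_le_mul (V := 𝕋 n x) (abs_of_nonneg (ψ.nonneg i x)).le h3
        · exact norm_smul_le_mul (V := 𝕋 n x) h2 (hD i x)
      · refine ⟨0, (hasMFDerivAt_const (I := 𝓡 n) (I' := 𝓘(ℝ, ℝ)) (0 : ℝ) x).congr_of_eventuallyEq ?_,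
          ?_⟩
        · filter_upwards [hzero i x hx] with y hy
          rw [hy, Pi.zero_apply, zero_mul]
        · refine (norm_zero (E := 𝕋 n x →L[ℝ] ℝ)).trans_le ?_
          have := ψ.nonneg i x
          have := hD0 i
          positivity
    choose d hd hdn using hd
    -- The subtraction does not change the differential at `x`: if `f x ≠ 0`, then nearby points lie
    -- in `Q`, where the partition functions sum to `1`.
    have h1 : HasMFDerivAt (𝓡 n) 𝓘(ℝ, ℝ) (fun y => f x * ∑ i, ψ i y) x
        (0 : 𝕋 n x →L[ℝ] ℝ) := by
      refine (hasMFDerivAt_const (I := 𝓡 n) (I' := 𝓘(ℝ, ℝ)) (f x) x).congr_of_eventuallyEq ?_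
      by_cases h0 : f x = 0
      · filter_upwards with y
        rw [h0, zero_mul]
      · have h2 : {y | f y ≠ 0} ∈ 𝓝 x := (isOpen_ne_fun hf.continuous continuous_const).mem_nhds h0
        filter_upwards [h2] with y hy
        rw [hsumQ y (by_contra fun h => hy (hfQ y h)), mul_one]
    have h4 : HasMFDerivAt (𝓡 n) 𝓘(ℝ, ℝ) (∑ i : t, fun y => ψ i y * (G i y - f x)) x (∑ i, d i) := by
      exact hasMFDerivAt_sum _ hd
    have h2 := h4.add h1
    have h3 : dfun (n := n) g x = (∑ i, d i) + 0 := by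
      refine (h2.congr_of_eventuallyEq (Eventually.of_forall fun y => ?_)).mfderiv
      simp only [hg, Pi.add_apply, Finset.sum_apply, mul_sub, Finset.sum_sub_distrib, ← Finset.sum_mul]
      ring
    rw [h3, add_zero]
    refine (norm_sum_le (E := 𝕋 n x →L[ℝ] ℝ) _ _).trans
      ((Finset.sum_le_sum fun i _ => hdn i).trans ?_)
    rw [Finset.sum_add_distrib, ← Finset.sum_mul, ← Finset.mul_sum]
    refine add_le_add (mul_le_of_le_one_left (by positivity) (hsum1 x)) hδS

/-- Complete manifolds have smooth compactly supported cut-offs with small differentials. -/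
lemma exists_cutoff [IsRiemannianManifold (𝓡 n) M] [SecondCountableTopology M] [CompleteSpace M]
    {K : Set M} (hK : IsCompact K) {ε : ℝ} (hε : 0 < ε) :
    ∃ g : M → ℝ, 𝒞 n g ∧ HasCompactSupport g ∧ (∀ x, 0 ≤ g x ∧ g x ≤ 1) ∧
      (∀ x ∈ K, g x = 1) ∧ ∀ x, ‖dfun (n := n) g x‖ ≤ ε := by
  haveI : LocallyCompactSpace M := Manifold.locallyCompact_of_finiteDimensional (𝓡 n)
  obtain ⟨c, hc0, hc⟩ := exists_bound_deriv_lineCut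
  -- The bound `1/4` keeps the approximation above `1/2` on `K`; the other one makes `c * (4 ε' +
  -- ε') ≤ ε`, with `c` a bound for the derivative of `lineCut`.
  set ε' := min (ε / (5 * (c + 1))) (1 / 4) with hε'
  have hε0 : 0 < ε' := lt_min (by positivity) (by norm_num)
  set r := ε'⁻¹ with hr
  have hr0 : 0 < r := inv_pos.2 hε0
  -- The distance to `K` is truncated at `r = 1 / ε'`, which keeps it finite on every component and
  -- makes `1 - ε' m` vanish outside the compact `r`-neighbourhood.
  set m : M → ℝ := fun x => (min (Metric.infEDist x K) (ENNReal.ofReal r)).toReal with hm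
  have hmtop : ∀ x, min (Metric.infEDist x K) (ENNReal.ofReal r) ≠ ⊤ := fun x =>
    ne_top_of_le_ne_top ENNReal.ofReal_ne_top (min_le_right _ _)
  have hmle : ∀ x, m x ≤ r := fun x => ENNReal.toReal_le_of_le_ofReal hr0.le (min_le_right _ _)
  have hlip : LipschitzWith 1 m := by
    have key : ∀ x y, m x - m y ≤ (edist x y).toReal ∨ edist x y = ⊤ := fun x y => by
      by_cases hxy : edist x y = ⊤
      · exact Or.inr hxy
      left
      rw [sub_le_iff_le_add', ← ENNReal.toReal_add (hmtop y) hxy]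
      refine ENNReal.toReal_mono (ENNReal.add_ne_top.2 ⟨hmtop y, hxy⟩) ?_
      rcases le_total (Metric.infEDist y K) (ENNReal.ofReal r) with h | h
      · rw [min_eq_left h]
        exact (min_le_left _ _).trans Metric.infEDist_le_infEDist_add_edist
      · rw [min_eq_right h]
        exact (min_le_right _ _).trans le_self_add
    intro x y
    rcases key x y with h | h
    · rcases key y x with h' | h'
      · by_cases hxy : edist x y = ⊤
        · simp [hxy]
        rw [edist_comm y x] at h'
        rw [ENNReal.coe_one, one_mul, edist_dist, Real.dist_eq]
        exact ENNReal.ofReal_le_of_le_toReal (abs_le.2 ⟨by linarith, h⟩)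
      · rw [edist_comm x y]; simp [h']
    · simp [h]
  set f : M → ℝ := fun x => 1 - ε' * m x with hf
  have hfl : LipschitzWith ε'.toNNReal f := by
    refine fun x y => ?_
    have h1 := hlip x y
    rw [ENNReal.coe_one, one_mul] at h1
    have h2 : edist (f x) (f y) = ENNReal.ofReal ε' * edist (m x) (m y) := by
      rw [edist_dist, edist_dist, ← ENNReal.ofReal_mul hε0.le, Real.dist_eq, Real.dist_eq,
        show f x - f y = -(ε' * (m x - m y)) by simp only [hf]; ring, abs_neg, abs_mul,
        abs_of_pos hε0]
    rw [h2]
    exact mul_le_mul_right h1 _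
  have hfQ : ∀ x ∉ Metric.cthickening r K, f x = 0 := fun x hx => by
    rw [Metric.mem_cthickening_iff, not_le] at hx
    have : m x = r := by
      simp only [hm]
      rw [min_eq_right hx.le, ENNReal.toReal_ofReal hr0.le]
    simp only [hf]
    rw [this, hr, mul_inv_cancel₀ hε0.ne', sub_self]
  have hfK : ∀ x ∈ K, f x = 1 := fun x hx => by
    simp [hf, hm, Metric.infEDist_zero_of_mem hx]
  obtain ⟨g, hg, hgc, hgf, hgd⟩ := exists_smooth_approx (n := n) hfl
    ((isLengthSpace n M).isCompact_cthickening hK r) hfQ hε0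
  -- Composition with `1 - lineCut` restores the exact value `1` on `K` and the range `[0, 1]`, and
  -- keeps compact support since `lineCut 0 = 1`.
  have hcut : 𝒞 n fun x => 1 - lineCut (g x) :=
    (contDiff_const.sub contDiff_lineCut).contMDiff.comp hg
  refine ⟨fun x => 1 - lineCut (g x), hcut, ?_, fun x => ?_, fun x hx => ?_, fun x => ?_⟩
  · refine HasCompactSupport.intro hgc fun x hx => ?_
    rw [image_eq_zero_of_notMem_tsupport hx, lineCut_of_le (by norm_num), sub_self]
  · have h1 := lineCut_nonneg (g x)
    have h2 := lineCut_le_one (g x)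
    constructor <;> linarith
  · have h1 := (abs_le.1 (hgf x)).1
    have h2 : ε' ≤ 1 / 4 := min_le_right _ _
    rw [hfK x hx] at h1
    simp only [lineCut_of_ge (show 1 / 2 ≤ g x by linarith), sub_zero]
  · have h1 : HasDerivAt (fun t => 1 - lineCut t) (-deriv lineCut (g x)) (g x) :=
      ((contDiff_lineCut.differentiable (by simp) _).hasDerivAt).const_sub 1
    have h2 := (h1.hasFDerivAt.hasMFDerivAt.comp x (hg.mdifferentiable (by simp) x).hasMFDerivAt).mfderiv
    have h3 : dfun (n := n) (fun x => 1 - lineCut (g x)) x =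
        (-deriv lineCut (g x)) • dfun (n := n) g x := by
      refine h2.trans ?_
      ext v
      change dfun g x v * -deriv lineCut (g x) = -deriv lineCut (g x) * dfun g x v
      exact mul_comm _ _
    rw [h3]
    have h4 := hgd x
    rw [Real.coe_toNNReal _ hε0.le] at h4
    have h5 : ε' ≤ ε / (5 * (c + 1)) := min_le_left _ _
    rw [le_div_iff₀ (by positivity)] at h5
    calc _ ≤ c * (4 * ε' + ε') := norm_smul_le_mul (V := 𝕋 n x)
          (by rw [abs_neg]; exact hc _) h4
      _ ≤ ε := by nlinarith

end SmoothApprox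

/-! ### Functions with exponentially small derivative. -/

section ExpDecay

/-- The function `-(A / η) e^{-ηr} - u r` is nondecreasing on the half-line. -/
lemma sub_le_of_deriv_exp {u u' : ℝ → ℝ} {A η : ℝ} (hη : 0 < η) (hu : ∀ s, HasDerivAt u (u' s) s)
    (h : ∀ s, 0 ≤ s → u' s ≤ A * Real.exp (-η * s)) {s t : ℝ} (hs : 0 ≤ s) (hst : s ≤ t) :
    u t - u s ≤ A / η * Real.exp (-η * s) - A / η * Real.exp (-η * t) := by
  have hw : ∀ r, HasDerivAt (fun r => -(A / η * Real.exp (-η * r)) - u r)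
      (A * Real.exp (-η * r) - u' r) r := fun r => by
    have h1 := (((hasDerivAt_id r).const_mul (-η)).exp.const_mul (A / η)).neg.sub (hu r)
    refine h1.congr_deriv ?_
    simp only [id]
    field_simp
  have hmono : MonotoneOn (fun r => -(A / η * Real.exp (-η * r)) - u r) (Ici 0) := by
    refine monotoneOn_of_deriv_nonneg (convex_Ici 0)
      (fun r _ => (hw r).continuousAt.continuousWithinAt)
      (fun r _ => (hw r).differentiableAt.differentiableWithinAt) fun r hr => ?_
    rw [interior_Ici] at hr
    rw [(hw r).deriv, sub_nonneg]
    exact h r (le_of_lt hr)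
  have := hmono (mem_Ici.2 hs) (mem_Ici.2 (hs.trans hst)) hst
  simp only at this
  linarith

/-- A function whose derivative decays exponentially is almost constant near infinity. -/
lemma abs_sub_le_of_deriv_exp {u u' : ℝ → ℝ} {A η : ℝ} (hη : 0 < η)
    (hu : ∀ s, HasDerivAt u (u' s) s) (h : ∀ s, 0 ≤ s → |u' s| ≤ A * Real.exp (-η * s)) {s t : ℝ}
    (hs : 0 ≤ s) (hst : s ≤ t) : |u t - u s| ≤ A / η * Real.exp (-η * s) := by
  have hA : 0 ≤ A := by
    have := (abs_nonneg _).trans (h 0 le_rfl)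
    rwa [mul_zero, Real.exp_zero, mul_one] at this
  have h1 := sub_le_of_deriv_exp hη hu (fun s hs => (le_abs_self _).trans (h s hs)) hs hst
  have h2 := sub_le_of_deriv_exp hη (fun s => (hu s).neg)
    (fun s hs => (neg_le_abs _).trans (h s hs)) hs hst
  have h3 : 0 ≤ A / η * Real.exp (-η * t) := by positivity
  simp only [Pi.neg_apply] at h2
  exact abs_le.2 ⟨by linarith, by linarith⟩

end ExpDecay

/-! ### Cut-offs that detect orbits leaving a compact set. -/

section FlowCut

variable {M : Type*} {φ : ℝ → M → M} {F : M → ℝ} {q : ℝ} {N m i : ℕ}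

/-- The values of `F` at the points of a grid of `[0, i]` along the orbits of the flow. -/
def gridFun (φ : ℝ → M → M) (F : M → ℝ) (m i j : ℕ) (x : M) : ℝ :=
  if j ≤ i * m then F (φ (j / m) x) else 0

/-- A smooth function which is small where `F` is large somewhere on the orbit up to time `i`. -/
def flowCut (q : ℝ) (N m : ℕ) (φ : ℝ → M → M) (F : M → ℝ) (i : ℕ) : M → ℝ :=
  softCut q (N * m + 1) (gridFun φ F m i)

lemma flowCut_nonneg (x : M) : 0 ≤ flowCut q N m φ F i x := lineCut_nonneg _

lemma flowCut_le_one (x : M) : flowCut q N m φ F i x ≤ 1 := lineCut_le_one _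

lemma div_mem_Icc {j a b : ℕ} (hm : 0 < m) (ha : a * m ≤ j) (hb : j ≤ b * m) :
    (j / m : ℝ) ∈ Icc (a : ℝ) b := by
  have hm' : (0 : ℝ) < m := by exact_mod_cast hm
  rw [mem_Icc, le_div_iff₀ hm', div_le_iff₀ hm']
  exact ⟨by exact_mod_cast ha, by exact_mod_cast hb⟩

/-- The soft maximum of zeros is `log P / q`, not `0`; `lineCut` equals `1` up to `1/4` precisely to
absorb this. -/
lemma flowCut_eq_one (hm : 0 < m) (hq : Real.log (N * m + 1 : ℕ) / q ≤ 1 / 4) {x : M}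
    (h : ∀ r ∈ Icc (0 : ℝ) i, F (φ r x) = 0) : flowCut q N m φ F i x = 1 := by
  rw [flowCut, softCut, softMax_of_zero, lineCut_of_le hq]
  intro j _
  rw [gridFun]
  split_ifs with hj
  · have := div_mem_Icc (a := 0) hm (by simp) hj
    rw [Nat.cast_zero] at this
    exact h _ this
  · rfl

/-- The extra grid values, at times in `[i, i + 1]`, are zero; as the number of terms in the soft
maximum depends on `N` and not on `i`, entries beyond the range already counted as zero. -/
lemma flowCut_succ (hm : 0 < m) {x : M} (h : ∀ r ∈ Icc (i : ℝ) (i + 1), F (φ r x) = 0) :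
    flowCut q N m φ F (i + 1) x = flowCut q N m φ F i x := by
  have e : (fun j => gridFun φ F m (i + 1) j x) = fun j => gridFun φ F m i j x := by
    funext j
    rw [gridFun, gridFun]
    by_cases h1 : j ≤ i * m
    · rw [if_pos h1, if_pos (h1.trans (Nat.mul_le_mul_right m (Nat.le_succ i)))]
    · rw [if_neg h1]
      split_ifs with h2
      · have := div_mem_Icc hm (le_of_lt (not_le.1 h1)) h2
        push_cast at this
        exact h _ this
      · rfl
  rw [flowCut, softCut, e]
  rfl

/-- The soft maximum dominates each value, and integer times belong to the grid. -/
lemma lt_of_flowCut_ne_zero (hm : 0 < m) (hq : 0 < q) {x : M} (h : flowCut q N m φ F N x ≠ 0)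
    {j : ℕ} (hj : j ≤ N) : F (φ j x) < 1 / 2 := by
  have h1 : softMax q (N * m + 1) (fun j => gridFun φ F m N j x) < 1 / 2 := by
    by_contra hle
    exact h (lineCut_of_ge (not_lt.1 hle))
  have hjm : j * m ≤ N * m := Nat.mul_le_mul_right m hj
  have h2 := le_softMax (P := N * m + 1) (u := fun j => gridFun φ F m N j x) hq
    (Nat.lt_succ_of_le hjm)
  have hm' : (m : ℝ) ≠ 0 := by exact_mod_cast hm.ne'
  have h3 : gridFun φ F m N (j * m) x = F (φ j x) := by
    rw [gridFun, if_pos hjm]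
    push_cast
    rw [mul_div_cancel_right₀ _ hm']
  simp only [h3] at h2
  exact h2.trans_lt h1

end FlowCut

/-! ### Choice of the grid and summation of the steps. -/

section RealLemmas

lemma exp_neg_le_inv {x : ℝ} (hx : 0 < x) : Real.exp (-x) ≤ x⁻¹ := by
  rw [Real.exp_neg]
  exact inv_anti₀ hx (by linarith [Real.add_one_le_exp x])

/-- First the mesh `1 / m` is fixed; then `q` is taken large compared with the logarithm of the
number of grid points and large enough to beat that number in the exponential term. -/
lemma exists_grid {A A' δ : ℝ} (hA : 0 < A) (hA' : 0 ≤ A') (hδ : 0 < δ) (N : ℕ) :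
    ∃ (m : ℕ) (q : ℝ), 0 < m ∧ 0 < q ∧ A' / m ≤ δ ^ 2 / (8 * A) ∧
      Real.log (N * m + 1 : ℕ) / q ≤ 1 / 4 ∧
      (N * m + 1 : ℕ) * (A' * Real.exp (-(q * (δ ^ 2 / (8 * A))))) ≤ δ := by
  set κ := δ ^ 2 / (8 * A) with hκ
  have hκ0 : 0 < κ := by positivity
  obtain ⟨m, hm⟩ := exists_nat_gt (A' / κ)
  have hm0 : (0 : ℝ) < m := (div_nonneg hA' hκ0.le).trans_lt hm
  set P : ℝ := ((N * m + 1 : ℕ) : ℝ) with hP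
  have hP1 : 1 ≤ P := by rw [hP]; exact_mod_cast Nat.succ_le_succ (Nat.zero_le _)
  have hlog : 0 ≤ Real.log P := Real.log_nonneg hP1
  set q := 4 * Real.log P + P * A' / (κ * δ) + 1 with hq
  have hq1 : 0 ≤ P * A' / (κ * δ) := by positivity
  have hq0 : 0 < q := by positivity
  refine ⟨m, q, by exact_mod_cast hm0, hq0, ?_, ?_, ?_⟩
  · rw [div_le_iff₀ hm0, mul_comm]
    exact ((div_lt_iff₀ hκ0).1 hm).le
  · rw [div_le_iff₀ hq0]
    linarith
  · have h1 : P * A' ≤ δ * (q * κ) := by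
      have h2 : P * A' / (κ * δ) ≤ q := by linarith
      rw [div_le_iff₀ (by positivity)] at h2
      linarith
    calc P * (A' * Real.exp (-(q * κ))) ≤ P * (A' * (q * κ)⁻¹) := by
          gcongr
          exact exp_neg_le_inv (by positivity)
      _ = P * A' / (q * κ) := by rw [← mul_assoc, div_eq_mul_inv]
      _ ≤ δ := (div_le_iff₀ (by positivity)).2 h1

/-- Telescoping from `S`; the geometric part is summed from index `S` on, so it is small when `S` is
large, whatever `N` is. -/
lemma abs_le_of_geometric_steps {a : ℕ → ℝ} {α β r : ℝ} (hr0 : 0 ≤ r) (hr1 : r < 1) (hα : 0 ≤ α)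
    (hβ : 0 ≤ β) {S N : ℕ} (hSN : S ≤ N) (hS : a S = 0)
    (h : ∀ i, S ≤ i → i < N → |a (i + 1) - a i| ≤ α * r ^ i + β) :
    |a N| ≤ α * r ^ S / (1 - r) + N * β := by
  have h1r : 0 < 1 - r := by linarith
  have key : ∀ j, S ≤ j → j ≤ N → |a j| ≤ α * (r ^ S - r ^ j) / (1 - r) + j * β := by
    intro j hj
    induction j, hj using Nat.le_induction with
    | base =>
      intro _
      rw [hS, sub_self, mul_zero, zero_div, zero_add, abs_zero]
      positivity
    | succ j hj ih =>
      intro hjN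
      have h1 := ih (by omega)
      have h2 := h j hj (by omega)
      have h3 : |a (j + 1)| ≤ |a (j + 1) - a j| + |a j| := by
        simpa using abs_add_le (a (j + 1) - a j) (a j)
      have h4 : α * (r ^ S - r ^ (j + 1)) / (1 - r) = α * r ^ j + α * (r ^ S - r ^ j) / (1 - r) := by
        field_simp
        ring
      rw [h4]
      push_cast
      linarith
  refine (key N hSN le_rfl).trans ?_
  gcongr
  have := pow_nonneg hr0 N
  linarith

end RealLemmas

/-! ### The differential of the flow cut-off. -/

section FlowCutDeriv

variable {n : ℕ} {M : Type*} [TopologicalSpace M] [T2Space M]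
  [ChartedSpace (𝔼 n) M] [IsManifold (𝓡 n) ∞ M]
  [RiemannianBundle (fun x : M => 𝕋 n x)]
  [IsContMDiffRiemannianBundle (𝓡 n) ∞ (𝔼 n) (fun x : M => 𝕋 n x)]
  [MeasurableSpace M] [BorelSpace M] [SecondCountableTopology M]
  {φ : ℝ → M → M} {ξ : (x : M) → 𝕋 n x} {p C η : ℝ} {k : ℕ} {F : M → ℝ} {q : ℝ}
  {N m i : ℕ}

lemma contMDiff_gridFun (hφ : IsFlowOf φ ξ) (hF : 𝒞 n F) (j : ℕ) :
    𝒞 n (gridFun φ F m i j) := by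
  unfold gridFun
  split_ifs
  · exact hF.comp (hφ.contMDiff _)
  · exact contMDiff_const

lemma contMDiff_flowCut (hφ : IsFlowOf φ ξ) (hF : 𝒞 n F) :
    𝒞 n (flowCut q N m φ F i) :=
  contMDiff_softCut (Nat.succ_pos _) fun j _ => contMDiff_gridFun hφ hF j

lemma norm_dwedge_zero (γ : DiffForm n M k) (x : M) : ‖dwedge (n := n) (fun _ => (0 : ℝ)) γ x‖ = 0 := by
  rw [dwedge, dfun_eq_zero (c := 0) (Eventually.of_forall fun _ => rfl), ← wedgeCLM_apply, map_zero]
  exact norm_zero (E := (𝕋 n x) [⋀^Fin (k + 1)]→L[ℝ] ℝ)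

/-- The differential of the cut-off along the flow is small against pulled back horizontal forms. -/
lemma norm_dwedge_flowCut_le (hφ : IsFlowOf φ ξ) (hC : 0 ≤ C) (hη : 0 ≤ η) {ε : ℝ} (hε : 0 ≤ ε)
    (h : ContractBound φ ξ k p C η) (hF : 𝒞 n F)
    (hFε : ∀ x, ‖dfun (n := n) F x‖ ≤ ε) (hF0 : ∀ x, 0 ≤ F x) {A A' δ c : ℝ} (hA : 0 < A)
    (hA' : ∀ x, |dfun (n := n) F x (ξ x)| ≤ A')
    (hA'' : ∀ x, |dfun (n := n) (fun x => dfun (n := n) F x (ξ x)) x (ξ x)| ≤ A) (hδ : 0 < δ)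
    (hδA : δ ≤ 2 * A) (hi : i ≤ N) (hm : 0 < m) (hmA : A' / m ≤ δ ^ 2 / (8 * A)) (hq : 0 < q)
    (hqP : (N * m + 1 : ℕ) * (A' * Real.exp (-(q * (δ ^ 2 / (8 * A))))) ≤ δ)
    (hc0 : 0 ≤ c) (hc : ∀ t, |deriv lineCut t| ≤ c) {s : ℝ} (hs : (i : ℝ) ≤ s) {x : M}
    (hx1 : ∀ r ∈ Icc (-1 : ℝ) 0, F (φ r x) = 0) (hx2 : ∀ r ∈ Icc (i : ℝ) (i + 1), F (φ r x) = 0)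
    {K : ℝ} (hK : 0 ≤ K) (hKx : ∀ r ∈ Icc (0 : ℝ) N, InterBound φ ξ k p C η (r, x) K)
    (γ : DiffForm n M (k + 1)) :
    ‖dwedge (n := n) (flowCut q N m φ F i) (pullbackForm (φ s) (interForm ξ γ)) x‖ ≤
      c * (2 * C ^ 2 * (k + 1) * ε * Real.exp (-η * s) + 2 * C * K * δ) *
        (weight (n := n) φ p s x * ‖interForm ξ γ (φ s x)‖) := by
  set W := weight (n := n) φ p s x * ‖interForm ξ γ (φ s x)‖ with hW
  have hW0 : 0 ≤ W := mul_nonneg (weight_nonneg _ _ _ _)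
    (norm_nonneg (E := (𝕋 n (φ s x)) [⋀^Fin k]→L[ℝ] ℝ) _)
  set a := 2 * C ^ 2 * (k + 1) * ε * Real.exp (-η * s) with ha
  have ha0 : 0 ≤ a := by positivity
  set G : M → ℝ := fun x => dfun (n := n) F x (ξ x) with hG
  have hGs : 𝒞 n G := contMDiff_dfun_apply hF hφ.isSmoothVec
  set w := softWeight q (N * m + 1) (fun j => gridFun φ F m i j x) with hw
  set d : ℕ → ℝ := fun j => if j ≤ i * m then |G (φ (j / m) x)| else 0 with hd
  -- The soft maximum argument is applied to `r ↦ F (φ r x)`, whose first two derivatives are the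
  -- iterated derivatives of `F` along `ξ`.
  have hsum : ∑ j ∈ Finset.range (N * m + 1), w j * d j ≤ 2 * δ :=
    sum_softWeight_deriv_le (fun r => hφ.hasDerivAt_comp hF r x) (fun r => hφ.hasDerivAt_comp hGs r x)
      hA (fun r => hA'' _) (fun r => hA' _) hδ hδA (fun r => hF0 _) hi hm hx1 hx2 hmA hq hqP rfl
  have hterm : ∀ j, ‖dwedge (n := n) (gridFun φ F m i j) (pullbackForm (φ s) (interForm ξ γ)) x‖ ≤
      (a + C * K * d j) * W := fun j => by
    by_cases hj : j ≤ i * m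
    · have e1 : gridFun φ F m i j = fun x => F (φ (j / m) x) := by
        funext y
        rw [gridFun, if_pos hj]
      have hr := div_mem_Icc (a := 0) hm (by simp) hj
      rw [Nat.cast_zero] at hr
      have hN : (j / m : ℝ) ∈ Icc (0 : ℝ) N := ⟨hr.1, hr.2.trans (by exact_mod_cast hi)⟩
      rw [e1]
      refine (norm_dwedge_comp_le hφ hC hε h hF hFε γ (hr.2.trans hs) hK (hKx _ hN)).trans ?_
      refine mul_le_mul_of_nonneg_right (add_le_add le_rfl ?_) hW0
      simp only [hd, if_pos hj]
      -- The factor `e^{-η(s - r)}` is dropped: smallness comes from the derivative of `F` along the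
      -- orbit.
      refine mul_le_of_le_one_right (by positivity) (Real.exp_le_one_iff.2 ?_)
      have := mul_nonneg hη (sub_nonneg.2 (hr.2.trans hs))
      linarith
    · have e1 : gridFun φ F m i j = fun _ => 0 := by
        funext y
        rw [gridFun, if_neg hj]
      rw [e1, norm_dwedge_zero]
      simp only [hd, if_neg hj]
      positivity
  refine (norm_dwedge_softCut_le hq.ne' (Nat.succ_pos _) (fun j _ => contMDiff_gridFun hφ hF j) hc
    _ x).trans ?_
  rw [mul_assoc]
  refine mul_le_mul_of_nonneg_left ?_ hc0
  calc _ ≤ ∑ j ∈ Finset.range (N * m + 1), w j * ((a + C * K * d j) * W) :=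
        Finset.sum_le_sum fun j _ => mul_le_mul_of_nonneg_left (hterm j) (softWeight_nonneg j)
    _ = (a * ∑ j ∈ Finset.range (N * m + 1), w j +
          C * K * ∑ j ∈ Finset.range (N * m + 1), w j * d j) * W := by
        rw [Finset.mul_sum, Finset.mul_sum, ← Finset.sum_add_distrib, Finset.sum_mul]
        exact Finset.sum_congr rfl fun j _ => by ring
    _ ≤ (a + 2 * C * K * δ) * W := by
        refine mul_le_mul_of_nonneg_right ?_ hW0
        rw [sum_softWeight (Nat.succ_pos _), mul_one]
        have := mul_le_mul_of_nonneg_left hsum (mul_nonneg hC hK)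
        linarith

end FlowCutDeriv

/-! ### Variation of the pairings with a cut-off test field. -/

section CompactSupport

variable {n : ℕ} {M : Type*} [TopologicalSpace M] [T2Space M]
  [ChartedSpace (𝔼 n) M] [IsManifold (𝓡 n) ∞ M]
  [RiemannianBundle (fun x : M => 𝕋 n x)]
  [IsContMDiffRiemannianBundle (𝓡 n) ∞ (𝔼 n) (fun x : M => 𝕋 n x)]
  [MeasurableSpace M] [BorelSpace M] [SecondCountableTopology M]
  {φ : ℝ → M → M} {ξ : (x : M) → 𝕋 n x} {p C η : ℝ} {k : ℕ} {F : M → ℝ} {K : Set M}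
  {D : ℝ}

/-- A test field is supported in `K` and bounded by `D`. -/
structure FieldBound (X : testFields n M k) (K : Set M) (D : ℝ) : Prop where
  nonneg : 0 ≤ D
  supp : ∀ x ∉ K, X.1 x = 0
  le : ∀ x β, |X.1 x β| ≤ D * ‖β‖

lemma FieldBound.mono {X : testFields n M k} {K' : Set M} {D' : ℝ} (h : FieldBound X K D)
    (hK : K ⊆ K') (hD : D ≤ D') : FieldBound X K' D' :=
  ⟨h.nonneg.trans hD, fun x hx => h.supp x fun hx' => hx (hK hx'), fun x β => (h.le x β).trans
    (mul_le_mul_of_nonneg_right hD (norm_nonneg (E := (𝕋 n x) [⋀^Fin k]→L[ℝ] ℝ) _))⟩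

lemma exists_fieldBound (X : testFields n M k) : ∃ K D, IsCompact K ∧ FieldBound X K D := by
  obtain ⟨K, hK, hX⟩ := X.2.2
  obtain ⟨D, hD, h⟩ := exists_bound_field X
  exact ⟨K, D, hK, hD, hX, h⟩

lemma FieldBound.smul {X : testFields n M k} (h : FieldBound X K D) {f : M → ℝ}
    (hf : 𝒞 n f) (hf0 : ∀ x, 0 ≤ f x) (hf1 : ∀ x, f x ≤ 1) :
    FieldBound (smulTest hf X) K D := by
  refine ⟨h.nonneg, fun x hx => ?_, fun x β => ?_⟩
  · change f x • X.1 x = 0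
    rw [h.supp x hx, smul_zero]
  · change |f x * X.1 x β| ≤ _
    rw [abs_mul, abs_of_nonneg (hf0 x)]
    exact (mul_le_of_le_one_left (abs_nonneg _) (hf1 x)).trans (h.le x β)

lemma IsFlowOf.abs_pairing_pullback_le (hφ : IsFlowOf φ ξ) (hp : 1 < p) {γ : DiffForm n M k}
    (hγ : MeasForm γ) (hγp : lpNorm p γ < ⊤) (hC : 0 ≤ C) (h : PullbackBound φ p C η γ)
    (hK : IsCompact K) {X : testFields n M k} (hX : FieldBound X K D) {s : ℝ} (hs : 0 ≤ s) :
    |pairing (pullbackForm (φ s) γ) X| ≤ D * (C * Real.exp (-η * s)) *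
      ((lpNorm p γ).toReal * (volFactor n p K).toReal) := by
  refine hφ.abs_pairing_le hp hγ hγp s hK hX.supp
    (mul_nonneg hX.nonneg (mul_nonneg hC (Real.exp_nonneg _))) fun x _ => ?_
  rw [mul_assoc]
  exact (hX.le x _).trans (mul_le_mul_of_nonneg_left (h s hs x) hX.nonneg)

lemma IsFlowOf.pairing_pullback_sub (hφ : IsFlowOf φ ξ) {γ : DiffForm n M k} (hγ : LocIntForm γ)
    (s : ℝ) (X Y : testFields n M k) : pairing (pullbackForm (φ s) γ) (subTest X Y) =
      pairing (pullbackForm (φ s) γ) X - pairing (pullbackForm (φ s) γ) Y := by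
  rw [hφ.pairing_pullback, hφ.pairing_pullback, hφ.pairing_pullback, ← hγ.pairing_sub, subTest,
    pushTest_add, pushTest_smul]
  rfl

/-- Measurable `Lᵖ` forms `g` and `z = dg`, with `Lᵖ` interior products. -/
structure LpPair (p : ℝ) (ξ : (x : M) → 𝕋 n x) (g : DiffForm n M (k + 1))
    (z : DiffForm n M (k + 2)) : Prop where
  meas : MeasForm g
  meas' : MeasForm z
  lp : lpNorm p g < ⊤
  lp' : lpNorm p z < ⊤
  inter : lpNorm p (interForm ξ g) < ⊤
  inter' : lpNorm p (interForm ξ z) < ⊤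
  differential : IsDifferential (pairing g) (pairing z)

variable {g : DiffForm n M (k + 1)} {z : DiffForm n M (k + 2)} {X : testFields n M (k + 1)}
  {Y : testFields n M k}

/-- The bound on the derivative of the pairings of the pull-backs with a test field. -/
def pairRate (p : ℝ) (ξ : (x : M) → 𝕋 n x) (g : DiffForm n M (k + 1))
    (z : DiffForm n M (k + 2)) (K : Set M) : ℝ :=
  ((lpNorm p (interForm ξ g)).toReal + (lpNorm p (interForm ξ z)).toReal) * (volFactor n p K).toReal

lemma pairRate_nonneg : 0 ≤ pairRate p ξ g z K :=
  mul_nonneg (add_nonneg ENNReal.toReal_nonneg ENNReal.toReal_nonneg) ENNReal.toReal_nonneg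

lemma LpPair.abs_deriv_le (hgz : LpPair p ξ g z) (hφ : IsFlowOf φ ξ) (hp : 1 < p) (hC : 0 ≤ C)
    (h0 : ContractBound φ ξ k p C η) (h1 : ContractBound φ ξ (k + 1) p C η) (hK : IsCompact K)
    (hX : FieldBound X K D) (hY : FieldBound Y K D) {s : ℝ} (hs : 0 ≤ s) :
    |pairing (pullbackForm (φ s) (interForm ξ g)) Y + pairing (pullbackForm (φ s) (interForm ξ z)) X| ≤
      D * C * pairRate p ξ g z K * Real.exp (-η * s) := by
  have e1 := hφ.abs_pairing_pullback_le hp (hgz.meas.inter hφ.isSmoothVec) hgz.inter hC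
    (h0.pullbackBound_inter g) hK hY hs
  have e2 := hφ.abs_pairing_pullback_le hp (hgz.meas'.inter hφ.isSmoothVec) hgz.inter' hC
    (h1.pullbackBound_inter z) hK hX hs
  refine (abs_add_le _ _).trans ((add_le_add e1 e2).trans_eq ?_)
  rw [pairRate]
  ring

lemma LpPair.locInt (hgz : LpPair p ξ g z) (hp : 1 < p) : LocIntForm g :=
  LocIntForm.of_lp hp hgz.meas hgz.lp

/-- The variation of the pairings with the complement of a cut-off of a test field. -/
lemma LpPair.abs_step_le (hgz : LpPair p ξ g z) (hφ : IsFlowOf φ ξ) (hp : 1 < p) (hC : 0 ≤ C)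
    (hη : 0 ≤ η) (h0 : ContractBound φ ξ k p C η) (h1 : ContractBound φ ξ (k + 1) p C η)
    (hK : IsCompact K) (hX : FieldBound X K D) (hY : FieldBound Y K D) (hXY : IsTranspose X Y)
    {f : M → ℝ} (hf : 𝒞 n f) (hf0 : ∀ x, 0 ≤ f x) (hf1 : ∀ x, f x ≤ 1)
    {i : ℕ} {E : ℝ} (hE : 0 ≤ E) (h : ∀ s ∈ Icc (i : ℝ) (i + 1), ∀ x ∈ K,
      ‖dwedge (n := n) f (pullbackForm (φ s) (interForm ξ g)) x‖ ≤
        E * (weight (n := n) φ p s x * ‖interForm ξ g (φ s x)‖)) :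
    |(pairing (pullbackForm (φ (i + 1)) g) X - pairing (pullbackForm (φ (i + 1)) g) (smulTest hf X)) -
      (pairing (pullbackForm (φ i) g) X - pairing (pullbackForm (φ i) g) (smulTest hf X))| ≤
      2 * (D * C * pairRate p ξ g z K) * Real.exp (-η * i) + D * E * pairRate p ξ g z K := by
  have hgi := LocIntForm.of_lp hp (hgz.meas.inter hφ.isSmoothVec) hgz.inter
  set V := (volFactor n p K).toReal
  have hder : ∀ s, HasDerivAt (fun s => pairing (pullbackForm (φ s) g) X -
      pairing (pullbackForm (φ s) g) (smulTest hf X)) _ s := fun s =>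
    (hφ.hasDerivAt_pairing_of_isDifferential (hgz.locInt hp) hgz.differential hXY s).sub
      (hφ.hasDerivAt_pairing_of_isDifferential (hgz.locInt hp) hgz.differential (hXY.smul hf) s)
  have hb : ∀ s ∈ Icc (i : ℝ) (i + 1),
      |(pairing (pullbackForm (φ s) (interForm ξ g)) Y + pairing (pullbackForm (φ s) (interForm ξ z)) X) -
        (pairing (pullbackForm (φ s) (interForm ξ g)) (subTest (smulTest hf Y) (contrTest hf X)) +
          pairing (pullbackForm (φ s) (interForm ξ z)) (smulTest hf X))| ≤
      2 * (D * C * pairRate p ξ g z K) * Real.exp (-η * i) + D * E * pairRate p ξ g z K := by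
    intro s hs
    have hs0 : 0 ≤ s := (Nat.cast_nonneg i).trans hs.1
    rw [hφ.pairing_pullback_sub hgi]
    have e1 := hgz.abs_deriv_le hφ hp hC h0 h1 hK hX hY hs0
    have e2 := hgz.abs_deriv_le hφ hp hC h0 h1 hK (hX.smul hf hf0 hf1) (hY.smul hf hf0 hf1) hs0
    -- The only term that sees the differential of the cut-off; all others decay by contraction as
    -- for the original field.
    have e3 : |pairing (pullbackForm (φ s) (interForm ξ g)) (contrTest hf X)| ≤
        D * E * ((lpNorm p (interForm ξ g)).toReal * V) := by
      refine hφ.abs_pairing_le hp (hgz.meas.inter hφ.isSmoothVec) hgz.inter s hK (fun x hx => ?_)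
        (mul_nonneg hX.nonneg hE) fun x hx => ?_
      · refine ContinuousLinearMap.ext fun β => ?_
        change X.1 x _ = 0
        rw [hX.supp x hx]
        rfl
      · rw [mul_assoc]
        exact (hX.le x _).trans (mul_le_mul_of_nonneg_left (h s hs x hx) hX.nonneg)
    have e4 : D * E * ((lpNorm p (interForm ξ g)).toReal * V) ≤ D * E * pairRate p ξ g z K := by
      refine mul_le_mul_of_nonneg_left ?_ (mul_nonneg hX.nonneg hE)
      rw [pairRate, add_mul]
      exact le_add_of_nonneg_right (mul_nonneg ENNReal.toReal_nonneg ENNReal.toReal_nonneg)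
    have e5 : D * C * pairRate p ξ g z K * Real.exp (-η * s) ≤
        D * C * pairRate p ξ g z K * Real.exp (-η * i) := by
      refine mul_le_mul_of_nonneg_left (Real.exp_le_exp.2 ?_)
        (mul_nonneg (mul_nonneg hX.nonneg hC) pairRate_nonneg)
      have := mul_le_mul_of_nonneg_left hs.1 hη
      linarith
    rw [abs_le] at e1 e2 e3 ⊢
    constructor <;> linarith [e1.1, e1.2, e2.1, e2.2, e3.1, e3.2]
  have := (convex_Icc (i : ℝ) (i + 1)).norm_image_sub_le_of_norm_hasDerivWithin_le
    (fun s _ => (hder s).hasDerivWithinAt) hb (left_mem_Icc.2 (by linarith))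
    (right_mem_Icc.2 (by linarith))
  rw [add_sub_cancel_left, norm_one, mul_one] at this
  exact this

end CompactSupport

/-! ### The weak form of `d² = 0`. -/

section TransposeSquare

/-- Each of the `k + 1` slots contributes `β` once, by expanding the vector in that slot along `e`
with coefficients `μ`. -/
lemma sum_wedge_inter {V : Type*} [NormedAddCommGroup V] [NormedSpace ℝ V] {m k : ℕ}
    {e : Fin m → V} {μ : Fin m → V →L[ℝ] ℝ} (h : ∀ v, ∑ i, μ i v • e i = v)
    (β : V [⋀^Fin (k + 1)]→L[ℝ] ℝ) :
    ∑ i, wedge (μ i) (inter (e i) β) = ((k : ℝ) + 1) • β := by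
  ext v
  rw [ContinuousAlternatingMap.sum_apply, ContinuousAlternatingMap.smul_apply]
  simp only [wedge_apply, inter_eq]
  rw [Finset.sum_comm]
  have h1 : ∀ j : Fin (k + 1), ∑ i, (-1) ^ (j : ℕ) *
      (μ i (v j) * β.curryLeft (e i) (Fin.removeNth j v)) = β v := fun j => by
    have h2 : β.curryLeft (v j) (Fin.removeNth j v) =
        ∑ i, μ i (v j) * β.curryLeft (e i) (Fin.removeNth j v) := by
      conv_lhs => rw [← h (v j)]
      rw [map_sum, ContinuousAlternatingMap.sum_apply]
      exact Finset.sum_congr rfl fun i _ => by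
        rw [map_smul, ContinuousAlternatingMap.smul_apply, smul_eq_mul]
    rw [← Finset.mul_sum, ← h2]
    have h3 := β.map_insertNth j (v j) (Fin.removeNth j v)
    rw [Fin.insertNth_self_removeNth] at h3
    rw [h3, zsmul_eq_mul]
    push_cast
    rfl
  rw [Finset.sum_congr rfl fun j _ => h1 j, Finset.sum_const, Finset.card_univ, Fintype.card_fin,
    nsmul_eq_mul, smul_eq_mul]
  push_cast
  rfl

variable {n : ℕ} {M : Type*} [TopologicalSpace M] [T2Space M]
  [ChartedSpace (𝔼 n) M] [IsManifold (𝓡 n) ∞ M]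
  [RiemannianBundle (fun x : M => 𝕋 n x)]
  [IsContMDiffRiemannianBundle (𝓡 n) ∞ (𝔼 n) (fun x : M => 𝕋 n x)]
  [MeasurableSpace M] [BorelSpace M] [SecondCountableTopology M] {k : ℕ}

lemma exists_extended_coordinate (z : M) (i : Fin n) : ∃ h : M → ℝ, 𝒞 n h ∧
    ∀ᶠ x in 𝓝 z, ∀ v, dfun (n := n) h x v = chartDeriv (n := n) z x v i := by
  obtain ⟨f⟩ := (inferInstance : Nonempty (SmoothBumpFunction (𝓡 n) z))
  have hg : ContMDiffOn (𝓡 n) 𝓘(ℝ, ℝ) ∞ (fun x => ℰ n z x i) (chartAt (𝔼 n) z).source :=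
    (EuclideanSpace.proj (𝕜 := ℝ) i).contMDiff.comp_contMDiffOn contMDiffOn_extChartAt
  refine ⟨_, f.contMDiff_smul hg, ?_⟩
  filter_upwards [f.eventuallyEq_one.eventually_nhds, (isOpen_extChartAt_source (I := 𝓡 n) z).mem_nhds
    (mem_extChartAt_source z)] with x hx hxz v
  have h1 : (fun x => f x • ℰ n z x i) =ᶠ[𝓝 x] fun x => ℰ n z x i := by
    filter_upwards [hx] with y hy
    rw [hy, Pi.one_apply, one_smul]
  have h2 : MDifferentiableAt (𝓡 n) 𝓘(ℝ, 𝔼 n) (ℰ n z) x :=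
    mdifferentiableAt_extChartAt (by rwa [extChartAt_source] at hxz)
  have h3 := (EuclideanSpace.proj (𝕜 := ℝ) i).hasMFDerivAt.comp x h2.hasMFDerivAt
  rw [dfun, h1.mfderiv_eq]
  exact DFunLike.congr_fun h3.mfderiv v

/-- A test field which annihilates the smooth forms vanishes almost everywhere. -/
lemma ae_eq_zero_of_forall_smooth : ∀ {k : ℕ} (Y : testFields n M k),
    (∀ α : DiffForm n M k, IsSmoothForm α → pairing α Y = 0) →
      ∀ᵐ x ∂(riemannianVolume n M), Y.1 x = 0
  | 0, Y, h => by
    haveI := sigmaCompact n M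
    set α : DiffForm n M 0 := fun x =>
      ContinuousAlternatingMap.constOfIsEmpty ℝ (𝕋 n x) (Fin 0) (1 : ℝ) with hα
    have hs : IsSmoothForm α := fun x₀ => by
      have : coordForm x₀ α =
          fun _ => ContinuousAlternatingMap.constOfIsEmpty ℝ (𝔼 n) (Fin 0) (1 : ℝ) := rfl
      rw [this]
      exact contDiffOn_const
    have h1 := ae_eq_zero_of_integral_contMDiff_smul_eq_zero (𝓡 n)
      (hs.locIntForm.integrable Y).locallyIntegrable fun g hg _ => by
        rw [← h _ (hs.smul hg)]
        exact integral_congr_ae (Eventually.of_forall fun x => ((Y.1 x).map_smul (g x) (α x)).symm)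
    filter_upwards [h1] with x hx
    refine ContinuousLinearMap.ext fun β => ?_
    have hβ : β = β 0 • α x := by
      ext v
      rw [Subsingleton.elim v 0, ContinuousAlternatingMap.smul_apply]
      exact (mul_one _).symm
    rw [hβ, map_smul, hx, smul_zero]
    rfl
  | k + 1, Y, h => by
    -- Contracting with `df` lowers the degree and preserves the property, since `df ∧ α` is smooth
    -- whenever `α` is; the induction hypothesis applies.
    have hdf : ∀ (f : M → ℝ), 𝒞 n f →
        ∀ᵐ x ∂(riemannianVolume n M), contrField f Y.1 x = 0 := fun f hf =>
      ae_eq_zero_of_forall_smooth (contrTest hf Y) fun α hα => by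
        rw [pairing_contrTest]
        exact h _ (hα.dwedge hf)
    refine measure_null_of_locally_null _ fun z _ => ?_
    choose f hf hfd using fun i => exists_extended_coordinate (n := n) z i
    have hU := (eventually_all.2 hfd).and ((isOpen_extChartAt_source (I := 𝓡 n) z).mem_nhds
      (mem_extChartAt_source z))
    refine ⟨_, inter_mem_nhdsWithin _ hU, ?_⟩
    -- Where the contractions with all `n` local coordinate differentials vanish, the identity `Σ
    -- dx_i ∧ ι_{∂_i} β = (k + 1) β` forces the field itself to vanish.
    refine measure_mono_null ?_ (ae_all_iff.2 fun i => hdf (f i) (hf i))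
    rintro x ⟨hx, hx1, hx2⟩ hx3
    refine hx (ContinuousLinearMap.ext fun β => ?_)
    have h1 := sum_wedge_inter (V := 𝕋 n x)
      (e := fun i => chartInvAt (n := n) z x (EuclideanSpace.basisFun (Fin n) ℝ i))
      (μ := fun i => dfun (n := n) (f i) x) (fun v => ?_) β
    · have h2 : ((k : ℝ) + 1) * Y.1 x β = 0 := by
        rw [← smul_eq_mul, ← map_smul, ← h1, map_sum]
        exact Finset.sum_eq_zero fun i _ => DFunLike.congr_fun (hx3 i) _
      exact (mul_eq_zero.1 h2).resolve_left (by positivity)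
    · simp only [hx1]
      conv_rhs => rw [← chartInvAt_chartDeriv_apply hx2 v, ← (EuclideanSpace.basisFun (Fin n) ℝ).sum_repr
        (chartDeriv (n := n) z x v)]
      simp [map_sum]

/-- The double transpose annihilates all smooth forms because `d² = 0`, hence is zero almost
everywhere, so it also annihilates forms that are not smooth. -/
lemma IsTranspose.pairing_eq_zero {X : testFields n M (k + 2)} {Y : testFields n M (k + 1)}
    {Z : testFields n M k} (hXY : IsTranspose X Y) (hYZ : IsTranspose Y Z) (γ : DiffForm n M k) :
    pairing γ Z = 0 := by
  have h := ae_eq_zero_of_forall_smooth Z fun α hα => by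
    have h2 : extDerivForm (extDerivForm α) = 0 := by
      funext x
      have hx := mem_extChartAt_source (I := 𝓡 n) x
      rw [extDerivForm, (coordForm_extDerivForm_eventuallyEq hα hx).extDeriv_eq,
        extDeriv_extDeriv_apply (isSmoothForm_iff.1 hα x x hx) (by
          rw [minSmoothness_of_isRCLikeNormedField]
          exact WithTop.coe_le_coe.2 le_top)]
      rfl
    rw [← hYZ α hα, ← hXY _ hα.extDeriv, h2, pairing_zero_left]
  refine integral_eq_zero_of_ae ?_
  filter_upwards [h] with x hx
  rw [hx]
  rfl

/-- Exact forms are closed. -/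
lemma IsDifferential.closed {β : DiffForm n M k} {τ : DiffForm n M (k + 1)}
    (h : IsDifferential (pairing β) (pairing τ)) : IsDifferential (pairing τ) fun _ => 0 := by
  intro X Y hXY
  obtain ⟨Z, hZ⟩ := exists_transpose Y
  rw [h Y Z hZ, hXY.pairing_eq_zero hZ]

end TransposeSquare

/-! ### Vanishing of boundary values, torsion and cohomology. -/

section Vanishing

variable {n : ℕ} {M : Type*} [EMetricSpace M]
  [ChartedSpace (𝔼 n) M] [IsManifold (𝓡 n) ∞ M]
  [RiemannianBundle (fun x : M => 𝕋 n x)]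
  [IsContMDiffRiemannianBundle (𝓡 n) ∞ (𝔼 n) (fun x : M => 𝕋 n x)]
  [MeasurableSpace M] [BorelSpace M] [SecondCountableTopology M]
  {φ : ℝ → M → M} {ξ : (x : M) → 𝕋 n x} {p C η B : ℝ} {k : ℕ} {g : DiffForm n M (k + 1)}
  {z : DiffForm n M (k + 2)} {X : testFields n M (k + 1)} {Y : testFields n M k}

lemma dfun_one_sub {f : M → ℝ} (hf : 𝒞 n f) (x : M) :
    dfun (n := n) (fun x => 1 - f x) x = -dfun (n := n) f x := by
  have h := (hasMFDerivAt_const (I := 𝓡 n) (I' := 𝓘(ℝ, ℝ)) (1 : ℝ) x).sub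
    (hf.mdifferentiable (by simp) x).hasMFDerivAt
  exact h.mfderiv.trans (zero_sub _)

lemma norm_dfun_one_sub {f : M → ℝ} (hf : 𝒞 n f) (x : M) :
    ‖dfun (n := n) (fun x => 1 - f x) x‖ = ‖dfun (n := n) f x‖ := by
  rw [dfun_one_sub hf]
  exact norm_neg (E := 𝕋 n x →L[ℝ] ℝ) _

/-- The time after which the contraction factor, including its constant, is at most `1/2`; it is the
step of the iteration along orbits. -/
lemma exists_decay_time (C : ℝ) {η : ℝ} (hη : 0 < η) : ∃ T : ℕ, 1 ≤ T ∧
    2 * C * Real.exp (-η * T) ≤ 1 / 2 ∧ Real.exp (-η * T) ≤ 1 / 2 := by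
  have h : Tendsto (fun T : ℕ => Real.exp (-η * T)) atTop (𝓝 0) := by
    refine Real.tendsto_exp_atBot.comp ?_
    exact tendsto_natCast_atTop_atTop.const_mul_atTop_of_neg (by linarith)
  have h1 : Tendsto (fun T : ℕ => 2 * C * Real.exp (-η * T)) atTop (𝓝 0) := by
    simpa using h.const_mul (2 * C)
  obtain ⟨T, h2, h3, h4⟩ := ((eventually_ge_atTop 1).and ((h1.eventually_le_const (by norm_num :
    (0 : ℝ) < 1 / 2)).and (h.eventually_le_const (by norm_num : (0 : ℝ) < 1 / 2)))).exists
  exact ⟨T, h2, h3, h4⟩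

lemma tendsto_linear_mul_pow (a b : ℝ) :
    Tendsto (fun j : ℕ => b * ((1 + a * j) * (1 / 2 : ℝ) ^ j)) atTop (𝓝 0) := by
  have h1 := tendsto_self_mul_const_pow_of_lt_one (r := (1 / 2 : ℝ)) (by norm_num) (by norm_num)
  have h2 := tendsto_pow_atTop_nhds_zero_of_lt_one (r := (1 / 2 : ℝ)) (by norm_num) (by norm_num)
  have h3 := (h2.add (h1.const_mul a)).const_mul b
  rw [mul_zero, add_zero, mul_zero] at h3
  refine h3.congr fun j => ?_
  ring

/-- Cut-offs adapted to a compact set of orbits. -/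
lemma exists_orbit_cutoff [IsRiemannianManifold (𝓡 n) M] [CompleteSpace M] (hφ : IsFlowOf φ ξ)
    {K Kg : Set M} (hK : IsCompact K) (hKg : IsCompact Kg) (S : ℕ) :
    ∃ F : M → ℝ, 𝒞 n F ∧ (∀ x, 0 ≤ F x) ∧
      (∀ x, ‖dfun (n := n) F x‖ ≤ 1) ∧ (∃ L, IsCompact L ∧ ∀ x ∉ L, F x = 1) ∧
      (∀ x ∈ K, ∀ r ∈ Icc (-1 : ℝ) S, F (φ r x) = 0) ∧
      ∀ x ∈ Kg, ∀ r ∈ Icc (-1 : ℝ) 1, F (φ r x) = 0 := by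
  obtain ⟨L₁, hL₁, h1⟩ := exists_compact_flow hφ hK (isCompact_Icc (a := (-1 : ℝ)) (b := S))
  obtain ⟨L₂, hL₂, h2⟩ := exists_compact_flow hφ hKg (isCompact_Icc (a := (-1 : ℝ)) (b := 1))
  obtain ⟨f, hf, hfc, hf01, hf1, hfd⟩ := exists_cutoff (n := n) (hL₁.union hL₂) one_pos
  refine ⟨fun x => 1 - f x, (contDiff_const.sub contDiff_id).contMDiff.comp hf,
    fun x => sub_nonneg.2 (hf01 x).2, fun x => (norm_dfun_one_sub hf x).trans_le (hfd x),
    ⟨tsupport f, hfc, fun x hx => ?_⟩, fun x hx r hr => ?_, fun x hx r hr => ?_⟩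
  · simp only [image_eq_zero_of_notMem_tsupport hx, sub_zero]
  · simp only [hf1 _ (Or.inl (h1 r hr x hx)), sub_self]
  · simp only [hf1 _ (Or.inr (h2 r hr x hx)), sub_self]

lemma exists_bounds_flow_deriv (hφ : IsFlowOf φ ξ) {F : M → ℝ} (hF : 𝒞 n F)
    {L : Set M} (hL : IsCompact L) (hFL : ∀ x ∉ L, F x = 1) :
    ∃ A A', 0 < A ∧ 0 ≤ A' ∧ (∀ x, |dfun (n := n) F x (ξ x)| ≤ A') ∧
      ∀ x, |dfun (n := n) (fun x => dfun (n := n) F x (ξ x)) x (ξ x)| ≤ A := by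
  obtain ⟨A', hA', h'⟩ := exists_bound_flow_deriv hφ.isSmoothVec hF hL hL.isClosed hFL
  obtain ⟨A, hA, h⟩ := exists_bound_flow_deriv hφ.isSmoothVec
    (contMDiff_dfun_apply hF hφ.isSmoothVec) hL hL.isClosed (c := 0) fun x hx => by
      rw [dfun_eq_zero (c := 1) (by
        filter_upwards [hL.isClosed.isOpen_compl.mem_nhds hx] with y hy
        exact hFL y hy)]
      rfl
  exact ⟨A + 1, A', by linarith, hA', h', fun x => (h x).trans (by linarith)⟩

lemma exp_neg_mul_nat (η : ℝ) (i : ℕ) : Real.exp (-η * i) = Real.exp (-η) ^ i := by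
  rw [← Real.exp_nat_mul, mul_comm]

lemma smulTest_eq_self {f : M → ℝ} (hf : 𝒞 n f)
    (h : ∀ x, X.1 x = 0 ∨ f x = 1) : smulTest hf X = X := by
  refine Subtype.ext (funext fun x => ?_)
  change f x • X.1 x = X.1 x
  rcases h x with h | h <;> simp [h]

lemma pullbackForm_eq_zero {j : ℕ} {γ : DiffForm n M j} {f : M → M} {x : M} (h : γ (f x) = 0) :
    pullbackForm f γ x = 0 := by
  rw [pullbackForm, h]
  rfl

lemma pairing_smulTest_congr {γ : DiffForm n M (k + 1)} {f f' : M → ℝ}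
    (hf : 𝒞 n f) (hf' : 𝒞 n f')
    (h : ∀ x, X.1 x = 0 ∨ γ x = 0 ∨ f x = f' x) :
    pairing γ (smulTest hf X) = pairing γ (smulTest hf' X) := by
  refine integral_congr_ae (Eventually.of_forall fun x => ?_)
  change f x * X.1 x (γ x) = f' x * X.1 x (γ x)
  rcases h x with h | h | h
  · rw [h, zero_apply, mul_zero, mul_zero]
  · rw [h, map_zero, mul_zero, mul_zero]
  · rw [h]

/-- The pull-backs of a compactly supported form become small along the flow. -/
lemma LpPair.exists_small_pairing [IsRiemannianManifold (𝓡 n) M] [CompleteSpace M]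
    (hgz : LpPair p ξ g z) (hφ : IsFlowOf φ ξ) (hp : 1 < p) (hB0 : 0 ≤ B)
    (hB : ∀ x, ‖ξ x‖ ≤ B) (hC : 0 < C)
    (hη : 0 < η) (h0 : ContractBound φ ξ k p C η) (h1 : ContractBound φ ξ (k + 1) p C η)
    {Kg : Set M} (hKg : IsCompact Kg) (hg0 : ∀ x ∉ Kg, g x = 0) (hXY : IsTranspose X Y) {ε : ℝ}
    (hε : 0 < ε) (N₀ : ℕ) : ∃ N : ℕ, N₀ ≤ N ∧ |pairing (pullbackForm (φ N) g) X| ≤ ε := by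
  obtain ⟨K₁, D₁, hK₁, hX₁⟩ := exists_fieldBound X
  obtain ⟨K₂, D₂, hK₂, hY₂⟩ := exists_fieldBound Y
  set K := K₁ ∪ K₂
  have hK : IsCompact K := hK₁.union hK₂
  set D := max D₁ D₂
  have hX : FieldBound X K D := hX₁.mono subset_union_left (le_max_left _ _)
  have hY : FieldBound Y K D := hY₂.mono subset_union_right (le_max_right _ _)
  have hD := hX.nonneg
  obtain ⟨c, hc0, hc⟩ := exists_bound_deriv_lineCut
  set R := pairRate p ξ g z K
  have hR : 0 ≤ R := pairRate_nonneg
  set α := 2 * (D * C * R) + D * (c * (2 * C ^ 2 * (k + 1))) * R with hα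
  have hα0 : 0 ≤ α := by positivity
  set r := Real.exp (-η) with hr
  have hr0 : 0 ≤ r := Real.exp_nonneg _
  have hr1 : r < 1 := Real.exp_lt_one_iff.2 (by linarith)
  -- The starting time `S` comes before everything else: `α` depends only on the forms, the test
  -- field and the contraction constants.
  obtain ⟨S, hS⟩ : ∃ S : ℕ, α * r ^ S / (1 - r) ≤ ε / 3 := by
    have h := ((tendsto_pow_atTop_nhds_zero_of_lt_one hr0 hr1).const_mul α).div_const (1 - r)
    rw [mul_zero, zero_div] at h
    exact (h.eventually_le_const (by positivity : (0 : ℝ) < ε / 3)).exists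
  -- `F` vanishes along the orbits of the support of the test field up to time `S`, and for times
  -- within `1` around the support of `g`.
  obtain ⟨F, hF, hF0, hFd, ⟨L, hL, hFL⟩, hFK, hFg⟩ := exists_orbit_cutoff (n := n) hφ hK hKg S
  obtain ⟨T, hT, hT1, hT2⟩ := exists_decay_time C hη
  obtain ⟨KL, hKL0, hKL⟩ := h1.exists_bound hφ hC (Q := {(T : ℝ)} ×ˢ L)
    (isCompact_singleton.prod hL) fun q hq => by
      rw [mem_singleton_iff.1 hq.1]
      exact Nat.cast_nonneg T
  set V := (volFactor n p K).toReal
  set Γ := (lpNorm p g).toReal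
  have hΓV : 0 ≤ Γ * V := mul_nonneg ENNReal.toReal_nonneg ENNReal.toReal_nonneg
  -- The number of iterations is fixed by the constant `KL` of the extended bound on `L` at the
  -- single time `T`, and is independent of the bound over long times.
  obtain ⟨J, hJ, hJε⟩ := ((eventually_ge_atTop (max N₀ S)).and
    ((tendsto_linear_mul_pow (2 * (KL * C * B)) (D * (Γ * V))).eventually_le_const
      (by positivity : (0 : ℝ) < ε / 3))).exists
  set N := J * T with hN
  have hJN : J ≤ N := Nat.le_mul_of_pos_right J hT
  have hSN : S ≤ N := (le_max_right _ _).trans (hJ.trans hJN)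
  obtain ⟨KN, hKN0, hKN⟩ := h1.exists_bound hφ hC (Q := Icc (0 : ℝ) N ×ˢ K)
    (isCompact_Icc.prod hK) fun q hq => hq.1.1
  obtain ⟨A, A', hA, hA0', hA', hA''⟩ := exists_bounds_flow_deriv hφ hF hL hFL
  set β₁ := D * (c * (2 * C * KN)) * R with hβ₁
  have hβ₁0 : 0 ≤ β₁ := by positivity
  -- Only now, knowing `N` and the constant `KN` of the extended bound over `[0, N] × K`, is the
  -- tolerance `δ` for the derivative of `F` along the orbits chosen, so that `N` steps cost at most
  -- `ε / 3`.
  set δ := min (2 * A) (ε / 3 / (N * β₁ + 1)) with hδ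
  have hδ0 : 0 < δ := lt_min (by positivity) (by positivity)
  have hδN : N * (β₁ * δ) ≤ ε / 3 := by
    have h2 : δ ≤ ε / 3 / (N * β₁ + 1) := min_le_right _ _
    rw [le_div_iff₀ (by positivity)] at h2
    linarith
  obtain ⟨m, q, hm, hq, hmA, hlog, hqP⟩ := exists_grid hA hA0' hδ0 N
  have hsm : ∀ i, 𝒞 n (flowCut q N m φ F i) := fun i => contMDiff_flowCut hφ hF
  -- The part of the pairing removed by the cut-off at stage `i`. It vanishes at `S`, grows by
  -- controlled steps, and its final value together with the cut-off pairing is the quantity sought.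
  set a : ℕ → ℝ := fun i => pairing (pullbackForm (φ i) g) X -
    pairing (pullbackForm (φ i) g) (smulTest (hsm i) X) with ha
  -- Where the pull-back of `g` is nonzero, the orbit is in the support of `g` at time `s`, so `F`
  -- vanishes along it within time `1` of `s`.
  have hFs : ∀ (s : ℝ) x, g (φ s x) ≠ 0 → ∀ r ∈ Icc (s - 1) (s + 1), F (φ r x) = 0 := by
    intro s x hs r hr
    have h2 := hFg (φ s x) (by_contra fun h => hs (hg0 _ h)) (r - s)
      ⟨by linarith [hr.1], by linarith [hr.2]⟩
    rwa [← hφ.add, sub_add_cancel] at h2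
  have haS : a S = 0 := by
    simp only [ha]
    rw [smulTest_eq_self, sub_self]
    intro x
    by_cases hx : x ∈ K
    · exact Or.inr (flowCut_eq_one hm hlog fun r hr => hFK x hx r ⟨by linarith [hr.1], hr.2⟩)
    · exact Or.inl (hX.supp x hx)
  have hstep : ∀ i, S ≤ i → i < N → |a (i + 1) - a i| ≤ α * r ^ i + β₁ * δ := by
    intro i hSi hiN
    -- Changing the cut-off from stage `i` to stage `i + 1` at time `i + 1` costs nothing, because
    -- both agree where the pull-back of `g` is nonzero.
    have e1 : pairing (pullbackForm (φ ((i + 1 : ℕ) : ℝ)) g) (smulTest (hsm (i + 1)) X) =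
        pairing (pullbackForm (φ ((i + 1 : ℕ) : ℝ)) g) (smulTest (hsm i) X) := by
      refine pairing_smulTest_congr _ _ fun x => ?_
      by_cases hx : g (φ ((i + 1 : ℕ) : ℝ) x) = 0
      · exact Or.inr (Or.inl (pullbackForm_eq_zero hx))
      · refine Or.inr (Or.inr (flowCut_succ hm fun r hr => hFs _ x hx r ?_))
        push_cast
        exact ⟨by linarith [hr.1], by linarith [hr.2]⟩
    have h2 := hgz.abs_step_le hφ hp hC.le hη.le h0 h1 hK hX hY hXY (hsm i)
      (fun x => flowCut_nonneg x) (fun x => flowCut_le_one x) (i := i)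
      (E := c * (2 * C ^ 2 * (k + 1) * r ^ i + 2 * C * KN * δ)) (by positivity) fun s hs x hx => by
        by_cases hgx : g (φ s x) = 0
        · have e2 : pullbackForm (φ s) (interForm ξ g) x = 0 := pullbackForm_eq_zero (by
            rw [interForm, hgx]
            rfl)
          have e3 : dwedge (n := n) (flowCut q N m φ F i) (pullbackForm (φ s) (interForm ξ g)) x = 0 := by
            rw [dwedge, e2, ← wedgeCLM_apply, map_zero]
          rw [e3]
          refine (norm_zero (E := (𝕋 n x) [⋀^Fin (k + 1)]→L[ℝ] ℝ)).trans_le ?_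
          exact mul_nonneg (by positivity) (mul_nonneg (weight_nonneg _ _ _ _)
            (norm_nonneg (E := (𝕋 n (φ s x)) [⋀^Fin k]→L[ℝ] ℝ) _))
        · have h3 := norm_dwedge_flowCut_le (γ := g) hφ hC.le hη.le zero_le_one h0 hF hFd hF0 hA hA' hA''
            hδ0 (min_le_left _ _) hiN.le hm hmA hq hqP hc0 hc hs.1
            (fun r hr => hFK x hx r ⟨hr.1, hr.2.trans (Nat.cast_nonneg S)⟩)
            (fun r hr => hFs s x hgx r ⟨by linarith [hr.1, hs.2], by linarith [hr.2, hs.1]⟩) hKN0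
            (fun r hr => hKN (r, x) ⟨hr, hx⟩)
          refine h3.trans (mul_le_mul_of_nonneg_right (mul_le_mul_of_nonneg_left ?_ hc0)
            (mul_nonneg (weight_nonneg _ _ _ _)
              (norm_nonneg (E := (𝕋 n (φ s x)) [⋀^Fin k]→L[ℝ] ℝ) _)))
          rw [mul_one, hr, ← exp_neg_mul_nat]
          have h4 : Real.exp (-η * s) ≤ Real.exp (-η * i) := Real.exp_le_exp.2 (by
            have := mul_le_mul_of_nonneg_left hs.1 hη.le
            linarith)
          gcongr
    simp only [ha]
    rw [e1]
    push_cast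
    refine h2.trans_eq ?_
    rw [exp_neg_mul_nat, hα, hβ₁]
    ring
  have haN := abs_le_of_geometric_steps hr0 hr1 hα0 (mul_nonneg hβ₁0 hδ0.le) hSN haS hstep
  have hNJ : (N : ℝ) = J * T := by rw [hN]; push_cast; rfl
  -- On the support of the last cut-off the orbit is in `L` at all multiples of `T` before `N`,
  -- since `F = 1` off `L`; the iterated bound therefore applies.
  have hlast : |pairing (pullbackForm (φ N) g) (smulTest (hsm N) X)| ≤ ε / 3 := by
    have hpos : 0 ≤ (1 + 2 * (KL * C * B) * J) * (1 / 2 : ℝ) ^ J := by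
      positivity
    refine (hφ.abs_pairing_le hp hgz.meas hgz.lp N hK
      (hX.smul (hsm N) (fun x => flowCut_nonneg x) fun x => flowCut_le_one x).supp
      (A := D * ((1 + 2 * (KL * C * B) * J) * (1 / 2) ^ J)) (mul_nonneg hD hpos)
      fun x hx => ?_).trans (le_trans (le_of_eq (by ring)) hJε)
    change |flowCut q N m φ F N x * X.1 x _| ≤ _
    by_cases h0x : flowCut q N m φ F N x = 0
    · rw [h0x, zero_mul, abs_zero]
      exact mul_nonneg (mul_nonneg hD hpos) (mul_nonneg (weight_nonneg φ p N x)
        (norm_nonneg (E := (𝕋 n (φ N x)) [⋀^Fin (k + 1)]→L[ℝ] ℝ) _))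
    · have hmem : ∀ i < J, φ (i * T) x ∈ L := fun i hi => by
        by_contra hL'
        have h2 := lt_of_flowCut_ne_zero hm hq h0x (Nat.mul_le_mul_right T hi.le)
        push_cast at h2
        rw [hFL _ hL'] at h2
        norm_num at h2
      have h2 := norm_pullback_iterate_le hφ hC.le (Nat.cast_nonneg T) hB hT1 hT2 hKL0
        (fun z hz => hKL (T, z) ⟨rfl, hz⟩) (h0.pullbackBound_inter g) J x hmem
      rw [← hNJ] at h2
      rw [abs_mul, abs_of_nonneg (flowCut_nonneg x), mul_assoc]
      refine (mul_le_of_le_one_left (abs_nonneg _) (flowCut_le_one x)).trans ?_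
      exact (hX.le x _).trans (mul_le_mul_of_nonneg_left h2 hD)
  refine ⟨N, (le_max_left _ _).trans (hJ.trans hJN), ?_⟩
  have e1 : pairing (pullbackForm (φ N) g) X =
      a N + pairing (pullbackForm (φ N) g) (smulTest (hsm N) X) := by simp only [ha]; ring
  rw [e1]
  refine (abs_add_le _ _).trans ?_
  linarith

lemma lpNorm_le_mul {l : ℕ} {θ : DiffForm n M l} {γ : DiffForm n M k} {c : ℝ}
    (h : ∀ x, ‖θ x‖ ≤ c * ‖γ x‖) : lpNorm p θ ≤ ENNReal.ofReal c * lpNorm p γ :=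
  eLpNorm_le_mul_eLpNorm_of_ae_le_mul (Eventually.of_forall fun x => by
    rw [norm_norm, norm_norm]
    exact h x) _

lemma toReal_lpNorm_le_mul {l : ℕ} {θ : DiffForm n M l} {γ : DiffForm n M k} {c : ℝ} (hc : 0 ≤ c)
    (hγ : lpNorm p γ < ⊤) (h : ∀ x, ‖θ x‖ ≤ c * ‖γ x‖) :
    (lpNorm p θ).toReal ≤ c * (lpNorm p γ).toReal := by
  refine (ENNReal.toReal_mono (ENNReal.mul_ne_top ENNReal.ofReal_ne_top hγ.ne)
    (lpNorm_le_mul h)).trans_eq ?_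
  rw [ENNReal.toReal_mul, ENNReal.toReal_ofReal hc]

lemma norm_smul_alternating_le {V : Type*} [NormedAddCommGroup V] [NormedSpace ℝ V] {c : ℝ}
    (h0 : 0 ≤ c) (h1 : c ≤ 1) (β : V [⋀^Fin k]→L[ℝ] ℝ) : ‖c • β‖ ≤ 1 * ‖β‖ := by
  rw [norm_smul, Real.norm_of_nonneg h0]
  exact mul_le_mul_of_nonneg_right h1 (norm_nonneg _)

lemma norm_smul_form_le {f : M → ℝ} (hf0 : ∀ x, 0 ≤ f x) (hf1 : ∀ x, f x ≤ 1) (γ : DiffForm n M k)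
    (x : M) : ‖(f • γ) x‖ ≤ 1 * ‖γ x‖ :=
  norm_smul_alternating_le (V := 𝕋 n x) (hf0 x) (hf1 x) (γ x)

lemma norm_dwedge_le {f : M → ℝ} {ε : ℝ} (hf : ∀ x, ‖dfun (n := n) f x‖ ≤ ε)
    (γ : DiffForm n M k) (x : M) : ‖dwedge (n := n) f γ x‖ ≤ ((k + 1) * ε) * ‖γ x‖ := by
  refine (norm_wedge_le (V := 𝕋 n x) _ _).trans ?_
  rw [mul_assoc]
  refine mul_le_mul_of_nonneg_left (mul_le_mul_of_nonneg_right (hf x) (norm_nonneg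
    (E := (𝕋 n x) [⋀^Fin k]→L[ℝ] ℝ) _)) (by positivity)

lemma norm_interForm_le (hB : ∀ x, ‖ξ x‖ ≤ B) (γ : DiffForm n M (k + 1)) (x : M) :
    ‖interForm ξ γ x‖ ≤ B * ‖γ x‖ :=
  (norm_inter_le (V := 𝕋 n x) _ _).trans (mul_le_mul_of_nonneg_right (hB x)
    (norm_nonneg (E := (𝕋 n x) [⋀^Fin (k + 1)]→L[ℝ] ℝ) _))

lemma lpNorm_add_le (hp : 1 < p) {θ γ : DiffForm n M k} (hθ : MeasForm θ) (hγ : MeasForm γ) :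
    lpNorm p (θ + γ) ≤ lpNorm p θ + lpNorm p γ := by
  have h1 : lpNorm p (θ + γ) ≤ eLpNorm ((fun x => ‖θ x‖) + fun x => ‖γ x‖) (ENNReal.ofReal p)
      (riemannianVolume n M) := eLpNorm_mono_real fun x => by
    rw [norm_norm]
    exact norm_add_le (E := (𝕋 n x) [⋀^Fin k]→L[ℝ] ℝ) _ _
  exact h1.trans (eLpNorm_add_le hθ.norm.aestronglyMeasurable hγ.norm.aestronglyMeasurable
    (by simpa using hp.le))

/-- The `Lᵖ` norm of a form is small away from a compact set. -/
lemma exists_compact_lpNorm_le {γ : DiffForm n M k} (hγ : MeasForm γ)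
    (hγp : lpNorm p γ < ⊤) {ε : ℝ} (hε : 0 < ε) : ∃ K : Set M, IsCompact K ∧ ∀ f : M → ℝ,
      (∀ x, 0 ≤ f x) → (∀ x, f x ≤ 1) → (∀ x ∈ K, f x = 0) → (lpNorm p (f • γ)).toReal ≤ ε := by
  haveI := sigmaCompact n M
  haveI := Manifold.locallyCompact_of_finiteDimensional (M := M) (𝓡 n)
  have h : MemLp (fun x => ‖γ x‖) (ENNReal.ofReal p) (riemannianVolume n M) :=
    ⟨hγ.norm.aestronglyMeasurable, hγp⟩
  obtain ⟨u, hu, hue, -⟩ := h.exists_hasCompactSupport_eLpNorm_sub_le ENNReal.ofReal_ne_top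
    (ENNReal.ofReal_pos.2 hε).ne'
  refine ⟨tsupport u, hu, fun f hf0 hf1 hfK => ENNReal.toReal_le_of_le_ofReal hε.le ?_⟩
  refine le_trans (eLpNorm_mono fun x => ?_) hue
  rw [norm_norm]
  by_cases hx : x ∈ tsupport u
  · rw [Pi.smul_apply', hfK x hx, zero_smul]
    exact (norm_zero (E := (𝕋 n x) [⋀^Fin k]→L[ℝ] ℝ)).trans_le (norm_nonneg _)
  · rw [Pi.sub_apply, image_eq_zero_of_notMem_tsupport hx, sub_zero, norm_norm]
    exact (norm_smul_form_le hf0 hf1 γ x).trans_eq (one_mul _)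

lemma LocIntForm.pairing_add_left {γ γ' : DiffForm n M k} (hγ : LocIntForm γ) (hγ' : LocIntForm γ')
    (X : testFields n M k) : pairing (γ + γ') X = pairing γ X + pairing γ' X := by
  rw [pairing, pairing, pairing, ← integral_add (hγ.integrable X) (hγ'.integrable X)]
  exact integral_congr_ae (Eventually.of_forall fun x => map_add _ _ _)

lemma LpPair.of_lp (hB : ∀ x, ‖ξ x‖ ≤ B) (hg : MeasForm g) (hz : MeasForm z)
    (hgp : lpNorm p g < ⊤) (hzp : lpNorm p z < ⊤) (h : IsDifferential (pairing g) (pairing z)) :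
    LpPair p ξ g z :=
  ⟨hg, hz, hgp, hzp, lpNorm_inter_lt_top hB hgp, lpNorm_inter_lt_top hB hzp, h⟩

/-- Multiplication of a form and its differential by a function with bounded differential. -/
lemma LpPair.smul (hgz : LpPair p ξ g z) (hp : 1 < p) (hB : ∀ x, ‖ξ x‖ ≤ B)
    {f : M → ℝ} (hf : 𝒞 n f) (hf0 : ∀ x, 0 ≤ f x) (hf1 : ∀ x, f x ≤ 1) {ε : ℝ}
    (hε : ∀ x, ‖dfun (n := n) f x‖ ≤ ε) : LpPair p ξ (f • g) (dwedge (n := n) f g + f • z) := by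
  have hfm : Measurable f := hf.continuous.measurable
  have m1 := hgz.meas.dwedge hf
  have m2 := hgz.meas'.smul hfm
  have l1 : lpNorm p (dwedge (n := n) f g) < ⊤ := (lpNorm_le_mul (norm_dwedge_le hε g)).trans_lt
    (ENNReal.mul_lt_top ENNReal.ofReal_lt_top hgz.lp)
  have l2 : lpNorm p (f • z) < ⊤ := (lpNorm_le_mul (norm_smul_form_le hf0 hf1 z)).trans_lt
    (ENNReal.mul_lt_top ENNReal.ofReal_lt_top hgz.lp')
  refine LpPair.of_lp hB (hgz.meas.smul hfm) (m1.add m2)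
    ((lpNorm_le_mul (norm_smul_form_le hf0 hf1 g)).trans_lt
    (ENNReal.mul_lt_top ENNReal.ofReal_lt_top hgz.lp))
    ((lpNorm_add_le hp m1 m2).trans_lt (ENNReal.add_lt_top.2 ⟨l1, l2⟩)) fun X Y hXY => ?_
  have h := hgz.differential _ _ (hXY.smul hf)
  rw [(LocIntForm.of_lp hp hgz.meas hgz.lp).pairing_sub, pairing_smulTest, pairing_smulTest,
    pairing_contrTest] at h
  rw [(LocIntForm.of_lp hp m1 l1).pairing_add_left (LocIntForm.of_lp hp m2 l2), h]
  ring

lemma FieldBound.common {m : ℕ} (X : testFields n M k) (Y : testFields n M m) :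
    ∃ K D, IsCompact K ∧ FieldBound X K D ∧ FieldBound Y K D := by
  obtain ⟨K₁, D₁, hK₁, hX⟩ := exists_fieldBound X
  obtain ⟨K₂, D₂, hK₂, hY⟩ := exists_fieldBound Y
  exact ⟨K₁ ∪ K₂, max D₁ D₂, hK₁.union hK₂, hX.mono subset_union_left (le_max_left _ _),
    hY.mono subset_union_right (le_max_right _ _)⟩

/-- The pairings of the pull-backs with a test field are small along a sequence of times. -/
lemma LpPair.exists_small [IsRiemannianManifold (𝓡 n) M] [CompleteSpace M]
    (hgz : LpPair p ξ g z) (hφ : IsFlowOf φ ξ) (hp : 1 < p) (hB0 : 0 ≤ B)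
    (hB : ∀ x, ‖ξ x‖ ≤ B) (hC : 0 < C)
    (hη : 0 < η) (h0 : ContractBound φ ξ k p C η) (h1 : ContractBound φ ξ (k + 1) p C η)
    (X : testFields n M (k + 1)) {ε : ℝ} (hε : 0 < ε) (N₀ : ℕ) :
    ∃ N : ℕ, N₀ ≤ N ∧ |pairing (pullbackForm (φ N) g) X| ≤ ε := by
  obtain ⟨Y, hXY⟩ := exists_transpose X
  obtain ⟨K, D, hK, hX, hY⟩ := FieldBound.common X Y
  have hD := hX.nonneg
  set V := (volFactor n p K).toReal with hV
  have hV0 : 0 ≤ V := ENNReal.toReal_nonneg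
  -- `A` converts `Lᵖ` norms of the tail into variation of the pairing; three contributions of size
  -- `δ` then amount to at most `ε / 2`.
  set A := D * C * (B * V) / η with hA
  have hA0 : 0 ≤ A := by positivity
  set δ := ε / (6 * A + 1) with hδ
  have hδ0 : 0 < δ := by positivity
  have hδA : A * (3 * δ) ≤ ε / 2 := by
    have : δ * (6 * A + 1) = ε := div_mul_cancel₀ _ (by positivity)
    nlinarith
  set G := (lpNorm p g).toReal with hG
  have hG0 : 0 ≤ G := ENNReal.toReal_nonneg
  -- The cut-off's differential is wedged with `g`, of degree `k + 1`; the factor `k + 2` is the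
  -- constant of the wedge inequality.
  set ε₁ := δ / ((k + 2) * (G + 1)) with hε₁
  have hε₁0 : 0 < ε₁ := by positivity
  have hε₁δ : ((k + 1 : ℕ) + 1) * ε₁ * G ≤ δ := by
    have : ε₁ * ((k + 2) * (G + 1)) = δ := div_mul_cancel₀ _ (by positivity)
    push_cast
    nlinarith [mul_pos hε₁0 (by positivity : (0 : ℝ) < k + 2)]
  obtain ⟨L₁, hL₁, hLg⟩ := exists_compact_lpNorm_le hgz.meas hgz.lp hδ0
  obtain ⟨L₂, hL₂, hLz⟩ := exists_compact_lpNorm_le hgz.meas' hgz.lp' hδ0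
  -- Split `g = f g + (1 - f) g`: the first part is compactly supported and handled by the previous
  -- lemma, and the second has small norm, as has its differential.
  obtain ⟨f, hf, hfc, hf01, hf1, hfd⟩ := exists_cutoff (n := n) (hK.union (hL₁.union hL₂)) hε₁0
  set F : M → ℝ := fun x => 1 - f x with hFdef
  have hF : 𝒞 n F := (contDiff_const.sub contDiff_id).contMDiff.comp hf
  have hF0 : ∀ x, 0 ≤ F x := fun x => sub_nonneg.2 (hf01 x).2
  have hF1 : ∀ x, F x ≤ 1 := fun x => sub_le_self _ (hf01 x).1
  have hFd : ∀ x, ‖dfun (n := n) F x‖ ≤ ε₁ := fun x => (norm_dfun_one_sub hf x).trans_le (hfd x)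
  have hFK : ∀ x ∈ K ∪ (L₁ ∪ L₂), F x = 0 := fun x hx => sub_eq_zero.2 (hf1 x hx).symm
  have hP := hgz.smul hp hB hf (fun x => (hf01 x).1) (fun x => (hf01 x).2) hfd
  have hQ := hgz.smul hp hB hF hF0 hF1 hFd
  obtain ⟨N, hN, hNε⟩ := hP.exists_small_pairing hφ hp hB0 hB hC hη h0 h1 hfc
    (fun x hx => by rw [Pi.smul_apply', image_eq_zero_of_notMem_tsupport hx, zero_smul]) hXY
    (half_pos hε) N₀
  have hsum : ∀ s, pairing (pullbackForm (φ s) g) X =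
      pairing (pullbackForm (φ s) (f • g)) X + pairing (pullbackForm (φ s) (F • g)) X := fun s => by
    have e : g = f • g + F • g := by
      funext x
      rw [Pi.add_apply, Pi.smul_apply', Pi.smul_apply', ← add_smul, hFdef, add_sub_cancel, one_smul]
    simp only [hφ.pairing_pullback]
    conv_lhs => rw [e]
    exact (hP.locInt hp).pairing_add_left (hQ.locInt hp) _
  -- The tail vanishes on the support of the test field at time `0`, so its pairing at time `N` is
  -- bounded by the total variation alone.
  have hzero : pairing (pullbackForm (φ 0) (F • g)) X = 0 := by
    rw [hφ.pullback_zero_time]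
    refine integral_eq_zero_of_ae (Eventually.of_forall fun x => ?_)
    by_cases hx : x ∈ K
    · change X.1 x (F x • g x) = 0
      rw [hFK x (Or.inl hx), zero_smul, map_zero]
    · change X.1 x _ = 0
      rw [hX.supp x hx]
      rfl
  have hder := fun s => hφ.hasDerivAt_pairing_of_isDifferential (hQ.locInt hp) hQ.differential hXY s
  have hvar := abs_sub_le_of_deriv_exp hη hder
    (fun s hs => hQ.abs_deriv_le hφ hp hC.le h0 h1 hK hX hY hs) le_rfl (Nat.cast_nonneg N)
  rw [hzero, sub_zero, mul_zero, Real.exp_zero, mul_one] at hvar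
  have e1 : (lpNorm p (interForm ξ (F • g))).toReal ≤ B * δ :=
    (toReal_lpNorm_le_mul hB0 hQ.lp (norm_interForm_le hB _)).trans (mul_le_mul_of_nonneg_left
      (hLg F hF0 hF1 fun x hx => hFK x (Or.inr (Or.inl hx))) hB0)
  have e2 : (lpNorm p (interForm ξ (dwedge (n := n) F g + F • z))).toReal ≤ B * (2 * δ) := by
    refine (toReal_lpNorm_le_mul hB0 hQ.lp' (norm_interForm_le hB _)).trans
      (mul_le_mul_of_nonneg_left ?_ hB0)
    have l1 := toReal_lpNorm_le_mul (by positivity) hgz.lp (norm_dwedge_le hFd g)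
    have l2 := hLz F hF0 hF1 fun x hx => hFK x (Or.inr (Or.inr hx))
    have f1 : lpNorm p (dwedge (n := n) F g) < ⊤ := (lpNorm_le_mul (norm_dwedge_le hFd g)).trans_lt
      (ENNReal.mul_lt_top ENNReal.ofReal_lt_top hgz.lp)
    have f2 : lpNorm p (F • z) < ⊤ := (lpNorm_le_mul (norm_smul_form_le hF0 hF1 z)).trans_lt
      (ENNReal.mul_lt_top ENNReal.ofReal_lt_top hgz.lp')
    have := ENNReal.toReal_mono (ENNReal.add_lt_top.2 ⟨f1, f2⟩).ne
      (lpNorm_add_le hp (hgz.meas.dwedge hF) (hgz.meas'.smul hF.continuous.measurable))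
    rw [ENNReal.toReal_add f1.ne f2.ne] at this
    linarith
  refine ⟨N, hN, ?_⟩
  rw [hsum]
  refine (abs_add_le _ _).trans ?_
  have hfin : D * C * pairRate p ξ (F • g) (dwedge (n := n) F g + F • z) K / η ≤ A * (3 * δ) := by
    rw [hA, div_mul_eq_mul_div, pairRate, mul_assoc (D * C) (B * V)]
    refine div_le_div_of_nonneg_right (mul_le_mul_of_nonneg_left ?_ (by positivity)) hη.le
    refine (mul_le_mul_of_nonneg_right (add_le_add e1 e2) hV0).trans_eq (by ring)
  linarith

/-- Smallness along some large times is enough because the limit is known to exist. The two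
contraction conditions are first given common constants. -/
lemma LpPair.eq_zero_of_tendsto [IsRiemannianManifold (𝓡 n) M] [CompleteSpace M]
    (hgz : LpPair p ξ g z) (hφ : IsFlowOf φ ξ) (hp : 1 < p) (hB0 : 0 ≤ B)
    (hB : ∀ x, ‖ξ x‖ ≤ B) (hc0 : IsContracting φ ξ k p) (hc1 : IsContracting φ ξ (k + 1) p)
    {L : ℝ} (h : Tendsto (fun t => pairing (pullbackForm (φ t) g) X) atTop (𝓝 L)) : L = 0 := by
  obtain ⟨C₀, η₀, hC₀, hη₀, h0⟩ := hc0.exists_contractBound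
  obtain ⟨C₁, η₁, hC₁, hη₁, h1⟩ := hc1.exists_contractBound
  have h0' := h0.mono hC₀.le (le_max_left C₀ C₁) (min_le_left η₀ η₁)
  have h1' := h1.mono hC₁.le (le_max_right C₀ C₁) (min_le_right η₀ η₁)
  by_contra hL
  have h2 := (h.comp tendsto_natCast_atTop_atTop).abs.eventually
    (lt_mem_nhds (half_lt_self (abs_pos.2 hL)))
  obtain ⟨N₀, hN₀⟩ := eventually_atTop.1 h2
  obtain ⟨N, hN, hNε⟩ := hgz.exists_small hφ hp hB0 hB (lt_max_of_lt_left hC₀) (lt_min hη₀ hη₁) h0' h1'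
    X (half_pos (abs_pos.2 hL)) N₀
  exact absurd hNε (not_le.2 (hN₀ N hN))

lemma ContractBound.pullbackBound_zero (h : ContractBound φ ξ 0 p C η) (γ : DiffForm n M 0) :
    PullbackBound φ p C η γ := by
  intro t ht x
  refine (h t ht x (γ (φ t x)) ?_).trans_eq (by rw [mul_assoc]; rfl)
  rintro v ⟨i, -⟩
  exact i.elim0

lemma tendsto_exp_neg_mul (a : ℝ) (hη : 0 < η) :
    Tendsto (fun t => a * Real.exp (-η * t)) atTop (𝓝 0) := by
  have h := (Real.tendsto_exp_atBot.comp
    (tendsto_id.const_mul_atTop_of_neg (neg_lt_zero.2 hη))).const_mul a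
  rwa [mul_zero] at h

/-- Functions in `Lᵖ` are pulled back to zero by a contracting flow. -/
lemma IsFlowOf.tendsto_pairing_degree_zero (hφ : IsFlowOf φ ξ) (hp : 1 < p)
    (hc : IsContracting φ ξ 0 p) {γ : DiffForm n M 0} (hγ : MeasForm γ) (hγp : lpNorm p γ < ⊤)
    (X : testFields n M 0) :
    Tendsto (fun t => pairing (pullbackForm (φ t) γ) X) atTop (𝓝 0) := by
  obtain ⟨C, η, hC, hη, h⟩ := hc.exists_contractBound
  obtain ⟨K, D, hK, hX⟩ := exists_fieldBound X
  refine squeeze_zero_norm' ?_ (tendsto_exp_neg_mul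
    (D * C * ((lpNorm p γ).toReal * (volFactor n p K).toReal)) hη)
  filter_upwards [eventually_ge_atTop 0] with t ht
  refine (hφ.abs_pairing_pullback_le hp hγ hγp hC.le (h.pullbackBound_zero γ) hK hX ht).trans_eq ?_
  ring

/-- The boundary value of an exact form is zero. -/
lemma IsBoundaryValue.eq_zero_of_exact [IsRiemannianManifold (𝓡 n) M] [CompleteSpace M]
    (hφ : IsFlowOf φ ξ) (hp : 1 < p) (hB0 : 0 ≤ B) (hB : ∀ x, ‖ξ x‖ ≤ B)
    (hc : IsContracting φ ξ k p) (hj : ∀ j, j + 1 = k → IsContracting φ ξ j p)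
    {θ : DiffForm n M (k + 1)} (hθ : θ ∈ lpExact n M p k) {T : DistForm n M (k + 1)}
    (hT : IsBoundaryValue φ θ T) : T.toLinearMap = 0 := by
  obtain ⟨hθL, β, hβL, hd⟩ := hθ
  obtain ⟨θ', hm, hL, hae⟩ := hθL.exists_rep
  obtain ⟨β', hm', hL', hae'⟩ := hβL.exists_rep
  have hd' : IsDifferential (pairing β') (pairing θ') := fun X Y hXY => by
    rw [← pairing_congr hae, ← pairing_congr hae', hd X Y hXY]
  refine LinearMap.ext fun X => ?_
  obtain ⟨Y, hXY⟩ := exists_transpose X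
  have h : Tendsto (fun t => pairing (pullbackForm (φ t) β') Y) atTop (𝓝 (T.toLinearMap X)) := by
    refine (hT X).congr fun t => ?_
    rw [hφ.pairing_pullback_congr hae, hφ.pairing_pullback, hφ.pairing_pullback,
      hd' _ _ (hXY.push hφ t)]
  cases k with
  -- A primitive of degree `0` is a function: no lower contraction condition is needed, as every
  -- function counts as annihilated by `ι_ξ`.
  | zero => exact tendsto_nhds_unique h (hφ.tendsto_pairing_degree_zero hp hc hm' hL'.2 Y)
  | succ j =>
    exact (LpPair.of_lp hB hm' hm hL'.2 hL.2 hd').eq_zero_of_tendsto hφ hp hB0 hB (hj j rfl) hc h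

lemma lpNorm_zero_lt_top : lpNorm p (0 : DiffForm n M k) < ⊤ := by
  have h : (fun x => ‖(0 : DiffForm n M k) x‖) = fun _ => (0 : ℝ) := funext fun x =>
    norm_zero (E := (𝕋 n x) [⋀^Fin k]→L[ℝ] ℝ)
  rw [lpNorm, h]
  simp

/-- The boundary value of a closed form is zero if the flow contracts the forms of its degree. -/
lemma IsBoundaryValue.eq_zero_of_closed [IsRiemannianManifold (𝓡 n) M] [CompleteSpace M]
    (hφ : IsFlowOf φ ξ) (hp : 1 < p) (hB0 : 0 ≤ B) (hB : ∀ x, ‖ξ x‖ ≤ B)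
    (hc : IsContracting φ ξ k p) (hc' : IsContracting φ ξ (k + 1) p)
    {θ : DiffForm n M (k + 1)} (hθ : θ ∈ lpClosed n M p (k + 1)) {T : DistForm n M (k + 1)}
    (hT : IsBoundaryValue φ θ T) : T.toLinearMap = 0 := by
  obtain ⟨θ', hm, hL, hae⟩ := hθ.1.exists_rep
  have hd : IsDifferential (pairing θ') (pairing (0 : DiffForm n M (k + 2))) := fun X Y hXY => by
    rw [← pairing_congr hae, ← hθ.2 X Y hXY, pairing_zero_left]
  refine LinearMap.ext fun X => ?_
  exact (LpPair.of_lp hB hm (fun v => measurable_const) hL.2 lpNorm_zero_lt_top hd).eq_zero_of_tendsto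
    hφ hp hB0 hB hc hc' ((hT X).congr fun t => hφ.pairing_pullback_congr hae t X)

/-- The boundary value of a closed form is bounded by its norm. -/
lemma IsFlowOf.exists_bound_limit (hφ : IsFlowOf φ ξ) (hp : 1 < p) (hB0 : 0 ≤ B)
    (hB : ∀ x, ‖ξ x‖ ≤ B) (hc : IsContracting φ ξ k p) (X : testFields n M (k + 1)) :
    ∃ c, 0 ≤ c ∧ ∀ (γ : DiffForm n M (k + 1)) (L : ℝ), MeasForm γ → lpNorm p γ < ⊤ →
      (IsDifferential (pairing γ) fun _ => 0) →
      Tendsto (fun t => pairing (pullbackForm (φ t) γ) X) atTop (𝓝 L) →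
      |L| ≤ c * (lpNorm p γ).toReal := by
  obtain ⟨C, η, hC, hη, h⟩ := hc.exists_contractBound
  obtain ⟨Y, hXY⟩ := exists_transpose X
  obtain ⟨K, D, hK, hX, hY⟩ := FieldBound.common X Y
  have hD := hX.nonneg
  set V := (volFactor n p K).toReal with hV
  have hV0 : 0 ≤ V := ENNReal.toReal_nonneg
  refine ⟨D * V + D * C * B * V / η, by positivity, fun γ L hγ hγp hd hL => ?_⟩
  have h0 : |pairing γ X| ≤ D * ((lpNorm p γ).toReal * V) :=
    hφ.abs_pairing_le hp hγ hγp 0 hK hX.supp hD fun x _ => by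
      rw [show φ 0 = id from funext hφ.zero, jacobian_mfderiv_id, Real.one_rpow, one_mul]
      exact hX.le x _
  have hi := lpNorm_inter_lt_top hB hγp
  have hvar := fun t (ht : 0 ≤ t) => abs_sub_le_of_deriv_exp hη
    (fun s => hφ.hasDerivAt_pairing_of_closed (LocIntForm.of_lp hp hγ hγp) hd hXY s)
    (A := D * C * B * V * (lpNorm p γ).toReal) (fun s hs => by
      refine (hφ.abs_pairing_pullback_le hp (hγ.inter hφ.isSmoothVec) hi hC.le
        (h.pullbackBound_inter γ) hK hY hs).trans ?_
      have := mul_le_mul_of_nonneg_left (toReal_lpNorm_le_mul hB0 hγp (norm_interForm_le hB γ))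
        (by positivity : 0 ≤ D * (C * Real.exp (-η * s)) * V)
      linarith) le_rfl ht
  refine le_of_tendsto hL.abs ?_
  filter_upwards [eventually_ge_atTop 0] with t ht
  have h1 := hvar t ht
  rw [hφ.pullback_zero_time, mul_zero, Real.exp_zero, mul_one] at h1
  have h2 := abs_sub_abs_le_abs_sub (pairing (pullbackForm (φ t) γ) X) (pairing γ X)
  have h3 : (D * V + D * C * B * V / η) * (lpNorm p γ).toReal =
      D * ((lpNorm p γ).toReal * V) + D * C * B * V * (lpNorm p γ).toReal / η := by ring
  linarith

/-- The boundary value of a limit of exact forms is zero. -/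
lemma IsBoundaryValue.eq_zero_of_closure [IsRiemannianManifold (𝓡 n) M] [CompleteSpace M]
    (hφ : IsFlowOf φ ξ) (hp : 1 < p) (hB0 : 0 ≤ B) (hB : ∀ x, ‖ξ x‖ ≤ B)
    (hc : IsContracting φ ξ k p) (hj : ∀ j, j + 1 = k → IsContracting φ ξ j p)
    {θ : DiffForm n M (k + 1)} (hθ : θ ∈ lpExactClosure n M p k) {T : DistForm n M (k + 1)}
    (hT : IsBoundaryValue φ θ T) : T.toLinearMap = 0 := by
  refine LinearMap.ext fun X => ?_
  obtain ⟨c, hc0, hbound⟩ := hφ.exists_bound_limit hp hB0 hB hc X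
  obtain ⟨θ', hm, hL, hae⟩ := hθ.1.1.exists_rep
  -- An exact form `τ` within `ε` of `θ` has zero boundary value, so `θ` and `θ - τ` have the same
  -- one, bounded by a multiple of `ε`.
  have key : ∀ ε : ℝ, 0 < ε → |T.toLinearMap X| ≤ c * ε := fun ε hε => by
    obtain ⟨τ, hτ, hτε⟩ := hθ.2 (ENNReal.ofReal ε) (ENNReal.ofReal_pos.2 hε)
    obtain ⟨τ', hm', hL', hae'⟩ := hτ.1.exists_rep
    have hτc : IsDifferential (pairing τ) fun _ => 0 := hτ.2.choose_spec.2.closed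
    obtain ⟨S, hS, -⟩ := hφ.exists_boundaryValue ⟨B, hB⟩ hp hc ⟨hτ.1, hτc⟩
    have hS0 := hS.eq_zero_of_exact hφ hp hB0 hB hc hj hτ
    have hmn : MeasForm (-τ') := fun v => (hm' v).neg
    have hLn : lpNorm p (-τ') < ⊤ := by rw [lpNorm_neg]; exact hL'.2
    have hadd := fun X => (LocIntForm.of_lp hp hm hL.2).pairing_add_left
      (LocIntForm.of_lp hp hmn hLn) X
    have hn : lpNorm p (θ' + -τ') < ENNReal.ofReal ε := by
      refine lt_of_eq_of_lt (lpNorm_congr ?_) hτε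
      filter_upwards [hae, hae'] with x hx hx'
      rw [Pi.sub_apply, hx, hx', sub_eq_add_neg]
      rfl
    refine (hbound (θ' + -τ') _ (hm.add hmn) (hn.trans ENNReal.ofReal_lt_top) (fun Y Z hYZ => ?_)
      ?_).trans (mul_le_mul_of_nonneg_left (ENNReal.toReal_le_of_le_ofReal hε.le hn.le) hc0)
    · rw [hadd, pairing_neg_left, ← pairing_congr hae, ← pairing_congr hae', ← hθ.1.2 Y Z hYZ,
        ← hτc Y Z hYZ, neg_zero, add_zero]
    · have h1 := (hT X).sub (hS X)
      rw [hS0, LinearMap.zero_apply, sub_zero] at h1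
      refine h1.congr fun t => ?_
      rw [hφ.pairing_pullback_congr hae, hφ.pairing_pullback_congr hae']
      simp only [hφ.pairing_pullback]
      rw [hadd, pairing_neg_left, sub_eq_add_neg]
  by_contra hne
  have hpos := abs_pos.2 hne
  have h1 := key (|T.toLinearMap X| / (2 * (c + 1))) (by positivity)
  have h2 : c * (|T.toLinearMap X| / (2 * (c + 1))) < |T.toLinearMap X| := by
    rw [← mul_div_assoc, div_lt_iff₀ (by positivity)]
    nlinarith
  exact absurd h1 (not_le.2 h2)

/-- A closed form whose boundary value is zero is exact. -/
lemma IsFlowOf.exact_of_boundaryValue_eq_zero (hφ : IsFlowOf φ ξ) (hp : 1 < p)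
    (hξ : ∃ B : ℝ, ∀ x, ‖ξ x‖ ≤ B) (hc : IsContracting φ ξ k p) {θ : DiffForm n M (k + 1)}
    (hθ : θ ∈ lpClosed n M p (k + 1))
    (h : ∀ T : DistForm n M (k + 1), IsBoundaryValue φ θ T → T.toLinearMap = 0) :
    θ ∈ lpExact n M p k := by
  obtain ⟨T, hT, β, hβ, hd⟩ := hφ.exists_boundaryValue hξ hp hc hθ
  refine ⟨hθ.1, β, hβ, fun X Y hXY => ?_⟩
  have h1 := hd X Y hXY
  beta_reduce at h1
  rwa [h T hT, LinearMap.zero_apply, sub_zero] at h1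

end Vanishing

end LpForms

end

/-- With degree `k + 1` in the role of the degree `k ≥ 1` of the theorem, `∀ j, j + 1 = k → …` is
contraction one degree below `k`; it is vacuous for `k = 0`, matching the convention that every
field is `(-1, p)`-contracting. -/
theorem mainTheorem5 {n : ℕ} {M : Type*} [EMetricSpace M]
    [ChartedSpace (EuclideanSpace ℝ (Fin n)) M] [IsManifold (𝓡 n) ∞ M]
    [SecondCountableTopology M] [MeasurableSpace M] [BorelSpace M]
    [RiemannianBundle (fun x : M => TangentSpace (𝓡 n) x)]
    [IsContMDiffRiemannianBundle (𝓡 n) ∞ (EuclideanSpace ℝ (Fin n))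
      (fun x : M => TangentSpace (𝓡 n) x)]
    [IsRiemannianManifold (𝓡 n) M]
    (ξ : (x : M) → TangentSpace (𝓡 n) x)
    (hξ : ContMDiff (𝓡 n) (𝓡 n).tangent ∞
      (fun x => (⟨x, ξ x⟩ : TangentBundle (𝓡 n) M)))
    (hξ_bdd : ∃ C : ℝ, ∀ x, ‖ξ x‖ ≤ C)
    (φ : ℝ → M → M) (hφ : LpForms.IsFlowOf φ ξ)
    (p : ℝ) (hp : 1 < p) (k : ℕ)
    (hcontr : LpForms.IsContracting φ ξ k p) :
    (∀ θ ∈ LpForms.lpClosed n M p (k + 1), ∃ T : LpForms.DistForm n M (k + 1),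
      LpForms.IsBoundaryValue φ θ T ∧
      ∃ β : LpForms.DiffForm n M k, LpForms.IsLpForm p β ∧
        LpForms.IsDifferential (LpForms.pairing β)
          (fun X => LpForms.pairing θ X - T.toLinearMap X)) ∧
    (CompleteSpace M → (∀ j, j + 1 = k → LpForms.IsContracting φ ξ j p) →
      (∀ θ ∈ LpForms.lpExact n M p k, ∀ T : LpForms.DistForm n M (k + 1),
        LpForms.IsBoundaryValue φ θ T → T.toLinearMap = 0) ∧
      LpForms.LpTorsionVanishes n M p k) ∧
    (CompleteSpace M → LpForms.IsContracting φ ξ (k + 1) p →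
      (∀ θ ∈ LpForms.lpClosed n M p (k + 1), ∀ T : LpForms.DistForm n M (k + 1),
        LpForms.IsBoundaryValue φ θ T → T.toLinearMap = 0) ∧
      LpForms.LpCohomologyVanishes n M p k) := by
  obtain ⟨B, hB'⟩ := hξ_bdd
  have hB : ∀ x, ‖ξ x‖ ≤ max B 0 := fun x => (hB' x).trans (le_max_left B 0)
  have hB0 : 0 ≤ max B 0 := le_max_right B 0
  refine ⟨fun θ hθ => hφ.exists_boundaryValue ⟨B, hB'⟩ hp hcontr hθ, fun _ hj => ⟨?_, ?_⟩,
    fun _ hc => ⟨?_, ?_⟩⟩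
  · exact fun θ hθ T hT => hT.eq_zero_of_exact hφ hp hB0 hB hcontr hj hθ
  · exact fun θ hθ => hφ.exact_of_boundaryValue_eq_zero hp ⟨B, hB'⟩ hcontr hθ.1
      fun T hT => hT.eq_zero_of_closure hφ hp hB0 hB hcontr hj hθ
  · exact fun θ hθ T hT => hT.eq_zero_of_closed hφ hp hB0 hB hcontr hc hθ
  · exact fun θ hθ => hφ.exact_of_boundaryValue_eq_zero hp ⟨B, hB'⟩ hcontr hθ
      fun T hT => hT.eq_zero_of_closed hφ hp hB0 hB hcontr hc hθ
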